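/- **Setting.** Let $\Omega=\mathbb T^2\times\mathbb R_+$ with points $x=(x_\parallel,x_3)$, let $0<\varepsilon$, $0<\kappa\le 1$, $\delta>0$, $T>0$, and write $\partial^\alpha=(\varepsilon\partial_t)^{\alpha_0}\partial_{x_1}^{\alpha_1}\partial_{x_2}^{\alpha_2}$ for $\alpha\in\mathbb N_0^3$. Let $\mu_0(\xi)=(2\pi)^{-3/2}e^{-|\xi|^2/2}$, $\varphi=\xi-\varepsilon U(t,x)$, $\mu=\mu_0(\varphi)$, $Q$ the hard-sphere collision operator $$Q(F,G)=\tfrac12\int_{\mathbb R^3\times\mathbb S^2}|(\xi-\xi_*)\cdot\omega|\,\big(F(\xi')G(\xi_*')+G(\xi')F(\xi'_*)-F(\xi)G(\xi_*)-G(\xi)F(\xi_*)\big)\,d\xi_*d\omega,$$ $\xi'=\xi-((\xi-\xi_*)\cdot\omega)\omega$, $\xi'_*=\xi_*+((\xi-\xi_*)\cdot\omega)\omega$, $\nu(t,x,\xi)=\int|(\xi-\xi_*)\cdot\omega|\,\mu(t,x,\xi_*)\,d\xi_*d\omega$, $L_0g=-\frac{2}{\sqrt{\mu_0}}Q(\mu_0,\sqrt{\mu_0}g)$,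 and $A_{ij}=L_0^{-1}\big[(\xi_i\xi_j-\frac{\delta_{ij}}3|\xi|^2)\sqrt{\mu_0}\big]$ (the solution that is orthogonal to the null space of $L_0$). *Fluid.* $(U,P)$ is a boundary layer flow with constant $K$ and analyticity radius $\tau_U>0$: $U$ and $P$ are smooth on $(0,T)\times\overline\Omega$, $U|_{x_3=0}=0$, for every $\gamma\in\mathbb N_0^3$ $$\tfrac{\tau_U^{|\gamma|}}{\gamma!}\Big(\|\partial^\gamma U\|_{L^\infty},\ \|\partial^\gamma\partial_{x_1}U\|_{L^\infty},\ \|\partial^\gamma\partial_{x_2}U\|_{L^\infty},\ \|\partial^\gamma\varepsilon\partial_tU\|_{L^\infty},\ \sqrt\kappa\,\|\partial^\gamma\partial_{x_3}U\|_{L^\infty}\Big)\le K$$ (each entry), $\|x_3\partial_{x_3}U_j\|_{L^\infty}\le K$ for $j=1,2$, $\|\nabla_x\cdot U\|_{L^\infty}\le K$ and $\|\nabla_xU(t)\|_{L^2}\le K\kappa^{-1/2}$. *Kinetic solution.* $F$ solves $\partial_tF+\varepsilon^{-1}\xi\cdot\nabla_xF=\frac1{\kappa\varepsilon^2}Q(F,F)$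 on $(0,T)\times\Omega\times\{\xi_3\ne0\}$, with $F=c_\mu\mu_0\int_{\zeta_3<0}F(\zeta)|\zeta_3|\,d\zeta$ for $x_3=0<\xi_3$, where $c_\mu\int_{\xi_3>0}\mu_0|\xi_3|d\xi=1$; $F$ is measurable and, for each $\xi$ with $\xi_3\neq0$, continuous up to $x_3=0$ and $C^1$ inside. Define the remainder $f$ by $$F=\mu+\varepsilon^2f_2\sqrt\mu+\varepsilon\delta f\sqrt\mu,\qquad f_2=P\sqrt\mu-\kappa\sum_{i,j}\partial_iU_j\,A_{ij}(\varphi),$$ and put $f_\alpha=\partial^\alpha f$. Assume that $f$ is smooth in $(t,x_\parallel)$ and that, for a given $\rho\in(0,\frac14)$, every $e^{\rho|\xi|^2}f_\alpha$ is bounded. Let $a_\alpha=\int f_\alpha\sqrt\mu\,d\xi$, $b_{\alpha,i}=\int f_\alpha\varphi_i\sqrt\mu\,d\xi$, $c_\alpha=\int f_\alpha\frac{|\varphi|^2-3}3\sqrt\mu\,d\xi$ and $\mathbf Pf_\alpha=(a_\alpha+b_\alpha\cdot\varphi+c_\alpha\frac{|\varphi|^2-3}2)\sqrt\mu$. *Norms.*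 All norms are at a fixed time $t$, $\|\cdot\|_{L^2}$ being over $\Omega\times\mathbb R^3$ for functions of $(x,\xi)$ and over $\Omega$ for functions of $x$. For $M_0\ge0$, $\tau_0\le\tau_U/2$ let $\tau(t)=\tau_0-M_0t$, $\mathcal A_\alpha(t)=\frac{\tau(t)^{|\alpha|}}{\alpha!}(1+|\alpha|)^9$ and $$\mathcal E_f^2=\sum_\alpha\mathcal A_\alpha^2\|f_\alpha\|_{L^2}^2,\quad \mathcal D_f^2=\frac1{\kappa\varepsilon^2}\sum_\alpha\mathcal A_\alpha^2\|\sqrt\nu(\mathbf I-\mathbf P)f_\alpha\|_{L^2}^2,\quad \mathcal Y_f^2=\sum_\alpha\frac{|\alpha|+1}{\tau(t)}\mathcal A_\alpha^2\|f_\alpha\|_{L^2}^2,$$ $$\mathcal H_f^2=\sum_\alpha\sup_{0<s\le t}\mathcal A_\alpha(s)^2\|e^{\rho|\xi|^2}f_\alpha(s)\|_{L^\infty_{x,\xi}}^2 .$$ *Fluid terms.* With $\nabla_\parallel=(\partial_{x_1},\partial_{x_2})$, $$\begin{aligned}\mathcal F_\alpha={}&(\varepsilon\delta)^{-1}\|\partial^\alpha(\nabla_x\cdot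 U)\|_{L^2}+\tfrac\varepsilon\delta\sum_{i=1}^2\|\partial^\alpha(U_i^2)\|_{L^2}+\tfrac{\varepsilon^2}\delta\|\partial^\alpha(\partial_tP+\nabla_\parallel\cdot(PU_\parallel))\|_{L^2}\\&+\tfrac{\varepsilon^2\kappa}\delta\sum_{i,j}\|\partial^\alpha(\partial_iU_j\,\nabla_x\cdot U)\|_{L^2}+\tfrac\varepsilon\delta\big(\|\partial_{x_3}\partial^\alpha(U_3^2)\|_{L^2}+\|\partial_{x_3}\partial^\alpha(PU_3)\|_{L^2}\big),\\ \mathcal F'_\alpha={}&\varepsilon\kappa^{-1/2}\delta^{-1}\big(\|\partial^\alpha(U_3^2)\|_{L^2}+\|\partial^\alpha(PU_3)\|_{L^2}\big),\qquad \mathcal G^2=\sum_\alpha\mathcal A_\alpha^2(\mathcal F_\alpha+\mathcal F_\alpha')^2 .\end{aligned}$$ **Statement.** There is an absolute constant $C_0>0$, and for all $K>0$, $\rho\in(0,\frac14)$ and $c\in(0,\frac14)$ there is $C>0$ depending only on $K,\rho,c$ (not on $\varepsilon,\kappa,\delta,T,\tau_U,\tau_0,M_0,t,\alpha,U,P,F$),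 such that for all data as above and all $t\in(0,T)$: (1) If $\varepsilon\le\sqrt\kappa$, then for every $\alpha$ the function $\mathcal T^b_\alpha$ defined by $$b_{\alpha,3}=\mathcal T^b_\alpha-\varepsilon U_3a_\alpha-\tfrac{\varepsilon}{2\delta}\partial^\alpha(U_3^2)-\tfrac\varepsilon\delta\partial^\alpha(PU_3)$$ satisfies $$\Big\|\frac{\mathcal T^b_\alpha}{x_3}\Big\|_{L^2}\le C\Big(\|f_\alpha\|_{L^2}+\sum_{\partial}\|\partial f_\alpha\|_{L^2}+\mathcal F_\alpha+\sum_{\substack{\beta+\gamma=\alpha\\|\gamma|\ge1}}\frac{\alpha!}{\beta!\gamma!}\Big(\|f_\beta\|_{L^2}+\sum_\partial\|\partial f_\beta\|_{L^2}\Big)\big\|e^{c|\xi|^2}(1,\varepsilon\partial_t,\nabla_x)\partial^\gamma\sqrt\mu\big\|_{L^\infty_{x,\xi}}\Big),$$ where $\partial$ runs over $\varepsilon\partial_t,\partial_{x_1},\partial_{x_2}$. (2) For every $\eta>0$ there is $\varepsilon_0>0$, depending only on $\eta,K,\rho,c$, such that, if $\varepsilon\le\varepsilon_0\sqrt\kappa$,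 then for every $\alpha$ the bulk integral $$\mathcal B_\alpha=\int_{\Omega\times\mathbb R^3}\frac{(\partial_t+\varepsilon^{-1}\xi\cdot\nabla_x)\sqrt\mu}{\sqrt\mu}|f_\alpha|^2\,dx\,d\xi$$ converges absolutely whenever $\|f_\alpha\|_{L^2}$ and $\|\sqrt\nu(\mathbf I-\mathbf P)f_\alpha\|_{L^2}$ are finite, and $$|\mathcal B_\alpha|\le\frac{\eta}{\kappa\varepsilon^2}\|\sqrt\nu(\mathbf I-\mathbf P)f_\alpha\|_{L^2}^2+C\Big(e^{-\frac\rho{2\varepsilon^2}}\|\nabla_xU\|_{L^2}\|e^{\rho|\xi|^2}f_\alpha\|_{L^\infty}\|f_\alpha\|_{L^2}+\|f_\alpha\|_{L^2}^2+\Big\|\frac{\mathcal T^b_\alpha}{x_3}\Big\|_{L^2}\|f_\alpha\|_{L^2}+\mathcal F'_\alpha\|f_\alpha\|_{L^2}\Big).$$ (3) With the same $\varepsilon_0$ and for $\varepsilon\le\varepsilon_0\sqrt\kappa$, whenever $M_0\ge0$, $\tau_0\le\tau_U/2$ and $\tau(t)>0$, $$\sum_\alpha\mathcal A_\alpha^2|\mathcal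 B_\alpha|\le\eta\,\mathcal D_f^2+C\,\mathcal E_f^2+C\,e^{-\frac{\rho}{4\varepsilon^2}}\mathcal H_f\,\mathcal E_f+\Big(C_0\max_{j=1,2}\|x_3\partial_{x_3}U_j\|_{L^\infty}+\eta\Big)\mathcal Y_f^2+C\,\mathcal G\,\mathcal E_f .$$ All right-hand sides are allowed to be $+\infty$ (with $0\cdot\infty=0$). -/

import Mathlib

open MeasureTheory Set
open scoped ENNReal ContDiff

noncomputable section

namespace PrandtlBoltzmann

/-- Positions and velocities: `ℝ³` with its Euclidean norm. The coordinates `0, 1, 2` are the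
coordinates `1, 2, 3` of the text: `x 0, x 1` are tangential, `x 2` is normal. -/
abbrev V3 := EuclideanSpace ℝ (Fin 3)

/-- Multi-indices `α = (α₀, α₁, α₂)`, for `ε∂_t`, `∂_{x₁}`, `∂_{x₂}`. -/
abbrev MI := Fin 3 → ℕ

/-- Coordinate vectors. -/
def e (i : Fin 3) : V3 := EuclideanSpace.single i 1

/-- A function on `𝕋² × ℝ₊` is a function on `ℝ³` of period one in `x₁` and in `x₂`
(only its values at `x₃ ≥ 0` matter). -/
def TorusPeriodic {β : Type*} (g : V3 → β) : Prop :=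
  ∀ x, g (x + e 0) = g x ∧ g (x + e 1) = g x

/-- The fundamental cell of `Ω = 𝕋² × ℝ₊`. -/
def cell : Set V3 := {x | x 0 ∈ Ico (0 : ℝ) 1 ∧ x 1 ∈ Ico (0 : ℝ) 1 ∧ 0 < x 2}

/-- Lebesgue measure on `Ω`. -/
def mX : Measure V3 := (volume : Measure V3).restrict cell

/-- Lebesgue measure on `Ω × ℝ³`. -/
def mXV : Measure (V3 × V3) := mX.prod volume

/-! ### Derivatives -/

section Derivatives

variable {E : Type*} [NormedAddCommGroup E] [NormedSpace ℝ E]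

/-- `∂_t g`. -/
def pt (g : ℝ → V3 → E) : ℝ → V3 → E := fun t x => deriv (fun s => g s x) t

/-- `∂_{x_i} g`. -/
def px (i : Fin 3) (g : ℝ → V3 → E) : ℝ → V3 → E := fun t x => lineDeriv ℝ (g t) x (e i)

/-- `∂^α g = (ε∂_t)^{α₀} ∂_{x₁}^{α₁} ∂_{x₂}^{α₂} g`. -/
def pMI (ε : ℝ) (α : MI) (g : ℝ → V3 → E) : ℝ → V3 → E :=
  (fun (h : ℝ → V3 → E) t x => ε • pt h t x)^[α 0] ((px 0)^[α 1] ((px 1)^[α 2] g))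

end Derivatives

/-- `|α|`. -/
def MI.deg (α : MI) : ℕ := ∑ i, α i

/-- `α!`. -/
def MI.fact (α : MI) : ℕ := ∏ i, (α i).factorial

/-- `α! / (γ! (α - γ)!)`. -/
def MI.binom (α γ : MI) : ℕ := ∏ i, (α i).choose (γ i)

/-! ### Maxwellian and collision operators -/

/-- The unit sphere of directions `ω`. -/
abbrev S2 := Metric.sphere (0 : V3) 1

/-- The measure `dω dξ_*`. -/
def mColl : Measure (V3 × S2) := (volume : Measure V3).prod (volume : Measure V3).toSphere

/-- `μ₀(ξ) = (2π)^{-3/2} exp(-|ξ|²/2)`. -/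
def mu0 (ξ : V3) : ℝ := (2 * Real.pi) ^ (-(3 / 2 : ℝ)) * Real.exp (-‖ξ‖ ^ 2 / 2)

/-- `ξ' = ξ - ((ξ - ξ_*)·ω) ω`. -/
def post (ξ ξs w : V3) : V3 := ξ - (inner ℝ (ξ - ξs) w) • w

/-- `ξ_*' = ξ_* + ((ξ - ξ_*)·ω) ω`. -/
def postStar (ξ ξs w : V3) : V3 := ξs + (inner ℝ (ξ - ξs) w) • w

/-- The hard-sphere collision operator `Q(F, G)`. -/
def collQ (F G : V3 → ℝ) (ξ : V3) : ℝ :=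
  (1 / 2) * ∫ p : V3 × S2, |inner ℝ (ξ - p.1) (p.2 : V3)| *
    (F (post ξ p.1 p.2) * G (postStar ξ p.1 p.2) + G (post ξ p.1 p.2) * F (postStar ξ p.1 p.2)
      - F ξ * G p.1 - G ξ * F p.1) ∂mColl

/-- The collision operator `L₀` linearized at `μ₀`. -/
def linL0 (f : V3 → ℝ) (ξ : V3) : ℝ :=
  -∫ p : V3 × S2, |inner ℝ (ξ - p.1) (p.2 : V3)| * √(mu0 p.1) *
    (√(mu0 (post ξ p.1 p.2)) * f (postStar ξ p.1 p.2)
      + f (post ξ p.1 p.2) * √(mu0 (postStar ξ p.1 p.2))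
      - √(mu0 ξ) * f p.1 - f ξ * √(mu0 p.1)) ∂mColl

/-- `A` is the continuous square-integrable solution of `L₀ A = g` orthogonal to the null space
`span {√μ₀, ξ_k √μ₀, |ξ|² √μ₀}` of `L₀`. -/
structure IsLinInverse (g A : V3 → ℝ) : Prop where
  cont : Continuous A
  memLp : MemLp A 2 volume
  orth_mass : ∫ ξ, A ξ * √(mu0 ξ) = 0
  orth_momentum : ∀ k : Fin 3, ∫ ξ, A ξ * (ξ k * √(mu0 ξ)) = 0
  orth_energy : ∫ ξ, A ξ * (‖ξ‖ ^ 2 * √(mu0 ξ)) = 0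
  eq : ∀ ξ, linL0 A ξ = g ξ

open Classical in
/-- `L₀⁻¹ g` (set to `0` where there is no solution, which does not happen for the functions
`Â_{ij}` below). -/
def linInv (g : V3 → ℝ) : V3 → ℝ :=
  if h : ∃ A, IsLinInverse g A then h.choose else 0

/-- `Â_{ij}(φ) = (φ_i φ_j - δ_{ij} |φ|²/3) √μ₀(φ)`. -/
def Ahat (i j : Fin 3) (φ : V3) : ℝ :=
  (φ i * φ j - (if i = j then ‖φ‖ ^ 2 / 3 else 0)) * √(mu0 φ)

/-- `A_{ij} = L₀⁻¹ Â_{ij}`. In the variable `φ = ξ - εU` this is `L⁻¹ Â_{ij}(φ)`, since `L` at the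
local Maxwellian is the translate of `L₀`. -/
def Aij (i j : Fin 3) : V3 → ℝ := linInv (Ahat i j)

/-- The normalization constant: `c_μ ∫_{ξ₃ > 0} μ₀(ξ) |ξ₃| dξ = 1`. -/
def cMu : ℝ := (∫ ξ in {ξ : V3 | 0 < ξ 2}, mu0 ξ * |ξ 2|)⁻¹

/-! ### The configuration: fluid fields and the Boltzmann solution -/

/-- Time horizon `T`, parameters `ε, κ, δ`, fluid velocity `U`, fluid pressure `P`, and the
particle density `F`. -/
structure Config where
  T : ℝ
  ε : ℝ
  κ : ℝ
  δ : ℝ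
  U : ℝ → V3 → V3
  P : ℝ → V3 → ℝ
  F : ℝ → V3 → V3 → ℝ

namespace Config

variable (S : Config)

/-- `∂^α`. -/
abbrev D {E : Type*} [NormedAddCommGroup E] [NormedSpace ℝ E] (α : MI) (g : ℝ → V3 → E) :
    ℝ → V3 → E := pMI S.ε α g

/-- `φ = ξ - εU(t,x)`. -/
def phi (t : ℝ) (x ξ : V3) : V3 := ξ - S.ε • S.U t x

/-- The local Maxwellian `μ(t,x,ξ) = μ₀(ξ - εU(t,x))`. -/
def mu (t : ℝ) (x ξ : V3) : ℝ := mu0 (S.phi t x ξ)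

/-- `√μ`. -/
def sqrtMu (t : ℝ) (x ξ : V3) : ℝ := √(S.mu t x ξ)

/-- The collision frequency `ν`. -/
def nu (t : ℝ) (x ξ : V3) : ℝ :=
  ∫ p : V3 × S2, |inner ℝ (ξ - p.1) (p.2 : V3)| * S.mu t x p.1 ∂mColl

/-- `f₂ = P √μ - κ ∑_{i,j} ∂_i U_j A_{ij}(φ)`. -/
def f2 (t : ℝ) (x ξ : V3) : ℝ :=
  S.P t x * S.sqrtMu t x ξ
    - S.κ * ∑ i, ∑ j, (px i S.U t x) j * Aij i j (S.phi t x ξ)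

/-- The remainder `f`, i.e. `F = μ + ε² f₂ √μ + ε δ f √μ`. -/
def f (t : ℝ) (x ξ : V3) : ℝ :=
  (S.F t x ξ - S.mu t x ξ - S.ε ^ 2 * S.f2 t x ξ * S.sqrtMu t x ξ)
    / (S.ε * S.δ * S.sqrtMu t x ξ)

/-- `f_α = ∂^α f`. -/
def fd (α : MI) (t : ℝ) (x ξ : V3) : ℝ := S.D α (fun s y => S.f s y ξ) t x

/-- `a_α = ∫ f_α √μ dξ`. -/
def a (α : MI) (t : ℝ) (x : V3) : ℝ := ∫ ξ, S.fd α t x ξ * S.sqrtMu t x ξ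

/-- `b_{α,i} = ∫ f_α φ_i √μ dξ`. -/
def b (α : MI) (i : Fin 3) (t : ℝ) (x : V3) : ℝ :=
  ∫ ξ, S.fd α t x ξ * S.phi t x ξ i * S.sqrtMu t x ξ

/-- `c_α = ∫ f_α (|φ|² - 3)/3 √μ dξ`. -/
def c (α : MI) (t : ℝ) (x : V3) : ℝ :=
  ∫ ξ, S.fd α t x ξ * ((‖S.phi t x ξ‖ ^ 2 - 3) / 3) * S.sqrtMu t x ξ

/-- The macroscopic part `𝐏 f_α`. -/
def Pf (α : MI) (t : ℝ) (x ξ : V3) : ℝ :=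
  (S.a α t x + ∑ i, S.b α i t x * S.phi t x ξ i
    + S.c α t x * ((‖S.phi t x ξ‖ ^ 2 - 3) / 2)) * S.sqrtMu t x ξ

/-- `∇_x · U`. -/
def divU (t : ℝ) (x : V3) : ℝ := ∑ i, (px i S.U t x) i

/-- `|∇_x U|`. -/
def gradU (t : ℝ) (x : V3) : ℝ := √(∑ i, ‖px i S.U t x‖ ^ 2)

/-- `U_i`. -/
def Uc (i : Fin 3) (t : ℝ) (x : V3) : ℝ := S.U t x i

/-- `U₃²`. -/
def U3sq (t : ℝ) (x : V3) : ℝ := S.Uc 2 t x ^ 2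

/-- `P U₃`. -/
def PU3 (t : ℝ) (x : V3) : ℝ := S.P t x * S.Uc 2 t x

/-- The space-time region `(0,T) × {x₃ ≥ 0}`. -/
def slab : Set (ℝ × V3) := Ioo 0 S.T ×ˢ {x | 0 ≤ x 2}

/-- The open space-time region `(0,T) × {x₃ > 0}`. -/
def slabInt : Set (ℝ × V3) := Ioo 0 S.T ×ˢ {x | 0 < x 2}

/-- Boundary layer velocity fields: smooth up to the boundary, no-slip, with gradients of size
`κ^{-1/2}` in the normal and of size one in the tangential directions and in `ε∂_t`, uniformly
with all derivatives `∂^γ` on the scale of real-analytic functions of radius `τU`; the normal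
derivative is concentrated in a layer, `|x₃ ∂₃U_∥| ≤ K`. -/
structure IsBoundaryLayerFlow (K τU : ℝ) : Prop where
  smooth_U : ContDiffOn ℝ ∞ (fun p : ℝ × V3 => S.U p.1 p.2) S.slab
  smooth_P : ContDiffOn ℝ ∞ (fun p : ℝ × V3 => S.P p.1 p.2) S.slab
  periodic_U : ∀ t, TorusPeriodic (S.U t)
  periodic_P : ∀ t, TorusPeriodic (S.P t)
  no_slip : ∀ t ∈ Ioo 0 S.T, ∀ x : V3, x 2 = 0 → S.U t x = 0
  bound : ∀ t ∈ Ioo 0 S.T, ∀ x : V3, 0 < x 2 → ∀ γ : MI,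
    τU ^ γ.deg / γ.fact * ‖S.D γ S.U t x‖ ≤ K
  bound_tangential : ∀ t ∈ Ioo 0 S.T, ∀ x : V3, 0 < x 2 → ∀ γ : MI, ∀ i : Fin 3, i ≠ 2 →
    τU ^ γ.deg / γ.fact * ‖S.D γ (px i S.U) t x‖ ≤ K
  bound_normal : ∀ t ∈ Ioo 0 S.T, ∀ x : V3, 0 < x 2 → ∀ γ : MI,
    τU ^ γ.deg / γ.fact * ‖S.D γ (px 2 S.U) t x‖ ≤ K / √S.κ
  bound_time : ∀ t ∈ Ioo 0 S.T, ∀ x : V3, 0 < x 2 → ∀ γ : MI,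
    τU ^ γ.deg / γ.fact * ‖S.D γ (fun s y => S.ε • pt S.U s y) t x‖ ≤ K
  bound_layer : ∀ t ∈ Ioo 0 S.T, ∀ x : V3, 0 < x 2 → ∀ j : Fin 3, j ≠ 2 →
    |x 2 * (px 2 S.U t x) j| ≤ K
  bound_div : ∀ t ∈ Ioo 0 S.T, ∀ x : V3, 0 < x 2 → |S.divU t x| ≤ K
  bound_L2 : ∀ t ∈ Ioo 0 S.T, eLpNorm (S.gradU t) 2 mX ≤ ENNReal.ofReal (K / √S.κ)

/-- `F` solves `∂_t F + ε⁻¹ ξ·∇_x F = (κε²)⁻¹ Q(F,F)` in `(0,T) × Ω × ℝ³` with the diffuse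
reflection boundary condition at `x₃ = 0`, away from the grazing velocities `ξ₃ = 0` (a null set);
the remainder `f` is smooth in `(t, x₁, x₂)`, and each `e^{ρ|ξ|²} f_α` is bounded. -/
structure IsSolution (ρ : ℝ) : Prop where
  meas : Measurable fun p : ℝ × V3 × V3 => S.F p.1 p.2.1 p.2.2
  periodic : ∀ t ξ, TorusPeriodic fun x => S.F t x ξ
  cont : ∀ ξ : V3, ξ 2 ≠ 0 → ContinuousOn (fun p : ℝ × V3 => S.F p.1 p.2 ξ) S.slab
  diff : ∀ ξ : V3, ξ 2 ≠ 0 → ContDiffOn ℝ 1 (fun p : ℝ × V3 => S.F p.1 p.2 ξ) S.slabInt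
  boltzmann : ∀ t ∈ Ioo 0 S.T, ∀ x ξ : V3, 0 < x 2 → ξ 2 ≠ 0 →
    pt (fun s y => S.F s y ξ) t x + S.ε⁻¹ * ∑ i, ξ i * px i (fun s y => S.F s y ξ) t x
      = (S.κ * S.ε ^ 2)⁻¹ * collQ (S.F t x) (S.F t x) ξ
  diffuse : ∀ t ∈ Ioo 0 S.T, ∀ x ξ : V3, x 2 = 0 → 0 < ξ 2 →
    S.F t x ξ = cMu * mu0 ξ * ∫ ζ in {ζ : V3 | ζ 2 < 0}, S.F t x ζ * |ζ 2|
  smooth : ∀ ξ : V3, ξ 2 ≠ 0 → ∀ x₃ : ℝ, 0 < x₃ →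
    ContDiffOn ℝ ∞ (fun p : ℝ × ℝ × ℝ => S.f p.1 !₂[p.2.1, p.2.2, x₃] ξ)
      (Ioo 0 S.T ×ˢ univ)
  decay : ∀ α : MI, ∃ M : ℝ, ∀ t ∈ Ioo 0 S.T, ∀ x ξ : V3, 0 < x 2 → ξ 2 ≠ 0 →
    |S.fd α t x ξ| ≤ M * Real.exp (-ρ * ‖ξ‖ ^ 2)

/-- The standing assumptions. -/
structure Admissible (K τU ρ : ℝ) : Prop where
  T_pos : 0 < S.T
  eps_pos : 0 < S.ε
  kappa_pos : 0 < S.κ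
  kappa_le : S.κ ≤ 1
  delta_pos : 0 < S.δ
  radius_pos : 0 < τU
  flow : S.IsBoundaryLayerFlow K τU
  sol : S.IsSolution ρ

/-! ### Norms at a fixed time and the quantities of the estimate -/

/-- `‖f_α(t)‖_{L²_{x,ξ}}`. -/
def nf (α : MI) (t : ℝ) : ℝ≥0∞ := eLpNorm (fun p : V3 × V3 => S.fd α t p.1 p.2) 2 mXV

/-- `‖√ν (𝐈 - 𝐏) f_α(t)‖_{L²_{x,ξ}}`. -/
def nDiss (α : MI) (t : ℝ) : ℝ≥0∞ :=
  eLpNorm (fun p : V3 × V3 => √(S.nu t p.1 p.2) * (S.fd α t p.1 p.2 - S.Pf α t p.1 p.2)) 2 mXV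

/-- `‖e^{ρ|ξ|²} f_α(t)‖_{L^∞_{x,ξ}}`. -/
def nInf (ρ : ℝ) (α : MI) (t : ℝ) : ℝ≥0∞ :=
  eLpNorm (fun p : V3 × V3 => Real.exp (ρ * ‖p.2‖ ^ 2) * S.fd α t p.1 p.2) ∞ mXV

/-- `‖e^{c|ξ|²} g(t)‖_{L^∞_{x,ξ}}` for `g = g(t,x,ξ)`. -/
def wInf (c : ℝ) (g : V3 → ℝ → V3 → ℝ) (t : ℝ) : ℝ≥0∞ :=
  eLpNorm (fun p : V3 × V3 => Real.exp (c * ‖p.2‖ ^ 2) * g p.2 t p.1) ∞ mXV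

/-- `∂^γ √μ`, with the velocity as first argument. -/
def dSqrtMu (γ : MI) (ξ : V3) : ℝ → V3 → ℝ := S.D γ (fun s y => S.sqrtMu s y ξ)

/-- `‖e^{c|ξ|²} (1, ε∂_t, ∇_x) ∂^γ √μ‖_{L^∞_{x,ξ}}`. -/
def nMu (c : ℝ) (γ : MI) (t : ℝ) : ℝ≥0∞ :=
  wInf c (S.dSqrtMu γ) t + wInf c (fun ξ s y => S.ε * pt (S.dSqrtMu γ ξ) s y) t
    + ∑ i, wInf c (fun ξ => px i (S.dSqrtMu γ ξ)) t

/-- `∑_{∂ ∈ {ε∂_t, ∂_{x₁}, ∂_{x₂}}} ‖∂ f_α‖_{L²_{x,ξ}}`. -/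
def nfOne (α : MI) (t : ℝ) : ℝ≥0∞ := ∑ i, S.nf (α + Pi.single i 1) t

/-- The singular factor `(∂_t + ε⁻¹ ξ·∇_x)√μ / √μ`. -/
def bulkFactor (t : ℝ) (x ξ : V3) : ℝ :=
  (pt (fun s y => S.sqrtMu s y ξ) t x
    + S.ε⁻¹ * ∑ i, ξ i * px i (fun s y => S.sqrtMu s y ξ) t x) / S.sqrtMu t x ξ

/-- The integrand of the bulk term. -/
def bulkIntegrand (α : MI) (t : ℝ) (p : V3 × V3) : ℝ :=
  S.bulkFactor t p.1 p.2 * |S.fd α t p.1 p.2| ^ 2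

/-- The bulk term `∫_{Ω×ℝ³} ((∂_t + ε⁻¹ ξ·∇_x)√μ / √μ) |f_α|² dx dξ`. -/
def bulk (α : MI) (t : ℝ) : ℝ := ∫ p, S.bulkIntegrand α t p ∂mXV

/-- `𝒯^b_α`, the part of `b_{α,3}` left when the explicit terms are split off. -/
def Tb (α : MI) (t : ℝ) (x : V3) : ℝ :=
  S.b α 2 t x + S.ε * S.Uc 2 t x * S.a α t x + S.ε / (2 * S.δ) * S.D α S.U3sq t x
    + S.ε / S.δ * S.D α S.PU3 t x

/-- `‖𝒯^b_α(t) / x₃‖_{L²_x}`. -/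
def nTb (α : MI) (t : ℝ) : ℝ≥0∞ := eLpNorm (fun x => S.Tb α t x / x 2) 2 mX

/-- The fluid terms in the bound of `𝒯^b_α / x₃`. -/
def forceT (α : MI) (t : ℝ) : ℝ≥0∞ :=
  ENNReal.ofReal (S.ε * S.δ)⁻¹ * eLpNorm (S.D α S.divU t) 2 mX
  + ENNReal.ofReal (S.ε / S.δ) * ∑ i ∈ ({0, 1} : Finset (Fin 3)),
      eLpNorm (S.D α (fun s y => S.Uc i s y ^ 2) t) 2 mX
  + ENNReal.ofReal (S.ε ^ 2 / S.δ) * eLpNorm (S.D α (fun s y => pt S.P s y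
      + ∑ i ∈ ({0, 1} : Finset (Fin 3)), px i (fun r z => S.P r z * S.Uc i r z) s y) t) 2 mX
  + ENNReal.ofReal (S.ε ^ 2 * S.κ / S.δ) * ∑ i, ∑ j,
      eLpNorm (S.D α (fun s y => (px i S.U s y) j * S.divU s y) t) 2 mX
  + ENNReal.ofReal (S.ε / S.δ) *
      (eLpNorm (px 2 (S.D α S.U3sq) t) 2 mX + eLpNorm (px 2 (S.D α S.PU3) t) 2 mX)

/-- `ε κ^{-1/2} δ⁻¹ (‖∂^α(U₃²)‖_{L²} + ‖∂^α(P U₃)‖_{L²})`. -/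
def forceB (α : MI) (t : ℝ) : ℝ≥0∞ :=
  ENNReal.ofReal (S.ε / (√S.κ * S.δ)) *
    (eLpNorm (S.D α S.U3sq t) 2 mX + eLpNorm (S.D α S.PU3 t) 2 mX)

/-- The right-hand side of the bound of `𝒯^b_α / x₃`. In the commutator sum `β = α - γ`. -/
def boundT (c : ℝ) (α : MI) (t : ℝ) : ℝ≥0∞ :=
  S.nf α t + S.nfOne α t + S.forceT α t
    + ∑ γ ∈ (Finset.Iic α).filter (fun γ => γ ≠ 0),
        (α.binom γ : ℝ≥0∞) * (S.nf (α - γ) t + S.nfOne (α - γ) t) * S.nMu c γ t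

/-- The right-hand side of the bound of the bulk term: coefficient `η` for the dissipation and
`C` for all other terms. -/
def boundBulk (η C ρ : ℝ) (α : MI) (t : ℝ) : ℝ≥0∞ :=
  ENNReal.ofReal (η / (S.κ * S.ε ^ 2)) * S.nDiss α t ^ 2
  + ENNReal.ofReal C *
    (ENNReal.ofReal (Real.exp (-ρ / (2 * S.ε ^ 2))) * eLpNorm (S.gradU t) 2 mX
        * S.nInf ρ α t * S.nf α t
      + S.nf α t ^ 2 + S.nTb α t * S.nf α t + S.forceB α t * S.nf α t)

/-- `max_{j=1,2} ‖x₃ ∂₃ U_j(t)‖_{L^∞}`. -/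
def layer (t : ℝ) : ℝ≥0∞ :=
  max (eLpNorm (fun x : V3 => x 2 * (px 2 S.U t x) 0) ∞ mX)
    (eLpNorm (fun x : V3 => x 2 * (px 2 S.U t x) 1) ∞ mX)

end Config

/-! ### Analytic norms -/

/-- The analyticity radius `τ(t) = τ₀ - M₀ t`. -/
def tau (τ0 M0 t : ℝ) : ℝ := τ0 - M0 * t

/-- `𝒜_α(t) = τ(t)^{|α|} ⟨α⟩⁹ / α!` with `⟨α⟩ = 1 + |α|`. -/
def wA (τ0 M0 : ℝ) (α : MI) (t : ℝ) : ℝ :=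
  tau τ0 M0 t ^ α.deg / α.fact * (1 + (α.deg : ℝ)) ^ 9

/-- The `ℓ²` norm over multi-indices. -/
def ellTwo (u : MI → ℝ≥0∞) : ℝ≥0∞ := (∑' α, u α ^ 2) ^ (1 / 2 : ℝ)

namespace Config

variable (S : Config)

/-- `ℰ_f(t)`. -/
def En (τ0 M0 t : ℝ) : ℝ≥0∞ :=
  ellTwo fun α => ENNReal.ofReal (wA τ0 M0 α t) * S.nf α t

/-- `𝒟_f(t)`. -/
def Dn (τ0 M0 t : ℝ) : ℝ≥0∞ :=
  ENNReal.ofReal (S.ε * √S.κ)⁻¹ * ellTwo fun α => ENNReal.ofReal (wA τ0 M0 α t) * S.nDiss α t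

/-- `ℋ_{ρ,f}(t)`, with the supremum over the times up to `t`. -/
def Hn (ρ τ0 M0 t : ℝ) : ℝ≥0∞ :=
  ellTwo fun α => ⨆ s ∈ Ioc 0 t, ENNReal.ofReal (wA τ0 M0 α s) * S.nInf ρ α s

/-- `𝒴_f(t)`. -/
def Yn (τ0 M0 t : ℝ) : ℝ≥0∞ :=
  (∑' α : MI, ENNReal.ofReal (((α.deg : ℝ) + 1) / tau τ0 M0 t) *
    (ENNReal.ofReal (wA τ0 M0 α t) * S.nf α t) ^ 2) ^ (1 / 2 : ℝ)

/-- The analytic norm of the fluid terms. -/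
def Gn (τ0 M0 t : ℝ) : ℝ≥0∞ :=
  ellTwo fun α => ENNReal.ofReal (wA τ0 M0 α t) * (S.forceT α t + S.forceB α t)

end Config

end PrandtlBoltzmann

end

open PrandtlBoltzmann

/-!
The singular part of the bulk factor `½ φ · (ε ∂ₜ + ξ · ∇) U` comes from the normal derivatives of
the tangential velocity, which are of size `κ^{-1/2}` in the boundary layer. The proof trades them
for the conormal derivatives `x₃ ∂₃U_j`, which are bounded, by showing that the normal momentum
`b_{α,3}` vanishes at the wall up to harmless terms.

**Normal momentum.** The collision operator conserves mass and diffuse reflection lets no mass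
through the wall, so the flux `∫ ξ₃ f √μ dξ` at height `x₃` is minus the integral, over the heights
below, of `ε ∂ₜ∫ f √μ + ∇_∥ · ∫ ξ_∥ f √μ` and of fluid terms (`mass_from_boundary`,
`avg_normal_eq`). The tensors `A_{ij}` are not known to be differentiable, so the equation is not
split into `f` and a source. The conservation law is derived for `F`, tested with functions of
`(t, x₁, x₂)` only (`tested_kinetic`, `tested_mass`); in its moments `A_{ij}`, being orthogonal to
the collision invariants, does not appear, and what is left is smooth, so the law holds pointwise
(`mass_between`). Hardy's inequality (`hardy_lintegral`, `eLpNorm_div_le`) turns the integral over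
the heights into a bound of `𝒯^b_α / x₃`. The commutators with `∂^γ √μ`, `γ ≠ 0`, vanish at the wall
by the no-slip condition, so they can be divided by `x₃` as well (`nTb_le`).

**Commutators.** Write `√μ = √μ₀ e^{lg}` with `lg` a polynomial in `ε U` and `ξ`. For the jet norms
`∑_{γ ≤ α} |∂^γ u| s^{|γ|} / γ!`, which are submultiplicative, the exponential is bounded by a
Grönwall argument in the radius `s` (`TSm.jet_exp_le`). Hence `∂^γ √μ`, `γ ≠ 0`, with its first
derivatives, is bounded by `(ε / √κ) γ! (3 τ_U / 4)^{-|γ|}` times a Gaussian (`nMu_le`).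

**Bulk term.** Up to a term of quadratic growth in `φ` with bounded coefficients the bulk factor is
`½ φ₃ (∂₃U₁ φ₁ + ∂₃U₂ φ₂)` (`abs_bulkFactor_sub_le`). The parts of the integral that involve
`(𝐈 - 𝐏) f_α` are absorbed by the dissipation for `|ξ| ≤ 1 / ε`, since `ν ≥ c₀ (1 + |ξ|)` and
`ε / √κ` is small; the velocities beyond are exponentially rare. By parity the macroscopic part is
a multiple of `b_{α,3} b_{α,j} ∂₃U_j` (`integral_bulkSing_mul`), in which `b_{α,3}` is replaced by
`𝒯^b_α`, and the factor `x₃` is moved from `𝒯^b_α / x₃` to `∂₃U_j` (`abs_bulk_le`).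

**Summation.** The weights satisfy `𝒜_α binom(α, γ) γ! (3 τ_U / 4)^{-|γ|} ≤ 𝒜_{α - γ} q_γ` with
a summable sequence `q`, as `τ ≤ τ_U / 2` (`wA_mul_binom_le`, `comSeq`), so the commutators sum up
by Young's inequality. The tangential derivative in the Hardy bound costs the factor
`(|α| + 1) / τ` and produces `𝒴_f` (`wA_le_add_single`). Its coefficient is absolute once
`ε₀ K ≤ 1`, and the terms with `γ ≠ 0` carry `ε / √κ ≤ ε₀`, which puts their share below `η` (`tsum_nTb_le`, `tsum_bulk_le`).
-/

set_option linter.unusedSectionVars false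

noncomputable section
namespace PrandtlBoltzmann

open ENNReal (ofReal)
open Real (exp)

/-! ### Tangential derivatives -/

section TangentialCalculus

variable {E : Type*} [NormedAddCommGroup E] [NormedSpace ℝ E]

/-- The point of the slice `x₃ = z` with tangential coordinates `y`. -/
def pnt (y : ℝ × ℝ) (z : ℝ) : V3 := !₂[y.1, y.2, z]

@[simp] lemma pnt_zero (y : ℝ × ℝ) (z : ℝ) : pnt y z 0 = y.1 := by simp [pnt]
@[simp] lemma pnt_one (y : ℝ × ℝ) (z : ℝ) : pnt y z 1 = y.2 := by simp [pnt]
@[simp] lemma pnt_two (y : ℝ × ℝ) (z : ℝ) : pnt y z 2 = z := by simp [pnt]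

lemma pnt_eta (x : V3) : pnt (x 0, x 1) (x 2) = x := by
  ext i; fin_cases i <;> simp [pnt]

lemma pnt_add (y : ℝ × ℝ) (z s : ℝ) : pnt y (z + s) = pnt y z + s • e 2 := by
  ext i; fin_cases i <;> simp [pnt, e]

lemma contDiff_pnt {n : WithTop ℕ∞} : ContDiff ℝ n fun p : (ℝ × ℝ) × ℝ => pnt p.1 p.2 := by
  unfold pnt
  rw [contDiff_euclidean]
  intro i
  fin_cases i <;> simp <;> fun_prop

lemma continuous_pnt : Continuous fun p : (ℝ × ℝ) × ℝ => pnt p.1 p.2 :=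
  (contDiff_pnt (n := 0)).continuous

/-- The restriction of `g` to the slice `x₃ = z`, as a function of `(t, x₁, x₂)`. -/
def slice (z : ℝ) (g : ℝ → V3 → E) (p : ℝ × ℝ × ℝ) : E := g p.1 (pnt p.2 z)

/-- The tangential region of times `t ∈ (0, T)`. -/
def tdom (T : ℝ) : Set (ℝ × ℝ × ℝ) := Ioo 0 T ×ˢ univ

lemma isOpen_tdom (T : ℝ) : IsOpen (tdom T) := isOpen_Ioo.prod isOpen_univ

/-- `g` is smooth in `(t, x₁, x₂)` on the slice `x₃ = z`. -/
def TSm (T z : ℝ) (g : ℝ → V3 → E) : Prop := ContDiffOn ℝ ∞ (slice z g) (tdom T)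

/-- `g` and `h` agree on the slice `x₃ = z`. -/
def TEq (T z : ℝ) (g h : ℝ → V3 → E) : Prop := ∀ t ∈ Ioo 0 T, ∀ x : V3, x 2 = z → g t x = h t x

/-- The derivations `ε∂_t`, `∂_{x₁}`, `∂_{x₂}`. -/
def dT (ε : ℝ) (i : Fin 3) (g : ℝ → V3 → E) : ℝ → V3 → E :=
  ![fun t x => ε • pt g t x, px 0 g, px 1 g] i

/-- The directions of the derivations `dT`. -/
def dirT (ε : ℝ) : Fin 3 → ℝ × ℝ × ℝ := ![(ε, 0, 0), (0, 1, 0), (0, 0, 1)]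

lemma pMI_eq (ε : ℝ) (α : MI) (g : ℝ → V3 → E) :
    pMI ε α g = (dT ε 0)^[α 0] ((dT ε 1)^[α 1] ((dT ε 2)^[α 2] g)) := rfl

@[simp] lemma pMI_zero (ε : ℝ) (g : ℝ → V3 → E) : pMI ε 0 g = g := rfl

variable {T z ε : ℝ} {g h : ℝ → V3 → E}

lemma TEq.refl (g : ℝ → V3 → E) : TEq T z g g := fun _ _ _ _ => rfl

lemma TEq.symm (H : TEq T z g h) : TEq T z h g := fun t ht x hx => (H t ht x hx).symm

lemma TEq.trans {k : ℝ → V3 → E} (H : TEq T z g h) (H' : TEq T z h k) : TEq T z g k :=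
  fun t ht x hx => (H t ht x hx).trans (H' t ht x hx)

lemma TEq.slice_eqOn (H : TEq T z g h) : EqOn (slice z g) (slice z h) (tdom T) :=
  fun p hp => H p.1 hp.1 _ (by simp)

lemma TSm.congr (H : TSm T z g) (H' : TEq T z h g) : TSm T z h :=
  ContDiffOn.congr H H'.slice_eqOn

lemma dT_eq_lineDeriv (g : ℝ → V3 → E) (t : ℝ) (x : V3) (i : Fin 3) :
    dT ε i g t x = lineDeriv ℝ (slice (x 2) g) (t, x 0, x 1) (dirT ε i) := by
  have key : ∀ s : ℝ, x + s • e 0 = pnt (x 0 + s, x 1) (x 2) := by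
    intro s; ext i; fin_cases i <;> simp [pnt, e]
  have key1 : ∀ s : ℝ, x + s • e 1 = pnt (x 0, x 1 + s) (x 2) := by
    intro s; ext i; fin_cases i <;> simp [pnt, e]
  fin_cases i
  · have h2 : dirT ε 0 = ε • ((1 : ℝ), (0 : ℝ), (0 : ℝ)) := by simp [dirT]
    have h3 : pt g t x = lineDeriv ℝ (slice (x 2) g) (t, x 0, x 1) (1, 0, 0) := by
      simp [lineDeriv, slice, pt, pnt_eta]
      rw [deriv_comp_const_add (fun s => g s x) t 0]; simp
    simp only [Fin.zero_eta, h2, lineDeriv_smul, ← h3]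
    simp [dT]
  · simp [dT, dirT, lineDeriv, slice, px, key]
  · simp [dT, dirT, lineDeriv, slice, px, key1]

lemma mem_tdom {t : ℝ} (ht : t ∈ Ioo 0 T) (y : ℝ × ℝ) : (t, y) ∈ tdom T := ⟨ht, mem_univ _⟩

lemma TSm.differentiableAt (H : TSm T z g) {p : ℝ × ℝ × ℝ} (hp : p ∈ tdom T) :
    DifferentiableAt ℝ (slice z g) p :=
  (ContDiffOn.contDiffAt H ((isOpen_tdom T).mem_nhds hp)).differentiableAt (by simp)

lemma TSm.dT_eq (H : TSm T z g) {t : ℝ} (ht : t ∈ Ioo 0 T) {x : V3} (hx : x 2 = z) (i : Fin 3) :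
    dT ε i g t x = fderiv ℝ (slice z g) (t, x 0, x 1) (dirT ε i) := by
  subst hx
  rw [dT_eq_lineDeriv, (H.differentiableAt (mem_tdom ht (x 0, x 1))).lineDeriv_eq_fderiv]

lemma TSm.slice_dT (H : TSm T z g) (i : Fin 3) :
    EqOn (slice z (dT ε i g)) (fun p => fderiv ℝ (slice z g) p (dirT ε i)) (tdom T) := by
  intro p hp
  have := H.dT_eq (ε := ε) hp.1 (x := pnt p.2 z) (by simp) i
  simpa [slice] using this

lemma TSm.contDiffOn_fderiv (H : TSm T z g) : ContDiffOn ℝ ∞ (fderiv ℝ (slice z g)) (tdom T) :=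
  ContDiffOn.fderiv_of_isOpen H (isOpen_tdom T) (by simp)

lemma TSm.deriv (H : TSm T z g) (i : Fin 3) : TSm T z (dT ε i g) :=
  (H.contDiffOn_fderiv.clm_apply contDiffOn_const).congr (H.slice_dT i)

lemma TEq.deriv (H : TEq T z g h) (i : Fin 3) : TEq T z (dT ε i g) (dT ε i h) := by
  intro t ht x hx
  subst hx
  rw [dT_eq_lineDeriv, dT_eq_lineDeriv]
  apply Filter.EventuallyEq.lineDeriv_eq
  exact H.slice_eqOn.eventuallyEq_of_mem ((isOpen_tdom T).mem_nhds (mem_tdom ht _))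

lemma TEq.dT_iterate (H : TEq T z g h) (i : Fin 3) (n : ℕ) :
    TEq T z ((dT ε i)^[n] g) ((dT ε i)^[n] h) := by
  induction n with
  | zero => exact H
  | succ n ih => rw [Function.iterate_succ_apply', Function.iterate_succ_apply']; exact ih.deriv i

lemma TEq.derivMI (H : TEq T z g h) (α : MI) : TEq T z (pMI ε α g) (pMI ε α h) := by
  rw [pMI_eq, pMI_eq]
  exact ((H.dT_iterate 2 _).dT_iterate 1 _).dT_iterate 0 _

lemma TSm.dT_iterate (H : TSm T z g) (i : Fin 3) (n : ℕ) :
    TSm T z ((dT ε i)^[n] g) := by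
  induction n with
  | zero => exact H
  | succ n ih => rw [Function.iterate_succ_apply']; exact ih.deriv i

lemma TSm.derivMI (H : TSm T z g) (α : MI) : TSm T z (pMI ε α g) := by
  rw [pMI_eq]
  exact ((H.dT_iterate 2 _).dT_iterate 1 _).dT_iterate 0 _

lemma TSm.dT_comm (H : TSm T z g) (i j : Fin 3) :
    TEq T z (dT ε i (dT ε j g))
      (dT ε j (dT ε i g)) := by
  intro t ht x hx
  have hp := mem_tdom ht (x 0, x 1)
  have hn := (isOpen_tdom T).mem_nhds hp
  have key : ∀ i j, dT ε i (dT ε j g) t x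
      = fderiv ℝ (fderiv ℝ (slice z g)) (t, x 0, x 1) (dirT ε i) (dirT ε j) := by
    intro i j
    rw [(H.deriv j).dT_eq ht hx i,
      ((H.slice_dT j).eventuallyEq_of_mem hn).fderiv_eq, fderiv_clm_apply]
    · simp
    · exact (H.contDiffOn_fderiv.contDiffAt hn).differentiableAt (by simp)
    · fun_prop
  rw [key, key]
  have := (ContDiffOn.contDiffAt H hn).isSymmSndFDerivAt (by
    simpa using WithTop.coe_le_coe.2 (le_top : (2 : ℕ∞) ≤ ⊤))
  exact this _ _

lemma TSm.dT_iterate_comm (H : TSm T z g) (i j : Fin 3) (n : ℕ) :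
    TEq T z (dT ε i ((dT ε j)^[n] g))
      ((dT ε j)^[n] (dT ε i g)) := by
  induction n with
  | zero => exact TEq.refl _
  | succ n ih =>
    rw [Function.iterate_succ_apply', Function.iterate_succ_apply']
    exact ((H.dT_iterate j n).dT_comm i j).trans (ih.deriv j)

/-- `∂^{α + e_i} = ∂^α ∂_i`. -/
lemma TSm.pMI_add_single (H : TSm T z g) (α : MI) (i : Fin 3) :
    TEq T z (pMI ε (α + Pi.single i 1) g)
      (pMI ε α (dT ε i g)) := by
  rw [pMI_eq, pMI_eq]
  fin_cases i
  · simp [Function.iterate_succ_apply]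
    exact (((H.dT_iterate 2 _).dT_iterate_comm 0 1 _).trans
      ((H.dT_iterate_comm 0 2 _).dT_iterate 1 _)).dT_iterate 0 _
  · simp [Function.iterate_succ_apply]
    exact ((H.dT_iterate_comm 1 2 _).dT_iterate 1 _).dT_iterate 0 _
  · simp [Function.iterate_succ_apply]
    exact TEq.refl _

/-- `∂^α ∂_i = ∂_i ∂^α`. -/
lemma TSm.pMI_dT (H : TSm T z g) (α : MI) (i : Fin 3) :
    TEq T z (pMI ε α (dT ε i g))
      (dT ε i (pMI ε α g)) := by
  rw [pMI_eq, pMI_eq]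
  refine TEq.symm ?_
  refine (((H.dT_iterate 2 _).dT_iterate 1 _).dT_iterate_comm i 0 _).trans (TEq.dT_iterate ?_ _ _)
  refine ((H.dT_iterate 2 _).dT_iterate_comm i 1 _).trans (TEq.dT_iterate ?_ _ _)
  exact H.dT_iterate_comm i 2 _

lemma TSm.pMI_add_single' (H : TSm T z g) (α : MI) (i : Fin 3) :
    TEq T z (pMI ε (α + Pi.single i 1) g)
      (dT ε i (pMI ε α g)) :=
  (H.pMI_add_single α i).trans (H.pMI_dT α i)

lemma MI.induction {p : MI → Prop} (h0 : p 0) (h1 : ∀ α i, p α → p (α + Pi.single i 1)) (α : MI) :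
    p α := by
  suffices ∀ n : ℕ, ∀ α : MI, ∑ i, α i = n → p α from this _ α rfl
  intro n
  induction n with
  | zero =>
    intro α hα
    have : α = 0 := by ext i; simpa using (Finset.sum_eq_zero_iff.1 hα) i
    rwa [this]
  | succ n ih =>
    intro α hα
    obtain ⟨i, hi⟩ : ∃ i, α i ≠ 0 := by
      by_contra! hc
      simp [hc] at hα
    have hle : Pi.single i 1 ≤ α := by
      intro j
      by_cases hj : j = i
      · subst hj; simp; omega
      · simp [hj]
    have h2 : α = (α - Pi.single i 1) + Pi.single i 1 := (tsub_add_cancel_of_le hle).symm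
    rw [h2]
    apply h1
    apply ih
    have h3 := congrArg (fun β : MI => ∑ j, β j) h2
    simp only [Pi.add_apply, Finset.sum_add_distrib, hα] at h3
    rw [Finset.sum_pi_single' i 1 Finset.univ] at h3
    simp at h3 ⊢
    omega

end TangentialCalculus

section TangentialAlgebra

variable {E G : Type*} [NormedAddCommGroup E] [NormedSpace ℝ E]
  [NormedAddCommGroup G] [NormedSpace ℝ G]
variable {T z ε : ℝ} {g h : ℝ → V3 → E} {u v : ℝ → V3 → ℝ}

lemma TSm.add (hg : TSm T z g) (hh : TSm T z h) : TSm T z (fun t x => g t x + h t x) :=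
  ContDiffOn.add hg hh

lemma TSm.mul (hu : TSm T z u) (hv : TSm T z v) : TSm T z (fun t x => u t x * v t x) :=
  ContDiffOn.mul hu hv

lemma TSm.clm (L : E →L[ℝ] G) (hg : TSm T z g) : TSm T z (fun t x => L (g t x)) :=
  L.contDiff.comp_contDiffOn hg

lemma TSm.const (c : E) : TSm T z (fun _ _ => c) := contDiffOn_const

lemma TSm.sum {ι : Type*} {s : Finset ι} {g : ι → ℝ → V3 → E} (hg : ∀ i ∈ s, TSm T z (g i)) :
    TSm T z (fun t x => ∑ i ∈ s, g i t x) :=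
  ContDiffOn.sum hg

lemma TSm.dT_add (hg : TSm T z g) (hh : TSm T z h) (i : Fin 3) :
    TEq T z (dT ε i (fun t x => g t x + h t x)) (fun t x => dT ε i g t x + dT ε i h t x) := by
  intro t ht x hx
  have hp := mem_tdom ht (x 0, x 1)
  simp only []
  rw [(hg.add hh).dT_eq ht hx, hg.dT_eq ht hx, hh.dT_eq ht hx]
  have : slice z (fun t x => g t x + h t x) = fun p => slice z g p + slice z h p := rfl
  rw [this, fderiv_fun_add (hg.differentiableAt hp) (hh.differentiableAt hp)]
  rfl

lemma TSm.dT_mul (hu : TSm T z u) (hv : TSm T z v) (i : Fin 3) :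
    TEq T z (dT ε i (fun t x => u t x * v t x))
      (fun t x => dT ε i u t x * v t x + u t x * dT ε i v t x) := by
  intro t ht x hx
  have hp := mem_tdom ht (x 0, x 1)
  simp only []
  rw [(hu.mul hv).dT_eq ht hx, hu.dT_eq ht hx, hv.dT_eq ht hx]
  have : slice z (fun t x => u t x * v t x) = fun p => slice z u p * slice z v p := rfl
  rw [this, fderiv_fun_mul (hu.differentiableAt hp) (hv.differentiableAt hp)]
  have hxx : pnt (x 0, x 1) z = x := by rw [← hx, pnt_eta]
  simp [slice, hxx]; ring

lemma TSm.dT_clm (L : E →L[ℝ] G) (hg : TSm T z g) (i : Fin 3) :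
    TEq T z (dT ε i (fun t x => L (g t x))) (fun t x => L (dT ε i g t x)) := by
  intro t ht x hx
  have hp := mem_tdom ht (x 0, x 1)
  simp only []
  rw [(hg.clm L).dT_eq ht hx, hg.dT_eq ht hx]
  have : HasFDerivAt (slice z (fun t x => L (g t x)))
      (L ∘L fderiv ℝ (slice z g) (t, x 0, x 1)) (t, x 0, x 1) :=
    L.hasFDerivAt.comp _ (hg.differentiableAt hp).hasFDerivAt
  rw [this.fderiv]
  rfl

lemma TSm.pMI_clm (L : E →L[ℝ] G) (hg : TSm T z g) (α : MI) :
    TEq T z (pMI ε α (fun t x => L (g t x))) (fun t x => L (pMI ε α g t x)) := by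
  induction α using MI.induction with
  | h0 => exact TEq.refl _
  | h1 α i ih =>
    refine ((hg.clm L).pMI_add_single' α i).trans ((ih.deriv i).trans
      (((hg.derivMI α).dT_clm L i).trans ?_))
    intro t ht x hx
    exact congrArg L ((hg.pMI_add_single' α i) t ht x hx).symm

lemma TSm.pMI_add (hg : TSm T z g) (hh : TSm T z h) (α : MI) :
    TEq T z (pMI ε α (fun t x => g t x + h t x)) (fun t x => pMI ε α g t x + pMI ε α h t x) := by
  induction α using MI.induction with
  | h0 => exact TEq.refl _
  | h1 α i ih =>
    refine ((hg.add hh).pMI_add_single' α i).trans ((ih.deriv i).trans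
      (((hg.derivMI α).dT_add (hh.derivMI α) i).trans ?_))
    intro t ht x hx
    exact congrArg₂ (· + ·) ((hg.pMI_add_single' α i) t ht x hx).symm
      ((hh.pMI_add_single' α i) t ht x hx).symm

lemma TSm.pMI_const_mul (hu : TSm T z u) (c : ℝ) (α : MI) :
    TEq T z (pMI ε α (fun t x => c * u t x)) (fun t x => c * pMI ε α u t x) := by
  simpa using hu.pMI_clm (c • ContinuousLinearMap.id ℝ ℝ) α

lemma dT_zero (i : Fin 3) : dT ε i (fun _ _ => (0 : E)) = fun _ _ => 0 := by
  fin_cases i <;> ext t x <;> simp [dT, pt, px, lineDeriv]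

lemma pMI_zero_fun (α : MI) : pMI ε α (fun _ _ => (0 : E)) = fun _ _ => 0 := by
  have : ∀ i n, (dT ε i)^[n] (fun _ _ => (0 : E)) = fun _ _ => 0 := by
    intro i n
    induction n with
    | zero => rfl
    | succ n ih => rw [Function.iterate_succ_apply', ih, dT_zero]
  rw [pMI_eq, this, this, this]

lemma TSm.pMI_sum {ι : Type*} (s : Finset ι) {g : ι → ℝ → V3 → E}
    (hg : ∀ i ∈ s, TSm T z (g i)) (α : MI) :
    TEq T z (pMI ε α (fun t x => ∑ i ∈ s, g i t x)) (fun t x => ∑ i ∈ s, pMI ε α (g i) t x) := by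
  classical
  induction s using Finset.induction_on with
  | empty => simp [pMI_zero_fun, TEq.refl]
  | insert a s ha ih =>
    have h1 : ∀ i ∈ s, TSm T z (g i) := fun i hi => hg i (Finset.mem_insert_of_mem hi)
    simp only [Finset.sum_insert ha]
    intro t ht x hx
    simp only []
    rw [(hg a (Finset.mem_insert_self a s)).pMI_add (TSm.sum h1) α t ht x hx]
    simp only []
    rw [ih h1 t ht x hx]

/-! ### Leibniz' rule -/

lemma MI.fact_pos (α : MI) : 0 < α.fact := Finset.prod_pos fun _ _ => Nat.factorial_pos _

lemma MI.fact_add_single (α : MI) (i : Fin 3) :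
    MI.fact (α + Pi.single i 1) = (α i + 1) * α.fact := by
  unfold MI.fact
  rw [← Finset.mul_prod_erase _ _ (Finset.mem_univ i),
    ← Finset.mul_prod_erase _ (fun j => (α j).factorial) (Finset.mem_univ i), ← mul_assoc]
  congr 1
  · simp [Nat.factorial_succ]
  · refine Finset.prod_congr rfl fun j hj => ?_
    simp [Finset.ne_of_mem_erase hj]

lemma MI.binom_mul_fact {α γ : MI} (h : γ ≤ α) :
    α.binom γ * γ.fact * (α - γ : MI).fact = α.fact := by
  unfold MI.binom MI.fact
  rw [← Finset.prod_mul_distrib, ← Finset.prod_mul_distrib]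
  exact Finset.prod_congr rfl fun i _ => Nat.choose_mul_factorial_mul_factorial (h i)

lemma MI.deg_add (α β : MI) : MI.deg (α + β) = α.deg + β.deg := by
  simp [MI.deg, Finset.sum_add_distrib]

lemma MI.deg_single (i : Fin 3) : MI.deg (Pi.single i 1) = 1 := by
  simp [MI.deg]

lemma MI.le_deg (α : MI) (i : Fin 3) : α i ≤ α.deg :=
  Finset.single_le_sum (fun _ _ => Nat.zero_le _) (Finset.mem_univ i)

lemma sum_Iic_shift (φ ψ : MI → ℝ) (α : MI) (i : Fin 3) :
    ∑ γ ∈ Finset.Iic α, ((γ i : ℝ) + 1) * φ (γ + Pi.single i 1) * ψ (α - γ)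
      = ∑ γ ∈ Finset.Iic (α + Pi.single i 1), (γ i : ℝ) * φ γ * ψ (α + Pi.single i 1 - γ) := by
  symm
  have hs : (Finset.Iic α).map (addRightEmbedding (Pi.single i 1)) ⊆
      Finset.Iic (α + Pi.single i 1 : MI) := by
    intro γ hγ
    simp only [Finset.mem_map, Finset.mem_Iic, addRightEmbedding_apply] at hγ ⊢
    obtain ⟨β, hβ, rfl⟩ := hγ
    gcongr
  rw [← Finset.sum_subset hs, Finset.sum_map]
  · refine Finset.sum_congr rfl fun γ _ => ?_
    have : α + Pi.single i 1 - (γ + Pi.single i 1) = α - γ := add_tsub_add_eq_tsub_right _ _ _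
    simp only [addRightEmbedding_apply, this]
    simp
  · intro γ hγ hn
    have : γ i = 0 := by
      by_contra h0
      apply hn
      have hle : Pi.single i 1 ≤ γ := by
        intro j
        by_cases hj : j = i
        · subst hj; simp; omega
        · simp [hj]
      simp only [Finset.mem_map, Finset.mem_Iic, addRightEmbedding_apply] at hγ ⊢
      exact ⟨γ - Pi.single i 1, tsub_le_iff_right.2 hγ, tsub_add_cancel_of_le hle⟩
    simp [this]

lemma sum_Iic_flip (φ : MI → MI → ℝ) (α : MI) :
    ∑ γ ∈ Finset.Iic α, φ γ (α - γ) = ∑ γ ∈ Finset.Iic α, φ (α - γ) γ := by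
  refine Finset.sum_nbij' (fun γ => α - γ) (fun γ => α - γ) ?_ ?_ ?_ ?_ ?_ <;>
    simp +contextual [tsub_tsub_cancel_of_le]

/-- The Taylor coefficient `∂^α u / α!`. -/
def tco (ε : ℝ) (α : MI) (u : ℝ → V3 → ℝ) (t : ℝ) (x : V3) : ℝ := pMI ε α u t x / α.fact

lemma TSm.tco_add_single (hu : TSm T z u) (α : MI) (i : Fin 3) {t : ℝ} (ht : t ∈ Ioo 0 T)
    {x : V3} (hx : x 2 = z) :
    ((α i : ℝ) + 1) * tco ε (α + Pi.single i 1) u t x = tco ε α (dT ε i u) t x := by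
  unfold tco
  rw [hu.pMI_add_single α i t ht x hx, MI.fact_add_single]
  have := MI.fact_pos α
  push_cast
  field_simp

lemma TSm.sum_tco_mul_dT (hv : TSm T z v) (α : MI) (i : Fin 3) {t : ℝ} (ht : t ∈ Ioo 0 T)
    {x : V3} (hx : x 2 = z) :
    ∑ γ ∈ Finset.Iic α, tco ε γ u t x * tco ε (α - γ) (dT ε i v) t x
      = ∑ γ ∈ Finset.Iic (α + Pi.single i 1), ((α + Pi.single i 1 - γ : MI) i : ℕ)
        * tco ε γ u t x * tco ε (α + Pi.single i 1 - γ) v t x := by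
  rw [sum_Iic_flip (fun γ γ' => tco ε γ u t x * tco ε γ' (dT ε i v) t x),
    sum_Iic_flip (fun γ γ' => (γ' i : ℝ) * tco ε γ u t x * tco ε γ' v t x)]
  have := sum_Iic_shift (fun γ => tco ε γ v t x) (fun γ => tco ε γ u t x) α i
  calc _ = ∑ γ ∈ Finset.Iic α, ((γ i : ℝ) + 1) * tco ε (γ + Pi.single i 1) v t x
        * tco ε (α - γ) u t x := Finset.sum_congr rfl fun γ _ => by
          rw [hv.tco_add_single γ i ht hx]; ring
    _ = _ := by rw [this]; exact Finset.sum_congr rfl fun γ _ => by ring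

lemma TSm.tco_mul (hu : TSm T z u) (hv : TSm T z v) (α : MI) {t : ℝ} (ht : t ∈ Ioo 0 T)
    {x : V3} (hx : x 2 = z) :
    tco ε α (fun t x => u t x * v t x) t x
      = ∑ γ ∈ Finset.Iic α, tco ε γ u t x * tco ε (α - γ) v t x := by
  induction α using MI.induction generalizing u v with
  | h0 =>
    have : Finset.Iic (0 : MI) = {0} := by ext γ; simp
    simp [tco, MI.fact, this]
  | h1 α i ih =>
    have hne : ((α i : ℝ) + 1) ≠ 0 := by positivity
    apply mul_left_cancel₀ hne
    rw [(hu.mul hv).tco_add_single α i ht hx]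
    have e1 : tco ε α (dT ε i (fun t x => u t x * v t x)) t x
        = tco ε α (fun t x => dT ε i u t x * v t x) t x
          + tco ε α (fun t x => u t x * dT ε i v t x) t x := by
      unfold tco
      rw [(hu.dT_mul hv i).derivMI α t ht x hx,
        ((hu.deriv i).mul hv).pMI_add (hu.mul (hv.deriv i)) α t ht x hx, add_div]
    rw [e1, ih (hu.deriv i) hv, ih hu (hv.deriv i)]
    have e2 : ∑ γ ∈ Finset.Iic α, tco ε γ (dT ε i u) t x * tco ε (α - γ) v t x
        = ∑ γ ∈ Finset.Iic (α + Pi.single i 1), (γ i : ℝ) * tco ε γ u t x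
          * tco ε (α + Pi.single i 1 - γ) v t x := by
      rw [← sum_Iic_shift (fun γ => tco ε γ u t x) (fun γ => tco ε γ v t x) α i]
      exact Finset.sum_congr rfl fun γ _ => by rw [hu.tco_add_single γ i ht hx]
    have e3 := hv.sum_tco_mul_dT (ε := ε) (u := u) α i ht hx
    rw [e2, e3, ← Finset.sum_add_distrib, Finset.mul_sum]
    refine Finset.sum_congr rfl fun γ hγ => ?_
    have h4 : γ i ≤ α i + 1 := by simpa using (Finset.mem_Iic.1 hγ) i
    have h5 : (((α + Pi.single i 1 - γ : MI) i : ℕ) : ℝ) = α i + 1 - γ i := by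
      simp [Nat.cast_sub h4]
    rw [h5]; ring

/-- Leibniz' rule. -/
lemma TSm.pMI_mul (hu : TSm T z u) (hv : TSm T z v) (α : MI) {t : ℝ} (ht : t ∈ Ioo 0 T)
    {x : V3} (hx : x 2 = z) :
    pMI ε α (fun t x => u t x * v t x) t x
      = ∑ γ ∈ Finset.Iic α, (α.binom γ : ℝ) * (pMI ε (α - γ) u t x * pMI ε γ v t x) := by
  have h1 := hu.tco_mul (ε := ε) hv α ht hx
  have hpos := fun α => (Nat.cast_pos (α := ℝ)).2 (MI.fact_pos α)
  rw [sum_Iic_flip (fun γ γ' => tco ε γ u t x * tco ε γ' v t x)] at h1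
  unfold tco at h1
  rw [div_eq_iff (hpos α).ne', Finset.sum_mul] at h1
  rw [h1]
  refine Finset.sum_congr rfl fun γ hγ => ?_
  have h2 := MI.binom_mul_fact (Finset.mem_Iic.1 hγ)
  rw [← h2]
  have := hpos γ
  have := hpos (α - γ)
  push_cast
  field_simp

end TangentialAlgebra

/-! ### Jets on the analytic scale -/

section Jets

variable {T z ε : ℝ} {u v w g : ℝ → V3 → ℝ}

lemma sum_Iic_conv_le {A B : MI → ℝ} (hA : ∀ γ, 0 ≤ A γ) (hB : ∀ γ, 0 ≤ B γ) (α : MI) :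
    ∑ γ ∈ Finset.Iic α, ∑ β ∈ Finset.Iic γ, A β * B (γ - β)
      ≤ (∑ γ ∈ Finset.Iic α, A γ) * ∑ γ ∈ Finset.Iic α, B γ := by
  rw [Finset.sum_mul_sum, ← Finset.sum_product', Finset.sum_sigma']
  set φ : (Σ _ : MI, MI) → MI × MI := fun p => (p.2, p.1 - p.2)
  have hinj : Set.InjOn φ ((Finset.Iic α).sigma fun γ => Finset.Iic γ) := by
    rintro ⟨γ, β⟩ hp ⟨γ', β'⟩ hp' h
    simp only [Finset.mem_sigma, Finset.mem_Iic, Finset.mem_coe, Prod.mk.injEq, φ] at hp hp' h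
    obtain ⟨rfl, h2⟩ := h
    have : γ = γ' := by
      rw [← tsub_add_cancel_of_le hp.2, h2, tsub_add_cancel_of_le hp'.2]
    subst this; rfl
  rw [← Finset.sum_image (f := fun q : MI × MI => A q.1 * B q.2) hinj]
  refine Finset.sum_le_sum_of_subset_of_nonneg ?_ fun p _ _ => mul_nonneg (hA _) (hB _)
  intro q hq
  obtain ⟨p, hp, rfl⟩ := Finset.mem_image.1 hq
  simp only [Finset.mem_sigma, Finset.mem_Iic, Finset.mem_product, φ] at hp ⊢
  exact ⟨hp.2.trans hp.1, (tsub_le_self).trans hp.1⟩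

/-- The sum `∑_{γ ≤ α} |∂^γ u| s^{|γ|} / γ!`. -/
def jet (ε s : ℝ) (α : MI) (u : ℝ → V3 → ℝ) (t : ℝ) (x : V3) : ℝ :=
  ∑ γ ∈ Finset.Iic α, |tco ε γ u t x| * s ^ γ.deg

lemma pow_deg_split (r : ℝ) {β γ : MI} (h : β ≤ γ) :
    r ^ γ.deg = r ^ β.deg * r ^ (γ - β : MI).deg := by
  rw [← pow_add, ← MI.deg_add, add_tsub_cancel_of_le h]

lemma jet_nonneg {s : ℝ} (hs : 0 ≤ s) (α : MI) (u : ℝ → V3 → ℝ) (t : ℝ) (x : V3) :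
    0 ≤ jet ε s α u t x :=
  Finset.sum_nonneg fun _ _ => by positivity

lemma TEq.tco_eq (H : TEq T z u v) (γ : MI) {t : ℝ} (ht : t ∈ Ioo 0 T) {x : V3} (hx : x 2 = z) :
    tco ε γ u t x = tco ε γ v t x := by
  unfold tco; rw [H.derivMI γ t ht x hx]

lemma TEq.jet_eq (H : TEq T z u v) (s : ℝ) (α : MI) {t : ℝ} (ht : t ∈ Ioo 0 T) {x : V3}
    (hx : x 2 = z) : jet ε s α u t x = jet ε s α v t x :=
  Finset.sum_congr rfl fun γ _ => by rw [H.tco_eq γ ht hx]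

lemma TSm.jet_mul_le (hu : TSm T z u) (hv : TSm T z v) {s : ℝ} (hs : 0 ≤ s) (α : MI) {t : ℝ}
    (ht : t ∈ Ioo 0 T) {x : V3} (hx : x 2 = z) :
    jet ε s α (fun t x => u t x * v t x) t x
      ≤ jet ε s α u t x * jet ε s α v t x := by
  refine le_trans ?_ (sum_Iic_conv_le (A := fun γ => |tco ε γ u t x| * s ^ γ.deg)
    (B := fun γ => |tco ε γ v t x| * s ^ γ.deg) (fun γ => by positivity)
    (fun γ => by positivity) α)
  refine Finset.sum_le_sum fun γ _ => ?_
  rw [hu.tco_mul hv γ ht hx]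
  refine (mul_le_mul_of_nonneg_right (Finset.abs_sum_le_sum_abs _ _) (by positivity)).trans
    (le_of_eq ?_)
  rw [Finset.sum_mul]
  refine Finset.sum_congr rfl fun β hβ => ?_
  rw [abs_mul, pow_deg_split s (Finset.mem_Iic.1 hβ)]
  ring

lemma TSm.jet_add_le (hu : TSm T z u) (hv : TSm T z v) {s : ℝ} (hs : 0 ≤ s) (α : MI) {t : ℝ}
    (ht : t ∈ Ioo 0 T) {x : V3} (hx : x 2 = z) :
    jet ε s α (fun t x => u t x + v t x) t x
      ≤ jet ε s α u t x + jet ε s α v t x := by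
  unfold jet
  rw [← Finset.sum_add_distrib]
  refine Finset.sum_le_sum fun γ _ => ?_
  have : tco ε γ (fun t x => u t x + v t x) t x
      = tco ε γ u t x + tco ε γ v t x := by
    unfold tco
    rw [hu.pMI_add hv γ t ht x hx, add_div]
  rw [this, ← add_mul]
  gcongr
  exact abs_add_le _ _

lemma TSm.jet_const_mul (hu : TSm T z u) (c s : ℝ) (α : MI) {t : ℝ}
    (ht : t ∈ Ioo 0 T) {x : V3} (hx : x 2 = z) :
    jet ε s α (fun t x => c * u t x) t x
      = |c| * jet ε s α u t x := by
  unfold jet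
  rw [Finset.mul_sum]
  refine Finset.sum_congr rfl fun γ _ => ?_
  have : tco ε γ (fun t x => c * u t x) t x
      = c * tco ε γ u t x := by
    unfold tco
    rw [hu.pMI_const_mul c γ t ht x hx, mul_div_assoc]
  rw [this, abs_mul, mul_assoc]

lemma tco_zero (u : ℝ → V3 → ℝ) (t : ℝ) (x : V3) : tco ε 0 u t x = u t x := by
  simp [tco, MI.fact]

lemma jet_eq_add (s : ℝ) (α : MI) (u : ℝ → V3 → ℝ) (t : ℝ) (x : V3) :
    jet ε s α u t x = |u t x| + ∑ γ ∈ (Finset.Iic α).erase 0, |tco ε γ u t x| * s ^ γ.deg := by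
  unfold jet
  rw [← Finset.add_sum_erase _ _ (Finset.mem_Iic.2 (zero_le : (0 : MI) ≤ α))]
  simp [tco_zero, MI.deg]

lemma abs_tco_mul_le_jet {s : ℝ} (hs : 0 ≤ s) (α : MI) (u : ℝ → V3 → ℝ) (t : ℝ) (x : V3) :
    |tco ε α u t x| * s ^ α.deg ≤ jet ε s α u t x :=
  Finset.single_le_sum (f := fun γ => |tco ε γ u t x| * s ^ γ.deg) (fun _ _ => by positivity)
    (Finset.mem_Iic.2 le_rfl)

/-- The chain rule for `w = e^g` in terms of Taylor coefficients. -/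
lemma TSm.tco_exp (hw : TSm T z w) (hg : TSm T z g)
    (hwg : ∀ i, TEq T z (dT ε i w) (fun t x => w t x * dT ε i g t x)) (γ : MI) (i : Fin 3) {t : ℝ}
    (ht : t ∈ Ioo 0 T) {x : V3} (hx : x 2 = z) :
    (γ i : ℝ) * tco ε γ w t x = ∑ β ∈ Finset.Iic γ, ((γ - β : MI) i : ℕ)
      * tco ε β w t x * tco ε (γ - β) g t x := by
  by_cases h0 : γ i = 0
  · simp [h0]
  · have hle : Pi.single i 1 ≤ γ := by
      intro j
      by_cases hj : j = i
      · subst hj; simp; omega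
      · simp [hj]
    obtain ⟨α, rfl⟩ : ∃ α : MI, γ = α + Pi.single i 1 :=
      ⟨γ - Pi.single i 1, (tsub_add_cancel_of_le hle).symm⟩
    have := hw.tco_add_single (ε := ε) α i ht hx
    have h2 : (((α + Pi.single i 1 : MI) i : ℕ) : ℝ) = (α i : ℝ) + 1 := by simp
    rw [h2, this, (hwg i).tco_eq α ht hx, hw.tco_mul (hg.deriv i) α ht hx,
      hg.sum_tco_mul_dT α i ht hx]

/-- The Taylor coefficients of `w = e^g` are dominated by those of the exponential of the
majorant series of `g`. -/
lemma TSm.jet_exp_le (hw : TSm T z w) (hg : TSm T z g)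
    (hwg : ∀ i, TEq T z (dT ε i w) (fun t x => w t x * dT ε i g t x)) {s : ℝ} (hs : 0 ≤ s) (α : MI)
    {t : ℝ} (ht : t ∈ Ioo 0 T) {x : V3} (hx : x 2 = z) :
    jet ε s α w t x
      ≤ |w t x| * exp (jet ε s α g t x - |g t x|) := by
  have hdeg : ∀ γ : MI, (γ.deg : ℝ) * |tco ε γ w t x| ≤
      ∑ β ∈ Finset.Iic γ, |tco ε β w t x| *
        (((γ - β : MI).deg : ℝ) * |tco ε (γ - β) g t x|) := by
    intro γ
    have h1 : (γ.deg : ℝ) * tco ε γ w t x = ∑ β ∈ Finset.Iic γ,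
        tco ε β w t x * (((γ - β : MI).deg : ℝ) *
          tco ε (γ - β) g t x) := by
      have : ∀ γ : MI, (γ.deg : ℝ) = ∑ i, (γ i : ℝ) := fun γ => by simp [MI.deg]
      rw [this, Finset.sum_mul, Finset.sum_congr rfl fun i _ => hw.tco_exp hg hwg γ i ht hx,
        Finset.sum_comm]
      refine Finset.sum_congr rfl fun β _ => ?_
      rw [this, Finset.sum_mul, Finset.mul_sum]
      exact Finset.sum_congr rfl fun i _ => by ring
    calc _ = |(γ.deg : ℝ) * tco ε γ w t x| := by simp [abs_mul]
      _ ≤ _ := by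
        rw [h1]
        refine (Finset.abs_sum_le_sum_abs _ _).trans (le_of_eq ?_)
        exact Finset.sum_congr rfl fun β _ => by simp [abs_mul]
  set Φ : ℝ → ℝ := fun r => jet ε r α w t x with hΦ
  set Γ : ℝ → ℝ := fun r => jet ε r α g t x with hΓ
  have hder : ∀ (u : ℝ → V3 → ℝ) (r : ℝ), 0 < r →
      HasDerivAt (fun r => jet ε r α u t x)
      (r⁻¹ * ∑ γ ∈ Finset.Iic α, (γ.deg : ℝ) * |tco ε γ u t x| * r ^ γ.deg) r := by
    intro u r hr
    unfold jet
    rw [Finset.mul_sum]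
    refine HasDerivAt.fun_sum fun γ _ => ?_
    refine ((hasDerivAt_pow γ.deg r).const_mul |tco ε γ u t x|).congr_deriv ?_
    rcases Nat.eq_zero_or_pos γ.deg with h | h
    · simp [h]
    · have : r ^ γ.deg = r ^ (γ.deg - 1) * r := by rw [← pow_succ]; congr 1; omega
      rw [this]; field_simp
  have hcont : ∀ u : ℝ → V3 → ℝ, Continuous fun r => jet ε r α u t x := by
    intro u; unfold jet; fun_prop
  -- Grönwall's argument in the radius: `Φ' ≤ Φ Γ'`, by the recursion for the coefficients of `e^g`
  have hanti : AntitoneOn (fun r => Φ r * exp (-Γ r)) (Icc 0 s) := by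
    refine antitoneOn_of_hasDerivWithinAt_nonpos (convex_Icc 0 s)
      (f' := fun r => (r⁻¹ * ∑ γ ∈ Finset.Iic α, (γ.deg : ℝ) *
          |tco ε γ w t x| * r ^ γ.deg) * exp (-Γ r)
        + Φ r * (exp (-Γ r) * -(r⁻¹ * ∑ γ ∈ Finset.Iic α, (γ.deg : ℝ) *
          |tco ε γ g t x| * r ^ γ.deg))) ?_ ?_ ?_
    · exact ((hcont w).mul (Real.continuous_exp.comp (hcont g).neg)).continuousOn
    · intro r hr
      rw [interior_Icc] at hr
      exact ((hder w r hr.1).mul ((hder g r hr.1).neg.exp)).hasDerivWithinAt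
    · intro r hr
      rw [interior_Icc] at hr
      have hr0 : 0 < r := hr.1
      have : ∑ γ ∈ Finset.Iic α, (γ.deg : ℝ) * |tco ε γ w t x| * r ^ γ.deg
          ≤ Φ r * ∑ γ ∈ Finset.Iic α, (γ.deg : ℝ) *
          |tco ε γ g t x| * r ^ γ.deg := by
        refine le_trans (Finset.sum_le_sum fun γ _ => ?_) (sum_Iic_conv_le
          (A := fun γ => |tco ε γ w t x| * r ^ γ.deg)
          (B := fun γ => (γ.deg : ℝ) * |tco ε γ g t x| * r ^ γ.deg)
          (fun γ => by positivity) (fun γ => by positivity) α)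
        refine (mul_le_mul_of_nonneg_right (hdeg γ) (by positivity)).trans (le_of_eq ?_)
        rw [Finset.sum_mul]
        refine Finset.sum_congr rfl fun β hβ => ?_
        rw [pow_deg_split r (Finset.mem_Iic.1 hβ)]; ring
      have h5 : 0 < r⁻¹ * exp (-Γ r) := by positivity
      nlinarith [mul_le_mul_of_nonneg_left this h5.le]
  have h0 : ∀ u : ℝ → V3 → ℝ, jet ε 0 α u t x = |u t x| := by
    intro u
    rw [jet_eq_add, Finset.sum_eq_zero, add_zero]
    intro γ hγ
    have : γ.deg ≠ 0 := by
      intro h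
      apply Finset.ne_of_mem_erase hγ
      ext i
      have := γ.le_deg i
      simp; omega
    simp [this]
  have := hanti (left_mem_Icc.2 hs) (right_mem_Icc.2 hs) hs
  simp only [hΦ, hΓ, h0] at this
  rw [sub_eq_add_neg, add_comm, Real.exp_add, ← mul_assoc]
  calc jet ε s α w t x
      = (jet ε s α w t x * exp (-jet ε s α g t x))
        * exp (jet ε s α g t x) := by
          rw [mul_assoc, ← Real.exp_add]; simp
    _ ≤ _ := by gcongr

end Jets

/-! ### Functions smooth up to the boundary -/

section Slab

variable {E G : Type*} [NormedAddCommGroup E] [NormedSpace ℝ E]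
  [NormedAddCommGroup G] [NormedSpace ℝ G]
variable {T z ε : ℝ} {g h : ℝ → V3 → E} {u v : ℝ → V3 → ℝ}

/-- The region `(0, T) × {x₃ ≥ 0}`. -/
def slabS (T : ℝ) : Set (ℝ × V3) := Ioo 0 T ×ˢ {x | 0 ≤ x 2}

/-- The region `(0, T) × {x₃ > 0}`. -/
def slabO (T : ℝ) : Set (ℝ × V3) := Ioo 0 T ×ˢ {x | 0 < x 2}

/-- `g` is smooth on `(0, T) × {x₃ ≥ 0}`, up to the boundary. -/
def SSm (T : ℝ) (g : ℝ → V3 → E) : Prop :=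
  ContDiffOn ℝ ∞ (fun p : ℝ × V3 => g p.1 p.2) (slabS T)

lemma continuous_coord (i : Fin 3) : Continuous fun x : V3 => x i := by fun_prop

lemma isOpen_slabO (T : ℝ) : IsOpen (slabO T) :=
  isOpen_Ioo.prod (isOpen_lt continuous_const (continuous_coord 2))

lemma slabO_subset (T : ℝ) : slabO T ⊆ slabS T := 
  fun _ hp => ⟨hp.1, (show (0 : ℝ) < _ from hp.2).le⟩

lemma uniqueDiffOn_slabS (T : ℝ) : UniqueDiffOn ℝ (slabS T) := by
  refine isOpen_Ioo.uniqueDiffOn.prod (uniqueDiffOn_convex ?_ ?_)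
  · intro x hx y hy a b ha hb _
    simp only [mem_ofPred_eq, PiLp.add_apply, PiLp.smul_apply, smul_eq_mul] at *
    positivity
  · refine ⟨e 2, ?_⟩
    rw [mem_interior]
    refine ⟨{x | 0 < x 2}, fun x hx => (show (0 : ℝ) < x 2 from hx).le,
      isOpen_lt continuous_const (continuous_coord 2), by simp [e]⟩

lemma SSm.mul (hu : SSm T u) (hv : SSm T v) : SSm T (fun t x => u t x * v t x) :=
  ContDiffOn.mul hu hv

lemma SSm.clm (L : E →L[ℝ] G) (hg : SSm T g) : SSm T (fun t x => L (g t x)) :=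
  L.contDiff.comp_contDiffOn hg

/-- The linear part of the embedding of a slice. -/
def embL : ℝ × ℝ × ℝ →L[ℝ] ℝ × V3 :=
  (ContinuousLinearMap.fst ℝ ℝ (ℝ × ℝ)).prod
    ((((ContinuousLinearMap.fst ℝ ℝ ℝ).comp (ContinuousLinearMap.snd ℝ ℝ (ℝ × ℝ))).smulRight (e 0))
    + (((ContinuousLinearMap.snd ℝ ℝ ℝ).comp
      (ContinuousLinearMap.snd ℝ ℝ (ℝ × ℝ))).smulRight (e 1)))

lemma emb_eq (z : ℝ) (p : ℝ × ℝ × ℝ) : (p.1, pnt p.2 z) = (0, z • e 2) + embL p := by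
  refine Prod.ext (by simp [embL]) ?_
  ext i; fin_cases i <;> simp [pnt, e, embL]

lemma hasFDerivAt_emb (z : ℝ) (p : ℝ × ℝ × ℝ) :
    HasFDerivAt (fun p : ℝ × ℝ × ℝ => (p.1, pnt p.2 z)) embL p := by
  have : (fun p : ℝ × ℝ × ℝ => (p.1, pnt p.2 z)) = fun p => (0, z • e 2) + embL p :=
    funext (emb_eq z)
  rw [this]
  exact embL.hasFDerivAt.const_add _

lemma contDiff_emb (z : ℝ) {n : WithTop ℕ∞} :
    ContDiff ℝ n (fun p : ℝ × ℝ × ℝ => (p.1, pnt p.2 z)) := by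
  have : (fun p : ℝ × ℝ × ℝ => (p.1, pnt p.2 z)) = fun p => (0, z • e 2) + embL p :=
    funext (emb_eq z)
  rw [this]
  exact contDiff_const.add embL.contDiff

lemma mapsTo_emb (hz : 0 ≤ z) : MapsTo (fun p : ℝ × ℝ × ℝ => (p.1, pnt p.2 z)) (tdom T) (slabS T) :=
  fun p hp => ⟨hp.1, by simpa using hz⟩

lemma SSm.tsm (hg : SSm T g) (hz : 0 ≤ z) : TSm T z g :=
  ContDiffOn.comp hg (contDiff_emb z).contDiffOn (mapsTo_emb hz)

lemma SSm.differentiableWithinAt (hg : SSm T g) {p : ℝ × V3} (hp : p ∈ slabS T) :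
    DifferentiableWithinAt ℝ (fun p : ℝ × V3 => g p.1 p.2) (slabS T) p :=
  ContDiffOn.differentiableOn hg (by simp) p hp

lemma SSm.dT_eq (hg : SSm T g) {t : ℝ} (ht : t ∈ Ioo 0 T) {x : V3} (hx : 0 ≤ x 2) (i : Fin 3) :
    dT ε i g t x = fderivWithin ℝ (fun p : ℝ × V3 => g p.1 p.2) (slabS T) (t, x)
      (embL (dirT ε i)) := by
  rw [(hg.tsm hx).dT_eq ht rfl i]
  have hxx : (t, pnt (x 0, x 1) (x 2)) = (t, x) := by rw [pnt_eta]
  have h1 := (hg.differentiableWithinAt (p := (t, x)) ⟨ht, hx⟩).hasFDerivWithinAt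
  rw [← hxx] at h1
  have h2 := (HasFDerivWithinAt.comp (t, x 0, x 1) h1
    (hasFDerivAt_emb (x 2) (t, x 0, x 1)).hasFDerivWithinAt (mapsTo_emb hx)).hasFDerivAt
    ((isOpen_tdom T).mem_nhds (mem_tdom ht _))
  have h3 : (fun p : ℝ × V3 => g p.1 p.2) ∘ (fun p : ℝ × ℝ × ℝ => (p.1, pnt p.2 (x 2)))
      = slice (x 2) g := rfl
  rw [h3, hxx] at h2
  rw [h2.fderiv]; rfl

lemma SSm.deriv_aux (hg : SSm T g) (w : ℝ × V3) :
    ContDiffOn ℝ ∞ (fun p => fderivWithin ℝ (fun p : ℝ × V3 => g p.1 p.2) (slabS T) p w)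
      (slabS T) :=
  (ContDiffOn.fderivWithin hg (uniqueDiffOn_slabS T) (by simp)).clm_apply contDiffOn_const

lemma SSm.deriv (hg : SSm T g) (i : Fin 3) : SSm T (dT ε i g) :=
  (hg.deriv_aux _).congr fun _ hp => hg.dT_eq hp.1 hp.2 i

lemma SSm.dT_iterate (hg : SSm T g) (i : Fin 3) (n : ℕ) : SSm T ((dT ε i)^[n] g) := by
  induction n with
  | zero => exact hg
  | succ n ih => rw [Function.iterate_succ_apply']; exact ih.deriv i

lemma SSm.derivMI (hg : SSm T g) (α : MI) : SSm T (pMI ε α g) := by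
  rw [pMI_eq]
  exact ((hg.dT_iterate 2 _).dT_iterate 1 _).dT_iterate 0 _

/-- The normal derivative, taken one-sided at the boundary. -/
def dN (T : ℝ) (g : ℝ → V3 → E) (t : ℝ) (x : V3) : E :=
  fderivWithin ℝ (fun p : ℝ × V3 => g p.1 p.2) (slabS T) (t, x) (0, e 2)

lemma SSm.dN (hg : SSm T g) : SSm T (dN T g) := hg.deriv_aux _

lemma SSm.contDiffAt (hg : SSm T g) {t : ℝ} (ht : t ∈ Ioo 0 T) {x : V3} (hx : 0 < x 2) :
    ContDiffAt ℝ ∞ (fun p : ℝ × V3 => g p.1 p.2) (t, x) :=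
  ContDiffOn.contDiffAt hg (Filter.mem_of_superset
    ((isOpen_slabO T).mem_nhds ⟨ht, hx⟩) (slabO_subset T))

lemma fderivWithin_slabS {k : ℝ × V3 → E} {t : ℝ} (ht : t ∈ Ioo 0 T) {x : V3} (hx : 0 < x 2) :
    fderivWithin ℝ k (slabS T) (t, x) = fderiv ℝ k (t, x) :=
  fderivWithin_of_mem_nhds (Filter.mem_of_superset
    ((isOpen_slabO T).mem_nhds ⟨ht, hx⟩) (slabO_subset T))

lemma SSm.hasDerivAt_line (hg : SSm T g) {t : ℝ} (ht : t ∈ Ioo 0 T) {x : V3} (hx : 0 < x 2)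
    (i : Fin 3) : HasDerivAt (fun s : ℝ => g t (x + s • e i))
      (fderiv ℝ (fun p : ℝ × V3 => g p.1 p.2) (t, x) (0, e i)) 0 := by
  have h1 := ((hg.contDiffAt ht hx).differentiableAt (by simp)).hasFDerivAt
  have h2 := h1.hasLineDerivAt (0, e i)
  unfold HasLineDerivAt at h2
  simpa using h2

lemma SSm.px_eq (hg : SSm T g) {t : ℝ} (ht : t ∈ Ioo 0 T) {x : V3} (hx : 0 < x 2) (i : Fin 3) :
    px i g t x = fderiv ℝ (fun p : ℝ × V3 => g p.1 p.2) (t, x) (0, e i) :=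
  (hg.hasDerivAt_line ht hx i).deriv

lemma SSm.px_two (hg : SSm T g) {t : ℝ} (ht : t ∈ Ioo 0 T) {x : V3} (hx : 0 < x 2) :
    px 2 g t x = PrandtlBoltzmann.dN T g t x := by
  rw [hg.px_eq ht hx, PrandtlBoltzmann.dN, fderivWithin_slabS ht hx]

lemma SSm.teq_px_two (hg : SSm T g) (hz : 0 < z) : TEq T z (px 2 g) (PrandtlBoltzmann.dN T g) :=
  fun _ ht _ hx => hg.px_two ht (hx ▸ hz)

lemma SSm.tsm_px_two (hg : SSm T g) (hz : 0 < z) : TSm T z (px 2 g) :=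
  (hg.dN.tsm hz.le).congr (hg.teq_px_two hz)

lemma SSm.px_two_dT (hg : SSm T g) (hz : 0 < z) (i : Fin 3) :
    TEq T z (px 2 (dT ε i g)) (dT ε i (px 2 g)) := by
  refine TEq.trans ?_ ((hg.teq_px_two hz).deriv i).symm
  intro t ht x hx
  have hx0 : 0 < x 2 := hx ▸ hz
  rw [(hg.deriv i).px_two ht hx0, hg.dN.dT_eq ht hx0.le]
  unfold PrandtlBoltzmann.dN
  rw [fderivWithin_slabS ht hx0, fderivWithin_slabS ht hx0]
  have hn := (isOpen_slabO T).mem_nhds (show (t, x) ∈ slabO T from ⟨ht, hx0⟩)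
  have hd : DifferentiableAt ℝ (fderiv ℝ (fun p : ℝ × V3 => g p.1 p.2)) (t, x) :=
    (((hg.contDiffAt ht hx0).fderiv_right (m := ∞) (by simp)).differentiableAt (by simp))
  have key : ∀ w : ℝ × V3, ∀ f : ℝ × V3 → E, (∀ p ∈ slabO T, f p =
      fderiv ℝ (fun p : ℝ × V3 => g p.1 p.2) p w) → ∀ w', fderiv ℝ f (t, x) w' =
      fderiv ℝ (fderiv ℝ (fun p : ℝ × V3 => g p.1 p.2)) (t, x) w' w := by
    intro w f hf w'
    have : f =ᶠ[nhds (t, x)] fun p => fderiv ℝ (fun p : ℝ × V3 => g p.1 p.2) p w :=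
      Filter.eventually_of_mem hn hf
    rw [this.fderiv_eq, fderiv_clm_apply hd (by fun_prop)]
    simp
  rw [key (embL (dirT ε i)), key (0, e 2)]
  · have := (hg.contDiffAt ht hx0).isSymmSndFDerivAt (by
      simpa using WithTop.coe_le_coe.2 (le_top : (2 : ℕ∞) ≤ ⊤))
    exact this _ _
  · intro p hp
    rw [← fderivWithin_slabS hp.1 hp.2]
  · intro p hp
    rw [← fderivWithin_slabS hp.1 hp.2]
    exact hg.dT_eq hp.1 hp.2.le i

lemma SSm.px_two_dT_iterate (hg : SSm T g) (hz : 0 < z) (i : Fin 3) (n : ℕ) :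
    TEq T z (px 2 ((dT ε i)^[n] g)) ((dT ε i)^[n] (px 2 g)) := by
  induction n with
  | zero => exact TEq.refl _
  | succ n ih =>
    rw [Function.iterate_succ_apply', Function.iterate_succ_apply']
    exact ((hg.dT_iterate i n).px_two_dT hz i).trans (ih.deriv i)

lemma SSm.px_two_pMI (hg : SSm T g) (hz : 0 < z) (α : MI) :
    TEq T z (px 2 (pMI ε α g)) (pMI ε α (px 2 g)) := by
  rw [pMI_eq, pMI_eq]
  refine (((hg.dT_iterate 2 _).dT_iterate 1 _).px_two_dT_iterate hz 0 _).trans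
    (TEq.dT_iterate ?_ _ _)
  refine ((hg.dT_iterate 2 _).px_two_dT_iterate hz 1 _).trans (TEq.dT_iterate ?_ _ _)
  exact hg.px_two_dT_iterate hz 2 _

lemma TEq.pMI_eq_zero (H : TEq T z g (fun _ _ => 0)) (α : MI) :
    TEq T z (pMI ε α g) (fun _ _ => 0) := by
  have := H.derivMI (ε := ε) α
  rwa [pMI_zero_fun] at this

lemma SSm.continuousOn_line (hg : SSm T g) {t : ℝ} (ht : t ∈ Ioo 0 T) (y : ℝ × ℝ) :
    ContinuousOn (fun s => g t (pnt y s)) (Ici 0) := by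
  have h : Continuous fun s : ℝ => (t, pnt y s) :=
    continuous_const.prodMk (continuous_pnt.comp (continuous_const.prodMk continuous_id))
  exact (ContDiffOn.continuousOn hg).comp h.continuousOn
    fun s hs => ⟨ht, by simpa using hs⟩

lemma SSm.hasDerivAt_normal (hg : SSm T g) {t : ℝ} (ht : t ∈ Ioo 0 T) (y : ℝ × ℝ) {s : ℝ}
    (hs : 0 < s) : HasDerivAt (fun s => g t (pnt y s)) (px 2 g t (pnt y s)) s := by
  have h1 := hg.hasDerivAt_line ht (x := pnt y s) (by simpa using hs) 2
  rw [← hg.px_eq ht (by simpa using hs)] at h1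
  simp only [← pnt_add] at h1
  have h0 := HasDerivAt.scomp (h := fun r : ℝ => r - s) s (by simpa using h1)
    ((hasDerivAt_id s).sub_const s)
  simpa [Function.comp_def] using h0

lemma SSm.intervalIntegrable_normal (hg : SSm T g) {t : ℝ} (ht : t ∈ Ioo 0 T) (y : ℝ × ℝ) {b : ℝ}
    (hb : 0 ≤ b) : IntervalIntegrable (fun s => px 2 g t (pnt y s)) volume 0 b := by
  have h1 : IntervalIntegrable (fun s => PrandtlBoltzmann.dN T g t (pnt y s)) volume 0 b := by
    apply ContinuousOn.intervalIntegrable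
    exact (hg.dN.continuousOn_line ht y).mono (by rw [uIcc_of_le hb]; exact Icc_subset_Ici_self)
  refine h1.congr ?_
  rw [uIoc_of_le hb]
  intro s hs
  exact (hg.px_two ht (by simpa using hs.1)).symm

lemma SSm.integral_normal [CompleteSpace E] (hg : SSm T g) {t : ℝ} (ht : t ∈ Ioo 0 T) (y : ℝ × ℝ)
    {b : ℝ} (hb : 0 ≤ b) :
    ∫ s in (0 : ℝ)..b, px 2 g t (pnt y s) = g t (pnt y b) - g t (pnt y 0) := by
  apply intervalIntegral.integral_eq_sub_of_hasDerivAt_of_le hb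
  · exact (hg.continuousOn_line ht y).mono Icc_subset_Ici_self
  · intro s hs; exact hg.hasDerivAt_normal ht y hs.1
  · exact hg.intervalIntegrable_normal ht y hb

end Slab

/-! ### The local Maxwellian on the analytic scale -/

lemma sum_pow_deg_le {q : ℝ} (h0 : 0 ≤ q) (h1 : q < 1) (α : MI) :
    ∑ γ ∈ Finset.Iic α, q ^ γ.deg ≤ ((1 - q)⁻¹) ^ 3 := by
  have h2 : Finset.Iic α = Fintype.piFinset fun i => Finset.Iic (α i) := by
    ext γ; simp [Pi.le_def]
  have h3 : ∀ γ : MI, q ^ γ.deg = ∏ i, q ^ γ i := fun γ => by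
    rw [MI.deg, Finset.prod_pow_eq_pow_sum]
  simp only [h2, h3]
  rw [← Finset.prod_univ_sum (fun i => Finset.Iic (α i)) (fun _ n => q ^ n)]
  have h4 : ∀ i, ∑ n ∈ Finset.Iic (α i), q ^ n ≤ (1 - q)⁻¹ := by
    intro i
    rw [← tsum_geometric_of_lt_one h0 h1]
    exact (summable_geometric_of_lt_one h0 h1).sum_le_tsum _ (fun _ _ => by positivity)
  calc _ ≤ ∏ _i : Fin 3, (1 - q)⁻¹ :=
        Finset.prod_le_prod (fun i _ => Finset.sum_nonneg fun _ _ => by positivity) fun i _ => h4 i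
    _ = _ := by simp

lemma sqrt_mu0 (ξ : V3) :
    √(mu0 ξ) = √((2 * Real.pi) ^ (-(3 / 2 : ℝ))) * exp (-‖ξ‖ ^ 2 / 4) := by
  unfold mu0
  rw [Real.sqrt_mul (by positivity), ← Real.exp_half]
  congr 2; ring

lemma mu0_pos (ξ : V3) : 0 < mu0 ξ := by unfold mu0; positivity

lemma sqrt_mu0_pos (ξ : V3) : 0 < √(mu0 ξ) := Real.sqrt_pos.2 (mu0_pos ξ)

lemma sqrt_mu0_le (ξ : V3) : √(mu0 ξ) ≤ exp (-‖ξ‖ ^ 2 / 4) := by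
  rw [sqrt_mu0]
  have : √((2 * Real.pi) ^ (-(3 / 2 : ℝ))) ≤ 1 := by
    rw [Real.sqrt_le_one]
    apply Real.rpow_le_one_of_one_le_of_nonpos _ (by norm_num)
    nlinarith [Real.pi_gt_three]
  exact mul_le_of_le_one_left (by positivity) this

lemma abs_coord_le (x : V3) (i : Fin 3) : |x i| ≤ ‖x‖ := by
  simpa using PiLp.norm_apply_le x i

namespace Config

variable (S : Config)

/-- The exponent `(ε ξ·U)/2 - ε²|U|²/4`, for which `√μ = √μ₀ e^{lg}`. -/
def lg (ξ : V3) (t : ℝ) (x : V3) : ℝ :=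
  ∑ k, ((S.ε / 2 * ξ k) * S.Uc k t x + (-(S.ε ^ 2 / 4)) * (S.Uc k t x * S.Uc k t x))

lemma sqrtMu_eq (t : ℝ) (x ξ : V3) : S.sqrtMu t x ξ = √(mu0 ξ) * exp (S.lg ξ t x) := by
  unfold sqrtMu mu
  rw [sqrt_mu0, sqrt_mu0, mul_assoc, ← Real.exp_add]
  congr 2
  rw [EuclideanSpace.norm_sq_eq, EuclideanSpace.norm_sq_eq, lg]
  simp only [Fin.sum_univ_three, phi, Uc, PiLp.sub_apply, PiLp.smul_apply, smul_eq_mul,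
    Real.norm_eq_abs, sq_abs]
  ring

lemma sqrtMu_pos (t : ℝ) (x ξ : V3) : 0 < S.sqrtMu t x ξ := sqrt_mu0_pos _

lemma mu_eq_sq (t : ℝ) (x ξ : V3) : S.mu t x ξ = S.sqrtMu t x ξ ^ 2 :=
  (Real.sq_sqrt (mu0_pos _).le).symm

variable {S} {K τU ρ : ℝ} (h : S.Admissible K τU ρ)
include h

namespace Admissible

lemma K_nonneg {t : ℝ} (ht : t ∈ Ioo 0 S.T) : 0 ≤ K :=
  (abs_nonneg _).trans (h.flow.bound_div t ht (e 2) (by simp [e]))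

lemma smU : SSm S.T S.U := h.flow.smooth_U

lemma smP : SSm S.T S.P := h.flow.smooth_P

lemma smUc (k : Fin 3) : SSm S.T (S.Uc k) := h.smU.clm (EuclideanSpace.proj k)

lemma sm_lg (ξ : V3) : SSm S.T (S.lg ξ) := by
  have := fun k => h.smUc k
  unfold SSm at this ⊢
  unfold lg
  fun_prop

lemma sm_sqrtMu (ξ : V3) : SSm S.T (fun t x => S.sqrtMu t x ξ) := by
  simp only [sqrtMu_eq]
  have := h.sm_lg ξ
  unfold SSm at this ⊢
  fun_prop

lemma dT_sqrtMu (ξ : V3) {z : ℝ} (hz : 0 ≤ z) (i : Fin 3) :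
    TEq S.T z (dT S.ε i (fun t x => S.sqrtMu t x ξ))
      (fun t x => S.sqrtMu t x ξ * dT S.ε i (S.lg ξ) t x) := by
  intro t ht x hx
  have hp := mem_tdom ht (x 0, x 1)
  have h1 := (h.sm_lg ξ).tsm hz
  have h2 := (h.sm_sqrtMu ξ).tsm hz
  simp only []
  rw [h2.dT_eq ht hx, h1.dT_eq ht hx]
  have h3 : slice z (fun t x => S.sqrtMu t x ξ) = fun p => √(mu0 ξ) * exp (slice z (S.lg ξ) p) :=
    funext fun p => S.sqrtMu_eq _ _ _
  have h4 := (h1.differentiableAt hp).hasFDerivAt.exp.const_mul (√(mu0 ξ))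
  rw [h3, h4.fderiv, S.sqrtMu_eq]
  have hxx : pnt (x 0, x 1) z = x := by rw [← hx, pnt_eta]
  simp [slice, hxx, mul_assoc]

lemma px_two_sqrtMu (ξ : V3) {z : ℝ} (hz : 0 < z) :
    TEq S.T z (px 2 (fun t x => S.sqrtMu t x ξ))
      (fun t x => S.sqrtMu t x ξ * px 2 (S.lg ξ) t x) := by
  intro t ht x hx
  have hx0 : 0 < x 2 := hx ▸ hz
  have h1 := (h.sm_lg ξ).hasDerivAt_line ht hx0 2
  rw [← (h.sm_lg ξ).px_eq ht hx0] at h1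
  have h4 := h1.exp.const_mul (√(mu0 ξ))
  simp only [← S.sqrtMu_eq] at h4
  have := h4.deriv
  simp only [zero_smul, add_zero, ← mul_assoc, ← S.sqrtMu_eq] at this
  exact this

lemma tco_U_le {t : ℝ} (ht : t ∈ Ioo 0 S.T) {x : V3} (γ : MI) (k : Fin 3)
    {V : ℝ → V3 → V3} (hV : TSm S.T (x 2) V) {B : ℝ}
    (hB : τU ^ γ.deg / γ.fact * ‖S.D γ V t x‖ ≤ B) :
    |tco S.ε γ (fun t x => V t x k) t x| * (3 / 4 * τU) ^ γ.deg ≤ B * (3 / 4) ^ γ.deg := by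
  have h1 : pMI S.ε γ (fun t x => V t x k) t x = pMI S.ε γ V t x k :=
    (hV.pMI_clm (EuclideanSpace.proj k) γ) t ht x rfl
  have h2 := h.radius_pos
  have h3 := (Nat.cast_pos (α := ℝ)).2 (MI.fact_pos γ)
  rw [mul_pow, tco, h1, abs_div, abs_of_pos h3]
  calc |pMI S.ε γ V t x k| / γ.fact * ((3 / 4) ^ γ.deg * τU ^ γ.deg)
      = (τU ^ γ.deg / γ.fact * |pMI S.ε γ V t x k|) * (3 / 4) ^ γ.deg := by ring
    _ ≤ (τU ^ γ.deg / γ.fact * ‖S.D γ V t x‖) * (3 / 4) ^ γ.deg := by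
        gcongr; exact abs_coord_le _ _
    _ ≤ _ := by gcongr

lemma jet_U_le {t : ℝ} (ht : t ∈ Ioo 0 S.T) {x : V3} (α : MI) (k : Fin 3)
    {V : ℝ → V3 → V3} (hV : TSm S.T (x 2) V) {B : ℝ}
    (hB : ∀ γ : MI, τU ^ γ.deg / γ.fact * ‖S.D γ V t x‖ ≤ B) :
    jet S.ε (3 / 4 * τU) α (fun t x => V t x k) t x ≤ 64 * B := by
  have hB0 : 0 ≤ B := by
    have h2 := h.radius_pos
    exact le_trans (by positivity) (hB 0)
  calc _ ≤ ∑ γ ∈ Finset.Iic α, B * (3 / 4 : ℝ) ^ γ.deg :=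
        Finset.sum_le_sum fun γ _ => h.tco_U_le ht γ k hV (hB γ)
    _ ≤ B * ((1 - 3 / 4)⁻¹) ^ 3 := by
        rw [← Finset.mul_sum]
        gcongr
        exact sum_pow_deg_le (by norm_num) (by norm_num) α
    _ = _ := by norm_num; ring

/-- The jets of a derivative `lg'` of `lg` are those of `ε(ξ - εU)·U'/2`. -/
lemma jet_bilin_le {t : ℝ} (ht : t ∈ Ioo 0 S.T) {x : V3} (hx : 0 < x 2) (α : MI) (ξ : V3)
    {V : ℝ → V3 → V3} (hV : TSm S.T (x 2) V) {B b : ℝ} (hε : S.ε ≤ 1) (hb : 0 ≤ b)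
    (hB : ∀ γ : MI, τU ^ γ.deg / γ.fact * ‖S.D γ V t x‖ ≤ B) :
    jet S.ε (3 / 4 * τU) α (fun t x => ∑ k, ((S.ε / 2 * ξ k) * V t x k
      + (-b * S.ε ^ 2) * (S.Uc k t x * V t x k))) t x
      ≤ S.ε * B * (96 + 3 * b * 64 ^ 2 * K) * (1 + ‖ξ‖) := by
  have hs : 0 ≤ 3 / 4 * τU := by have := h.radius_pos; positivity
  have hB0 : 0 ≤ B := by
    have h2 := h.radius_pos
    exact le_trans (by positivity) (hB 0)
  have hK := h.K_nonneg ht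
  have hε0 := h.eps_pos
  have hU := h.smU.tsm hx.le
  have hUc := fun k => (h.smUc k).tsm hx.le
  have hVc : ∀ k, TSm S.T (x 2) (fun t x => V t x k) := fun k => hV.clm (EuclideanSpace.proj k)
  have hc : ∀ c : ℝ, ∀ u : ℝ → V3 → ℝ, TSm S.T (x 2) u → TSm S.T (x 2) (fun t x => c * u t x) :=
    fun c u hu => (TSm.const c).mul hu
  have ht1 : ∀ k, jet S.ε (3 / 4 * τU) α (fun t x => (S.ε / 2 * ξ k) * V t x k
      + (-b * S.ε ^ 2) * (S.Uc k t x * V t x k)) t x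
      ≤ S.ε / 2 * ‖ξ‖ * (64 * B) + b * S.ε ^ 2 * (64 * K * (64 * B)) := by
    intro k
    refine ((hc _ _ (hVc k)).jet_add_le (hc _ _ ((hUc k).mul (hVc k))) hs α ht rfl).trans ?_
    rw [(hVc k).jet_const_mul _ _ α ht rfl, ((hUc k).mul (hVc k)).jet_const_mul _ _ α ht rfl]
    have j1 := h.jet_U_le ht α k hV hB
    have j2 : jet S.ε (3 / 4 * τU) α (S.Uc k) t x ≤ 64 * K :=
      h.jet_U_le ht α k hU (h.flow.bound t ht x hx)
    have j3 := (hUc k).jet_mul_le (ε := S.ε) (hVc k) hs α ht rfl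
    have a1 : |S.ε / 2 * ξ k| ≤ S.ε / 2 * ‖ξ‖ := by
      rw [abs_mul, abs_of_pos (by positivity)]; gcongr; exact abs_coord_le _ _
    have a2 : |-b * S.ε ^ 2| = b * S.ε ^ 2 := by
      rw [abs_mul, abs_neg, abs_of_nonneg hb, abs_of_pos (by positivity)]
    rw [a2]
    have n1 := jet_nonneg (ε := S.ε) hs α (fun t x => V t x k) t x
    have n2 := jet_nonneg (ε := S.ε) hs α (S.Uc k) t x
    gcongr
    exact j3.trans (by gcongr)
  have hsum : jet S.ε (3 / 4 * τU) α (fun t x => ∑ k, ((S.ε / 2 * ξ k) * V t x k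
      + (-b * S.ε ^ 2) * (S.Uc k t x * V t x k))) t x
      ≤ ∑ k, jet S.ε (3 / 4 * τU) α (fun t x => (S.ε / 2 * ξ k) * V t x k
      + (-b * S.ε ^ 2) * (S.Uc k t x * V t x k)) t x := by
    have hk : ∀ k, TSm S.T (x 2) (fun t x => (S.ε / 2 * ξ k) * V t x k
      + (-b * S.ε ^ 2) * (S.Uc k t x * V t x k)) := fun k =>
        (hc _ _ (hVc k)).add (hc _ _ ((hUc k).mul (hVc k)))
    simp only [Fin.sum_univ_three]
    refine (((hk 0).add (hk 1)).jet_add_le (hk 2) hs α ht rfl).trans ?_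
    gcongr
    exact (hk 0).jet_add_le (hk 1) hs α ht rfl
  refine hsum.trans ((Finset.sum_le_sum fun k _ => ht1 k).trans ?_)
  simp only [Finset.sum_const, Finset.card_univ, Fintype.card_fin, nsmul_eq_mul, Nat.cast_ofNat]
  have hq : S.ε ^ 2 ≤ S.ε := by nlinarith
  have hn := norm_nonneg ξ
  calc _ = S.ε * B * 96 * ‖ξ‖ + S.ε ^ 2 * (B * (3 * b * 64 ^ 2 * K)) := by ring
    _ ≤ S.ε * B * 96 * (1 + ‖ξ‖) + S.ε * (B * (3 * b * 64 ^ 2 * K)) * (1 + ‖ξ‖) := by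
        refine add_le_add (by gcongr; linarith) ?_
        calc _ ≤ S.ε * (B * (3 * b * 64 ^ 2 * K)) := by gcongr
          _ ≤ _ := le_mul_of_one_le_right (by positivity) (by linarith)
    _ = _ := by ring

lemma dT_lg (ξ : V3) {z : ℝ} (hz : 0 ≤ z) (i : Fin 3) :
    TEq S.T z (dT S.ε i (S.lg ξ)) (fun t x => ∑ k, ((S.ε / 2 * ξ k) * dT S.ε i S.U t x k
      + (-(1 / 2) * S.ε ^ 2) * (S.Uc k t x * dT S.ε i S.U t x k))) := by
  intro t ht x hx
  have hp := mem_tdom ht (x 0, x 1)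
  have hU := fun k => (h.smUc k).tsm hz
  simp only []
  rw [((h.sm_lg ξ).tsm hz).dT_eq ht hx]
  have h1 : slice z (S.lg ξ) = fun p => ∑ k, ((S.ε / 2 * ξ k) * slice z (S.Uc k) p
      + (-(S.ε ^ 2 / 4)) * (slice z (S.Uc k) p * slice z (S.Uc k) p)) := rfl
  have hd := fun k => ((hU k).differentiableAt hp).hasFDerivAt
  have h2 := HasFDerivAt.fun_sum (u := Finset.univ) fun k _ =>
    ((hd k).const_mul (S.ε / 2 * ξ k)).add (((hd k).mul (hd k)).const_mul (-(S.ε ^ 2 / 4)))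
  have h3 : ∀ k, dT S.ε i S.U t x k = fderiv ℝ (slice z (S.Uc k)) (t, x 0, x 1) (dirT S.ε i) := by
    intro k
    rw [← (hU k).dT_eq ht hx]
    exact ((h.smU.tsm hz).dT_clm (EuclideanSpace.proj k) i t ht x hx).symm
  rw [h1]
  erw [h2.fderiv]
  have hxx : pnt (x 0, x 1) z = x := by rw [← hx, pnt_eta]
  simp only [h3, sum_apply]
  refine Finset.sum_congr rfl fun k _ => ?_
  simp [slice, hxx]; ring

lemma px_Uc {t : ℝ} (ht : t ∈ Ioo 0 S.T) {x : V3} (hx : 0 < x 2) (i k : Fin 3) :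
    px i (S.Uc k) t x = px i S.U t x k := by
  have h1 := h.smU.hasDerivAt_line ht hx i
  have h2 := ((EuclideanSpace.proj (𝕜 := ℝ) k).hasFDerivAt.comp_hasDerivAt 0 h1).deriv
  rw [← h.smU.px_eq ht hx] at h2
  exact h2

lemma px_lg (ξ : V3) {t : ℝ} (ht : t ∈ Ioo 0 S.T) {x : V3} (hx : 0 < x 2) (i : Fin 3) :
    px i (S.lg ξ) t x = ∑ k, ((S.ε / 2 * ξ k) * px i S.U t x k
      + (-(1 / 2) * S.ε ^ 2) * (S.Uc k t x * px i S.U t x k)) := by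
  have hd := fun k => (h.smUc k).hasDerivAt_line ht hx i
  simp only [← (h.smUc _).px_eq ht hx, h.px_Uc ht hx] at hd
  have h2 := HasDerivAt.fun_sum (u := Finset.univ) fun k _ =>
    ((hd k).const_mul (S.ε / 2 * ξ k)).add (((hd k).mul (hd k)).const_mul (-(S.ε ^ 2 / 4)))
  refine h2.deriv.trans (Finset.sum_congr rfl fun k _ => ?_)
  simp; ring

end Admissible

end Config

/-- The constant in the analytic bounds of `√μ`. -/
def cA (K : ℝ) : ℝ := K * (96 + 6144 * K)

/-- The velocity weight that dominates all derivatives of `√μ` on the analytic scale. -/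
def wgt (K : ℝ) (ξ : V3) : ℝ := √(mu0 ξ) * exp ((cA K + 1) * (1 + ‖ξ‖))

lemma cA_nonneg {K : ℝ} (hK : 0 ≤ K) : 0 ≤ cA K := by unfold cA; positivity

lemma wgt_pos (K : ℝ) (ξ : V3) : 0 < wgt K ξ := mul_pos (sqrt_mu0_pos ξ) (Real.exp_pos _)

lemma exp_sub_one_le (x : ℝ) : exp x - 1 ≤ x * exp x := by
  have h1 := Real.add_one_le_exp (-x)
  have h2 := Real.exp_pos x
  have h3 : exp (-x) * exp x = 1 := by rw [← Real.exp_add]; simp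
  nlinarith

lemma wgt_le_exp (K : ℝ) {c : ℝ} (hc : c < 1 / 4) :
    ∃ M : ℝ, 0 < M ∧ ∀ ξ : V3, wgt K ξ ≤ M * exp (-c * ‖ξ‖ ^ 2) := by
  set a := cA K + 1
  refine ⟨exp (a + a ^ 2 / (4 * (1 / 4 - c))), Real.exp_pos _, fun ξ => ?_⟩
  calc wgt K ξ ≤ exp (-‖ξ‖ ^ 2 / 4) * exp (a * (1 + ‖ξ‖)) := by
        unfold wgt; gcongr; exact sqrt_mu0_le ξ
    _ ≤ _ := by
        rw [← Real.exp_add, ← Real.exp_add]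
        apply Real.exp_le_exp.2
        have hd : 0 < 1 / 4 - c := by linarith
        set d := 1 / 4 - c with hdd
        have h1 : a * ‖ξ‖ ≤ a ^ 2 / (4 * d) + d * ‖ξ‖ ^ 2 := by
          rw [div_add' _ _ _ (by positivity), le_div_iff₀ (by positivity)]
          nlinarith [sq_nonneg (a - 2 * d * ‖ξ‖)]
        have h2 : c = 1 / 4 - d := by rw [hdd]; ring
        rw [h2]
        nlinarith

lemma ae_mXV_pos : ∀ᵐ p ∂mXV, 0 < p.1 2 := by
  have : ∀ᵐ x ∂mX, 0 < x 2 := by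
    unfold mX cell
    refine (ae_restrict_iff' ?_).2 (Filter.Eventually.of_forall fun x hx => hx.2.2)
    refine ((measurableSet_Ico.preimage (continuous_coord 0).measurable).inter
      ((measurableSet_Ico.preimage (continuous_coord 1).measurable).inter
      (measurableSet_Ioi.preimage (continuous_coord 2).measurable)))
  exact (Measure.quasiMeasurePreserving_fst (μ := mX) (ν := volume)).ae this

namespace Config

variable {S : Config} {K τU ρ : ℝ}

namespace Admissible

variable (h : S.Admissible K τU ρ)
include h

lemma sqrtκ_pos : 0 < √S.κ := Real.sqrt_pos.2 h.kappa_pos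

lemma sqrtκ_le : √S.κ ≤ 1 := Real.sqrt_le_one.2 h.kappa_le

lemma le_div_sqrtκ {B : ℝ} (hB : 0 ≤ B) : B ≤ B / √S.κ :=
  le_div_self hB h.sqrtκ_pos h.sqrtκ_le

lemma radius : 0 ≤ 3 / 4 * τU := by have := h.radius_pos; positivity

lemma bound_dT {t : ℝ} (ht : t ∈ Ioo 0 S.T) {x : V3} (hx : 0 < x 2) (i : Fin 3) (γ : MI) :
    τU ^ γ.deg / γ.fact * ‖S.D γ (dT S.ε i S.U) t x‖ ≤ K := by
  fin_cases i
  · exact h.flow.bound_time t ht x hx γ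
  · exact h.flow.bound_tangential t ht x hx γ 0 (by simp)
  · exact h.flow.bound_tangential t ht x hx γ 1 (by simp)

/-- The jet of `lg = log (√μ / √μ₀)`, a polynomial in `ε U` and `ξ`; all its terms carry a factor `ε`. -/
lemma jet_lg_le {t : ℝ} (ht : t ∈ Ioo 0 S.T) {x : V3} (hx : 0 < x 2) (hε : S.ε ≤ 1) (α : MI)
    (ξ : V3) : jet S.ε (3 / 4 * τU) α (S.lg ξ) t x ≤ S.ε * cA K * (1 + ‖ξ‖) := by
  have h1 := h.jet_bilin_le ht hx α ξ (h.smU.tsm hx.le) hε (b := 1 / 4) (by norm_num)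
    (h.flow.bound t ht x hx)
  have h2 : S.lg ξ = fun t x => ∑ k, ((S.ε / 2 * ξ k) * S.U t x k
      + (-(1 / 4) * S.ε ^ 2) * (S.Uc k t x * S.U t x k)) := by
    ext t x
    unfold lg Uc
    exact Finset.sum_congr rfl fun k _ => by ring
  rw [h2]
  refine h1.trans ?_
  have hK := h.K_nonneg ht
  have := h.eps_pos.le
  rw [mul_assoc S.ε, cA]
  gcongr
  linarith

lemma jet_dT_lg_le {t : ℝ} (ht : t ∈ Ioo 0 S.T) {x : V3} (hx : 0 < x 2) (hε : S.ε ≤ 1) (α : MI)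
    (ξ : V3) (i : Fin 3) :
    jet S.ε (3 / 4 * τU) α (dT S.ε i (S.lg ξ)) t x ≤ S.ε / √S.κ * cA K * (1 + ‖ξ‖) := by
  rw [(h.dT_lg ξ hx.le i).jet_eq _ α ht rfl]
  refine (h.jet_bilin_le ht hx α ξ ((h.smU.tsm hx.le).deriv i) hε (b := 1 / 2) (by norm_num)
    (h.bound_dT ht hx i)).trans ?_
  have hK := h.K_nonneg ht
  have := h.eps_pos.le
  have h3 := h.le_div_sqrtκ this
  rw [mul_assoc S.ε, cA]
  gcongr
  linarith

lemma jet_px_lg_le {t : ℝ} (ht : t ∈ Ioo 0 S.T) {x : V3} (hx : 0 < x 2) (hε : S.ε ≤ 1) (α : MI)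
    (ξ : V3) :
    jet S.ε (3 / 4 * τU) α (px 2 (S.lg ξ)) t x ≤ S.ε / √S.κ * cA K * (1 + ‖ξ‖) := by
  have h0 : TEq S.T (x 2) (px 2 (S.lg ξ)) (fun t x => ∑ k, ((S.ε / 2 * ξ k) * px 2 S.U t x k
      + (-(1 / 2) * S.ε ^ 2) * (S.Uc k t x * px 2 S.U t x k))) := by
    intro t ht x' hx'
    exact h.px_lg ξ ht (hx' ▸ hx) 2
  rw [h0.jet_eq _ α ht rfl]
  refine (h.jet_bilin_le ht hx α ξ (h.smU.tsm_px_two hx) hε (b := 1 / 2) (by norm_num)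
    (h.flow.bound_normal t ht x hx)).trans ?_
  have hK := h.K_nonneg ht
  have := h.eps_pos.le
  have h3 := h.sqrtκ_pos
  rw [cA]
  have : S.ε * (K / √S.κ) * (96 + 3 * (1 / 2) * 64 ^ 2 * K) =
    S.ε / √S.κ * (K * (96 + 6144 * K)) := by ring
  rw [this]

lemma jet_sqrtMu_le {t : ℝ} (ht : t ∈ Ioo 0 S.T) {x : V3} (hx : 0 < x 2) (hε : S.ε ≤ 1) (α : MI)
    (ξ : V3) : jet S.ε (3 / 4 * τU) α (fun t x => S.sqrtMu t x ξ) t x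
      ≤ √(mu0 ξ) * exp (cA K * (1 + ‖ξ‖)) ∧
    jet S.ε (3 / 4 * τU) α (fun t x => S.sqrtMu t x ξ) t x - S.sqrtMu t x ξ
      ≤ √(mu0 ξ) * exp (cA K * (1 + ‖ξ‖)) * (S.ε * cA K * (1 + ‖ξ‖)) := by
  have h1 := ((h.sm_sqrtMu ξ).tsm hx.le).jet_exp_le ((h.sm_lg ξ).tsm hx.le)
    (fun i => h.dT_sqrtMu ξ hx.le i) h.radius α ht rfl
  have hA := cA_nonneg (h.K_nonneg ht)
  have h2 := h.jet_lg_le ht hx hε α ξ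
  have h2' : S.ε * cA K * (1 + ‖ξ‖) ≤ cA K * (1 + ‖ξ‖) := by
    have := norm_nonneg ξ
    gcongr
    exact mul_le_of_le_one_left hA hε
  rw [abs_of_pos (S.sqrtMu_pos t x ξ)] at h1
  set J := jet S.ε (3 / 4 * τU) α (S.lg ξ) t x
  have h3 : S.sqrtMu t x ξ ≤ √(mu0 ξ) * exp |S.lg ξ t x| := by
    rw [S.sqrtMu_eq]; gcongr; exact le_abs_self _
  have h4 : S.sqrtMu t x ξ * exp (J - |S.lg ξ t x|) ≤ √(mu0 ξ) * exp (cA K * (1 + ‖ξ‖)) := by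
    calc _ ≤ √(mu0 ξ) * exp |S.lg ξ t x| * exp (J - |S.lg ξ t x|) := by gcongr
      _ = √(mu0 ξ) * exp J := by rw [mul_assoc, ← Real.exp_add]; congr 2; ring
      _ ≤ _ := by gcongr; exact h2.trans h2'
  refine ⟨h1.trans h4, ?_⟩
  have h5 : 0 ≤ J - |S.lg ξ t x| := by
    have := jet_eq_add (ε := S.ε) (3 / 4 * τU) α (S.lg ξ) t x
    have hs : 0 ≤ ∑ γ ∈ (Finset.Iic α).erase 0, |tco S.ε γ (S.lg ξ) t x| * (3 / 4 * τU) ^ γ.deg :=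
      Finset.sum_nonneg fun _ _ => by have := h.radius; positivity
    simp only [J]; linarith
  have h6 := exp_sub_one_le (J - |S.lg ξ t x|)
  have h7 := (S.sqrtMu_pos t x ξ).le
  calc _ ≤ S.sqrtMu t x ξ * (exp (J - |S.lg ξ t x|) - 1) := by linarith
    _ ≤ S.sqrtMu t x ξ * ((J - |S.lg ξ t x|) * exp (J - |S.lg ξ t x|)) := by gcongr
    _ = (S.sqrtMu t x ξ * exp (J - |S.lg ξ t x|)) * (J - |S.lg ξ t x|) := by ring
    _ ≤ _ := by
        gcongr
        have := abs_nonneg (S.lg ξ t x)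
        linarith

omit h in
lemma exp_mul_le_wgt (ξ : V3) :
    √(mu0 ξ) * exp (cA K * (1 + ‖ξ‖)) ≤ wgt K ξ ∧
    √(mu0 ξ) * exp (cA K * (1 + ‖ξ‖)) * (1 + ‖ξ‖) ≤ wgt K ξ := by
  have hn := norm_nonneg ξ
  have h1 : wgt K ξ = √(mu0 ξ) * exp (cA K * (1 + ‖ξ‖)) * exp (1 + ‖ξ‖) := by
    unfold wgt; rw [mul_assoc, ← Real.exp_add]; congr 2; ring
  have h2 := Real.add_one_le_exp (1 + ‖ξ‖)
  have h3 : 0 ≤ √(mu0 ξ) * exp (cA K * (1 + ‖ξ‖)) := by positivity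
  rw [h1]
  constructor
  · exact le_mul_of_one_le_right h3 (by linarith)
  · gcongr; linarith

lemma abs_le_of_tco {u : ℝ → V3 → ℝ} {γ : MI} {t : ℝ} {x : V3} {B : ℝ}
    (hB : |tco S.ε γ u t x| * (3 / 4 * τU) ^ γ.deg ≤ B) :
    |S.D γ u t x| ≤ γ.fact / (3 / 4 * τU) ^ γ.deg * B := by
  have h2 := h.radius_pos
  have h3 := (Nat.cast_pos (α := ℝ)).2 (MI.fact_pos γ)
  rw [tco, abs_div, abs_of_pos h3] at hB
  have hs : 0 < (3 / 4 * τU) ^ γ.deg := by positivity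
  rw [div_mul_eq_mul_div, le_div_iff₀ hs]
  rw [div_mul_eq_mul_div, div_le_iff₀ h3] at hB
  linarith

/-- Bound of `∂^γ √μ`. -/
lemma abs_D_sqrtMu_le {t : ℝ} (ht : t ∈ Ioo 0 S.T) {x : V3} (hx : 0 < x 2) (hε : S.ε ≤ 1) (γ : MI)
    (ξ : V3) : |S.dSqrtMu γ ξ t x| ≤ γ.fact / (3 / 4 * τU) ^ γ.deg * wgt K ξ :=
  h.abs_le_of_tco ((abs_tco_mul_le_jet h.radius γ _ t x).trans
    ((h.jet_sqrtMu_le ht hx hε γ ξ).1.trans (exp_mul_le_wgt (K := K) ξ).1))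

/-- For `γ ≠ 0` the derivative `∂^γ √μ` falls on `εU`, which gains a factor `ε`. -/
lemma abs_D_sqrtMu_le_of_ne {t : ℝ} (ht : t ∈ Ioo 0 S.T) {x : V3} (hx : 0 < x 2) (hε : S.ε ≤ 1)
    {γ : MI} (hγ : γ ≠ 0) (ξ : V3) :
    |S.dSqrtMu γ ξ t x| ≤ γ.fact / (3 / 4 * τU) ^ γ.deg * (S.ε * cA K * wgt K ξ) := by
  refine h.abs_le_of_tco ?_
  have h1 := (h.jet_sqrtMu_le ht hx hε γ ξ).2
  have h2 : |tco S.ε γ (fun t x => S.sqrtMu t x ξ) t x| * (3 / 4 * τU) ^ γ.deg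
      ≤ jet S.ε (3 / 4 * τU) γ (fun t x => S.sqrtMu t x ξ) t x - S.sqrtMu t x ξ := by
    rw [jet_eq_add, abs_of_pos (S.sqrtMu_pos t x ξ), add_sub_cancel_left]
    exact Finset.single_le_sum (f := fun γ => |tco S.ε γ (fun t x => S.sqrtMu t x ξ) t x|
      * (3 / 4 * τU) ^ γ.deg) (fun _ _ => by have := h.radius; positivity)
      (Finset.mem_erase.2 ⟨hγ, Finset.mem_Iic.2 le_rfl⟩)
  refine h2.trans (h1.trans ?_)
  have hA := cA_nonneg (h.K_nonneg ht)
  have := h.eps_pos.le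
  calc _ = S.ε * cA K * (√(mu0 ξ) * exp (cA K * (1 + ‖ξ‖)) * (1 + ‖ξ‖)) := by ring
    _ ≤ _ := by gcongr; exact (exp_mul_le_wgt (K := K) ξ).2

/-- The product estimate for jets, applied to `√μ v`. -/
lemma jet_mul_sqrtMu_le {t : ℝ} (ht : t ∈ Ioo 0 S.T) {x : V3} (hx : 0 < x 2) (hε : S.ε ≤ 1)
    (γ : MI) (ξ : V3) {v : ℝ → V3 → ℝ} (hv : TSm S.T (x 2) v)
    (hj : jet S.ε (3 / 4 * τU) γ v t x ≤ S.ε / √S.κ * cA K * (1 + ‖ξ‖)) :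
    |S.D γ (fun t x => S.sqrtMu t x ξ * v t x) t x|
      ≤ γ.fact / (3 / 4 * τU) ^ γ.deg * (S.ε / √S.κ * cA K * wgt K ξ) := by
  refine h.abs_le_of_tco ((abs_tco_mul_le_jet h.radius γ _ t x).trans ?_)
  refine (((h.sm_sqrtMu ξ).tsm hx.le).jet_mul_le hv h.radius γ ht rfl).trans ?_
  have hA := cA_nonneg (h.K_nonneg ht)
  have := h.eps_pos.le
  have := h.sqrtκ_pos
  calc _ ≤ (√(mu0 ξ) * exp (cA K * (1 + ‖ξ‖))) * (S.ε / √S.κ * cA K * (1 + ‖ξ‖)) := by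
        gcongr
        · exact jet_nonneg h.radius _ _ _ _
        · exact (h.jet_sqrtMu_le ht hx hε γ ξ).1
    _ = S.ε / √S.κ * cA K * (√(mu0 ξ) * exp (cA K * (1 + ‖ξ‖)) * (1 + ‖ξ‖)) := by ring
    _ ≤ _ := by gcongr; exact (exp_mul_le_wgt (K := K) ξ).2

/-- Since `∂√μ = √μ ∂lg`, one derivative of `∂^γ √μ` is `∂^γ (√μ ∂lg)`, so the product estimate
applies without a loss of radius. -/
lemma abs_dT_D_sqrtMu_le {t : ℝ} (ht : t ∈ Ioo 0 S.T) {x : V3} (hx : 0 < x 2) (hε : S.ε ≤ 1)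
    (γ : MI) (ξ : V3) (i : Fin 3) :
    |dT S.ε i (S.dSqrtMu γ ξ) t x|
      ≤ γ.fact / (3 / 4 * τU) ^ γ.deg * (S.ε / √S.κ * cA K * wgt K ξ) := by
  have h1 : dT S.ε i (S.dSqrtMu γ ξ) t x
      = S.D γ (fun t x => S.sqrtMu t x ξ * dT S.ε i (S.lg ξ) t x) t x := by
    unfold dSqrtMu
    rw [← ((h.sm_sqrtMu ξ).tsm hx.le).pMI_dT γ i t ht x rfl,
      (h.dT_sqrtMu ξ hx.le i).derivMI γ t ht x rfl]
  rw [h1]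
  exact h.jet_mul_sqrtMu_le ht hx hε γ ξ (((h.sm_lg ξ).tsm hx.le).deriv i)
    (h.jet_dT_lg_le ht hx hε γ ξ i)

lemma abs_px_D_sqrtMu_le {t : ℝ} (ht : t ∈ Ioo 0 S.T) {x : V3} (hx : 0 < x 2) (hε : S.ε ≤ 1)
    (γ : MI) (ξ : V3) :
    |px 2 (S.dSqrtMu γ ξ) t x|
      ≤ γ.fact / (3 / 4 * τU) ^ γ.deg * (S.ε / √S.κ * cA K * wgt K ξ) := by
  have h1 : px 2 (S.dSqrtMu γ ξ) t x
      = S.D γ (fun t x => S.sqrtMu t x ξ * px 2 (S.lg ξ) t x) t x := by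
    unfold dSqrtMu
    rw [(h.sm_sqrtMu ξ).px_two_pMI hx γ t ht x rfl,
      (h.px_two_sqrtMu ξ hx).derivMI γ t ht x rfl]
  rw [h1]
  exact h.jet_mul_sqrtMu_le ht hx hε γ ξ ((h.sm_lg ξ).tsm_px_two hx)
    (h.jet_px_lg_le ht hx hε γ ξ)

omit h in
lemma wInf_le {c M : ℝ} (hM : ∀ ξ : V3, wgt K ξ ≤ M * exp (-c * ‖ξ‖ ^ 2)) {t B : ℝ}
    (hB : 0 ≤ B) {g : V3 → ℝ → V3 → ℝ}
    (hg : ∀ x : V3, 0 < x 2 → ∀ ξ, |g ξ t x| ≤ B * wgt K ξ) :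
    wInf c g t ≤ ofReal (B * M) := by
  unfold wInf
  rw [eLpNorm_exponent_top]
  refine eLpNormEssSup_le_of_ae_bound ?_
  filter_upwards [ae_mXV_pos] with p hp
  rw [norm_mul, Real.norm_eq_abs, Real.norm_eq_abs, abs_of_pos (Real.exp_pos _)]
  calc _ ≤ exp (c * ‖p.2‖ ^ 2) * (B * (M * exp (-c * ‖p.2‖ ^ 2))) := by
        gcongr
        exact (hg p.1 hp p.2).trans (by gcongr; exact hM _)
    _ = B * M * (exp (c * ‖p.2‖ ^ 2) * exp (-c * ‖p.2‖ ^ 2)) := by ring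
    _ = B * M := by rw [← Real.exp_add]; simp

/-- The weighted norms of `∂^γ √μ` and its first derivatives are small for `γ ≠ 0`. -/
lemma nMu_le {c M : ℝ} (hM : ∀ ξ : V3, wgt K ξ ≤ M * exp (-c * ‖ξ‖ ^ 2)) (hM0 : 0 < M) {t : ℝ}
    (ht : t ∈ Ioo 0 S.T) (hε : S.ε ≤ 1) {γ : MI} (hγ : γ ≠ 0) :
    S.nMu c γ t ≤ ofReal (S.ε / √S.κ * (γ.fact / (3 / 4 * τU) ^ γ.deg)
      * (5 * (cA K * M))) := by
  have hA := cA_nonneg (h.K_nonneg ht)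
  have := h.eps_pos.le
  have h3 := h.sqrtκ_pos
  have hs := h.radius_pos
  set B := γ.fact / (3 / 4 * τU) ^ γ.deg * (S.ε / √S.κ * cA K) with hBdef
  have hB : 0 ≤ B := by positivity
  have b1 : wInf c (S.dSqrtMu γ) t ≤ ofReal (B * M) := by
    refine wInf_le hM hB fun x hx ξ => (h.abs_D_sqrtMu_le_of_ne ht hx hε hγ ξ).trans ?_
    have := wgt_pos K ξ
    rw [hBdef, mul_assoc ((γ.fact : ℝ) / (3 / 4 * τU) ^ γ.deg)]
    gcongr
    exact h.le_div_sqrtκ h.eps_pos.le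
  have b2 : ∀ i, wInf c (fun ξ => dT S.ε i (S.dSqrtMu γ ξ)) t ≤ ofReal (B * M) := by
    intro i
    refine wInf_le hM hB fun x hx ξ => (h.abs_dT_D_sqrtMu_le ht hx hε γ ξ i).trans (le_of_eq ?_)
    rw [hBdef]; ring
  have b3 : wInf c (fun ξ => px 2 (S.dSqrtMu γ ξ)) t ≤ ofReal (B * M) := by
    refine wInf_le hM hB fun x hx ξ => (h.abs_px_D_sqrtMu_le ht hx hε γ ξ).trans (le_of_eq ?_)
    rw [hBdef]; ring
  unfold nMu
  rw [Fin.sum_univ_three]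
  have e1 : S.ε / √S.κ * (γ.fact / (3 / 4 * τU) ^ γ.deg) * (5 * (cA K * M))
      = B * M + B * M + (B * M + B * M + B * M) := by rw [hBdef]; ring
  rw [e1]
  repeat rw [ENNReal.ofReal_add (by positivity) (by positivity)]
  exact add_le_add (add_le_add b1 (b2 0)) (add_le_add (add_le_add (b2 1) (b2 2)) b3)

end Admissible

end Config

/-! ### Integration over slices and Hardy's inequality -/

lemma lintegral_mul_sq_le {X : Type*} [MeasurableSpace X] {m : Measure X} {f g : X → ℝ≥0∞}
    (hf : AEMeasurable f m) (hg : AEMeasurable g m) :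
    (∫⁻ x, f x * g x ∂m) ^ 2 ≤ (∫⁻ x, f x ^ 2 ∂m) * ∫⁻ x, g x ^ 2 ∂m := by
  have h1 := ENNReal.lintegral_mul_le_Lp_mul_Lq m Real.HolderConjugate.two_two hf hg
  simp only [Pi.mul_apply, ENNReal.rpow_ofNat] at h1
  calc _ ≤ _ := pow_le_pow_left' h1 2
    _ = _ := by
      rw [mul_pow, ← ENNReal.rpow_natCast, ← ENNReal.rpow_mul, ← ENNReal.rpow_natCast,
        ← ENNReal.rpow_mul]
      norm_num

lemma eLpNorm_two_sq {X F : Type*} [MeasurableSpace X] [ENorm F] {m : Measure X}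
    (f : X → F) : eLpNorm f 2 m ^ 2 = ∫⁻ x, ‖f x‖ₑ ^ 2 ∂m := by
  have := eLpNorm_nnreal_pow_eq_lintegral (f := f) (μ := m) (p := 2) (by norm_num)
  simpa using this

lemma eLpNorm_two_eq {X F : Type*} [MeasurableSpace X] [ENorm F] {m : Measure X}
    (f : X → F) : eLpNorm f 2 m = (∫⁻ x, ‖f x‖ₑ ^ 2 ∂m) ^ (1 / 2 : ℝ) := by
  rw [← eLpNorm_two_sq, ← ENNReal.rpow_natCast, ← ENNReal.rpow_mul]; norm_num

lemma lintegral_rpow_neg_half {b : ℝ} (hb : 0 < b) :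
    ∫⁻ s in Ioc 0 b, ofReal (s ^ (-(1 / 4) : ℝ)) ^ 2
      = ofReal (2 * b ^ (1 / 2 : ℝ)) := by
  have h1 : ∀ s ∈ Ioc 0 b, ofReal (s ^ (-(1 / 4) : ℝ)) ^ 2
      = ofReal (s ^ (-(1 / 2) : ℝ)) := by
    intro s hs
    rw [← ENNReal.ofReal_pow (Real.rpow_nonneg hs.1.le _), ← Real.rpow_natCast, ← Real.rpow_mul hs.1.le]
    norm_num
  rw [setLIntegral_congr_fun measurableSet_Ioc h1, ← ofReal_integral_eq_lintegral_ofReal]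
  · rw [← intervalIntegral.integral_of_le hb.le, integral_rpow (Or.inl (by norm_num))]
    congr 1
    norm_num
    ring
  · exact (intervalIntegrable_iff_integrableOn_Ioc_of_le hb.le).1
      (intervalIntegral.intervalIntegrable_rpow' (by norm_num))
  · filter_upwards [ae_restrict_mem measurableSet_Ioc] with s hs
    exact Real.rpow_nonneg hs.1.le _

lemma lintegral_rpow_neg_three_half {s : ℝ} (hs : 0 < s) :
    ∫⁻ b in Ioi s, ofReal (2 * b ^ (-(3 / 2) : ℝ))
      = ofReal (4 * s ^ (-(1 / 2) : ℝ)) := by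
  rw [← ofReal_integral_eq_lintegral_ofReal]
  · rw [integral_const_mul, integral_Ioi_rpow_of_lt (by norm_num) hs]
    congr 1
    norm_num
    ring
  · exact (integrableOn_Ioi_rpow_of_lt (by norm_num) hs).const_mul 2
  · filter_upwards [ae_restrict_mem measurableSet_Ioi] with b hb
    have : 0 < b := hs.trans hb
    positivity

/-- Hardy's inequality on the half-line, by the Cauchy-Schwarz inequality with the weight
`s^{1/4}` and Tonelli's theorem. -/
lemma hardy_lintegral {h : ℝ → ℝ≥0∞} (hh : Measurable h) :
    ∫⁻ b in Ioi (0 : ℝ), ((∫⁻ s in Ioc 0 b, h s) / ofReal b) ^ 2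
      ≤ 4 * ∫⁻ s in Ioi (0 : ℝ), h s ^ 2 := by
  have hm : Measurable fun s : ℝ => ofReal (s ^ (1 / 4 : ℝ)) := by fun_prop
  have hm' : Measurable fun s : ℝ => ofReal (s ^ (-(1 / 4) : ℝ)) := by fun_prop
  have hk : Measurable fun s : ℝ => (h s * ofReal (s ^ (1 / 4 : ℝ))) ^ 2 := by fun_prop
  have step1 : ∀ b ∈ Ioi (0 : ℝ), ((∫⁻ s in Ioc 0 b, h s) / ofReal b) ^ 2
      ≤ ∫⁻ s in Ioi (0 : ℝ), (Ioi s).indicator (fun b => ofReal (2 * b ^ (-(3 / 2) : ℝ))) b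
        * (h s * ofReal (s ^ (1 / 4 : ℝ))) ^ 2 := by
    intro b hb
    have hb0 : 0 < b := hb
    have e1 : ∫⁻ s in Ioc 0 b, h s = ∫⁻ s in Ioc 0 b, (h s * ofReal (s ^ (1 / 4 : ℝ)))
        * ofReal (s ^ (-(1 / 4) : ℝ)) := by
      refine setLIntegral_congr_fun measurableSet_Ioc fun s hs => ?_
      rw [mul_assoc, ← ENNReal.ofReal_mul (Real.rpow_nonneg hs.1.le _), ← Real.rpow_add hs.1]
      norm_num
    have e2 := lintegral_mul_sq_le (m := volume.restrict (Ioc 0 b))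
      (hh.mul hm).aemeasurable hm'.aemeasurable
    simp only [Pi.mul_apply] at e2
    rw [lintegral_rpow_neg_half hb0, ← e1] at e2
    have e3 : ofReal (2 * b ^ (1 / 2 : ℝ)) / ofReal b ^ 2
        = ofReal (2 * b ^ (-(3 / 2) : ℝ)) := by
      rw [← ENNReal.ofReal_pow hb0.le, ← ENNReal.ofReal_div_of_pos (by positivity)]
      congr 1
      rw [div_eq_iff (by positivity), mul_assoc, ← Real.rpow_natCast, ← Real.rpow_add hb0]
      norm_num
    calc _ = (∫⁻ s in Ioc 0 b, h s) ^ 2 / ofReal b ^ 2 := by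
          rw [ENNReal.div_eq_inv_mul, mul_pow, ENNReal.div_eq_inv_mul, ENNReal.inv_pow]
      _ ≤ ((∫⁻ s in Ioc 0 b, (h s * ofReal (s ^ (1 / 4 : ℝ))) ^ 2)
          * ofReal (2 * b ^ (1 / 2 : ℝ))) / ofReal b ^ 2 := by gcongr
      _ = ∫⁻ s in Ioc 0 b, ofReal (2 * b ^ (-(3 / 2) : ℝ)) *
          (h s * ofReal (s ^ (1 / 4 : ℝ))) ^ 2 := by
          rw [lintegral_const_mul _ hk, mul_div_assoc, e3, mul_comm]
      _ = ∫⁻ s in Ioo 0 b, ofReal (2 * b ^ (-(3 / 2) : ℝ)) *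
          (h s * ofReal (s ^ (1 / 4 : ℝ))) ^ 2 := by
          rw [restrict_Ioo_eq_restrict_Ioc]
      _ ≤ _ := by
          rw [← lintegral_indicator measurableSet_Ioo, ← lintegral_indicator measurableSet_Ioi]
          refine lintegral_mono fun s => ?_
          by_cases hs : s ∈ Ioo 0 b
          · have : s ∈ Ioi (0 : ℝ) := hs.1
            have h2 : b ∈ Ioi s := hs.2
            simp [hs, this, h2]
          · simp [hs]
  calc _ ≤ ∫⁻ b in Ioi (0 : ℝ), ∫⁻ s in Ioi (0 : ℝ),
        (Ioi s).indicator (fun b => ofReal (2 * b ^ (-(3 / 2) : ℝ))) b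
        * (h s * ofReal (s ^ (1 / 4 : ℝ))) ^ 2 :=
        setLIntegral_mono' measurableSet_Ioi step1
    _ = ∫⁻ s in Ioi (0 : ℝ), ∫⁻ b in Ioi (0 : ℝ),
        (Ioi s).indicator (fun b => ofReal (2 * b ^ (-(3 / 2) : ℝ))) b
        * (h s * ofReal (s ^ (1 / 4 : ℝ))) ^ 2 := by
        rw [lintegral_lintegral_swap]
        refine (Measurable.mul ?_ (hk.comp measurable_snd)).aemeasurable
        have : (fun p : ℝ × ℝ => (Ioi p.2).indicator
            (fun b => ofReal (2 * b ^ (-(3 / 2) : ℝ))) p.1)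
            = {p : ℝ × ℝ | p.2 < p.1}.indicator
              (fun p => ofReal (2 * p.1 ^ (-(3 / 2) : ℝ))) := by
          ext p; simp [indicator]
        erw [this]
        exact Measurable.indicator (by fun_prop) (measurableSet_lt measurable_snd measurable_fst)
    _ = ∫⁻ s in Ioi (0 : ℝ), 4 * h s ^ 2 := by
        refine setLIntegral_congr_fun measurableSet_Ioi fun s hs => ?_
        have hs0 : 0 < s := hs
        rw [lintegral_mul_const _ (Measurable.indicator (by fun_prop) measurableSet_Ioi),
          lintegral_indicator measurableSet_Ioi,
          Measure.restrict_restrict measurableSet_Ioi, inter_eq_left.2 (Ioi_subset_Ioi hs0.le),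
          lintegral_rpow_neg_three_half hs0, mul_pow, ← ENNReal.ofReal_pow (by positivity),
          mul_comm (h s ^ 2), ← mul_assoc, ← ENNReal.ofReal_mul (by positivity)]
        have : 4 * s ^ (-(1 / 2) : ℝ) * (s ^ (1 / 4 : ℝ)) ^ 2 = 4 := by
          rw [mul_assoc, ← Real.rpow_natCast, ← Real.rpow_mul hs0.le, ← Real.rpow_add hs0]
          norm_num
        rw [this]; norm_num
    _ = _ := lintegral_const_mul _ (by fun_prop)

/-- The tangential unit cell. -/
def cellPar : Set (ℝ × ℝ) := Ico 0 1 ×ˢ Ico 0 1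

/-- The measure of the fundamental cell in the coordinates `((x₁, x₂), x₃)`. -/
def mYZ : Measure ((ℝ × ℝ) × ℝ) := (volume.restrict cellPar).prod (volume.restrict (Ioi 0))

lemma measurePreserving_pnt :
    MeasurePreserving (fun p : (ℝ × ℝ) × ℝ => pnt p.1 p.2) volume volume := by
  have h1 := (PiLp.volume_preserving_toLp (Fin 3)).comp
    (volume_preserving_piFinSuccAbove (fun _ : Fin 3 => ℝ) 2).symm
  have h2 := h1.comp ((MeasurePreserving.id (volume : Measure ℝ)).prod
    (volume_preserving_finTwoArrow ℝ).symm)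
  have h3 := h2.comp (Measure.measurePreserving_swap (μ := (volume : Measure (ℝ × ℝ)))
    (ν := (volume : Measure ℝ)))
  have h4 : (fun p : (ℝ × ℝ) × ℝ => pnt p.1 p.2)
      = ((WithLp.toLp 2 ∘ (MeasurableEquiv.piFinSuccAbove (fun _ : Fin 3 => ℝ) 2).symm) ∘
        Prod.map id MeasurableEquiv.finTwoArrow.symm) ∘ Prod.swap := by
    funext p
    ext i
    fin_cases i
    · simp [MeasurableEquiv.finTwoArrow, MeasurableEquiv.piFinSuccAbove, Fin.insertNthEquiv]
      rfl
    · simp [MeasurableEquiv.finTwoArrow, MeasurableEquiv.piFinSuccAbove, Fin.insertNthEquiv]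
      rfl
    · simp [MeasurableEquiv.finTwoArrow, MeasurableEquiv.piFinSuccAbove, Fin.insertNthEquiv]
  rw [h4]
  exact h3

lemma measurableSet_cell : MeasurableSet cell :=
  (measurableSet_Ico.preimage (continuous_coord 0).measurable).inter
      ((measurableSet_Ico.preimage (continuous_coord 1).measurable).inter
      (measurableSet_Ioi.preimage (continuous_coord 2).measurable))

lemma measurePreserving_pnt_cell :
    MeasurePreserving (fun p : (ℝ × ℝ) × ℝ => pnt p.1 p.2) mYZ mX := by
  have h1 := measurePreserving_pnt.restrict_preimage measurableSet_cell
  have h2 : (fun p : (ℝ × ℝ) × ℝ => pnt p.1 p.2) ⁻¹' cell = cellPar ×ˢ Ioi 0 := by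
    ext p; simp [cell, cellPar, and_assoc]
  rw [h2] at h1
  unfold mYZ mX
  rwa [Measure.prod_restrict]

instance : SFinite mX := by unfold mX; infer_instance

instance : SFinite mYZ := by unfold mYZ; infer_instance

/-- Hardy's inequality in the normal variable: division by `x₃` costs one normal derivative. -/
lemma eLpNorm_div_le {g : V3 → ℝ} {H : V3 → ℝ≥0∞} (hH : AEMeasurable H mX)
    (hg : ∀ y ∈ cellPar, ∀ b, 0 < b → ‖g (pnt y b)‖ₑ ≤ ∫⁻ s in Ioc 0 b, H (pnt y s)) :
    eLpNorm (fun x => g x / x 2) 2 mX ≤ 2 * eLpNorm H 2 mX := by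
  set H' := hH.mk H
  have hH' : Measurable H' := hH.measurable_mk
  have hHe : H =ᵐ[mX] H' := hH.ae_eq_mk
  have hP := measurePreserving_pnt_cell
  have h1 : ∀ᵐ y ∂(volume.restrict cellPar), ∀ᵐ s ∂(volume.restrict (Ioi (0 : ℝ))),
      H (pnt y s) = H' (pnt y s) := Measure.ae_ae_of_ae_prod (hP.quasiMeasurePreserving.ae hHe)
  have hme : Measurable fun p : (ℝ × ℝ) × ℝ => H' (pnt p.1 p.2) := hH'.comp hP.measurable
  have key : ∫⁻ x, ‖g x / x 2‖ₑ ^ 2 ∂mX ≤ 4 * ∫⁻ x, ‖H x‖ₑ ^ 2 ∂mX := by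
    have hmL : Measurable fun p : (ℝ × ℝ) × ℝ =>
        (∫⁻ s in Ioc 0 p.2, H' (pnt p.1 s)) / ofReal p.2 := by
      refine Measurable.div ?_ (by fun_prop)
      have : (fun p : (ℝ × ℝ) × ℝ => ∫⁻ s in Ioc 0 p.2, H' (pnt p.1 s))
          = fun p => ∫⁻ s, {q : ((ℝ × ℝ) × ℝ) × ℝ | 0 < q.2 ∧ q.2 ≤ q.1.2}.indicator
            (fun q => H' (pnt q.1.1 q.2)) (p, s) := by
        ext p
        rw [← lintegral_indicator measurableSet_Ioc]
        rfl
      rw [this]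
      refine Measurable.lintegral_prod_right' (Measurable.indicator ?_ ?_)
      · exact hme.comp (f := fun q : ((ℝ × ℝ) × ℝ) × ℝ => (q.1.1, q.2)) (by fun_prop)
      · exact (measurableSet_lt measurable_const measurable_snd).inter
          (measurableSet_le measurable_snd (by fun_prop))
    have step : ∀ᵐ p ∂mYZ, ‖g (pnt p.1 p.2) / pnt p.1 p.2 2‖ₑ ^ 2
        ≤ ((∫⁻ s in Ioc 0 p.2, H' (pnt p.1 s)) / ofReal p.2) ^ 2 := by
      have a1 : ∀ᵐ p ∂mYZ, ∀ᵐ s ∂(volume.restrict (Ioi (0 : ℝ))),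
          H (pnt p.1 s) = H' (pnt p.1 s) := Measure.quasiMeasurePreserving_fst.ae h1
      have a2 : ∀ᵐ p ∂mYZ, p ∈ cellPar ×ˢ Ioi (0 : ℝ) := by
        unfold mYZ
        rw [Measure.prod_restrict]
        exact ae_restrict_mem ((measurableSet_Ico.prod measurableSet_Ico).prod measurableSet_Ioi)
      filter_upwards [a1, a2] with p hp1 hp2
      have hp0 : (0 : ℝ) < p.2 := hp2.2
      gcongr
      rw [pnt_two, div_eq_mul_inv, enorm_mul, ENNReal.div_eq_inv_mul, mul_comm, enorm_inv hp0.ne',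
        Real.enorm_of_nonneg hp0.le]
      gcongr
      refine (hg p.1 hp2.1 p.2 hp0).trans (le_of_eq ?_)
      refine lintegral_congr_ae ?_
      exact ae_restrict_of_ae_restrict_of_subset (fun s hs => hs.1) hp1
    calc _ ≤ ∫⁻ p, ‖g (pnt p.1 p.2) / pnt p.1 p.2 2‖ₑ ^ 2 ∂mYZ := by
          rw [← hP.map_eq]
          exact lintegral_map_le _ _
      _ ≤ ∫⁻ p, ((∫⁻ s in Ioc 0 p.2, H' (pnt p.1 s)) / ofReal p.2) ^ 2 ∂mYZ :=
          lintegral_mono_ae step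
      _ = ∫⁻ y in cellPar, ∫⁻ b in Ioi (0 : ℝ),
          ((∫⁻ s in Ioc 0 b, H' (pnt y s)) / ofReal b) ^ 2 :=
          lintegral_prod _ (hmL.pow_const 2).aemeasurable
      _ ≤ ∫⁻ y in cellPar, 4 * ∫⁻ b in Ioi (0 : ℝ), H' (pnt y b) ^ 2 :=
          lintegral_mono fun y => hardy_lintegral (hme.comp (measurable_const.prodMk measurable_id))
      _ = 4 * ∫⁻ y in cellPar, ∫⁻ b in Ioi (0 : ℝ), H' (pnt y b) ^ 2 :=
          lintegral_const_mul _ (Measurable.lintegral_prod_right' (hme.pow_const 2))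
      _ = 4 * ∫⁻ p, H' (pnt p.1 p.2) ^ 2 ∂mYZ := by
          rw [mYZ, lintegral_prod _ (hme.pow_const 2).aemeasurable]
      _ = 4 * ∫⁻ x, H' x ^ 2 ∂mX := by
          rw [← hP.lintegral_comp (hH'.pow_const 2)]
      _ = _ := by
          congr 1
          refine lintegral_congr_ae ?_
          filter_upwards [hHe] with x hx
          simp [hx]
  rw [eLpNorm_two_eq, eLpNorm_two_eq]
  calc _ ≤ (4 * ∫⁻ x, ‖H x‖ₑ ^ 2 ∂mX) ^ (1 / 2 : ℝ) := by gcongr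
    _ = _ := by
      rw [ENNReal.mul_rpow_of_nonneg _ _ (by norm_num)]
      congr 1
      have : (4 : ℝ≥0∞) = 2 ^ (2 : ℝ) := by norm_num
      rw [this, ← ENNReal.rpow_mul]; norm_num

/-! ### Derivatives of parameter integrals -/

section Param

variable {T z ε : ℝ}

/-- The function `g` with the normal variable frozen at `s`. -/
def atZ {E : Type*} (s : ℝ) (g : ℝ → V3 → E) : ℝ → V3 → E := fun t x => g t (pnt (x 0, x 1) s)

lemma slice_atZ {E : Type*} (s : ℝ) (g : ℝ → V3 → E) : slice z (atZ s g) = slice s g := by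
  ext p; simp [slice, atZ]

section
variable {E : Type*} [NormedAddCommGroup E] [NormedSpace ℝ E] {g : ℝ → V3 → E}

lemma dT_atZ (s : ℝ) (g : ℝ → V3 → E) (i : Fin 3) : dT ε i (atZ s g) = atZ s (dT ε i g) := by
  ext t x
  rw [dT_eq_lineDeriv, slice_atZ]
  simp [atZ, dT_eq_lineDeriv]

lemma pMI_atZ (s : ℝ) (g : ℝ → V3 → E) (α : MI) : pMI ε α (atZ s g) = atZ s (pMI ε α g) := by
  have : ∀ i n (g : ℝ → V3 → E), (dT ε i)^[n] (atZ s g) = atZ s ((dT ε i)^[n] g) := by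
    intro i n g
    induction n with
    | zero => rfl
    | succ n ih => rw [Function.iterate_succ_apply', Function.iterate_succ_apply', ih, dT_atZ]
  rw [pMI_eq, pMI_eq, this, this, this]

lemma TSm.atZ {s : ℝ} (hg : TSm T s g) : TSm T z (atZ s g) := by
  unfold TSm; rw [slice_atZ]; exact hg

end

/-- The dual basis of the directions `dirT`. -/
def codirT (ε : ℝ) : Fin 3 → (ℝ × ℝ × ℝ →L[ℝ] ℝ) :=
  ![ε⁻¹ • ContinuousLinearMap.fst ℝ ℝ (ℝ × ℝ),
    (ContinuousLinearMap.fst ℝ ℝ ℝ).comp (ContinuousLinearMap.snd ℝ ℝ (ℝ × ℝ)),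
    (ContinuousLinearMap.snd ℝ ℝ ℝ).comp (ContinuousLinearMap.snd ℝ ℝ (ℝ × ℝ))]

lemma codirT_dirT (hε : ε ≠ 0) (i j : Fin 3) :
    codirT ε i (dirT ε j) = if i = j then 1 else 0 := by
  fin_cases i <;> fin_cases j <;> simp [codirT, dirT, hε]

lemma clm_eq_sum_codirT (hε : ε ≠ 0) (L : ℝ × ℝ × ℝ →L[ℝ] ℝ) :
    L = ∑ i, L (dirT ε i) • codirT ε i := by
  ext
  · simp [Fin.sum_univ_three, codirT, dirT]
    have : ((ε, 0, 0) : ℝ × ℝ × ℝ) = ε • (1, 0) := by ext <;> simp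
    rw [this, map_smul]; simp; field_simp
  · simp [Fin.sum_univ_three, codirT, dirT]
  · simp [Fin.sum_univ_three, codirT, dirT]

variable {Z : Type*} [MeasurableSpace Z] {m : Measure Z}

/-- A family of functions that are smooth on a slice, whose tangential derivatives are measurable
in the parameter and locally dominated by integrable functions. -/
structure DomFam (ε T z : ℝ) (m : Measure Z) (h : Z → ℝ → V3 → ℝ) : Prop where
  smooth : ∀ᵐ ζ ∂m, TSm T z (h ζ)
  meas : ∀ α : MI, ∀ p ∈ tdom T, AEStronglyMeasurable (fun ζ => slice z (pMI ε α (h ζ)) p) m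
  dom : ∀ α : MI, ∀ p ∈ tdom T, ∃ r > 0, ∃ B : Z → ℝ, Integrable B m ∧ ∀ᵐ ζ ∂m, ∀ q ∈ tdom T,
    dist q p < r → |slice z (pMI ε α (h ζ)) q| ≤ B ζ

namespace DomFam

variable {h : Z → ℝ → V3 → ℝ} (H : DomFam ε T z m h)
include H

lemma integrable (α : MI) {p : ℝ × ℝ × ℝ} (hp : p ∈ tdom T) :
    Integrable (fun ζ => slice z (pMI ε α (h ζ)) p) m := by
  obtain ⟨r, hr, B, hB, hb⟩ := H.dom α p hp
  refine hB.mono' (H.meas α p hp) ?_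
  filter_upwards [hb] with ζ hζ
  exact hζ p hp (by simpa using hr)

lemma continuousOn (α : MI) : ContinuousOn (fun p => ∫ ζ, slice z (pMI ε α (h ζ)) p ∂m) (tdom T) := by
  intro p hp
  obtain ⟨r, hr, B, hB, hb⟩ := H.dom α p hp
  have hn := (isOpen_tdom T).mem_nhds hp
  refine ContinuousAt.continuousWithinAt (continuousAt_of_dominated (bound := B) ?_ ?_ hB ?_)
  · filter_upwards [hn] with q hq using H.meas α q hq
  · filter_upwards [hn, Metric.ball_mem_nhds p hr] with q hq hq'
    filter_upwards [hb] with ζ hζ using hζ q hq hq'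
  · filter_upwards [H.smooth] with ζ hζ
    exact (ContDiffOn.continuousOn (hζ.derivMI α)).continuousAt hn

lemma hasFDerivAt (hε : ε ≠ 0) (α : MI) {p : ℝ × ℝ × ℝ} (hp : p ∈ tdom T) :
    HasFDerivAt (fun p => ∫ ζ, slice z (pMI ε α (h ζ)) p ∂m)
      (∑ i, (∫ ζ, slice z (pMI ε (α + Pi.single i 1) (h ζ)) p ∂m) • codirT ε i) p := by
  choose r hr B hB hb using fun i : Fin 3 => H.dom (α + Pi.single i 1) p hp
  have hs : (tdom T ∩ ⋂ i, Metric.ball p (r i)) ∈ nhds p :=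
    Filter.inter_mem ((isOpen_tdom T).mem_nhds hp)
      (Filter.iInter_mem.2 fun i => Metric.ball_mem_nhds p (hr i))
  have hint := fun i => H.integrable (α + Pi.single i 1) hp
  have key := hasFDerivAt_integral_of_dominated_of_fderiv_le (μ := m) (x₀ := p) (𝕜 := ℝ)
    (F := fun p ζ => slice z (pMI ε α (h ζ)) p)
    (F' := fun p ζ => ∑ i, slice z (pMI ε (α + Pi.single i 1) (h ζ)) p • codirT ε i)
    (bound := fun ζ => ∑ i, B i ζ * ‖codirT ε i‖) hs ?_ (H.integrable α hp) ?_ ?_ ?_ ?_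
  · have e1 : ∫ ζ, ∑ i, slice z (pMI ε (α + Pi.single i 1) (h ζ)) p • codirT ε i ∂m
        = ∑ i, (∫ ζ, slice z (pMI ε (α + Pi.single i 1) (h ζ)) p ∂m) • codirT ε i := by
      rw [integral_finsetSum _ fun i _ => (hint i).smul_const (codirT ε i)]
      exact Finset.sum_congr rfl fun i _ => integral_smul_const _ _
    rw [← e1]; exact key
  · filter_upwards [(isOpen_tdom T).mem_nhds hp] with q hq using H.meas α q hq
  · exact (integrable_finsetSum _ fun i _ => (hint i).smul_const (codirT ε i)).aestronglyMeasurable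
  · filter_upwards [ae_all_iff.2 hb] with ζ hζ q hq
    refine (norm_sum_le _ _).trans (Finset.sum_le_sum fun i _ => ?_)
    rw [norm_smul]
    gcongr
    exact hζ i q hq.1 (mem_iInter.1 hq.2 i)
  · exact integrable_finsetSum _ fun i _ => (hB i).mul_const _
  · filter_upwards [H.smooth] with ζ hζ q hq
    have h1 := ((hζ.derivMI (ε := ε) α).differentiableAt hq.1).hasFDerivAt
    rw [clm_eq_sum_codirT hε (fderiv ℝ (slice z (pMI ε α (h ζ))) q)] at h1
    have e1 : ∑ i, slice z (pMI ε (α + Pi.single i 1) (h ζ)) q • codirT ε i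
        = ∑ i, fderiv ℝ (slice z (pMI ε α (h ζ))) q (dirT ε i) • codirT ε i := by
      refine Finset.sum_congr rfl fun i _ => ?_
      rw [(hζ.pMI_add_single' α i).slice_eqOn hq.1, (hζ.derivMI α).slice_dT i hq.1]
    rw [e1]; exact h1

lemma tsm_aux (hε : ε ≠ 0) (n : ℕ) (α : MI) :
    ContDiffOn ℝ n (fun p => ∫ ζ, slice z (pMI ε α (h ζ)) p ∂m) (tdom T) := by
  induction n generalizing α with
  | zero => exact contDiffOn_zero.2 (H.continuousOn α)
  | succ n ih =>
    rw [Nat.cast_succ, contDiffOn_succ_iff_fderiv_of_isOpen (isOpen_tdom T)]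
    refine ⟨fun p hp => (H.hasFDerivAt hε α hp).differentiableAt.differentiableWithinAt,
      by simp, ?_⟩
    refine ContDiffOn.congr ?_ fun p hp => (H.hasFDerivAt hε α hp).fderiv
    exact ContDiffOn.sum fun i _ => (ih (α + Pi.single i 1)).smul contDiffOn_const

lemma tsm (hε : ε ≠ 0) : TSm T z fun t x => ∫ ζ, h ζ t x ∂m :=
  contDiffOn_infty.2 fun n => H.tsm_aux hε n 0

lemma tsm_pMI (hε : ε ≠ 0) (α : MI) : TSm T z fun t x => ∫ ζ, pMI ε α (h ζ) t x ∂m :=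
  contDiffOn_infty.2 fun n => H.tsm_aux hε n α

lemma dT_integral (hε : ε ≠ 0) (α : MI) (i : Fin 3) :
    TEq T z (dT ε i fun t x => ∫ ζ, pMI ε α (h ζ) t x ∂m)
      (fun t x => ∫ ζ, pMI ε (α + Pi.single i 1) (h ζ) t x ∂m) := by
  intro t ht x hx
  subst hx
  have hp := mem_tdom ht (x 0, x 1)
  rw [(H.tsm_pMI hε α).dT_eq ht rfl i]
  have h1 : slice (x 2) (fun t x => ∫ ζ, pMI ε α (h ζ) t x ∂m)
      = fun p => ∫ ζ, slice (x 2) (pMI ε α (h ζ)) p ∂m := rfl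
  have h2 := clm_eq_sum_codirT hε (fderiv ℝ (slice (x 2) (fun t x => ∫ ζ, pMI ε α (h ζ) t x ∂m))
    (t, x 0, x 1))
  rw [h1, (H.hasFDerivAt hε α hp).fderiv]
  simp only [sum_apply, smul_apply, codirT_dirT hε]
  simp [slice, pnt_eta]

/-- Tangential derivatives commute with the integral. -/
lemma pMI_integral (hε : ε ≠ 0) (α : MI) :
    TEq T z (pMI ε α fun t x => ∫ ζ, h ζ t x ∂m) (fun t x => ∫ ζ, pMI ε α (h ζ) t x ∂m) := by
  induction α using MI.induction with
  | h0 => exact TEq.refl _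
  | h1 α i ih =>
    exact ((H.tsm hε).pMI_add_single' α i).trans ((ih.deriv i).trans (H.dT_integral hε α i))

end DomFam

end Param

/-! ### Measurability of the remainder and its derivatives -/

/-- The points `(t, x, ξ)` inside the domain with a non-grazing velocity. -/
def goodSet (T : ℝ) : Set (ℝ × V3 × V3) := {q | q.1 ∈ Ioo 0 T ∧ 0 < q.2.1 2 ∧ q.2.2 2 ≠ 0}

lemma measurableSet_goodSet (T : ℝ) : MeasurableSet (goodSet T) := by
  have h1 : Measurable fun q : ℝ × V3 × V3 => q.2.1 2 := by fun_prop
  have h2 : Measurable fun q : ℝ × V3 × V3 => q.2.2 2 := by fun_prop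
  exact (measurableSet_Ioo.preimage measurable_fst).inter
    ((measurableSet_lt measurable_const h1).inter
      (measurableSet_eq_fun h2 measurable_const).compl)

/-- `h` is measurable on `goodSet T`. -/
def MeasOn (T : ℝ) (h : ℝ → V3 → V3 → ℝ) : Prop :=
  Measurable ((goodSet T).indicator fun q => h q.1 q.2.1 q.2.2)

section

variable {T ε : ℝ} {h k : ℝ → V3 → V3 → ℝ}

lemma MeasOn.congr (H : MeasOn T h) (e : ∀ q ∈ goodSet T, k q.1 q.2.1 q.2.2 = h q.1 q.2.1 q.2.2) :
    MeasOn T k := by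
  unfold MeasOn
  rwa [indicator_congr e]

lemma MeasOn.mul (H : MeasOn T h) (H' : MeasOn T k) : MeasOn T fun t x ξ => h t x ξ * k t x ξ := by
  unfold MeasOn
  rw [indicator_mul]
  exact Measurable.mul H H'

lemma MeasOn.add (H : MeasOn T h) (H' : MeasOn T k) : MeasOn T fun t x ξ => h t x ξ + k t x ξ := by
  unfold MeasOn
  rw [indicator_add]
  exact Measurable.add H H'

lemma MeasOn.sub (H : MeasOn T h) (H' : MeasOn T k) : MeasOn T fun t x ξ => h t x ξ - k t x ξ := by
  unfold MeasOn
  rw [indicator_sub]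
  exact Measurable.sub H H'

lemma MeasOn.of_measurable (H : Measurable fun q : ℝ × V3 × V3 => h q.1 q.2.1 q.2.2) : MeasOn T h :=
  H.indicator (measurableSet_goodSet T)

lemma MeasOn.const (c : ℝ) : MeasOn T fun _ _ _ => c := MeasOn.of_measurable measurable_const

lemma MeasOn.sum {ι : Type*} {s : Finset ι} {h : ι → ℝ → V3 → V3 → ℝ}
    (H : ∀ i ∈ s, MeasOn T (h i)) : MeasOn T fun t x ξ => ∑ i ∈ s, h i t x ξ := by
  classical
  induction s using Finset.induction_on with
  | empty => simpa using MeasOn.const 0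
  | insert a s ha ih =>
    simp only [Finset.sum_insert ha]
    exact (H a (Finset.mem_insert_self a s)).add
      (ih fun i hi => H i (Finset.mem_insert_of_mem hi))

lemma MeasOn.of_continuousOn
    (H : ContinuousOn (fun q : ℝ × V3 × V3 => h q.1 q.2.1 q.2.2) (goodSet T)) : MeasOn T h := by
  classical
  unfold MeasOn
  rw [← piecewise_eq_indicator]
  exact ContinuousOn.measurable_piecewise H continuous_zero.continuousOn (measurableSet_goodSet T)

lemma MeasOn.div (H : MeasOn T h) (H' : MeasOn T k) : MeasOn T fun t x ξ => h t x ξ / k t x ξ := by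
  have : MeasOn T fun t x ξ => (k t x ξ)⁻¹ := by
    have h1 := Measurable.inv H'
    unfold MeasOn
    have e : ((goodSet T).indicator fun q => (k q.1 q.2.1 q.2.2)⁻¹)
        = ((goodSet T).indicator fun q => k q.1 q.2.1 q.2.2)⁻¹ := by
      ext q
      by_cases hq : q ∈ goodSet T <;> simp [hq]
    rw [e]; exact h1
  simpa [div_eq_mul_inv] using H.mul this

lemma MeasOn.aestronglyMeasurable {X : Type*} [MeasurableSpace X] {m : Measure X} (H : MeasOn T h)
    {φ : X → ℝ × V3 × V3} (hφ : Measurable φ) (hm : ∀ᵐ a ∂m, φ a ∈ goodSet T) :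
    AEStronglyMeasurable (fun a => h (φ a).1 (φ a).2.1 (φ a).2.2) m := by
  refine (Measurable.aestronglyMeasurable (Measurable.comp H hφ)).congr ?_
  filter_upwards [hm] with a ha
  simp [ha]

lemma MeasOn.deriv (H : MeasOn T h) (hs : ∀ z, 0 < z → ∀ ξ : V3, ξ 2 ≠ 0 →
    TSm T z fun t x => h t x ξ) (i : Fin 3) :
    MeasOn T fun t x ξ => dT ε i (fun t x => h t x ξ) t x := by
  set h' := (goodSet T).indicator fun q => h q.1 q.2.1 q.2.2 with hh'
  set w := embL (dirT ε i) with hw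
  have hlim : ∀ q ∈ goodSet T, Filter.Tendsto (fun n : ℕ => ((n : ℝ) + 1) *
      (h' (q.1 + ((n : ℝ) + 1)⁻¹ * w.1, q.2.1 + ((n : ℝ) + 1)⁻¹ • w.2, q.2.2) - h' q))
      Filter.atTop (nhds (dT ε i (fun t x => h t x q.2.2) q.1 q.2.1)) := by
    rintro ⟨t, x, ξ⟩ ⟨ht, hx, hξ⟩
    simp only [] at ht hx hξ
    have hT := hs (x 2) hx ξ hξ
    have hd := (hT.differentiableAt (mem_tdom ht (x 0, x 1))).hasFDerivAt.hasLineDerivAt (dirT ε i)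
    rw [← hT.dT_eq ht rfl] at hd
    have h1 := (hasDerivAt_iff_tendsto_slope.1 hd)
    have h2 : Filter.Tendsto (fun n : ℕ => ((n : ℝ) + 1)⁻¹) Filter.atTop (nhdsWithin 0 {0}ᶜ) := by
      refine tendsto_nhdsWithin_iff.2 ⟨?_, Filter.Eventually.of_forall fun n => ?_⟩
      · simpa using tendsto_one_div_add_atTop_nhds_zero_nat (𝕜 := ℝ)
      · have : (0 : ℝ) < (n : ℝ) + 1 := by positivity
        simpa using this.ne'
    have h3 := h1.comp h2
    refine h3.congr' ?_
    have h4 : ∀ᶠ n : ℕ in Filter.atTop, t + ((n : ℝ) + 1)⁻¹ * w.1 ∈ Ioo 0 T := by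
      have hc : Filter.Tendsto (fun r : ℝ => t + r * w.1) (nhds 0) (nhds t) := by
        have : Continuous fun r : ℝ => t + r * w.1 := by fun_prop
        simpa using this.tendsto 0
      exact (hc.comp (tendsto_nhds_of_tendsto_nhdsWithin h2)).eventually
        (isOpen_Ioo.mem_nhds ht)
    filter_upwards [h4] with n hn
    have h5 : ∀ r : ℝ, (x + r • w.2 : V3) = pnt ((x 0, x 1) + r • (dirT ε i).2) (x 2) := by
      intro r
      ext j
      fin_cases i <;> fin_cases j <;> simp [hw, embL, dirT, e, pnt]
    have h6 : ∀ r : ℝ, (x + r • w.2 : V3) 2 = x 2 := by intro r; rw [h5]; simp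
    have e1 : h' (t + ((n : ℝ) + 1)⁻¹ * w.1, x + ((n : ℝ) + 1)⁻¹ • w.2, ξ)
        = h (t + ((n : ℝ) + 1)⁻¹ * w.1) (x + ((n : ℝ) + 1)⁻¹ • w.2) ξ := by
      have : (t + ((n : ℝ) + 1)⁻¹ * w.1, x + ((n : ℝ) + 1)⁻¹ • w.2, ξ) ∈ goodSet T :=
        ⟨hn, by simpa only [h6] using hx, hξ⟩
      rw [hh', indicator_of_mem this]
    have e2 : h' (t, x, ξ) = h t x ξ := by
      have : (t, x, ξ) ∈ goodSet T := ⟨ht, hx, hξ⟩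
      rw [hh', indicator_of_mem this]
    have hw1 : w.1 = (dirT ε i).1 := by simp [hw, embL]
    simp only [Function.comp_def, slope, vsub_eq_sub, sub_zero, inv_inv, smul_eq_mul, e1, e2]
    rw [h5]
    simp [slice, hw1, pnt_eta]
  refine measurable_of_tendsto_metrizable (f := fun n : ℕ => (goodSet T).indicator fun q =>
    ((n : ℝ) + 1) * (h' (q.1 + ((n : ℝ) + 1)⁻¹ * w.1, q.2.1 + ((n : ℝ) + 1)⁻¹ • w.2, q.2.2) - h' q))
    ?_ ?_
  · intro n
    refine Measurable.indicator ?_ (measurableSet_goodSet T)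
    have hm : Measurable h' := H
    have h1 : Measurable fun q : ℝ × V3 × V3 =>
      (q.1 + ((n : ℝ) + 1)⁻¹ * w.1, q.2.1 + ((n : ℝ) + 1)⁻¹ • w.2, q.2.2) := by fun_prop
    exact ((hm.comp h1).sub hm).const_mul _
  · refine tendsto_pi_nhds.2 fun q => ?_
    by_cases hq : q ∈ goodSet T
    · simpa [hq] using hlim q hq
    · simp [hq]

lemma MeasOn.derivMI (H : MeasOn T h) (hs : ∀ z, 0 < z → ∀ ξ : V3, ξ 2 ≠ 0 →
    TSm T z fun t x => h t x ξ) (α : MI) :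
    MeasOn T fun t x ξ => pMI ε α (fun t x => h t x ξ) t x := by
  induction α using MI.induction with
  | h0 => exact H
  | h1 α i ih =>
    refine (ih.deriv (ε := ε) (fun z hz ξ hξ => (hs z hz ξ hξ).derivMI α) i).congr ?_
    rintro ⟨t, x, ξ⟩ ⟨ht, hx, hξ⟩
    exact (hs (x 2) hx ξ hξ).pMI_add_single' α i t ht x rfl

end

lemma ae_normal_ne : ∀ᵐ ξ : V3, ξ 2 ≠ 0 := by
  have h1 : ∀ᵐ p : (ℝ × ℝ) × ℝ, p.2 ≠ 0 :=
    Measure.quasiMeasurePreserving_snd.ae (Measure.ae_ne volume 0)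
  have h2 : Measurable fun ξ : V3 => ξ 2 := by fun_prop
  have hms : MeasurableSet {ξ : V3 | ξ 2 ≠ 0} := (measurableSet_eq_fun h2 measurable_const).compl
  rw [← measurePreserving_pnt.map_eq]
  rw [ae_map_iff measurePreserving_pnt.measurable.aemeasurable hms]
  filter_upwards [h1] with p hp
  simpa using hp

lemma linInv_continuous (g : V3 → ℝ) : Continuous (linInv g) := by
  classical
  unfold linInv
  split_ifs with h
  · exact h.choose_spec.cont
  · exact continuous_zero

lemma continuous_mu0 : Continuous mu0 := by unfold mu0; fun_prop

lemma measOn_of_continuousOn {T : ℝ} {u : ℝ → V3 → ℝ}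
    (hu : ContinuousOn (fun p : ℝ × V3 => u p.1 p.2) (slabO T)) : MeasOn T fun t x _ => u t x :=
  MeasOn.of_continuousOn (hu.comp (f := fun q : ℝ × V3 × V3 => (q.1, q.2.1))
    (by fun_prop) fun q hq => ⟨hq.1, hq.2.1⟩)

lemma continuousOn_px {T : ℝ} (i : Fin 3) {u : ℝ → V3 → ℝ} (hu : SSm T u) :
    ContinuousOn (fun p : ℝ × V3 => px i u p.1 p.2) (slabO T) := by
  have h1 : ContDiffOn ℝ ∞ (fun p : ℝ × V3 => u p.1 p.2) (slabO T) :=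
    ContDiffOn.mono hu (slabO_subset _)
  have h2 := (h1.fderiv_of_isOpen (isOpen_slabO _) (m := ∞) (by simp)).clm_apply
    (contDiffOn_const (c := ((0 : ℝ), e i)))
  exact h2.continuousOn.congr fun p hp => hu.px_eq hp.1 hp.2 i

lemma ae_mXV_good {T : ℝ} {t : ℝ} (ht : t ∈ Ioo 0 T) : ∀ᵐ p ∂mXV, (t, p.1, p.2) ∈ goodSet T := by
  have h1 : ∀ᵐ p ∂mXV, p.2 2 ≠ 0 :=
    (Measure.quasiMeasurePreserving_snd (μ := mX) (ν := (volume : Measure V3))).ae ae_normal_ne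
  filter_upwards [ae_mXV_pos, h1] with p hp hp2
  exact ⟨ht, hp, hp2⟩

lemma aesm_mXV {T : ℝ} {t : ℝ} (ht : t ∈ Ioo 0 T) {g : ℝ → V3 → V3 → ℝ} (hg : MeasOn T g) :
    AEStronglyMeasurable (fun p : V3 × V3 => g t p.1 p.2) mXV :=
  hg.aestronglyMeasurable (φ := fun p : V3 × V3 => (t, p.1, p.2)) (by fun_prop) (ae_mXV_good ht)

lemma aesm_vel {T : ℝ} {t : ℝ} (ht : t ∈ Ioo 0 T) {x : V3} (hx : 0 < x 2) {g : ℝ → V3 → V3 → ℝ}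
    (hg : MeasOn T g) : AEStronglyMeasurable (fun ξ : V3 => g t x ξ) volume := by
  refine hg.aestronglyMeasurable (φ := fun ξ : V3 => (t, x, ξ)) (by fun_prop) ?_
  filter_upwards [ae_normal_ne] with ξ hξ using ⟨ht, hx, hξ⟩

namespace Config

variable {S : Config} {K τU ρ : ℝ}

namespace Admissible

variable (h : S.Admissible K τU ρ)
include h

lemma continuousOn_phi : ContinuousOn (fun q : ℝ × V3 × V3 => S.phi q.1 q.2.1 q.2.2)
    (goodSet S.T) := by
  have h1 : ContinuousOn (fun q : ℝ × V3 × V3 => S.U q.1 q.2.1) (goodSet S.T) :=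
    (ContDiffOn.continuousOn h.smU).comp (f := fun q : ℝ × V3 × V3 => (q.1, q.2.1))
      (by fun_prop) fun q hq => ⟨hq.1, (show (0 : ℝ) < q.2.1 2 from hq.2.1).le⟩
  unfold phi
  fun_prop

lemma measOn_comp_phi {g : V3 → ℝ} (hg : Continuous g) : MeasOn S.T fun t x ξ => g (S.phi t x ξ) :=
  MeasOn.of_continuousOn (hg.comp_continuousOn h.continuousOn_phi)

lemma measOn_sqrtMu : MeasOn S.T fun t x ξ => S.sqrtMu t x ξ :=
  h.measOn_comp_phi (g := fun ξ => √(mu0 ξ)) (by have := continuous_mu0; fun_prop)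

lemma measOn_mu : MeasOn S.T fun t x ξ => S.mu t x ξ := h.measOn_comp_phi continuous_mu0

lemma measOn_f : MeasOn S.T fun t x ξ => S.f t x ξ := by
  have hP := measOn_of_continuousOn ((ContDiffOn.continuousOn h.smP).mono (slabO_subset _))
  have hU : ∀ i j, MeasOn S.T fun t x _ => (px i S.U t x) j := fun i j =>
    (measOn_of_continuousOn (continuousOn_px i (h.smUc j))).congr
      fun q hq => (h.px_Uc hq.1 hq.2.1 i j).symm
  have hA : ∀ i j, MeasOn S.T fun t x ξ => Aij i j (S.phi t x ξ) := fun i j =>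
    h.measOn_comp_phi (linInv_continuous _)
  have hf2 : MeasOn S.T fun t x ξ => S.f2 t x ξ := by
    unfold f2
    exact (hP.mul h.measOn_sqrtMu).sub ((MeasOn.const _).mul
      (MeasOn.sum fun i _ => MeasOn.sum fun j _ => (hU i j).mul (hA i j)))
  unfold f
  exact (((MeasOn.of_measurable h.sol.meas).sub h.measOn_mu).sub
    (((MeasOn.const _).mul hf2).mul h.measOn_sqrtMu)).div ((MeasOn.const _).mul h.measOn_sqrtMu)

lemma tsm_f {z : ℝ} (hz : 0 < z) {ξ : V3} (hξ : ξ 2 ≠ 0) : TSm S.T z fun t x => S.f t x ξ :=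
  h.sol.smooth ξ hξ z hz

lemma measOn_fd (α : MI) : MeasOn S.T fun t x ξ => S.fd α t x ξ :=
  h.measOn_f.derivMI (fun _ hz _ hξ => h.tsm_f hz hξ) α

lemma measOn_dSqrtMu (α : MI) : MeasOn S.T fun t x ξ => S.dSqrtMu α ξ t x :=
  h.measOn_sqrtMu.derivMI (fun _ hz ξ _ => (h.sm_sqrtMu ξ).tsm hz.le) α

end Admissible

end Config

/-! ### Gaussian integrals and moments of the fluid part -/

lemma integrable_exp_neg_sq {a : ℝ} (ha : 0 < a) :
    Integrable fun ξ : V3 => exp (-a * ‖ξ‖ ^ 2) := by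
  have h := (GaussianFourier.integrable_cexp_neg_mul_sq_norm_add (b := (a : ℂ)) (V := V3)
    (by simpa using ha) 0 0).norm
  refine h.congr (Filter.Eventually.of_forall fun ξ => ?_)
  simp [Complex.norm_exp, ← Complex.ofReal_pow]

lemma one_add_pow_mul_exp_le {a : ℝ} (ha : 0 < a) (n : ℕ) (r : ℝ) (hr : 0 ≤ r) :
    (1 + r) ^ n * exp (-a * r ^ 2) ≤ exp (n ^ 2 / (2 * a)) * exp (-(a / 2) * r ^ 2) := by
  have h1 : (1 + r) ^ n ≤ exp (n * r) := by
    rw [Real.exp_nat_mul]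
    exact pow_le_pow_left₀ (by positivity) (by linarith [Real.add_one_le_exp r]) n
  calc (1 + r) ^ n * exp (-a * r ^ 2) ≤ exp (n * r) * exp (-a * r ^ 2) := by gcongr
    _ ≤ _ := by
      rw [← Real.exp_add, ← Real.exp_add, Real.exp_le_exp]
      have : (n : ℝ) ^ 2 / (2 * a) + -(a / 2) * r ^ 2 - (n * r + -a * r ^ 2)
          = (n - a * r) ^ 2 / (2 * a) := by field_simp; ring
      have h2 : 0 ≤ ((n : ℝ) - a * r) ^ 2 / (2 * a) := by positivity
      linarith

lemma integrable_pow_mul_exp {a : ℝ} (ha : 0 < a) (n : ℕ) :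
    Integrable fun ξ : V3 => (1 + ‖ξ‖) ^ n * exp (-a * ‖ξ‖ ^ 2) := by
  refine Integrable.mono' ((integrable_exp_neg_sq (half_pos ha)).const_mul
    (exp (n ^ 2 / (2 * a)))) (by fun_prop) (Filter.Eventually.of_forall fun ξ => ?_)
  rw [Real.norm_of_nonneg (by positivity)]
  exact one_add_pow_mul_exp_le ha n _ (norm_nonneg _)

lemma mu0_eq_sq (ξ : V3) : mu0 ξ = √(mu0 ξ) * √(mu0 ξ) := (Real.mul_self_sqrt (mu0_pos ξ).le).symm

lemma mu0_le (ξ : V3) : mu0 ξ ≤ exp (-(1 / 2) * ‖ξ‖ ^ 2) := by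
  rw [mu0_eq_sq]
  calc √(mu0 ξ) * √(mu0 ξ) ≤ exp (-‖ξ‖ ^ 2 / 4) * exp (-‖ξ‖ ^ 2 / 4) :=
        mul_le_mul (sqrt_mu0_le ξ) (sqrt_mu0_le ξ) (Real.sqrt_nonneg _) (Real.exp_pos _).le
    _ = _ := by rw [← Real.exp_add]; congr 1; ring

lemma integral_mu0 : ∫ ξ, mu0 ξ = 1 := by
  unfold mu0
  rw [integral_const_mul]
  have h := GaussianFourier.integral_rexp_neg_mul_sq_norm (V := V3) (b := 1 / 2) (by norm_num)
  have e : (fun ξ : V3 => exp (-‖ξ‖ ^ 2 / 2)) = fun ξ => exp (-(1 / 2) * ‖ξ‖ ^ 2) := by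
    ext ξ; congr 1; ring
  rw [e, h]
  have : Real.pi / (1 / 2) = 2 * Real.pi := by ring
  rw [this]
  simp only [finrank_euclideanSpace, Fintype.card_fin]
  push_cast
  rw [← Real.rpow_add (by positivity)]
  norm_num

lemma integrable_pow_mul_mu0 (n : ℕ) : Integrable fun ξ : V3 => (1 + ‖ξ‖) ^ n * mu0 ξ := by
  refine (integrable_pow_mul_exp (a := 1 / 2) (by norm_num) n).mono'
    (by have := continuous_mu0; fun_prop) (Filter.Eventually.of_forall fun ξ => ?_)
  rw [Real.norm_of_nonneg (mul_nonneg (by positivity) (mu0_pos ξ).le)]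
  gcongr
  exact mu0_le ξ

/-- A function of polynomial growth is integrable against the Maxwellian. -/
lemma integrable_mul_mu0 {g : V3 → ℝ} (hg : Continuous g) {n : ℕ} {C : ℝ}
    (hb : ∀ ξ, |g ξ| ≤ C * (1 + ‖ξ‖) ^ n) : Integrable fun ξ => g ξ * mu0 ξ := by
  refine ((integrable_pow_mul_mu0 n).const_mul C).mono'
    (by have := continuous_mu0; fun_prop) (Filter.Eventually.of_forall fun ξ => ?_)
  rw [norm_mul, Real.norm_of_nonneg (mu0_pos ξ).le, ← mul_assoc]
  exact mul_le_mul_of_nonneg_right (hb ξ) (mu0_pos ξ).le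

lemma mu0_neg (ξ : V3) : mu0 (-ξ) = mu0 ξ := by simp [mu0]

lemma integral_eq_zero_of_odd {g : V3 → ℝ} (hg : ∀ ξ, g (-ξ) = -g ξ) : ∫ ξ, g ξ = 0 := by
  have h := integral_neg_eq_self g (volume : Measure V3)
  simp only [hg, integral_neg] at h
  linarith

lemma integral_coord_mu0 (k : Fin 3) : ∫ ξ : V3, ξ k * mu0 ξ = 0 :=
  integral_eq_zero_of_odd fun ξ => by simp [mu0_neg]

/-- Where no solution exists `linInv` is zero by definition; the moment identities below hold in both
cases, so that the solvability of `L₀ h = g` is never needed. -/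
lemma isLinInverse_or (g : V3 → ℝ) : linInv g = 0 ∨ IsLinInverse g (linInv g) := by
  classical
  unfold linInv
  split_ifs with h
  · exact Or.inr h.choose_spec
  · exact Or.inl rfl

lemma linInv_memLp (g : V3 → ℝ) : MemLp (linInv g) 2 := by
  rcases isLinInverse_or g with h | h
  · rw [h]; exact MemLp.zero
  · exact h.memLp

lemma linInv_mass (g : V3 → ℝ) : ∫ ξ, linInv g ξ * √(mu0 ξ) = 0 := by
  rcases isLinInverse_or g with h | h
  · simp [h]
  · exact h.orth_mass

lemma linInv_momentum (g : V3 → ℝ) (k : Fin 3) : ∫ ξ, ξ k * (linInv g ξ * √(mu0 ξ)) = 0 := by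
  rcases isLinInverse_or g with h | h
  · simp [h]
  · rw [← h.orth_momentum k]
    congr 1; ext ξ; ring

lemma memLp_pow_mul_sqrt_mu0 (n : ℕ) : MemLp (fun ξ : V3 => (1 + ‖ξ‖) ^ n * √(mu0 ξ)) 2 := by
  have hc : Continuous fun ξ : V3 => (1 + ‖ξ‖) ^ n * √(mu0 ξ) := by
    have := continuous_mu0; fun_prop
  rw [memLp_two_iff_integrable_sq hc.aestronglyMeasurable]
  refine (integrable_pow_mul_mu0 (n * 2)).congr (Filter.Eventually.of_forall fun ξ => ?_)
  simp only [mul_pow, Real.sq_sqrt (mu0_pos ξ).le, pow_mul]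

lemma integrable_linInv (g : V3 → ℝ) :
    Integrable fun ξ => (1 + ‖ξ‖) * (linInv g ξ * √(mu0 ξ)) := by
  have h := (linInv_memLp g).integrable_mul (memLp_pow_mul_sqrt_mu0 1)
  refine h.congr (Filter.Eventually.of_forall fun ξ => ?_)
  simp only [Pi.mul_apply, pow_one]; ring

section Fluid

/-- The fluid part `μ + ε² f₂ √μ` of the density, as a function of the pressure `p`, of the
velocity `u`, and of the velocity gradient `M`. -/
def fluidDens (ε κ p : ℝ) (u : V3) (M : Fin 3 → Fin 3 → ℝ) (ξ : V3) : ℝ :=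
  (1 + ε ^ 2 * p) * mu0 (ξ - ε • u)
    - ε ^ 2 * κ * ∑ i, ∑ j, M i j * (Aij i j (ξ - ε • u) * √(mu0 (ξ - ε • u)))

variable (ε κ p : ℝ) (u : V3) (M : Fin 3 → Fin 3 → ℝ)

lemma fluidDens_shift (ξ : V3) : fluidDens ε κ p u M (ξ + ε • u) = fluidDens ε κ p 0 M ξ := by
  simp [fluidDens]

lemma integrable_one_add_mul_fluidDens_zero :
    Integrable fun ξ => (1 + ‖ξ‖) * fluidDens ε κ p 0 M ξ := by
  have h1 := ((integrable_pow_mul_mu0 1).const_mul (1 + ε ^ 2 * p))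
  have h2 := (integrable_finsetSum Finset.univ fun i _ => integrable_finsetSum Finset.univ
    fun j _ => (integrable_linInv (Ahat i j)).const_mul (M i j)).const_mul (ε ^ 2 * κ)
  refine (h1.sub h2).congr (Filter.Eventually.of_forall fun ξ => ?_)
  simp only [fluidDens, smul_zero, sub_zero, Pi.sub_apply, pow_one]
  simp only [← Finset.mul_sum, mul_left_comm (M _ _) (1 + ‖ξ‖), Aij]
  ring

lemma fluidDens_measurable : Measurable (fluidDens ε κ p u M) := by
  have h1 := continuous_mu0
  have h2 : ∀ i j, Continuous (Aij i j) := fun i j => linInv_continuous _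
  have : Continuous (fluidDens ε κ p u M) := by
    unfold fluidDens
    fun_prop
  exact this.measurable

/-- The total size of the fluid part. -/
def fluidBound (ε κ p : ℝ) (u : V3) (M : Fin 3 → Fin 3 → ℝ) : ℝ :=
  (1 + ‖ε • u‖) * (|1 + ε ^ 2 * p| * ∫ ξ, (1 + ‖ξ‖) * mu0 ξ) + (1 + ‖ε • u‖) * (|ε ^ 2 * κ| *
    ∑ i, ∑ j, |M i j| * ∫ ξ, (1 + ‖ξ‖) * |linInv (Ahat i j) ξ * √(mu0 ξ)|)

lemma one_add_norm_shift_le (ξ v : V3) : 1 + ‖ξ + v‖ ≤ (1 + ‖v‖) * (1 + ‖ξ‖) := by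
  have := norm_add_le ξ v
  nlinarith [norm_nonneg ξ, norm_nonneg v]

lemma integrable_one_add_mul_fluidDens :
    Integrable fun ξ => (1 + ‖ξ‖) * fluidDens ε κ p u M ξ := by
  have h := (integrable_one_add_mul_fluidDens_zero ε κ p M).norm.const_mul (1 + ‖ε • u‖)
  have h2 : Integrable fun ξ => (1 + ‖ξ + ε • u‖) * fluidDens ε κ p 0 M ξ := by
    refine h.mono' ?_ (Filter.Eventually.of_forall fun ξ => ?_)
    · have := fluidDens_measurable ε κ p 0 M
      fun_prop
    · rw [norm_mul, norm_mul, ← mul_assoc, Real.norm_of_nonneg (by positivity : 0 ≤ 1 + ‖ξ‖),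
        Real.norm_of_nonneg (by positivity : 0 ≤ 1 + ‖ξ + ε • u‖)]
      gcongr
      exact one_add_norm_shift_le _ _
  have h3 := h2.comp_sub_right (ε • u)
  refine h3.congr (Filter.Eventually.of_forall fun ξ => ?_)
  simp only [sub_add_cancel]
  rw [← fluidDens_shift ε κ p u, sub_add_cancel]

lemma lintegral_fluidDens_le :
    ∫⁻ ξ, ‖(1 + ‖ξ‖) * fluidDens ε κ p u M ξ‖ₑ ≤ ofReal (fluidBound ε κ p u M) := by
  rw [← ofReal_integral_norm_eq_lintegral_enorm (integrable_one_add_mul_fluidDens ε κ p u M)]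
  apply ENNReal.ofReal_le_ofReal
  have e1 : ∫ ξ, ‖(1 + ‖ξ‖) * fluidDens ε κ p u M ξ‖
      = ∫ ξ, ‖(1 + ‖ξ + ε • u‖) * fluidDens ε κ p 0 M ξ‖ := by
    rw [← integral_add_right_eq_self _ (ε • u)]
    simp only [fluidDens_shift]
  have i1 : Integrable fun ξ : V3 => (1 + ‖ε • u‖) * (|1 + ε ^ 2 * p| * ((1 + ‖ξ‖) * mu0 ξ)) := by
    simpa using ((integrable_pow_mul_mu0 1).const_mul (|1 + ε ^ 2 * p|)).const_mul (1 + ‖ε • u‖)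
  have i3 : ∀ i j, Integrable fun ξ => (1 + ‖ξ‖) * |linInv (Ahat i j) ξ * √(mu0 ξ)| := fun i j => by
    refine (integrable_linInv (Ahat i j)).norm.congr (Filter.Eventually.of_forall fun ξ => ?_)
    simp only [norm_mul, abs_mul, Real.norm_eq_abs]
    rw [abs_of_nonneg (by positivity : 0 ≤ 1 + ‖ξ‖)]
  have i2 : Integrable fun ξ : V3 => (1 + ‖ε • u‖) * (|ε ^ 2 * κ| *
      ∑ i, ∑ j, |M i j| * ((1 + ‖ξ‖) * |linInv (Ahat i j) ξ * √(mu0 ξ)|)) :=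
    ((integrable_finsetSum Finset.univ fun i _ => integrable_finsetSum Finset.univ
      fun j _ => (i3 i j).const_mul (|M i j|)).const_mul _).const_mul _
  have e2 : fluidBound ε κ p u M = ∫ ξ : V3, ((1 + ‖ε • u‖) * (|1 + ε ^ 2 * p| * ((1 + ‖ξ‖) * mu0 ξ))
      + (1 + ‖ε • u‖) * (|ε ^ 2 * κ| *
      ∑ i, ∑ j, |M i j| * ((1 + ‖ξ‖) * |linInv (Ahat i j) ξ * √(mu0 ξ)|))) := by
    rw [integral_add i1 i2]
    simp only [integral_const_mul]
    rw [integral_finsetSum _ fun i _ => integrable_finsetSum Finset.univ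
      fun j _ => (i3 i j).const_mul (|M i j|)]
    simp_rw [integral_finsetSum _ fun j _ => (i3 _ j).const_mul (|M _ j|)]
    simp only [integral_const_mul, fluidBound]
  rw [e1, e2]
  refine integral_mono_of_nonneg (Filter.Eventually.of_forall fun ξ => norm_nonneg _) (i1.add i2)
    (Filter.Eventually.of_forall fun ξ => ?_)
  simp only []
  rw [norm_mul, Real.norm_of_nonneg (by positivity)]
  have h1 : ‖fluidDens ε κ p 0 M ξ‖ ≤ |1 + ε ^ 2 * p| * mu0 ξ + |ε ^ 2 * κ| *
      ∑ i, ∑ j, |M i j| * |linInv (Ahat i j) ξ * √(mu0 ξ)| := by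
    unfold fluidDens
    simp only [smul_zero, sub_zero]
    refine (norm_sub_le _ _).trans (add_le_add ?_ ?_)
    · rw [norm_mul, Real.norm_of_nonneg (mu0_pos ξ).le, Real.norm_eq_abs]
    · rw [norm_mul, Real.norm_eq_abs (ε ^ 2 * κ)]
      gcongr
      refine (norm_sum_le _ _).trans (Finset.sum_le_sum fun i _ => (norm_sum_le _ _).trans
        (Finset.sum_le_sum fun j _ => ?_))
      rw [norm_mul]; rfl
  calc (1 + ‖ξ + ε • u‖) * ‖fluidDens ε κ p 0 M ξ‖
      ≤ ((1 + ‖ε • u‖) * (1 + ‖ξ‖)) * (|1 + ε ^ 2 * p| * mu0 ξ + |ε ^ 2 * κ| *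
      ∑ i, ∑ j, |M i j| * |linInv (Ahat i j) ξ * √(mu0 ξ)|) :=
        mul_le_mul (one_add_norm_shift_le _ _) h1 (norm_nonneg _) (by positivity)
    _ = _ := by
      simp only [← Finset.mul_sum, mul_left_comm _ (1 + ‖ξ‖)]
      ring

lemma integrable_fluidDens : Integrable (fluidDens ε κ p u M) := by
  refine (integrable_one_add_mul_fluidDens ε κ p u M).mono
    (fluidDens_measurable ε κ p u M).aestronglyMeasurable (Filter.Eventually.of_forall fun ξ => ?_)
  rw [norm_mul, Real.norm_of_nonneg (by positivity : 0 ≤ 1 + ‖ξ‖)]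
  nlinarith [norm_nonneg ξ, norm_nonneg (fluidDens ε κ p u M ξ)]

lemma integrable_coord_mul {g : V3 → ℝ} (hm : AEStronglyMeasurable g)
    (hg : Integrable fun ξ => (1 + ‖ξ‖) * g ξ) (k : Fin 3) :
    Integrable fun ξ => ξ k * g ξ := by
  refine hg.mono (by fun_prop) (Filter.Eventually.of_forall fun ξ => ?_)
  rw [norm_mul, norm_mul, Real.norm_of_nonneg (by positivity : 0 ≤ 1 + ‖ξ‖)]
  gcongr
  have := abs_coord_le ξ k
  rw [Real.norm_eq_abs]; linarith

lemma integral_fluidDens_zero : ∫ ξ, fluidDens ε κ p 0 M ξ = 1 + ε ^ 2 * p := by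
  have i3 : ∀ i j, Integrable fun ξ => linInv (Ahat i j) ξ * √(mu0 ξ) := fun i j =>
    (linInv_memLp _).integrable_mul (by simpa using memLp_pow_mul_sqrt_mu0 0)
  have i1 : Integrable mu0 := by simpa using integrable_pow_mul_mu0 0
  unfold fluidDens
  simp only [smul_zero, sub_zero, Aij]
  rw [integral_sub (i1.const_mul _) ((integrable_finsetSum _ fun i _ => integrable_finsetSum _
    fun j _ => (i3 i j).const_mul _).const_mul _), integral_const_mul, integral_const_mul,
    integral_finsetSum _ fun i _ => integrable_finsetSum _ fun j _ => (i3 i j).const_mul _]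
  simp_rw [integral_finsetSum _ fun j _ => (i3 _ j).const_mul (M _ j), integral_const_mul,
    linInv_mass, integral_mu0]
  simp

lemma integral_coord_fluidDens_zero (k : Fin 3) : ∫ ξ : V3, ξ k * fluidDens ε κ p 0 M ξ = 0 := by
  have i3 : ∀ i j, Integrable fun ξ : V3 => ξ k * (linInv (Ahat i j) ξ * √(mu0 ξ)) := fun i j =>
    integrable_coord_mul (((linInv_memLp (Ahat i j)).integrable_mul
      (by simpa using memLp_pow_mul_sqrt_mu0 0)).aestronglyMeasurable) (integrable_linInv _) k
  have i1 : Integrable fun ξ : V3 => ξ k * mu0 ξ :=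
    integrable_coord_mul continuous_mu0.aestronglyMeasurable
      (by simpa using integrable_pow_mul_mu0 1) k
  have e : (fun ξ : V3 => ξ k * fluidDens ε κ p 0 M ξ) = fun ξ => (1 + ε ^ 2 * p) * (ξ k * mu0 ξ)
      - ε ^ 2 * κ * ∑ i, ∑ j, M i j * (ξ k * (linInv (Ahat i j) ξ * √(mu0 ξ))) := by
    ext ξ
    simp only [fluidDens, smul_zero, sub_zero, mul_left_comm (M _ _) (ξ k), ← Finset.mul_sum, Aij]
    ring
  rw [e, integral_sub (i1.const_mul _) ((integrable_finsetSum _ fun i _ => integrable_finsetSum _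
    fun j _ => (i3 i j).const_mul _).const_mul _), integral_const_mul, integral_const_mul,
    integral_finsetSum _ fun i _ => integrable_finsetSum _ fun j _ => (i3 i j).const_mul _]
  simp_rw [integral_finsetSum _ fun j _ => (i3 _ j).const_mul (M _ j), integral_const_mul,
    linInv_momentum, integral_coord_mu0]
  simp

lemma integral_fluidDens : ∫ ξ, fluidDens ε κ p u M ξ = 1 + ε ^ 2 * p := by
  rw [← integral_add_right_eq_self _ (ε • u)]
  simp only [fluidDens_shift]
  exact integral_fluidDens_zero ε κ p M

lemma integral_coord_fluidDens (k : Fin 3) :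
    ∫ ξ : V3, ξ k * fluidDens ε κ p u M ξ = (1 + ε ^ 2 * p) * (ε * u k) := by
  rw [← integral_add_right_eq_self _ (ε • u)]
  simp only [fluidDens_shift, PiLp.add_apply, PiLp.smul_apply, smul_eq_mul, add_mul]
  have i1 := integrable_fluidDens ε κ p 0 M
  have i2 := integrable_coord_mul i1.aestronglyMeasurable
    (integrable_one_add_mul_fluidDens ε κ p 0 M) k
  rw [integral_add i2 (i1.const_mul _), integral_coord_fluidDens_zero, integral_const_mul,
    integral_fluidDens_zero]
  ring

/-- The fluid part depends continuously on its parameters. -/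
lemma tendsto_fluidDens {ι : Type*} {l : Filter ι} {p : ι → ℝ} {u : ι → V3}
    {M : ι → Fin 3 → Fin 3 → ℝ} {p' : ℝ} {u' : V3} {M' : Fin 3 → Fin 3 → ℝ}
    (hp : Filter.Tendsto p l (nhds p')) (hu : Filter.Tendsto u l (nhds u'))
    (hM : ∀ i j, Filter.Tendsto (fun a => M a i j) l (nhds (M' i j))) (ξ : V3) :
    Filter.Tendsto (fun a => fluidDens ε κ (p a) (u a) (M a) ξ) l
      (nhds (fluidDens ε κ p' u' M' ξ)) := by
  have h0 : Filter.Tendsto (fun a => ξ - ε • u a) l (nhds (ξ - ε • u')) :=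
    tendsto_const_nhds.sub (hu.const_smul ε)
  have h1 := (continuous_mu0.tendsto _).comp h0
  have h2 := fun i j => ((linInv_continuous (Ahat i j)).tendsto _).comp h0
  unfold fluidDens Aij
  refine ((tendsto_const_nhds.add (hp.const_mul _)).mul h1).sub
    ((tendsto_finsetSum _ fun i _ => tendsto_finsetSum _ fun j _ => (hM i j).mul
      ((h2 i j).mul ?_)).const_mul _)
  exact ((Real.continuous_sqrt.comp continuous_mu0).tendsto _).comp h0

end Fluid

/-! ### Mass conservation of the collision operator -/

section Collision

/-- The collision `(ξ, ξ_*) ↦ (ξ', ξ_*')` with direction `ω`, as a linear map. -/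
def collMap (w : V3) : V3 × V3 →ₗ[ℝ] V3 × V3 where
  toFun q := (post q.1 q.2 w, postStar q.1 q.2 w)
  map_add' a b := by
    have : (a.1 + b.1) - (a.2 + b.2) = (a.1 - a.2) + (b.1 - b.2) := by abel
    simp only [post, postStar, Prod.fst_add, Prod.snd_add, this, inner_add_left, add_smul]
    ext1 <;> simp only [Prod.fst_add, Prod.snd_add] <;> abel
  map_smul' r a := by
    simp only [post, postStar, Prod.smul_fst, Prod.smul_snd, ← smul_sub, real_inner_smul_left,
      RingHom.id_apply, mul_smul]
    ext1 <;> simp [smul_sub, smul_add]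

lemma inner_post {w : V3} (hw : ‖w‖ = 1) (ξ ξs : V3) :
    inner ℝ (post ξ ξs w - postStar ξ ξs w) w = -inner ℝ (ξ - ξs) w := by
  have h : post ξ ξs w - postStar ξ ξs w = (ξ - ξs) - (2 * inner ℝ (ξ - ξs) w) • w := by
    rw [post, postStar, two_mul, add_smul]; abel
  rw [h, inner_sub_left, real_inner_smul_left, real_inner_self_eq_norm_sq, hw]
  ring

lemma collMap_invol {w : V3} (hw : ‖w‖ = 1) (q : V3 × V3) : collMap w (collMap w q) = q := by
  have h := inner_post hw q.1 q.2
  have h1 : collMap w (collMap w q) = (post q.1 q.2 w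
      - inner ℝ (post q.1 q.2 w - postStar q.1 q.2 w) w • w, postStar q.1 q.2 w
      + inner ℝ (post q.1 q.2 w - postStar q.1 q.2 w) w • w) := rfl
  rw [h1, h]
  ext1 <;> simp [post, postStar]

lemma map_collMap {w : V3} (hw : ‖w‖ = 1) :
    Measure.map (collMap w) ((volume : Measure V3).prod volume) = (volume : Measure V3).prod volume := by
  have hc : (collMap w).comp (collMap w) = LinearMap.id := LinearMap.ext fun q => collMap_invol hw q
  have hd : LinearMap.det (collMap w) * LinearMap.det (collMap w) = 1 := by
    rw [← LinearMap.det_comp, hc, LinearMap.det_id]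
  have h0 : LinearMap.det (collMap w) ≠ 0 := fun h => by simp [h] at hd
  rw [Measure.map_linearMap_addHaar_eq_smul_addHaar _ h0]
  have : |(LinearMap.det (collMap w))⁻¹| = 1 := by
    rcases mul_self_eq_one_iff.1 hd with h | h <;> simp [h]
  simp [this]

/-- The measure `dξ dξ_* dω`. -/
def mTriple : Measure (V3 × V3 × S2) := (volume : Measure V3).prod mColl

instance : SFinite mColl := by unfold mColl; exact Measure.prod.instSFinite

instance : SFinite mTriple := by unfold mTriple; exact Measure.prod.instSFinite

/-- Collisions preserve the measure `dξ dξ_* dω`. -/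
lemma measurePreserving_coll : MeasurePreserving
    (fun q : V3 × V3 × S2 => (post q.1 q.2.1 q.2.2, postStar q.1 q.2.1 q.2.2, q.2.2))
    mTriple mTriple := by
  have hA : MeasurePreserving (fun q : V3 × V3 × S2 => (q.2.2, (q.1, q.2.1))) mTriple
      (((volume : Measure V3).toSphere).prod ((volume : Measure V3).prod volume)) := by
    have h1 := (measurePreserving_prodAssoc (volume : Measure V3) (volume : Measure V3)
      (volume : Measure V3).toSphere).symm
    exact (Measure.measurePreserving_swap (μ := (volume : Measure V3).prod volume)
      (ν := (volume : Measure V3).toSphere)).comp h1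
  have hA' : MeasurePreserving (fun q : S2 × (V3 × V3) => (q.2.1, q.2.2, q.1))
      (((volume : Measure V3).toSphere).prod ((volume : Measure V3).prod volume)) mTriple := by
    have h1 := (measurePreserving_prodAssoc (volume : Measure V3) (volume : Measure V3)
      (volume : Measure V3).toSphere)
    exact h1.comp (Measure.measurePreserving_swap (μ := (volume : Measure V3).toSphere)
      (ν := (volume : Measure V3).prod volume))
  have hB : MeasurePreserving (fun q : S2 × (V3 × V3) => (q.1, collMap q.1 q.2))
      (((volume : Measure V3).toSphere).prod ((volume : Measure V3).prod volume))
      (((volume : Measure V3).toSphere).prod ((volume : Measure V3).prod volume)) := by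
    refine (MeasurePreserving.id _).skew_product (g := fun (w : S2) q => collMap (w : V3) q) ?_
      (Filter.Eventually.of_forall fun w => map_collMap (norm_eq_of_mem_sphere w))
    have : Continuous fun q : S2 × (V3 × V3) =>
      (post q.2.1 q.2.2 q.1, postStar q.2.1 q.2.2 q.1) := by
      unfold post postStar; fun_prop
    exact this.measurable
  exact (hA'.comp hB).comp hA

variable {H : V3 → ℝ}

/-- The loss density `|(ξ - ξ_*)·ω| H(ξ) H(ξ_*)`. -/
def lossDens (H : V3 → ℝ) (q : V3 × V3 × S2) : ℝ :=
  |inner ℝ (q.1 - q.2.1) (q.2.2 : V3)| * (H q.1 * H q.2.1)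

/-- The gain density `|(ξ - ξ_*)·ω| H(ξ') H(ξ_*')`. -/
def gainDens (H : V3 → ℝ) (q : V3 × V3 × S2) : ℝ :=
  lossDens H (post q.1 q.2.1 q.2.2, postStar q.1 q.2.1 q.2.2, q.2.2)

lemma lossDens_le (q : V3 × V3 × S2) :
    ‖lossDens H q‖ₑ ≤ ‖(1 + ‖q.1‖) * H q.1‖ₑ * ‖(1 + ‖q.2.1‖) * H q.2.1‖ₑ := by
  rw [← enorm_mul, enorm_le_iff_norm_le]
  have h1 : |inner ℝ (q.1 - q.2.1) (q.2.2 : V3)| ≤ (1 + ‖q.1‖) * (1 + ‖q.2.1‖) := by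
    refine (abs_real_inner_le_norm _ _).trans ?_
    have : ‖(q.2.2 : V3)‖ = 1 := by simp
    rw [this, mul_one]
    have := norm_sub_le q.1 q.2.1
    nlinarith [norm_nonneg q.1, norm_nonneg q.2.1]
  rw [lossDens, norm_mul, norm_mul, norm_mul, norm_mul, norm_mul,
    Real.norm_of_nonneg (abs_nonneg _), Real.norm_of_nonneg (by positivity : 0 ≤ 1 + ‖q.1‖),
    Real.norm_of_nonneg (by positivity : 0 ≤ 1 + ‖q.2.1‖)]
  calc _ ≤ ((1 + ‖q.1‖) * (1 + ‖q.2.1‖)) * (‖H q.1‖ * ‖H q.2.1‖) := by gcongr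
    _ = _ := by ring

/-- The total mass of the sphere of directions. -/
def sphMass : ℝ≥0∞ := (volume : Measure V3).toSphere univ

lemma sphMass_lt_top : sphMass < ⊤ := measure_lt_top _ _

lemma measurable_lossDens (hH : Measurable H) : Measurable (lossDens H) := by
  unfold lossDens
  have h1 : Measurable fun q : V3 × V3 × S2 => |inner ℝ (q.1 - q.2.1) (q.2.2 : V3)| := by
    have : Continuous fun q : V3 × V3 × S2 => |inner ℝ (q.1 - q.2.1) (q.2.2 : V3)| := by fun_prop
    exact this.measurable
  fun_prop

lemma lintegral_lossDens_le (hH : Measurable H) : ∫⁻ q, ‖lossDens H q‖ₑ ∂mTriple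
    ≤ sphMass * (∫⁻ ξ, ‖(1 + ‖ξ‖) * H ξ‖ₑ) ^ 2 := by
  have hm : Measurable fun ξ : V3 => ‖(1 + ‖ξ‖) * H ξ‖ₑ := by fun_prop
  refine (lintegral_mono lossDens_le).trans (le_of_eq ?_)
  have h1 : ∫⁻ p : V3 × S2, ‖(1 + ‖p.1‖) * H p.1‖ₑ ∂mColl
      = (∫⁻ ξ, ‖(1 + ‖ξ‖) * H ξ‖ₑ) * sphMass := by
    unfold mColl
    rw [lintegral_prod (fun p : V3 × S2 => ‖(1 + ‖p.1‖) * H p.1‖ₑ)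
      (hm.comp measurable_fst).aemeasurable]
    simp only [lintegral_const]
    rw [lintegral_mul_const _ hm, sphMass]
  unfold mTriple
  rw [lintegral_prod_mul hm.aemeasurable (g := fun p : V3 × S2 => ‖(1 + ‖p.1‖) * H p.1‖ₑ)
    (hm.comp measurable_fst).aemeasurable, h1]
  ring

variable (hH : Measurable H) (hi : ∫⁻ ξ, ‖(1 + ‖ξ‖) * H ξ‖ₑ < ⊤)
include hH hi

lemma integrable_lossDens : Integrable (lossDens H) mTriple :=
  ⟨(measurable_lossDens hH).aestronglyMeasurable, (lintegral_lossDens_le hH).trans_lt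
    (ENNReal.mul_lt_top sphMass_lt_top (ENNReal.pow_lt_top hi))⟩

omit hi in
lemma collQ_eq (ξ : V3) : collQ H H ξ = ∫ p, (gainDens H (ξ, p) - lossDens H (ξ, p)) ∂mColl := by
  unfold collQ
  rw [← integral_const_mul]
  congr 1; ext p
  have : |inner ℝ (post ξ p.1 p.2 - postStar ξ p.1 p.2) (p.2 : V3)|
      = |inner ℝ (ξ - p.1) (p.2 : V3)| := by
    rw [inner_post (by simp), abs_neg]
  simp only [gainDens, lossDens, this]
  ring

lemma integrable_gainLoss : Integrable (fun q => gainDens H q - lossDens H q) mTriple := by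
  have h := integrable_lossDens hH hi
  exact ((measurePreserving_coll.integrable_comp h.aestronglyMeasurable).2 h).sub h

/-- Collisions conserve mass. -/
lemma integral_collQ : ∫ ξ, collQ H H ξ = 0 := by
  have h := integrable_gainLoss hH hi
  have h0 := integrable_lossDens hH hi
  have h1 : Integrable (gainDens H) mTriple :=
    (measurePreserving_coll.integrable_comp h0.aestronglyMeasurable).2 h0
  have h3 : ∫ q, gainDens H q ∂mTriple = ∫ q, lossDens H q ∂mTriple := by
    have := integral_map (μ := mTriple) (f := lossDens H)
      measurePreserving_coll.measurable.aemeasurable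
      (by rw [measurePreserving_coll.map_eq]; exact h0.aestronglyMeasurable)
    rw [measurePreserving_coll.map_eq] at this
    exact this.symm
  have h2 : ∫ q, (gainDens H q - lossDens H q) ∂mTriple = ∫ ξ, collQ H H ξ := by
    simp_rw [collQ_eq hH]
    exact integral_prod _ h
  rw [← h2, integral_sub h1 h0, h3, sub_self]

omit hi in
lemma lintegral_collQ_le : ∫⁻ ξ, ‖collQ H H ξ‖ₑ
    ≤ 2 * (sphMass * (∫⁻ ξ, ‖(1 + ‖ξ‖) * H ξ‖ₑ) ^ 2) := by
  have hm := measurable_lossDens hH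
  have hm2 : Measurable fun q : V3 × V3 × S2 => gainDens H q :=
    hm.comp measurePreserving_coll.measurable
  calc ∫⁻ ξ, ‖collQ H H ξ‖ₑ ≤ ∫⁻ ξ, ∫⁻ p, ‖gainDens H (ξ, p) - lossDens H (ξ, p)‖ₑ ∂mColl := by
        refine lintegral_mono fun ξ => ?_
        simp only []
        rw [collQ_eq hH]
        exact enorm_integral_le_lintegral_enorm _
    _ = ∫⁻ q, ‖gainDens H q - lossDens H q‖ₑ ∂mTriple :=
        (lintegral_prod (fun q : V3 × V3 × S2 => ‖gainDens H q - lossDens H q‖ₑ)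
          (hm2.sub hm).enorm.aemeasurable).symm
    _ ≤ ∫⁻ q, (‖gainDens H q‖ₑ + ‖lossDens H q‖ₑ) ∂mTriple :=
        lintegral_mono fun q => enorm_sub_le
    _ = 2 * ∫⁻ q, ‖lossDens H q‖ₑ ∂mTriple := by
        have e := measurePreserving_coll.lintegral_comp (f := fun q => ‖lossDens H q‖ₑ) hm.enorm
        rw [lintegral_add_right _ hm.enorm, two_mul]
        exact congrArg (· + _) e
    _ ≤ _ := by gcongr; exact lintegral_lossDens_le hH

end Collision

/-! ### Integrals along the normal direction -/

section Normal

variable {T ε : ℝ} {g h : ℝ → V3 → ℝ}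

/-- `g` is measurable on `(0, T) × {x₃ > 0}`. -/
def MeasX (T : ℝ) (g : ℝ → V3 → ℝ) : Prop := Measurable ((slabO T).indicator fun q => g q.1 q.2)

lemma measurableSet_slabO (T : ℝ) : MeasurableSet (slabO T) := (isOpen_slabO T).measurableSet

lemma MeasX.congr (H : MeasX T g) (e : ∀ q ∈ slabO T, h q.1 q.2 = g q.1 q.2) : MeasX T h := by
  unfold MeasX
  rwa [indicator_congr e]

lemma MeasX.add (H : MeasX T g) (H' : MeasX T h) : MeasX T fun t x => g t x + h t x := by
  unfold MeasX
  rw [indicator_add]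
  exact Measurable.add H H'

lemma MeasX.const_mul (H : MeasX T g) (c : ℝ) : MeasX T fun t x => c * g t x := by
  unfold MeasX
  have : ((slabO T).indicator fun q => c * g q.1 q.2)
      = fun q => c * (slabO T).indicator (fun q => g q.1 q.2) q := by
    ext q; by_cases hq : q ∈ slabO T <;> simp [hq]
  rw [this]
  exact Measurable.const_mul H c

lemma MeasX.of_continuousOn (H : ContinuousOn (fun q : ℝ × V3 => g q.1 q.2) (slabO T)) :
    MeasX T g := by
  classical
  unfold MeasX
  rw [← piecewise_eq_indicator]
  exact ContinuousOn.measurable_piecewise H continuous_zero.continuousOn (measurableSet_slabO T)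

lemma MeasX.aestronglyMeasurable {X : Type*} [MeasurableSpace X] {m : Measure X} (H : MeasX T g)
    {φ : X → ℝ × V3} (hφ : Measurable φ) (hm : ∀ᵐ a ∂m, φ a ∈ slabO T) :
    AEStronglyMeasurable (fun a => g (φ a).1 (φ a).2) m := by
  refine (Measurable.aestronglyMeasurable (Measurable.comp H hφ)).congr ?_
  filter_upwards [hm] with a ha
  simp [ha]

/-- Velocity averages of measurable functions are measurable. -/
lemma MeasOn.integral {k : ℝ → V3 → V3 → ℝ} (H : MeasOn T k) :
    MeasX T fun t x => ∫ ξ, k t x ξ := by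
  have h1 : StronglyMeasurable fun q : ℝ × V3 => ∫ ξ : V3,
      (goodSet T).indicator (fun q => k q.1 q.2.1 q.2.2) (q.1, q.2, ξ) := by
    apply StronglyMeasurable.integral_prod_right
    refine Measurable.stronglyMeasurable ?_
    exact Measurable.comp H (f := fun p : (ℝ × V3) × V3 => (p.1.1, p.1.2, p.2)) (by fun_prop)
  have h2 := Measurable.indicator h1.measurable (measurableSet_slabO T)
  unfold MeasX
  rw [indicator_congr (g := fun q : ℝ × V3 => ∫ ξ : V3,
      (goodSet T).indicator (fun q => k q.1 q.2.1 q.2.2) (q.1, q.2, ξ))]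
  · exact h2
  · rintro ⟨t, x⟩ ⟨ht, hx⟩
    refine integral_congr_ae ?_
    filter_upwards [ae_normal_ne] with ξ hξ
    have : (t, x, ξ) ∈ goodSet T := ⟨ht, hx, hξ⟩
    rw [indicator_of_mem this]

/-- Functions on `(0, T) × {x₃ > 0}`, smooth in the tangential variables, all of whose tangential
derivatives are measurable and bounded up to `x₃ = 0`, locally uniformly in the tangential
variables. -/
structure TBdd (ε T : ℝ) (G : ℝ → V3 → ℝ) : Prop where
  smooth : ∀ s, 0 < s → TSm T s G
  meas : ∀ α, MeasX T (pMI ε α G)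
  bdd : ∀ α, ∀ b : ℝ, ∀ p ∈ tdom T, ∃ r > 0, ∃ B : ℝ, ∀ q ∈ tdom T, dist q p < r →
    ∀ s ∈ Ioc 0 b, |slice s (pMI ε α G) q| ≤ B

namespace TBdd

lemma congr (H : TBdd ε T g) (e : ∀ s, 0 < s → TEq T s h g) : TBdd ε T h where
  smooth s hs := (H.smooth s hs).congr (e s hs)
  meas α := (H.meas α).congr fun q hq => (e (q.2 2) hq.2).derivMI α q.1 hq.1 q.2 rfl
  bdd α b p hp := by
    obtain ⟨r, hr, B, hB⟩ := H.bdd α b p hp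
    refine ⟨r, hr, B, fun q hq hqp s hs => ?_⟩
    rw [((e s hs.1).derivMI α).slice_eqOn hq]
    exact hB q hq hqp s hs

lemma add (H : TBdd ε T g) (H' : TBdd ε T h) : TBdd ε T fun t x => g t x + h t x where
  smooth s hs := (H.smooth s hs).add (H'.smooth s hs)
  meas α := ((H.meas α).add (H'.meas α)).congr fun q hq =>
    (H.smooth (q.2 2) hq.2).pMI_add (H'.smooth _ hq.2) α q.1 hq.1 q.2 rfl
  bdd α b p hp := by
    obtain ⟨r, hr, B, hB⟩ := H.bdd α b p hp
    obtain ⟨r', hr', B', hB'⟩ := H'.bdd α b p hp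
    refine ⟨min r r', lt_min hr hr', B + B', fun q hq hqp s hs => ?_⟩
    rw [((H.smooth s hs.1).pMI_add (H'.smooth s hs.1) α).slice_eqOn hq]
    exact (abs_add_le _ _).trans (add_le_add (hB q hq (hqp.trans_le (min_le_left _ _)) s hs)
      (hB' q hq (hqp.trans_le (min_le_right _ _)) s hs))

lemma const_mul (H : TBdd ε T g) (c : ℝ) : TBdd ε T fun t x => c * g t x where
  smooth s hs := (H.smooth s hs).clm (c • ContinuousLinearMap.id ℝ ℝ)
  meas α := ((H.meas α).const_mul c).congr fun q hq =>
    (H.smooth (q.2 2) hq.2).pMI_const_mul c α q.1 hq.1 q.2 rfl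
  bdd α b p hp := by
    obtain ⟨r, hr, B, hB⟩ := H.bdd α b p hp
    refine ⟨r, hr, |c| * B, fun q hq hqp s hs => ?_⟩
    rw [((H.smooth s hs.1).pMI_const_mul c α).slice_eqOn hq]
    simp only [slice, abs_mul]
    gcongr
    exact hB q hq hqp s hs

lemma sum {ι : Type*} {s : Finset ι} {g : ι → ℝ → V3 → ℝ} (H : ∀ i ∈ s, TBdd ε T (g i)) :
    TBdd ε T fun t x => ∑ i ∈ s, g i t x := by
  classical
  induction s using Finset.induction_on with
  | empty =>
    simp only [Finset.sum_empty]
    refine ⟨fun s _ => TSm.const 0, fun α => ?_, fun α b p _ => ⟨1, one_pos, 0, fun q _ _ s _ => ?_⟩⟩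
    · rw [pMI_zero_fun]; exact MeasX.of_continuousOn continuousOn_const
    · rw [pMI_zero_fun]; simp [slice]
  | insert a s ha ih =>
    simp only [Finset.sum_insert ha]
    exact (H a (Finset.mem_insert_self a s)).add
      (ih fun i hi => H i (Finset.mem_insert_of_mem hi))

lemma deriv (H : TBdd ε T g) (i : Fin 3) : TBdd ε T (dT ε i g) where
  smooth s hs := (H.smooth s hs).deriv i
  meas α := (H.meas (α + Pi.single i 1)).congr fun q hq =>
    ((H.smooth (q.2 2) hq.2).pMI_add_single α i q.1 hq.1 q.2 rfl).symm
  bdd α b p hp := by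
    obtain ⟨r, hr, B, hB⟩ := H.bdd (α + Pi.single i 1) b p hp
    refine ⟨r, hr, B, fun q hq hqp s hs => ?_⟩
    rw [← ((H.smooth s hs.1).pMI_add_single α i).slice_eqOn hq]
    exact hB q hq hqp s hs

lemma derivMI (H : TBdd ε T g) (α : MI) : TBdd ε T (pMI ε α g) := by
  induction α using MI.induction with
  | h0 => exact H
  | h1 α i ih => exact (ih.deriv i).congr fun s hs => (H.smooth s hs).pMI_add_single' α i

/-- Functions smooth up to the boundary. -/
lemma of_ssm (H : SSm T g) : TBdd ε T g where
  smooth s hs := H.tsm hs.le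
  meas α := MeasX.of_continuousOn ((ContDiffOn.continuousOn (H.derivMI α)).mono (slabO_subset T))
  bdd α b p hp := by
    obtain ⟨r, hr, hball⟩ := Metric.nhds_basis_closedBall.mem_iff.1 ((isOpen_tdom T).mem_nhds hp)
    have hK : IsCompact (Metric.closedBall p r ×ˢ Icc (0 : ℝ) b) :=
      (isCompact_closedBall p r).prod isCompact_Icc
    have hc : ContinuousOn (fun a : (ℝ × ℝ × ℝ) × ℝ => slice a.2 (pMI ε α g) a.1)
        (Metric.closedBall p r ×ˢ Icc (0 : ℝ) b) := by
      refine (ContDiffOn.continuousOn (H.derivMI (ε := ε) α)).comp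
        (f := fun a : (ℝ × ℝ × ℝ) × ℝ => (a.1.1, pnt a.1.2 a.2)) ?_ ?_
      · exact ((continuous_fst.comp continuous_fst).prodMk (continuous_pnt.comp
          ((continuous_snd.comp continuous_fst).prodMk continuous_snd))).continuousOn
      · rintro ⟨q, s⟩ ⟨hq, hs⟩
        exact ⟨(hball hq).1, by simpa using hs.1⟩
    obtain ⟨B, hB⟩ := hK.exists_bound_of_continuousOn hc
    exact ⟨r, hr, B, fun q _ hqp s hs => hB (q, s) ⟨hqp.le, hs.1.le, hs.2⟩⟩

lemma px_two (H : SSm T g) : TBdd ε T (px 2 g) :=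
  (of_ssm H.dN).congr fun _ hs => H.teq_px_two hs

variable (H : TBdd ε T g)
include H

lemma domFam (z b : ℝ) {a : ℝ} (ha : 0 ≤ a) :
    DomFam ε T z (volume.restrict (Ioc a b)) (fun s => atZ s g) where
  smooth := by
    filter_upwards [ae_restrict_mem measurableSet_Ioc] with s hs
    exact (H.smooth s (ha.trans_lt hs.1)).atZ
  meas α p hp := by
    simp only [pMI_atZ, slice]
    refine (H.meas α).aestronglyMeasurable (φ := fun s : ℝ => (p.1, pnt p.2 s)) ?_ ?_
    · exact (continuous_const.prodMk (continuous_pnt.comp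
        (continuous_const.prodMk continuous_id))).measurable
    · filter_upwards [ae_restrict_mem measurableSet_Ioc] with s hs
      exact ⟨hp.1, by simpa using ha.trans_lt hs.1⟩
  dom α p hp := by
    obtain ⟨r, hr, B, hB⟩ := H.bdd α b p hp
    refine ⟨r, hr, fun _ => B, integrable_const B, ?_⟩
    filter_upwards [ae_restrict_mem measurableSet_Ioc] with s hs q hq hqp
    rw [pMI_atZ, slice_atZ]
    exact hB q hq hqp s ⟨ha.trans_lt hs.1, hs.2⟩

/-- Tangential derivatives pass under the integral along the normal. -/
lemma pMI_integral (hε : ε ≠ 0) (z b : ℝ) {a : ℝ} (ha : 0 ≤ a) (α : MI) :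
    TEq T z (pMI ε α fun t x => ∫ s in Ioc a b, g t (pnt (x 0, x 1) s))
      (fun t x => ∫ s in Ioc a b, pMI ε α g t (pnt (x 0, x 1) s)) := by
  have h1 := (H.domFam z b ha).pMI_integral hε α
  simp only [pMI_atZ] at h1
  exact h1

lemma integrable_normal {t : ℝ} (ht : t ∈ Ioo 0 T) (y : ℝ × ℝ) (b : ℝ) :
    IntegrableOn (fun s => g t (pnt y s)) (Ioc 0 b) := by
  have h1 := (H.domFam 0 b le_rfl).integrable 0 (mem_tdom ht y)
  simp only [pMI_atZ, slice] at h1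
  exact h1

lemma tsm_integral (hε : ε ≠ 0) (z b : ℝ) {a : ℝ} (ha : 0 ≤ a) :
    TSm T z fun t x => ∫ s in Ioc a b, g t (pnt (x 0, x 1) s) := (H.domFam z b ha).tsm hε

end TBdd

end Normal

/-! ### Velocity averages of the remainder -/

namespace Config

variable {S : Config} {K τU ρ : ℝ}

variable (S) in
/-- `f √μ`. -/
def fs (ξ : V3) (t : ℝ) (x : V3) : ℝ := S.f t x ξ * S.sqrtMu t x ξ

variable (S) in
/-- The velocity average `∫ w f √μ dξ`. -/
def avg (w : V3 → ℝ) (t : ℝ) (x : V3) : ℝ := ∫ ξ, w ξ * S.fs ξ t x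

namespace Admissible

variable (h : S.Admissible K τU ρ)
include h

lemma tsm_sqrtMu (ξ : V3) {z : ℝ} (hz : 0 ≤ z) : TSm S.T z fun t x => S.sqrtMu t x ξ :=
  (h.sm_sqrtMu ξ).tsm hz

lemma tsm_fs {z : ℝ} (hz : 0 < z) {ξ : V3} (hξ : ξ 2 ≠ 0) : TSm S.T z (S.fs ξ) :=
  (h.tsm_f hz hξ).mul (h.tsm_sqrtMu ξ hz.le)

lemma measOn_fs : MeasOn S.T fun t x ξ => S.fs ξ t x := h.measOn_f.mul h.measOn_sqrtMu

/-- Leibniz' rule for `f √μ`. -/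
lemma D_fs (α : MI) {t : ℝ} (ht : t ∈ Ioo 0 S.T) {x ξ : V3} (hx : 0 < x 2) (hξ : ξ 2 ≠ 0) :
    S.D α (S.fs ξ) t x = ∑ γ ∈ Finset.Iic α, (α.binom γ : ℝ) *
      (S.fd (α - γ) t x ξ * S.dSqrtMu γ ξ t x) :=
  (h.tsm_f hx hξ).pMI_mul (h.tsm_sqrtMu ξ hx.le) α ht rfl

lemma exists_abs_D_fs_le (hε : S.ε ≤ 1) (α : MI) : ∃ M : ℝ, 0 ≤ M ∧ ∀ t ∈ Ioo 0 S.T, ∀ x ξ : V3,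
    0 < x 2 → ξ 2 ≠ 0 → |S.D α (S.fs ξ) t x| ≤ M * exp (-ρ * ‖ξ‖ ^ 2) := by
  choose M hM using h.sol.decay
  obtain ⟨W, hW, hWb⟩ := wgt_le_exp K (c := 0) (by norm_num)
  have hs := h.radius_pos
  refine ⟨∑ γ ∈ Finset.Iic α, (α.binom γ : ℝ) * (|M (α - γ)| * (γ.fact / (3 / 4 * τU) ^ γ.deg * W)),
    Finset.sum_nonneg fun γ _ => by positivity, fun t ht x ξ hx hξ => ?_⟩
  rw [h.D_fs α ht hx hξ, Finset.sum_mul]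
  refine (Finset.abs_sum_le_sum_abs _ _).trans (Finset.sum_le_sum fun γ _ => ?_)
  rw [abs_mul, abs_mul, Nat.abs_cast, mul_assoc]
  refine mul_le_mul_of_nonneg_left ?_ (Nat.cast_nonneg _)
  calc |S.fd (α - γ) t x ξ| * |S.dSqrtMu γ ξ t x|
      ≤ (|M (α - γ)| * exp (-ρ * ‖ξ‖ ^ 2)) * (γ.fact / (3 / 4 * τU) ^ γ.deg * W) := by
        gcongr
        · exact (hM (α - γ) t ht x ξ hx hξ).trans (by gcongr; exact le_abs_self _)
        · refine (h.abs_D_sqrtMu_le ht hx hε γ ξ).trans ?_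
          gcongr
          simpa using hWb ξ
    _ = _ := by ring

variable {w : V3 → ℝ} (hw : Continuous w) (hwb : ∀ ξ, |w ξ| ≤ 1 + ‖ξ‖) (hε : S.ε ≤ 1) (hρ : 0 < ρ)

lemma tsm_wfs (w : V3 → ℝ) {z : ℝ} (hz : 0 < z) {ξ : V3} (hξ : ξ 2 ≠ 0) :
    TSm S.T z fun t x => w ξ * S.fs ξ t x :=
  (h.tsm_fs hz hξ).clm (w ξ • ContinuousLinearMap.id ℝ ℝ)

lemma D_wfs (w : V3 → ℝ) (α : MI) {t : ℝ} (ht : t ∈ Ioo 0 S.T) {x ξ : V3} (hx : 0 < x 2)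
    (hξ : ξ 2 ≠ 0) : S.D α (fun t x => w ξ * S.fs ξ t x) t x = w ξ * S.D α (S.fs ξ) t x :=
  (h.tsm_fs hx hξ).pMI_const_mul (w ξ) α t ht x rfl

include hw in
lemma measOn_wfs : MeasOn S.T fun t x ξ => w ξ * S.fs ξ t x := by
  refine MeasOn.mul (MeasOn.of_measurable ?_) h.measOn_fs
  have := hw.measurable
  fun_prop

include hw hwb hε hρ

lemma domFam_wfs {z : ℝ} (hz : 0 < z) :
    DomFam S.ε S.T z volume fun ξ t x => w ξ * S.fs ξ t x where
  smooth := by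
    filter_upwards [ae_normal_ne] with ξ hξ using h.tsm_wfs w hz hξ
  meas α p hp := by
    have h1 := (h.measOn_wfs hw).derivMI (ε := S.ε) (fun z hz ξ hξ => h.tsm_wfs w hz hξ) α
    exact aesm_vel hp.1 (x := pnt p.2 z) (by simpa using hz) h1
  dom α p hp := by
    obtain ⟨M, hM0, hM⟩ := h.exists_abs_D_fs_le hε α
    refine ⟨1, one_pos, fun ξ => M * ((1 + ‖ξ‖) ^ 1 * exp (-ρ * ‖ξ‖ ^ 2)),
      (integrable_pow_mul_exp hρ 1).const_mul M, ?_⟩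
    filter_upwards [ae_normal_ne] with ξ hξ q hq _
    have e : pMI S.ε α (fun t x => w ξ * S.fs ξ t x) q.1 (pnt q.2 z) = _ :=
      h.D_wfs w α hq.1 (x := pnt q.2 z) (by simpa using hz) hξ
    rw [slice, e, abs_mul, pow_one,
      mul_left_comm]
    have := hM q.1 hq.1 (pnt q.2 z) ξ (by simpa using hz) hξ
    have := hwb ξ
    gcongr

/-- Velocity averages of the remainder are tangentially smooth and bounded. -/
lemma tbdd_avg : TBdd S.ε S.T (S.avg w) where
  smooth s hs := (h.domFam_wfs hw hwb hε hρ hs).tsm h.eps_pos.ne'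
  meas α := by
    have h1 := (h.measOn_wfs hw).derivMI (ε := S.ε) (fun z hz ξ hξ => h.tsm_wfs w hz hξ) α
    exact h1.integral.congr fun q hq =>
      (h.domFam_wfs hw hwb hε hρ hq.2).pMI_integral h.eps_pos.ne' α q.1 hq.1 q.2 rfl
  bdd α b p hp := by
    obtain ⟨M, hM0, hM⟩ := h.exists_abs_D_fs_le hε α
    refine ⟨1, one_pos, ∫ ξ : V3, M * ((1 + ‖ξ‖) ^ 1 * exp (-ρ * ‖ξ‖ ^ 2)),
      fun q hq _ s hs => ?_⟩
    have e := ((h.domFam_wfs hw hwb hε hρ hs.1).pMI_integral h.eps_pos.ne' α).slice_eqOn hq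
    have e2 : slice s (pMI S.ε α (S.avg w)) q = ∫ ξ, pMI S.ε α (fun t x => w ξ * S.fs ξ t x) q.1
      (pnt q.2 s) := e
    rw [e2, ← Real.norm_eq_abs]
    refine norm_integral_le_of_norm_le ((integrable_pow_mul_exp hρ 1).const_mul M) ?_
    filter_upwards [ae_normal_ne] with ξ hξ
    have e : pMI S.ε α (fun t x => w ξ * S.fs ξ t x) q.1 (pnt q.2 s) = _ :=
      h.D_wfs w α hq.1 (x := pnt q.2 s) (by simpa using hs.1) hξ
    rw [e, norm_mul, pow_one,
      mul_left_comm]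
    have := hM q.1 hq.1 (pnt q.2 s) ξ (by simpa using hs.1) hξ
    have := hwb ξ
    simp only [Real.norm_eq_abs]
    gcongr

lemma D_avg (α : MI) {t : ℝ} (ht : t ∈ Ioo 0 S.T) {x : V3} (hx : 0 < x 2) :
    S.D α (S.avg w) t x = ∫ ξ, w ξ * S.D α (S.fs ξ) t x := by
  have e : S.D α (S.avg w) t x = ∫ ξ, S.D α (fun t x => w ξ * S.fs ξ t x) t x :=
    (h.domFam_wfs hw hwb hε hρ hx).pMI_integral h.eps_pos.ne' α t ht x rfl
  rw [e]
  refine integral_congr_ae ?_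
  filter_upwards [ae_normal_ne] with ξ hξ using h.D_wfs w α ht hx hξ

end Admissible

end Config

/-! ### The weak form of the conservation of mass -/

section Weak

variable {O : Set (ℝ × ℝ × ℝ)} {χ ψ : ℝ × ℝ × ℝ → ℝ}

lemma integrable_mul_of_tsupport (hO : IsOpen O) (hψ : Continuous ψ) (hc : HasCompactSupport ψ)
    (hs : tsupport ψ ⊆ O) {u : ℝ × ℝ × ℝ → ℝ} (hu : ContinuousOn u O) :
    Integrable fun q => ψ q * u q := by
  refine Continuous.integrable_of_hasCompactSupport ?_ hc.mul_right
  refine ContinuousOn.continuous_of_tsupport_subset (hψ.continuousOn.mul hu) hO ?_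
  exact (tsupport_mul_subset_left).trans hs

/-- Integration by parts against a test function. -/
lemma integral_mul_fderiv_eq (hO : IsOpen O) (hχ : ContDiff ℝ ∞ χ) (hc : HasCompactSupport χ)
    (hs : tsupport χ ⊆ O) {u : ℝ × ℝ × ℝ → ℝ} (hu : ContDiffOn ℝ 1 u O) (v : ℝ × ℝ × ℝ) :
    ∫ q, χ q * fderiv ℝ u q v = -∫ q, fderiv ℝ χ q v * u q := by
  have hdc : Continuous fun q => fderiv ℝ χ q v :=
    (hχ.continuous_fderiv (by simp)).clm_apply continuous_const
  have hdcs : HasCompactSupport fun q => fderiv ℝ χ q v := hc.fderiv_apply ℝ v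
  have hds : tsupport (fun q => fderiv ℝ χ q v) ⊆ O := (tsupport_fderiv_apply_subset ℝ v).trans hs
  have hu' : ContinuousOn (fun q => fderiv ℝ u q v) O :=
    (hu.continuousOn_fderiv_of_isOpen hO le_rfl).clm_apply continuousOn_const
  have h2 : (volume : Measure (ℝ × ℝ)).IsAddHaarMeasure :=
    Measure.prod.instIsAddHaarMeasure volume volume
  have h3 : (volume : Measure (ℝ × ℝ × ℝ)).IsAddHaarMeasure :=
    Measure.prod.instIsAddHaarMeasure volume volume
  refine integral_bilinear_hasLineDerivAt_right_eq_neg_left_of_integrable (μ := volume)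
    (f := χ) (f' := fun q => fderiv ℝ χ q v) (g := u) (g' := fun q => fderiv ℝ u q v) (v := v)
    (B := ContinuousLinearMap.mul ℝ ℝ) ?_ ?_ ?_ ?_ ?_
  · exact integrable_mul_of_tsupport hO hdc hdcs hds hu.continuousOn
  · exact integrable_mul_of_tsupport hO hχ.continuous hc hs hu'
  · exact integrable_mul_of_tsupport hO hχ.continuous hc hs hu.continuousOn
  · intro x _
    exact ((hχ.differentiable (by simp)) x).hasFDerivAt.hasLineDerivAt v
  · intro x hx
    exact ((hu.contDiffAt (hO.mem_nhds (hs hx))).differentiableAt (by simp)).hasFDerivAt.hasLineDerivAt v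

lemma integrable_prod_mul_of_tsupport {a b : ℝ} (ha : 0 < a) (hψ : Continuous ψ)
    (hc : HasCompactSupport ψ) (hs : tsupport ψ ⊆ O) {u : (ℝ × ℝ × ℝ) × ℝ → ℝ}
    (hu : ContinuousOn u (O ×ˢ Ioi 0)) :
    Integrable (fun p : (ℝ × ℝ × ℝ) × ℝ => ψ p.1 * u p)
      ((volume : Measure (ℝ × ℝ × ℝ)).prod (volume.restrict (Ioc a b))) := by
  have h1 : (volume : Measure (ℝ × ℝ × ℝ)).prod ((volume : Measure ℝ).restrict (Ioc a b))
      = (volume.prod volume).restrict (univ ×ˢ Ioc a b) := by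
    rw [← Measure.prod_restrict, Measure.restrict_univ]
  rw [h1]
  have hK : IsCompact (tsupport ψ ×ˢ Icc a b) := hc.isCompact.prod isCompact_Icc
  have hcon : ContinuousOn (fun p : (ℝ × ℝ × ℝ) × ℝ => ψ p.1 * u p) (tsupport ψ ×ˢ Icc a b) :=
    (hψ.comp continuous_fst).continuousOn.mul
      (hu.mono (prod_mono hs fun s hs => ha.trans_le hs.1))
  have h2 : IntegrableOn (fun p : (ℝ × ℝ × ℝ) × ℝ => ψ p.1 * u p) (tsupport ψ ×ˢ Ioc a b)
      (volume.prod volume) :=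
    (hcon.integrableOn_compact hK).mono_set (prod_mono le_rfl Ioc_subset_Icc_self)
  refine IntegrableOn.of_forall_sdiff_eq_zero h2 (MeasurableSet.univ.prod measurableSet_Ioc) ?_
  rintro ⟨q, s⟩ ⟨hq, hq2⟩
  have : q ∉ tsupport ψ := fun hqs => hq2 ⟨hqs, hq.2⟩
  simp [image_eq_zero_of_notMem_tsupport this]

/-- A product is integrable if one factor is integrable and the other one has bounded fiber
integrals where the first one does not vanish. -/
lemma integrable_mul_of_fiber {X Y : Type*} [MeasurableSpace X] [MeasurableSpace Y] {m : Measure X}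
    {n : Measure Y} [SFinite n] {ψ : X → ℝ} (hψ : Integrable ψ m) (hψm : Measurable ψ)
    {k : X → Y → ℝ} (hk : Measurable (Function.uncurry k)) {C : ℝ≥0∞} (hC : C ≠ ⊤)
    (hb : ∀ᵐ x ∂m, ψ x ≠ 0 → ∫⁻ y, ‖k x y‖ₑ ∂n ≤ C) :
    Integrable (Function.uncurry fun x y => ψ x * k x y) (m.prod n) := by
  have hm : Measurable (Function.uncurry fun x y => ψ x * k x y) :=
    (hψm.comp measurable_fst).mul hk
  refine ⟨hm.aestronglyMeasurable, ?_⟩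
  rw [hasFiniteIntegral_iff_enorm, lintegral_prod _ hm.enorm.aemeasurable]
  calc ∫⁻ x, ∫⁻ y, ‖Function.uncurry (fun x y => ψ x * k x y) (x, y)‖ₑ ∂n ∂m
      ≤ ∫⁻ x, ‖ψ x‖ₑ * C ∂m := by
        refine lintegral_mono_ae ?_
        filter_upwards [hb] with x hx
        simp only [Function.uncurry_apply_pair, enorm_mul]
        have hkx : Measurable fun y => ‖k x y‖ₑ := (hk.comp measurable_prodMk_left).enorm
        rw [lintegral_const_mul _ hkx]
        by_cases h0 : ψ x = 0
        · simp [h0]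
        · gcongr
          exact hx h0
    _ = (∫⁻ x, ‖ψ x‖ₑ ∂m) * C := lintegral_mul_const _ hψm.enorm
    _ < ⊤ := ENNReal.mul_lt_top hψ.2 hC.lt_top

end Weak

/-- The velocity weights `1, ξ₁, ξ₂` of the tangential derivatives `ε∂_t, ∂_{x₁}, ∂_{x₂}`. -/
def wT (i : Fin 3) (ξ : V3) : ℝ := ![1, ξ 0, ξ 1] i

lemma continuous_wT (i : Fin 3) : Continuous (wT i) := by
  unfold wT
  fin_cases i <;> simp <;> fun_prop

lemma abs_wT_le (i : Fin 3) (ξ : V3) : |wT i ξ| ≤ 1 + ‖ξ‖ := by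
  have h0 := abs_coord_le ξ 0
  have h1 := abs_coord_le ξ 1
  have h2 := norm_nonneg ξ
  unfold wT
  fin_cases i <;> simp <;> linarith

lemma abs_coord_le' (k : Fin 3) (ξ : V3) : |ξ k| ≤ 1 + ‖ξ‖ := by
  have := abs_coord_le ξ k
  linarith

/-- The tangential derivative of a test function. -/
def dχ (ε : ℝ) (χ : ℝ × ℝ × ℝ → ℝ) (i : Fin 3) (q : ℝ × ℝ × ℝ) : ℝ := fderiv ℝ χ q (dirT ε i)

namespace Config

variable {S : Config} {K τU ρ : ℝ}

variable (S) in
/-- The density `F` along the normal, as a function of `((t, x₁, x₂), x₃)`. -/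
def dens (ξ : V3) (p : (ℝ × ℝ × ℝ) × ℝ) : ℝ := S.F p.1.1 (pnt p.1.2 p.2) ξ

variable (S) in
/-- The collision term along the normal. -/
def collTerm (ξ : V3) (p : (ℝ × ℝ × ℝ) × ℝ) : ℝ :=
  collQ (S.F p.1.1 (pnt p.1.2 p.2)) (S.F p.1.1 (pnt p.1.2 p.2)) ξ

namespace Admissible

variable (h : S.Admissible K τU ρ)
include h

lemma contDiffOn_dens {ξ : V3} (hξ : ξ 2 ≠ 0) :
    ContDiffOn ℝ 1 (S.dens ξ) (tdom S.T ×ˢ Ioi 0) := by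
  refine (h.sol.diff ξ hξ).comp (f := fun p : (ℝ × ℝ × ℝ) × ℝ => (p.1.1, pnt p.1.2 p.2)) ?_ ?_
  · refine ContDiff.contDiffOn ?_
    exact (contDiff_fst.comp contDiff_fst).prodMk (contDiff_pnt.comp
      ((contDiff_snd.comp contDiff_fst).prodMk contDiff_snd))
  · rintro ⟨q, s⟩ ⟨hq, hs⟩
    exact ⟨hq.1, by simpa using hs⟩

lemma hasFDerivAt_dens {ξ : V3} (hξ : ξ 2 ≠ 0) {q : ℝ × ℝ × ℝ} (hq : q ∈ tdom S.T) {s : ℝ}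
    (hs : 0 < s) : HasFDerivAt (S.dens ξ) (fderiv ℝ (S.dens ξ) (q, s)) (q, s) :=
  (((h.contDiffOn_dens hξ).contDiffAt (((isOpen_tdom S.T).prod isOpen_Ioi).mem_nhds
    (mk_mem_prod hq (mem_Ioi.2 hs)))).differentiableAt (by simp)).hasFDerivAt

lemma fderiv_dens_slice {ξ : V3} (hξ : ξ 2 ≠ 0) {q : ℝ × ℝ × ℝ} (hq : q ∈ tdom S.T) {s : ℝ}
    (hs : 0 < s) (v : ℝ × ℝ × ℝ) : fderiv ℝ (fun q => S.dens ξ (q, s)) q v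
      = fderiv ℝ (S.dens ξ) (q, s) (v, 0) := by
  have h1 := (h.hasFDerivAt_dens hξ hq hs).comp (f := fun q => (q, s)) q
    (hasFDerivAt_prodMk_left q s)
  have h2 : fderiv ℝ (fun q => S.dens ξ (q, s)) q = _ := h1.fderiv
  rw [h2]
  simp

lemma hasDerivAt_dens {ξ : V3} (hξ : ξ 2 ≠ 0) {q : ℝ × ℝ × ℝ} (hq : q ∈ tdom S.T) {s : ℝ}
    (hs : 0 < s) : HasDerivAt (fun s => S.dens ξ (q, s))
      (fderiv ℝ (S.dens ξ) (q, s) (0, 1)) s := by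
  have h1 := (h.hasFDerivAt_dens hξ hq hs).comp_hasDerivAt s
    ((hasDerivAt_const s q).prodMk (hasDerivAt_id s))
  simpa [Function.comp_def] using h1

/-- The Boltzmann equation along the normal. -/
lemma kinetic {ξ : V3} (hξ : ξ 2 ≠ 0) {q : ℝ × ℝ × ℝ} (hq : q ∈ tdom S.T) {s : ℝ} (hs : 0 < s) :
    ξ 2 * fderiv ℝ (S.dens ξ) (q, s) (0, 1)
      + ∑ i, wT i ξ * fderiv ℝ (S.dens ξ) (q, s) (dirT S.ε i, 0)
      = (S.κ * S.ε)⁻¹ * S.collTerm ξ (q, s) := by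
  have hB := h.sol.boltzmann q.1 hq.1 (pnt q.2 s) ξ (by simpa using hs) hξ
  have hε := h.eps_pos.ne'
  have hκ := h.kappa_pos.ne'
  have hT : ∀ i, dT S.ε i (fun t x => S.F t x ξ) q.1 (pnt q.2 s)
      = fderiv ℝ (S.dens ξ) (q, s) (dirT S.ε i, 0) := by
    intro i
    rw [← h.fderiv_dens_slice hξ hq hs, dT_eq_lineDeriv]
    simp only [pnt_zero, pnt_one, pnt_two]
    have h1 : slice s (fun t x => S.F t x ξ) = fun q => S.dens ξ (q, s) := rfl
    rw [h1]
    have h2 := (h.hasFDerivAt_dens hξ hq hs).comp (f := fun q => (q, s)) q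
      (hasFDerivAt_prodMk_left q s)
    exact DifferentiableAt.lineDeriv_eq_fderiv h2.differentiableAt
  have hN : px 2 (fun t x => S.F t x ξ) q.1 (pnt q.2 s)
      = fderiv ℝ (S.dens ξ) (q, s) (0, 1) := by
    have h1 := (h.hasDerivAt_dens hξ hq hs)
    have h2 : HasDerivAt (fun r : ℝ => S.dens ξ (q, s + r))
        (fderiv ℝ (S.dens ξ) (q, s) (0, 1)) 0 := by
      have := HasDerivAt.comp_const_add s 0 (f := fun s => S.dens ξ (q, s)) (by simpa using h1)
      exact this
    have h3 : (fun r : ℝ => S.dens ξ (q, s + r))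
        = fun r => S.F q.1 (pnt q.2 s + r • e 2) ξ := by
      ext r; simp only [dens, pnt_add]
    rw [h3] at h2
    exact h2.deriv
  have h0 := hT 0
  have h1 := hT 1
  have h2 := hT 2
  simp only [dT, Matrix.cons_val_zero, Matrix.cons_val_one, Matrix.cons_val] at h0 h1 h2
  rw [Fin.sum_univ_three] at hB ⊢
  rw [h1, h2, hN] at hB
  rw [← h0]
  simp only [wT, Matrix.cons_val_zero, Matrix.cons_val_one, Matrix.cons_val, collTerm, smul_eq_mul]
  field_simp at hB ⊢
  linarith

/-- The transport equation tested with `χ(t, x₁, x₂)` between the heights `a` and `b`, for a fixed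
velocity. -/
lemma tested_kinetic {ξ : V3} (hξ : ξ 2 ≠ 0) {a b : ℝ} (ha : 0 < a) (hab : a ≤ b)
    {χ : ℝ × ℝ × ℝ → ℝ} (hχ : ContDiff ℝ ∞ χ) (hc : HasCompactSupport χ)
    (hs : tsupport χ ⊆ tdom S.T) :
    ξ 2 * ((∫ q, χ q * S.dens ξ (q, b)) - ∫ q, χ q * S.dens ξ (q, a))
      = (S.κ * S.ε)⁻¹ * (∫ p, χ p.1 * S.collTerm ξ p
          ∂((volume : Measure (ℝ × ℝ × ℝ)).prod (volume.restrict (Ioc a b))))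
        + ∑ i, wT i ξ * ∫ p, dχ S.ε χ i p.1 * S.dens ξ p
          ∂((volume : Measure (ℝ × ℝ × ℝ)).prod (volume.restrict (Ioc a b))) := by
  have hO := isOpen_tdom S.T
  have hC1 := h.contDiffOn_dens hξ
  have hop : IsOpen (tdom S.T ×ˢ Ioi (0 : ℝ)) := hO.prod isOpen_Ioi
  have hd : ∀ v, ContinuousOn (fun p => fderiv ℝ (S.dens ξ) p v) (tdom S.T ×ˢ Ioi (0 : ℝ)) :=
    fun v => (hC1.continuousOn_fderiv_of_isOpen hop le_rfl).clm_apply continuousOn_const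
  have hslice : ∀ s, 0 < s → ContDiffOn ℝ 1 (fun q => S.dens ξ (q, s)) (tdom S.T) := fun s hs =>
    hC1.comp (f := fun q : ℝ × ℝ × ℝ => (q, s)) (by fun_prop) fun q hq => ⟨hq, hs⟩
  have i0 := integrable_prod_mul_of_tsupport (b := b) ha hχ.continuous hc hs (hd (0, 1))
  have iT := fun i => integrable_prod_mul_of_tsupport (b := b) ha hχ.continuous hc hs
    (hd (dirT S.ε i, 0))
  have hdc : ∀ i, Continuous (dχ S.ε χ i) := fun i =>
    (hχ.continuous_fderiv (by simp)).clm_apply continuous_const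
  have hdcs : ∀ i, HasCompactSupport (dχ S.ε χ i) := fun i => hc.fderiv_apply ℝ _
  have hds : ∀ i, tsupport (dχ S.ε χ i) ⊆ tdom S.T := fun i =>
    (tsupport_fderiv_apply_subset ℝ _).trans hs
  have iD := fun i => integrable_prod_mul_of_tsupport (b := b) ha (hdc i) (hdcs i) (hds i)
    hC1.continuousOn
  -- the normal derivative
  have e0 : (∫ q, χ q * S.dens ξ (q, b)) - ∫ q, χ q * S.dens ξ (q, a)
      = ∫ p, χ p.1 * fderiv ℝ (S.dens ξ) p (0, 1)
          ∂((volume : Measure (ℝ × ℝ × ℝ)).prod (volume.restrict (Ioc a b))) := by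
    rw [integral_prod _ i0, ← integral_sub
      (integrable_mul_of_tsupport hO hχ.continuous hc hs (hslice b (ha.trans_le hab)).continuousOn)
      (integrable_mul_of_tsupport hO hχ.continuous hc hs (hslice a ha).continuousOn)]
    refine integral_congr_ae (Filter.Eventually.of_forall fun q => ?_)
    simp only []
    by_cases hq : q ∈ tdom S.T
    · rw [integral_const_mul, ← mul_sub, ← intervalIntegral.integral_of_le hab,
        intervalIntegral.integral_eq_sub_of_hasDerivAt (f := fun s => S.dens ξ (q, s))]
      · intro s hs'
        rw [uIcc_of_le hab] at hs'
        exact h.hasDerivAt_dens hξ hq (ha.trans_le hs'.1)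
      · refine ContinuousOn.intervalIntegrable ((hd (0, 1)).comp
          (f := fun s : ℝ => (q, s)) (by fun_prop) fun s hs' => ⟨hq, ?_⟩)
        rw [uIcc_of_le hab] at hs'
        exact ha.trans_le hs'.1
    · have : χ q = 0 := image_eq_zero_of_notMem_tsupport fun hh => hq (hs hh)
      simp [this]
  -- the tangential derivatives
  have eT : ∀ i, ∫ p, χ p.1 * fderiv ℝ (S.dens ξ) p (dirT S.ε i, 0)
          ∂((volume : Measure (ℝ × ℝ × ℝ)).prod (volume.restrict (Ioc a b)))
      = -∫ p, dχ S.ε χ i p.1 * S.dens ξ p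
          ∂((volume : Measure (ℝ × ℝ × ℝ)).prod (volume.restrict (Ioc a b))) := by
    intro i
    rw [integral_prod_symm _ (iT i), integral_prod_symm _ (iD i), ← integral_neg]
    refine setIntegral_congr_fun measurableSet_Ioc fun s hs' => ?_
    have hs0 := ha.trans hs'.1
    simp only []
    rw [show (∫ q, dχ S.ε χ i q * S.dens ξ (q, s)) = ∫ q, fderiv ℝ χ q (dirT S.ε i)
      * (fun q => S.dens ξ (q, s)) q from rfl,
      ← integral_mul_fderiv_eq hO hχ hc hs (hslice s hs0) (dirT S.ε i)]
    refine integral_congr_ae (Filter.Eventually.of_forall fun q => ?_)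
    simp only []
    by_cases hq : q ∈ tdom S.T
    · rw [h.fderiv_dens_slice hξ hq hs0]
    · have : χ q = 0 := image_eq_zero_of_notMem_tsupport fun hh => hq (hs hh)
      simp [this]
  have eQ : (S.κ * S.ε)⁻¹ * (∫ p, χ p.1 * S.collTerm ξ p
          ∂((volume : Measure (ℝ × ℝ × ℝ)).prod (volume.restrict (Ioc a b))))
      = ∫ p, (ξ 2 * (χ p.1 * fderiv ℝ (S.dens ξ) p (0, 1))
          + ∑ i, wT i ξ * (χ p.1 * fderiv ℝ (S.dens ξ) p (dirT S.ε i, 0)))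
          ∂((volume : Measure (ℝ × ℝ × ℝ)).prod (volume.restrict (Ioc a b))) := by
    rw [← integral_const_mul]
    have hae : ∀ᵐ p ∂((volume : Measure (ℝ × ℝ × ℝ)).prod (volume.restrict (Ioc a b))),
        p.2 ∈ Ioc a b := Measure.quasiMeasurePreserving_snd.ae (ae_restrict_mem measurableSet_Ioc)
    refine integral_congr_ae ?_
    filter_upwards [hae] with p hp
    by_cases hq : p.1 ∈ tdom S.T
    · have := h.kinetic hξ hq (ha.trans hp.1)
      simp only [Prod.mk.eta] at this
      rw [mul_left_comm, ← this, mul_add, Finset.mul_sum]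
      congr 1
      · ring
      · exact Finset.sum_congr rfl fun i _ => by ring
    · have : χ p.1 = 0 := image_eq_zero_of_notMem_tsupport fun hh => hq (hs hh)
      simp [this]
  rw [eQ, integral_add (i0.const_mul _) (integrable_finsetSum _ fun i _ => (iT i).const_mul _),
    integral_finsetSum _ fun i _ => (iT i).const_mul _, e0, integral_const_mul]
  simp only [integral_const_mul, eT, mul_neg, Finset.sum_neg_distrib]
  ring

end Admissible

end Config

/-! ### Conservation of mass -/

lemma integral_swap_of_integrable {X Y : Type*} [MeasurableSpace X] [MeasurableSpace Y]
    {m : Measure X} {n : Measure Y} [SFinite m] [SFinite n] {ψ : X → ℝ} {w : Y → ℝ} {d : X → Y → ℝ}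
    (H : Integrable (Function.uncurry fun x y => ψ x * (w y * d x y)) (m.prod n)) :
    Integrable (fun y => w y * ∫ x, ψ x * d x y ∂m) n ∧
      ∫ y, w y * ∫ x, ψ x * d x y ∂m ∂n = ∫ x, ψ x * ∫ y, w y * d x y ∂n ∂m := by
  have e : ∀ y, w y * ∫ x, ψ x * d x y ∂m = ∫ x, ψ x * (w y * d x y) ∂m := fun y => by
    rw [← integral_const_mul]
    congr 1; ext x; ring
  simp only [e]
  refine ⟨H.integral_prod_right, ?_⟩
  rw [← integral_integral_swap H]
  simp only [integral_const_mul]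

namespace Config

variable {S : Config} {K τU ρ : ℝ}

variable (S) in
/-- The fluid part of the density. -/
def fluid (t : ℝ) (x : V3) : V3 → ℝ :=
  fluidDens S.ε S.κ (S.P t x) (S.U t x) fun i j => (px i S.U t x) j

variable (S) in
/-- The velocity average `∫ w F dξ`. -/
def mom (w : V3 → ℝ) (t : ℝ) (x : V3) : ℝ := ∫ ξ, w ξ * S.F t x ξ

variable (S) in
/-- Mass density and tangential momenta of the fluid part. -/
def flT (i : Fin 3) (t : ℝ) (x : V3) : ℝ :=
  ![1 + S.ε ^ 2 * S.P t x, (1 + S.ε ^ 2 * S.P t x) * (S.ε * S.Uc 0 t x),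
    (1 + S.ε ^ 2 * S.P t x) * (S.ε * S.Uc 1 t x)] i

variable (S) in
/-- Normal momentum of the fluid part. -/
def flN (t : ℝ) (x : V3) : ℝ := (1 + S.ε ^ 2 * S.P t x) * (S.ε * S.Uc 2 t x)

lemma integral_wT_fluid (i : Fin 3) (t : ℝ) (x : V3) :
    ∫ ξ, wT i ξ * S.fluid t x ξ = S.flT i t x := by
  have h1 := integral_fluidDens S.ε S.κ (S.P t x) (S.U t x) fun i j => (px i S.U t x) j
  have h2 := integral_coord_fluidDens S.ε S.κ (S.P t x) (S.U t x) fun i j => (px i S.U t x) j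
  fin_cases i
  · simpa [wT, flT, fluid] using h1
  · simpa [wT, flT, fluid, Uc] using h2 0
  · simpa [wT, flT, fluid, Uc] using h2 1

lemma integral_normal_fluid (t : ℝ) (x : V3) :
    ∫ ξ : V3, ξ 2 * S.fluid t x ξ = S.flN t x :=
  integral_coord_fluidDens S.ε S.κ (S.P t x) (S.U t x) (fun i j => (px i S.U t x) j) 2

namespace Admissible

variable (h : S.Admissible K τU ρ)
include h

lemma F_eq (t : ℝ) (x ξ : V3) : S.F t x ξ = S.fluid t x ξ + S.ε * S.δ * S.fs ξ t x := by
  have hε := h.eps_pos.ne'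
  have hδ := h.delta_pos.ne'
  have hs := (S.sqrtMu_pos t x ξ).ne'
  have e1 : S.ε * S.δ * S.fs ξ t x = S.F t x ξ - S.mu t x ξ - S.ε ^ 2 * S.f2 t x ξ * S.sqrtMu t x ξ := by
    unfold fs f
    field_simp
  have e2 : S.fluid t x ξ = S.mu t x ξ + S.ε ^ 2 * S.f2 t x ξ * S.sqrtMu t x ξ := by
    have hsq := S.mu_eq_sq t x ξ
    have e3 : mu0 (ξ - S.ε • S.U t x) = S.mu t x ξ := rfl
    have e4 : √(mu0 (ξ - S.ε • S.U t x)) = S.sqrtMu t x ξ := rfl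
    unfold fluid fluidDens f2
    rw [e4, e3]
    simp only [← mul_assoc, ← Finset.sum_mul]
    have e5 : S.phi t x ξ = ξ - S.ε • S.U t x := rfl
    rw [e5]
    linear_combination (S.ε ^ 2 * S.P t x) * hsq
  rw [e1, e2]; ring

lemma measurable_F (t : ℝ) (x : V3) : Measurable (S.F t x) :=
  h.sol.meas.comp (f := fun ξ : V3 => (t, x, ξ)) (by fun_prop)

variable (hε : S.ε ≤ 1) (hρ : 0 < ρ)
include hε hρ

/-- The first velocity moment of `F` is bounded on compact sets inside the domain. -/
lemma exists_lintegral_F_le {C : Set (ℝ × V3)} (hC : IsCompact C) (hCs : C ⊆ slabO S.T) :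
    ∃ N : ℝ≥0∞, N ≠ ⊤ ∧ ∀ p ∈ C, ∫⁻ ξ, ‖(1 + ‖ξ‖) * S.F p.1 p.2 ξ‖ₑ ≤ N := by
  have hP : ContinuousOn (fun p : ℝ × V3 => S.P p.1 p.2) C :=
    (ContDiffOn.continuousOn h.smP).mono (hCs.trans (slabO_subset _))
  have hU : ContinuousOn (fun p : ℝ × V3 => S.U p.1 p.2) C :=
    (ContDiffOn.continuousOn h.smU).mono (hCs.trans (slabO_subset _))
  have hM : ∀ i j, ContinuousOn (fun p : ℝ × V3 => (px i S.U p.1 p.2) j) C := fun i j =>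
    ((continuousOn_px i (h.smUc j)).mono hCs).congr
      fun p hp => (h.px_Uc (hCs hp).1 (hCs hp).2 i j).symm
  have hB : ContinuousOn (fun p : ℝ × V3 => fluidBound S.ε S.κ (S.P p.1 p.2) (S.U p.1 p.2)
      fun i j => (px i S.U p.1 p.2) j) C := by
    unfold fluidBound
    fun_prop
  obtain ⟨B, hB⟩ := hC.exists_bound_of_continuousOn hB
  obtain ⟨M, hM0, hM⟩ := h.exists_abs_D_fs_le hε 0
  have hfi := (integrable_pow_mul_exp hρ 1).const_mul (S.ε * S.δ * M)
  refine ⟨ofReal B + ∫⁻ ξ : V3, ‖S.ε * S.δ * M * ((1 + ‖ξ‖) ^ 1 * exp (-ρ * ‖ξ‖ ^ 2))‖ₑ,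
    ENNReal.add_ne_top.2 ⟨ENNReal.ofReal_ne_top, hfi.2.ne⟩, fun p hp => ?_⟩
  have hmf : Measurable fun ξ : V3 => (1 + ‖ξ‖) * S.fluid p.1 p.2 ξ :=
    Measurable.mul (by fun_prop) (fluidDens_measurable _ _ _ _ _)
  calc ∫⁻ ξ, ‖(1 + ‖ξ‖) * S.F p.1 p.2 ξ‖ₑ
      ≤ ∫⁻ ξ, (‖(1 + ‖ξ‖) * S.fluid p.1 p.2 ξ‖ₑ
          + ‖S.ε * S.δ * M * ((1 + ‖ξ‖) ^ 1 * exp (-ρ * ‖ξ‖ ^ 2))‖ₑ) := by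
        refine lintegral_mono_ae ?_
        filter_upwards [ae_normal_ne] with ξ hξ
        rw [h.F_eq, mul_add]
        refine (enorm_add_le _ _).trans (add_le_add le_rfl ?_)
        rw [enorm_le_iff_norm_le]
        have h1 := hM p.1 (hCs hp).1 p.2 ξ (hCs hp).2 hξ
        have hε0 := h.eps_pos
        have hδ0 := h.delta_pos
        rw [Real.norm_of_nonneg (by positivity : 0 ≤ S.ε * S.δ * M *
          ((1 + ‖ξ‖) ^ 1 * exp (-ρ * ‖ξ‖ ^ 2))), norm_mul, norm_mul,
          Real.norm_of_nonneg (by positivity : 0 ≤ S.ε * S.δ),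
          Real.norm_of_nonneg (by positivity : 0 ≤ 1 + ‖ξ‖), pow_one]
        calc _ ≤ (1 + ‖ξ‖) * (S.ε * S.δ * (M * exp (-ρ * ‖ξ‖ ^ 2))) := by
              gcongr
              exact h1
          _ = _ := by ring
    _ = (∫⁻ ξ, ‖(1 + ‖ξ‖) * S.fluid p.1 p.2 ξ‖ₑ)
          + ∫⁻ ξ : V3, ‖S.ε * S.δ * M * ((1 + ‖ξ‖) ^ 1 * exp (-ρ * ‖ξ‖ ^ 2))‖ₑ :=
        lintegral_add_left hmf.enorm _
    _ ≤ _ := by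
        gcongr
        refine (lintegral_fluidDens_le _ _ _ _ _).trans (ENNReal.ofReal_le_ofReal ?_)
        exact (le_abs_self _).trans (hB p hp)

/-- The decomposition `F = fluid + ε δ f √μ` at the level of moments. -/
lemma mom_eq {w : V3 → ℝ} (hw : Continuous w) (hwb : ∀ ξ, |w ξ| ≤ 1 + ‖ξ‖) {t : ℝ}
    (ht : t ∈ Ioo 0 S.T) {x : V3} (hx : 0 < x 2) :
    S.mom w t x = (∫ ξ, w ξ * S.fluid t x ξ) + S.ε * S.δ * S.avg w t x := by
  have i1 : Integrable fun ξ => w ξ * S.fluid t x ξ := by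
    refine (integrable_one_add_mul_fluidDens S.ε S.κ (S.P t x) (S.U t x)
      (fun i j => (px i S.U t x) j)).mono
      (hw.measurable.mul (fluidDens_measurable _ _ _ _ _)).aestronglyMeasurable
      (Filter.Eventually.of_forall fun ξ => ?_)
    rw [norm_mul, norm_mul, Real.norm_of_nonneg (by positivity : 0 ≤ 1 + ‖ξ‖)]
    exact mul_le_mul_of_nonneg_right (hwb ξ) (norm_nonneg _)
  have i2 : Integrable fun ξ => w ξ * S.fs ξ t x := by
    have := (h.domFam_wfs hw hwb hε hρ hx).integrable 0 (mem_tdom ht (x 0, x 1))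
    simpa [slice, pnt_eta] using this
  unfold mom avg
  rw [← integral_const_mul, ← integral_add i1 (i2.const_mul _)]
  congr 1; ext ξ
  rw [h.F_eq]; ring

/-- The conservation law for mass between the heights `a` and `b`, tested with `χ(t, x₁, x₂)`. -/
lemma tested_mass {a b : ℝ} (ha : 0 < a) (hab : a ≤ b)
    {χ : ℝ × ℝ × ℝ → ℝ} (hχ : ContDiff ℝ ∞ χ) (hc : HasCompactSupport χ)
    (hs : tsupport χ ⊆ tdom S.T) :
    ((∫ q, χ q * S.mom (fun ξ => ξ 2) q.1 (pnt q.2 b))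
        - ∫ q, χ q * S.mom (fun ξ => ξ 2) q.1 (pnt q.2 a))
      = ∑ i, ∫ q, dχ S.ε χ i q * ∫ s in Ioc a b, S.mom (wT i) q.1 (pnt q.2 s) := by
  set mP := (volume : Measure (ℝ × ℝ × ℝ)).prod ((volume : Measure ℝ).restrict (Ioc a b)) with hmP
  -- the first moment of the density is bounded over the support of `χ`
  have hcont : Continuous fun p : (ℝ × ℝ × ℝ) × ℝ => (p.1.1, pnt p.1.2 p.2) :=
    (continuous_fst.comp continuous_fst).prodMk (continuous_pnt.comp
      ((continuous_snd.comp continuous_fst).prodMk continuous_snd))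
  obtain ⟨N, hN, hNb⟩ := h.exists_lintegral_F_le hε hρ
    ((hc.isCompact.prod (isCompact_Icc (a := a) (b := b))).image hcont) (by
      rintro _ ⟨⟨q, s⟩, ⟨hq, hs'⟩, rfl⟩
      exact ⟨(hs hq).1, by simpa using ha.trans_le hs'.1⟩)
  have hNb' : ∀ q ∈ tsupport χ, ∀ s ∈ Icc a b,
      ∫⁻ ξ, ‖(1 + ‖ξ‖) * S.F q.1 (pnt q.2 s) ξ‖ₑ ≤ N := fun q hq s hs' =>
    hNb _ ⟨(q, s), ⟨hq, hs'⟩, rfl⟩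
  have hNw : ∀ w : V3 → ℝ, (∀ ξ, |w ξ| ≤ 1 + ‖ξ‖) → ∀ q ∈ tsupport χ, ∀ s ∈ Icc a b,
      ∫⁻ ξ, ‖w ξ * S.F q.1 (pnt q.2 s) ξ‖ₑ ≤ N := by
    intro w hwb q hq s hs'
    refine (lintegral_mono fun ξ => ?_).trans (hNb' q hq s hs')
    rw [enorm_le_iff_norm_le, norm_mul, norm_mul, Real.norm_of_nonneg (by positivity : 0 ≤ 1 + ‖ξ‖)]
    exact mul_le_mul_of_nonneg_right (hwb ξ) (norm_nonneg _)
  have hFm : Measurable fun p : ((ℝ × ℝ × ℝ) × ℝ) × V3 => S.dens p.2 p.1 :=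
    h.sol.meas.comp (f := fun p : ((ℝ × ℝ × ℝ) × ℝ) × V3 => (p.1.1.1, pnt p.1.1.2 p.1.2, p.2))
      (((measurable_fst.comp measurable_fst).comp measurable_fst).prodMk
      ((hcont.measurable.snd.comp measurable_fst).prodMk measurable_snd))
  have hFs : ∀ s : ℝ, Measurable fun p : (ℝ × ℝ × ℝ) × V3 => S.dens p.2 (p.1, s) := fun s =>
    hFm.comp (f := fun p : (ℝ × ℝ × ℝ) × V3 => ((p.1, s), p.2)) (by fun_prop)
  have hdc : ∀ i, Continuous (dχ S.ε χ i) := fun i =>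
    (hχ.continuous_fderiv (by simp)).clm_apply continuous_const
  have hdcs : ∀ i, HasCompactSupport (dχ S.ε χ i) := fun i => hc.fderiv_apply ℝ _
  have hds : ∀ i q, dχ S.ε χ i q ≠ 0 → q ∈ tsupport χ := fun i q hq =>
    tsupport_fderiv_apply_subset ℝ _ (subset_tsupport _ hq)
  have hae : ∀ᵐ p ∂mP, p.2 ∈ Ioc a b :=
    Measure.quasiMeasurePreserving_snd.ae (ae_restrict_mem measurableSet_Ioc)
  have hw2 : Continuous fun ξ : V3 => ξ 2 := continuous_coord 2
  -- the boundary terms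
  have B : ∀ s ∈ Icc a b, Integrable (fun ξ : V3 => ξ 2 * ∫ q, χ q * S.dens ξ (q, s)) ∧
      ∫ ξ : V3, ξ 2 * ∫ q, χ q * S.dens ξ (q, s)
        = ∫ q, χ q * S.mom (fun ξ => ξ 2) q.1 (pnt q.2 s) := by
    intro s hs'
    refine integral_swap_of_integrable (ψ := χ) (w := fun ξ : V3 => ξ 2)
      (d := fun q ξ => S.dens ξ (q, s)) ?_
    refine integrable_mul_of_fiber (hχ.continuous.integrable_of_hasCompactSupport hc)
      hχ.continuous.measurable (k := fun q ξ => ξ 2 * S.dens ξ (q, s))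
      ((hw2.measurable.comp measurable_snd).mul (hFs s)) hN
      (Filter.Eventually.of_forall fun q hq => ?_)
    exact hNw _ (abs_coord_le' 2) q (subset_tsupport _ hq) s hs'
  have iψ : ∀ ψ : ℝ × ℝ × ℝ → ℝ, Continuous ψ → HasCompactSupport ψ →
      Integrable (fun p : (ℝ × ℝ × ℝ) × ℝ => ψ p.1) mP := fun ψ hψ hψc => by
    have := (hψ.integrable_of_hasCompactSupport hψc (μ := volume)).mul_prod
      (integrable_const (1 : ℝ) (μ := (volume : Measure ℝ).restrict (Ioc a b)))
    simpa using this
  -- the tangential terms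
  have jT : ∀ i, Integrable (Function.uncurry fun (p : (ℝ × ℝ × ℝ) × ℝ) ξ =>
      dχ S.ε χ i p.1 * (wT i ξ * S.dens ξ p)) (mP.prod volume) := by
    intro i
    refine integrable_mul_of_fiber (iψ _ (hdc i) (hdcs i))
      ((hdc i).measurable.comp measurable_fst) (k := fun p ξ => wT i ξ * S.dens ξ p)
      (((continuous_wT i).measurable.comp measurable_snd).mul hFm) hN ?_
    filter_upwards [hae] with p hp hq
    exact hNw _ (abs_wT_le i) p.1 (hds i _ hq) p.2 (Ioc_subset_Icc_self hp)
  have T := fun i => integral_swap_of_integrable (jT i)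
  -- the collision term
  have hQm : Measurable fun p : ((ℝ × ℝ × ℝ) × ℝ) × V3 => S.collTerm p.2 p.1 := by
    have hpost : Measurable fun r : (((ℝ × ℝ × ℝ) × ℝ) × V3) × (V3 × S2) =>
        post r.1.2 r.2.1 r.2.2 := by
      have : Continuous fun r : (((ℝ × ℝ × ℝ) × ℝ) × V3) × (V3 × S2) => post r.1.2 r.2.1 r.2.2 := by
        unfold post; fun_prop
      exact this.measurable
    have hpostS : Measurable fun r : (((ℝ × ℝ × ℝ) × ℝ) × V3) × (V3 × S2) =>
        postStar r.1.2 r.2.1 r.2.2 := by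
      have : Continuous fun r : (((ℝ × ℝ × ℝ) × ℝ) × V3) × (V3 × S2) =>
        postStar r.1.2 r.2.1 r.2.2 := by
        unfold postStar; fun_prop
      exact this.measurable
    have hker : Measurable fun r : (((ℝ × ℝ × ℝ) × ℝ) × V3) × (V3 × S2) =>
        |inner ℝ (r.1.2 - r.2.1) (r.2.2 : V3)| := by
      have : Continuous fun r : (((ℝ × ℝ × ℝ) × ℝ) × V3) × (V3 × S2) =>
        |inner ℝ (r.1.2 - r.2.1) (r.2.2 : V3)| := by fun_prop
      exact this.measurable
    have hcomp : ∀ v : (((ℝ × ℝ × ℝ) × ℝ) × V3) × (V3 × S2) → V3, Measurable v →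
        Measurable fun r => S.F r.1.1.1.1 (pnt r.1.1.1.2 r.1.1.2) (v r) := fun v hv =>
      hFm.comp (f := fun r : (((ℝ × ℝ × ℝ) × ℝ) × V3) × (V3 × S2) => (r.1.1, v r))
        ((measurable_fst.comp measurable_fst).prodMk hv)
    have m1 := hcomp _ hpost
    have m2 := hcomp _ hpostS
    have m3 := hcomp (fun r => r.1.2) (by fun_prop)
    have m4 := hcomp (fun r => r.2.1) (by fun_prop)
    unfold collTerm collQ
    refine Measurable.const_mul ?_ _
    refine (StronglyMeasurable.integral_prod_right (Measurable.stronglyMeasurable ?_)).measurable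
    exact hker.mul ((((m1.mul m2).add (m1.mul m2)).sub (m3.mul m4)).sub (m3.mul m4))
  have jQ : Integrable (Function.uncurry fun (p : (ℝ × ℝ × ℝ) × ℝ) ξ =>
      χ p.1 * (1 * S.collTerm ξ p)) (mP.prod volume) := by
    refine integrable_mul_of_fiber (iψ _ hχ.continuous hc)
      (hχ.continuous.measurable.comp measurable_fst) (k := fun p ξ => 1 * S.collTerm ξ p)
      (C := 2 * (sphMass * N ^ 2)) (by simp only [one_mul]; exact hQm) ?_ ?_
    · exact ENNReal.mul_ne_top (by simp) (ENNReal.mul_ne_top sphMass_lt_top.ne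
        (ENNReal.pow_ne_top hN))
    · filter_upwards [hae] with p hp hq
      simp only [one_mul]
      refine (lintegral_collQ_le (h.measurable_F _ _)).trans ?_
      gcongr
      exact hNb' _ (subset_tsupport _ hq) _ (Ioc_subset_Icc_self hp)
  have Q := integral_swap_of_integrable jQ
  have Q0 : ∫ ξ, ∫ p, χ p.1 * S.collTerm ξ p ∂mP = 0 := by
    have e1 := Q.2
    simp only [one_mul] at e1
    rw [e1]
    refine (integral_congr_ae ?_).trans (integral_zero _ _)
    filter_upwards [hae] with p hp
    by_cases hq : p.1 ∈ tsupport χ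
    · have : ∫ ξ, S.collTerm ξ p = 0 := integral_collQ (h.measurable_F _ _)
        ((hNb' _ hq _ (Ioc_subset_Icc_self hp)).trans_lt hN.lt_top)
      rw [this, mul_zero]
    · rw [image_eq_zero_of_notMem_tsupport hq, zero_mul]
  have QI : Integrable fun ξ => ∫ p, χ p.1 * S.collTerm ξ p ∂mP := by simpa using Q.1
  -- integration over the velocities
  have key : ∫ ξ : V3, ξ 2 * ((∫ q, χ q * S.dens ξ (q, b)) - ∫ q, χ q * S.dens ξ (q, a))
      = ∫ ξ : V3, ((S.κ * S.ε)⁻¹ * (∫ p, χ p.1 * S.collTerm ξ p ∂mP)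
        + ∑ i, wT i ξ * ∫ p, dχ S.ε χ i p.1 * S.dens ξ p ∂mP) := by
    refine integral_congr_ae ?_
    filter_upwards [ae_normal_ne] with ξ hξ using h.tested_kinetic hξ ha hab hχ hc hs
  have Bb := B b ⟨hab, le_rfl⟩
  have Ba := B a ⟨le_rfl, hab⟩
  simp only [mul_sub] at key
  rw [integral_sub Bb.1 Ba.1, Bb.2, Ba.2, integral_add (QI.const_mul _)
    (integrable_finsetSum _ fun i _ => (T i).1), integral_const_mul, Q0, mul_zero, zero_add,
    integral_finsetSum _ fun i _ => (T i).1] at key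
  rw [key]
  refine Finset.sum_congr rfl fun i _ => ?_
  rw [(T i).2]
  have jT' := (jT i).integral_prod_left
  simp only [Function.uncurry_apply_pair, integral_const_mul] at jT'
  rw [hmP, integral_prod _ jT']
  simp only [integral_const_mul]
  rfl

end Admissible

end Config

lemma pMI_single {E : Type*} [NormedAddCommGroup E] [NormedSpace ℝ E] (ε : ℝ) (i : Fin 3)
    (g : ℝ → V3 → E) : pMI ε (Pi.single i 1) g = dT ε i g := by
  rw [pMI_eq]
  fin_cases i <;> simp

lemma ofReal_integral_mu0_half_pos : 0 < ∫ ξ in {ξ : V3 | 0 < ξ 2}, mu0 ξ * |ξ 2| := by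
  have hO : IsOpen {ξ : V3 | 0 < ξ 2} := isOpen_lt continuous_const (continuous_coord 2)
  have hi : Integrable fun ξ : V3 => |ξ 2| * mu0 ξ :=
    integrable_mul_mu0 (by fun_prop) (n := 1) (C := 1) fun ξ => by
      simpa using abs_coord_le' 2 ξ
  simp only [mul_comm] at hi ⊢
  rw [setIntegral_pos_iff_support_of_nonneg_ae _ hi.integrableOn]
  · have : (Function.support fun ξ : V3 => mu0 ξ * |ξ 2|) ∩ {ξ : V3 | 0 < ξ 2} = {ξ : V3 | 0 < ξ 2} := by
      refine inter_eq_right.2 fun ξ hξ => ?_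
      have h1 : (0 : ℝ) < ξ 2 := hξ
      have := mu0_pos ξ
      simp [h1.ne', this.ne']
    rw [this]
    exact hO.measure_pos _ ⟨e 2, by simp [e]⟩
  · filter_upwards with ξ
    have := mu0_pos ξ
    simp only [Pi.zero_apply]
    positivity

/-- Diffuse reflection produces no normal mass flux. -/
lemma integral_normal_diffuse {F : V3 → ℝ} (hF : Integrable fun ξ : V3 => ξ 2 * F ξ)
    (hd : ∀ ξ : V3, 0 < ξ 2 → F ξ = cMu * mu0 ξ * ∫ ζ in {ζ : V3 | ζ 2 < 0}, F ζ * |ζ 2|) :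
    ∫ ξ : V3, ξ 2 * F ξ = 0 := by
  set I := ∫ ζ in {ζ : V3 | ζ 2 < 0}, F ζ * |ζ 2| with hI
  have m1 : MeasurableSet {ξ : V3 | 0 < ξ 2} :=
    (isOpen_lt continuous_const (continuous_coord 2)).measurableSet
  have m2 : MeasurableSet {ξ : V3 | ξ 2 < 0} :=
    (isOpen_lt (continuous_coord 2) continuous_const).measurableSet
  have hd1 : Disjoint {ξ : V3 | 0 < ξ 2} {ξ : V3 | ξ 2 < 0} :=
    disjoint_left.2 fun ξ h1 h2 => lt_asymm (show (0 : ℝ) < ξ 2 from h1) h2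
  have e0 : ∫ ξ : V3, ξ 2 * F ξ = ∫ ξ in {ξ : V3 | 0 < ξ 2} ∪ {ξ : V3 | ξ 2 < 0}, ξ 2 * F ξ := by
    rw [setIntegral_eq_integral_of_forall_compl_eq_zero]
    intro ξ hξ
    have h1 : ¬ (0 : ℝ) < ξ 2 := fun hh => hξ (Or.inl hh)
    have h2 : ¬ ξ 2 < (0 : ℝ) := fun hh => hξ (Or.inr hh)
    have : ξ 2 = 0 := le_antisymm (not_lt.1 h1) (not_lt.1 h2)
    rw [this, zero_mul]
  rw [e0, setIntegral_union hd1 m2 hF.integrableOn hF.integrableOn]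
  have e1 : ∫ ξ in {ξ : V3 | 0 < ξ 2}, ξ 2 * F ξ = I := by
    have : ∫ ξ in {ξ : V3 | 0 < ξ 2}, ξ 2 * F ξ
        = ∫ ξ in {ξ : V3 | 0 < ξ 2}, cMu * I * (mu0 ξ * |ξ 2|) := by
      refine setIntegral_congr_fun m1 fun ξ hξ => ?_
      have h1 : (0 : ℝ) < ξ 2 := hξ
      simp only []
      rw [hd ξ h1, abs_of_pos h1]; ring
    rw [this, integral_const_mul, cMu]
    have := ofReal_integral_mu0_half_pos.ne'
    field_simp
  have e2 : ∫ ξ in {ξ : V3 | ξ 2 < 0}, ξ 2 * F ξ = -I := by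
    rw [hI, ← integral_neg]
    refine setIntegral_congr_fun m2 fun ξ hξ => ?_
    have h1 : ξ 2 < (0 : ℝ) := hξ
    simp only []
    rw [abs_of_neg h1]; ring
  rw [e1, e2]; ring

namespace Config

variable {S : Config} {K τU ρ : ℝ}

namespace Admissible

variable (h : S.Admissible K τU ρ)
include h

lemma sm_flN : SSm S.T S.flN := by
  have h1 := h.smP
  have h2 := h.smUc 2
  unfold SSm at h1 h2 ⊢
  unfold flN
  fun_prop

lemma sm_flT (i : Fin 3) : SSm S.T (S.flT i) := by
  have h1 := h.smP
  have h2 := h.smUc 0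
  have h3 := h.smUc 1
  unfold SSm at h1 h2 h3 ⊢
  unfold flT
  fin_cases i <;> simp <;> fun_prop

/-- The velocity gradient extends smoothly to the boundary. -/
lemma exists_gradient (i j : Fin 3) : ∃ g : ℝ → V3 → ℝ, SSm S.T g ∧
    ∀ t ∈ Ioo 0 S.T, ∀ x : V3, 0 < x 2 → (px i S.U t x) j = g t x := by
  have key : ∃ g : ℝ → V3 → ℝ, SSm S.T g ∧
    ∀ t ∈ Ioo 0 S.T, ∀ x : V3, 0 < x 2 → px i (S.Uc j) t x = g t x := by
    fin_cases i
    · exact ⟨dT S.ε 1 (S.Uc j), (h.smUc j).deriv 1, fun _ _ _ _ => rfl⟩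
    · exact ⟨dT S.ε 2 (S.Uc j), (h.smUc j).deriv 2, fun _ _ _ _ => rfl⟩
    · exact ⟨dN S.T (S.Uc j), (h.smUc j).dN, fun t ht x hx => (h.smUc j).px_two ht hx⟩
  obtain ⟨g, hg, hg'⟩ := key
  exact ⟨g, hg, fun t ht x hx => by rw [← hg' t ht x hx, h.px_Uc ht hx]⟩

lemma Uc_boundary {t : ℝ} (ht : t ∈ Ioo 0 S.T) {x : V3} (hx : x 2 = 0) (k : Fin 3) :
    S.Uc k t x = 0 := by
  simp [Uc, h.flow.no_slip t ht x hx]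

variable (hε : S.ε ≤ 1) (hρ : 0 < ρ)
include hε hρ

lemma mom_wT_eq (i : Fin 3) {t : ℝ} (ht : t ∈ Ioo 0 S.T) {x : V3} (hx : 0 < x 2) :
    S.mom (wT i) t x = S.flT i t x + S.ε * S.δ * S.avg (wT i) t x := by
  rw [h.mom_eq hε hρ (continuous_wT i) (abs_wT_le i) ht hx, integral_wT_fluid]

lemma mom_normal_eq {t : ℝ} (ht : t ∈ Ioo 0 S.T) {x : V3} (hx : 0 < x 2) :
    S.mom (fun ξ => ξ 2) t x = S.flN t x + S.ε * S.δ * S.avg (fun ξ => ξ 2) t x := by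
  rw [h.mom_eq hε hρ (continuous_coord 2) (abs_coord_le' 2) ht hx, integral_normal_fluid]

lemma tbdd_mom_wT (i : Fin 3) : TBdd S.ε S.T (S.mom (wT i)) :=
  ((TBdd.of_ssm (h.sm_flT i)).add ((h.tbdd_avg (continuous_wT i) (abs_wT_le i) hε hρ).const_mul
    (S.ε * S.δ))).congr fun _ hs _ ht _ hx => h.mom_wT_eq hε hρ i ht (hx ▸ hs)

lemma tbdd_mom_normal : TBdd S.ε S.T (S.mom fun ξ => ξ 2) :=
  ((TBdd.of_ssm h.sm_flN).add ((h.tbdd_avg (continuous_coord 2) (abs_coord_le' 2) hε hρ).const_mul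
    (S.ε * S.δ))).congr fun _ hs _ ht _ hx => h.mom_normal_eq hε hρ ht (hx ▸ hs)

/-- The conservation law for mass between two heights. -/
lemma mass_between {a b : ℝ} (ha : 0 < a) (hab : a ≤ b) {t : ℝ} (ht : t ∈ Ioo 0 S.T) (y : ℝ × ℝ) :
    S.mom (fun ξ => ξ 2) t (pnt y b) - S.mom (fun ξ => ξ 2) t (pnt y a)
      = -∑ i, ∫ s in Ioc a b, dT S.ε i (S.mom (wT i)) t (pnt y s) := by
  set M : Fin 3 → ℝ → V3 → ℝ := fun i t x => ∫ s in Ioc a b, S.mom (wT i) t (pnt (x 0, x 1) s)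
    with hM
  have hε0 := h.eps_pos.ne'
  have hMs : ∀ i, TSm S.T 0 (M i) := fun i =>
    (h.tbdd_mom_wT hε hρ i).tsm_integral hε0 0 b ha.le
  have hN := h.tbdd_mom_normal hε hρ
  have hO := isOpen_tdom S.T
  have hcb := ContDiffOn.continuousOn (hN.smooth b (ha.trans_le hab))
  have hca := ContDiffOn.continuousOn (hN.smooth a ha)
  have hcM := fun i => ContDiffOn.continuousOn ((hMs i).deriv (ε := S.ε) i)
  set W : ℝ × ℝ × ℝ → ℝ := fun q => (slice b (S.mom fun ξ => ξ 2) q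
    - slice a (S.mom fun ξ => ξ 2) q) + ∑ i, slice 0 (dT S.ε i (M i)) q with hW
  have hWc : ContinuousOn W (tdom S.T) :=
    (hcb.sub hca).add (continuousOn_finsetSum _ fun i _ => hcM i)
  -- both sides of the tested law are continuous in `(t, x₁, x₂)`, so it holds pointwise
  have hae : ∀ᵐ q : ℝ × ℝ × ℝ, q ∈ tdom S.T → W q = 0 := by
    refine hO.ae_eq_zero_of_integral_contDiff_smul_eq_zero
      (hWc.locallyIntegrableOn hO.measurableSet) fun χ hχ hc hs => ?_
    have T := h.tested_mass hε hρ ha hab hχ hc hs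
    have ib := integrable_mul_of_tsupport hO hχ.continuous hc hs hcb
    have ia := integrable_mul_of_tsupport hO hχ.continuous hc hs hca
    have iM := fun i => integrable_mul_of_tsupport hO hχ.continuous hc hs (hcM i)
    have e1 : ∀ i, ∫ q, χ q * slice 0 (dT S.ε i (M i)) q
        = -∫ q, dχ S.ε χ i q * ∫ s in Ioc a b, S.mom (wT i) q.1 (pnt q.2 s) := by
      intro i
      have h1 := integral_mul_fderiv_eq hO hχ hc hs
        (ContDiffOn.of_le (hMs i) (by simp)) (dirT S.ε i)
      have h2 : ∀ q, slice 0 (M i) q = ∫ s in Ioc a b, S.mom (wT i) q.1 (pnt q.2 s) := fun q => by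
        simp [slice, hM]
      simp only [h2] at h1
      refine Eq.trans (integral_congr_ae (Filter.Eventually.of_forall fun q => ?_)) h1
      simp only []
      by_cases hq : q ∈ tdom S.T
      · rw [(hMs i).slice_dT i hq]
      · have : χ q = 0 := image_eq_zero_of_notMem_tsupport fun hh => hq (hs hh)
        simp [this]
    have e2 : ∫ q, χ q • W q = ((∫ q, χ q * slice b (S.mom fun ξ => ξ 2) q)
        - ∫ q, χ q * slice a (S.mom fun ξ => ξ 2) q) + ∑ i, ∫ q, χ q * slice 0 (dT S.ε i (M i)) q := by
      rw [← integral_sub ib ia, ← integral_finsetSum _ fun i _ => iM i,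
        ← integral_add (f := fun q => χ q * slice b (S.mom fun ξ => ξ 2) q
          - χ q * slice a (S.mom fun ξ => ξ 2) q) (ib.sub ia)
          (integrable_finsetSum _ fun i _ => iM i)]
      congr 1; ext q
      simp only [hW, smul_eq_mul, mul_add, mul_sub, Finset.mul_sum]
    rw [e2]
    simp only [e1, Finset.sum_neg_distrib]
    have T' : ((∫ q, χ q * slice b (S.mom fun ξ => ξ 2) q)
        - ∫ q, χ q * slice a (S.mom fun ξ => ξ 2) q) = _ := T
    rw [T']; ring
  have hzero : EqOn W (fun _ => 0) (tdom S.T) := by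
    refine Measure.eqOn_open_of_ae_eq (μ := volume) ?_ hO hWc continuousOn_const
    exact (ae_restrict_iff' hO.measurableSet).2 hae
  have h0 := hzero (mem_tdom ht y)
  have hMi : ∀ i, slice 0 (dT S.ε i (M i)) (t, y)
      = ∫ s in Ioc a b, dT S.ε i (S.mom (wT i)) t (pnt y s) := by
    intro i
    have := (h.tbdd_mom_wT hε hρ i).pMI_integral hε0 0 b ha.le (Pi.single i 1) t ht (pnt y 0) (by simp)
    simpa [pMI_single, hM, slice] using this
  simp only [hW, hMi] at h0
  simp only [slice] at h0
  linarith

/-- No mass flows through the boundary in the limit `x₃ → 0`. -/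
lemma tendsto_avg_normal {t : ℝ} (ht : t ∈ Ioo 0 S.T) (y : ℝ × ℝ) :
    Filter.Tendsto (fun s => S.avg (fun ξ => ξ 2) t (pnt y s)) (nhdsWithin 0 (Ioi 0)) (nhds 0) := by
  choose g hg hg' using h.exists_gradient
  have hε0 := h.eps_pos.ne'
  have hδ0 := h.delta_pos.ne'
  obtain ⟨M, hM0, hM⟩ := h.exists_abs_D_fs_le hε 0
  set fl0 := fluidDens S.ε S.κ (S.P t (pnt y 0)) 0 (fun i j => g i j t (pnt y 0)) with hfl0
  -- `L` is the boundary value of `f √μ`; its mass flux is read off from the diffuse reflection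
  set L : V3 → ℝ := fun ξ => (S.F t (pnt y 0) ξ - fl0 ξ) / (S.ε * S.δ) with hL
  have hpos : ∀ᶠ s : ℝ in nhdsWithin 0 (Ioi 0), 0 < s := self_mem_nhdsWithin
  have hcl : ∀ u : ℝ → V3 → ℝ, SSm S.T u → Filter.Tendsto (fun s => u t (pnt y s))
      (nhdsWithin 0 (Ioi 0)) (nhds (u t (pnt y 0))) := fun u hu =>
    ((hu.continuousOn_line ht y) 0 self_mem_Ici).tendsto.mono_left
      (nhdsWithin_mono _ Ioi_subset_Ici_self)
  have hlim : ∀ ξ : V3, ξ 2 ≠ 0 → Filter.Tendsto (fun s => S.fs ξ t (pnt y s))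
      (nhdsWithin 0 (Ioi 0)) (nhds (L ξ)) := by
    intro ξ hξ
    have hF : Filter.Tendsto (fun s => S.F t (pnt y s) ξ) (nhdsWithin 0 (Ioi 0))
        (nhds (S.F t (pnt y 0) ξ)) := by
      have hc : Continuous fun s : ℝ => (t, pnt y s) :=
        continuous_const.prodMk (continuous_pnt.comp (continuous_const.prodMk continuous_id))
      have := (h.sol.cont ξ hξ).comp (s := Ici 0) hc.continuousOn
        fun s hs => ⟨ht, by simpa using hs⟩
      exact (this 0 self_mem_Ici).tendsto.mono_left (nhdsWithin_mono _ Ioi_subset_Ici_self)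
    have hU : Filter.Tendsto (fun s => S.U t (pnt y s)) (nhdsWithin 0 (Ioi 0)) (nhds 0) := by
      have := ((h.smU.continuousOn_line ht y) 0 self_mem_Ici).tendsto.mono_left
        (nhdsWithin_mono _ Ioi_subset_Ici_self)
      rwa [h.flow.no_slip t ht _ (by simp)] at this
    have hG : Filter.Tendsto (fun s => S.fluid t (pnt y s) ξ) (nhdsWithin 0 (Ioi 0))
        (nhds (fl0 ξ)) := by
      refine tendsto_fluidDens S.ε S.κ (hcl _ h.smP) hU (fun i j => ?_) ξ
      refine (hcl _ (hg i j)).congr' ?_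
      filter_upwards [hpos] with s hs
      rw [hg' i j t ht _ (by simpa using hs)]
    refine ((hF.sub hG).div_const (S.ε * S.δ)).congr fun s => ?_
    rw [h.F_eq]
    field_simp
    ring
  have hfsb : ∀ ξ : V3, ξ 2 ≠ 0 → ∀ s, 0 < s →
      |ξ 2 * S.fs ξ t (pnt y s)| ≤ M * ((1 + ‖ξ‖) ^ 1 * exp (-ρ * ‖ξ‖ ^ 2)) := by
    intro ξ hξ s hs
    rw [abs_mul, pow_one, mul_left_comm]
    have := hM t ht (pnt y s) ξ (by simpa using hs) hξ
    exact mul_le_mul (abs_coord_le' 2 ξ) this (abs_nonneg _) (by positivity)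
  have hbi := (integrable_pow_mul_exp hρ 1).const_mul M
  have hT : Filter.Tendsto (fun s => S.avg (fun ξ => ξ 2) t (pnt y s)) (nhdsWithin 0 (Ioi 0))
      (nhds (∫ ξ : V3, ξ 2 * L ξ)) := by
    refine tendsto_integral_filter_of_dominated_convergence _ ?_ ?_ hbi ?_
    · filter_upwards [hpos] with s hs
      exact aesm_vel ht (by simpa using hs) (h.measOn_wfs (continuous_coord 2))
    · filter_upwards [hpos] with s hs
      filter_upwards [ae_normal_ne] with ξ hξ using hfsb ξ hξ s hs
    · filter_upwards [ae_normal_ne] with ξ hξ using (hlim ξ hξ).const_mul _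
  have hFm := h.measurable_F t (pnt y 0)
  have hflm : Measurable fl0 := fluidDens_measurable _ _ _ _ _
  have hLm : Measurable L := (hFm.sub hflm).div_const _
  have hLi : Integrable fun ξ : V3 => ξ 2 * L ξ := by
    refine hbi.mono' ((continuous_coord 2).measurable.mul hLm).aestronglyMeasurable ?_
    filter_upwards [ae_normal_ne] with ξ hξ
    refine le_of_tendsto ((hlim ξ hξ).const_mul (ξ 2)).norm ?_
    filter_upwards [hpos] with s hs using hfsb ξ hξ s hs
  have hfi : Integrable fun ξ : V3 => ξ 2 * fl0 ξ :=
    integrable_coord_mul hflm.aestronglyMeasurable (integrable_one_add_mul_fluidDens _ _ _ _ _) 2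
  have hFe : ∀ ξ : V3, ξ 2 * S.F t (pnt y 0) ξ = S.ε * S.δ * (ξ 2 * L ξ) + ξ 2 * fl0 ξ := by
    intro ξ; simp only [hL]; field_simp; ring
  have hFi : Integrable fun ξ : V3 => ξ 2 * S.F t (pnt y 0) ξ := by
    simp only [hFe]; exact (hLi.const_mul _).add hfi
  have hF0 := integral_normal_diffuse hFi fun ξ hξ => h.sol.diffuse t ht (pnt y 0) ξ (by simp) hξ
  simp only [hFe] at hF0
  rw [integral_add (hLi.const_mul _) hfi, integral_const_mul, hfl0,
    integral_coord_fluidDens] at hF0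
  have : ∫ ξ : V3, ξ 2 * L ξ = 0 := by
    have h1 : S.ε * S.δ ≠ 0 := mul_ne_zero hε0 hδ0
    simpa [hε0, hδ0] using hF0
  rwa [this] at hT

/-- The conservation law for mass between the boundary and the height `b`. -/
lemma mass_from_boundary {b : ℝ} (hb : 0 < b) {t : ℝ} (ht : t ∈ Ioo 0 S.T) (y : ℝ × ℝ) :
    S.mom (fun ξ => ξ 2) t (pnt y b)
      = -∑ i, ∫ s in Ioc 0 b, dT S.ε i (S.mom (wT i)) t (pnt y s) := by
  have hpos : ∀ᶠ s : ℝ in nhdsWithin 0 (Ioi 0), s ∈ Ioc 0 b := Ioc_mem_nhdsGT hb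
  have hmom : Filter.Tendsto (fun a => S.mom (fun ξ => ξ 2) t (pnt y a)) (nhdsWithin 0 (Ioi 0))
      (nhds 0) := by
    have h1 := ((h.sm_flN.continuousOn_line ht y) 0 self_mem_Ici).tendsto.mono_left
      (nhdsWithin_mono _ Ioi_subset_Ici_self)
    have h2 := h1.add ((h.tendsto_avg_normal hε hρ ht y).const_mul (S.ε * S.δ))
    have h3 : S.flN t (pnt y 0) + S.ε * S.δ * 0 = 0 := by
      simp [flN, h.Uc_boundary ht]
    rw [h3] at h2
    refine h2.congr' ?_
    filter_upwards [hpos] with a ha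
    exact (h.mom_normal_eq hε hρ ht (by simpa using ha.1)).symm
  have hint : ∀ i, Filter.Tendsto (fun a => ∫ s in Ioc a b, dT S.ε i (S.mom (wT i)) t (pnt y s))
      (nhdsWithin 0 (Ioi 0)) (nhds (∫ s in Ioc 0 b, dT S.ε i (S.mom (wT i)) t (pnt y s))) := by
    intro i
    have hI := ((h.tbdd_mom_wT hε hρ i).deriv i).integrable_normal ht y b
    have hI' : IntervalIntegrable (fun s => dT S.ε i (S.mom (wT i)) t (pnt y s)) volume 0 b :=
      (intervalIntegrable_iff_integrableOn_Ioc_of_le hb.le).2 hI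
    have hc := intervalIntegral.continuousOn_primitive_interval' hI' (right_mem_uIcc)
    have h1 := (((hc 0 left_mem_uIcc).tendsto).neg).mono_left
      (nhdsWithin_le_iff.2 (show uIcc 0 b ∈ nhdsWithin 0 (Ioc 0 b) by
        rw [uIcc_of_le hb.le]; exact Filter.mem_of_superset self_mem_nhdsWithin Ioc_subset_Icc_self))
    rw [nhdsWithin_Ioc_eq_nhdsGT hb] at h1
    simp only [← intervalIntegral.integral_symm] at h1
    rw [intervalIntegral.integral_of_le hb.le] at h1
    refine h1.congr' ?_
    filter_upwards [hpos] with a ha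
    rw [intervalIntegral.integral_of_le ha.2]
  have hsum := (tendsto_finsetSum Finset.univ fun i _ => hint i).neg
  have hdiff := (tendsto_const_nhds (x := S.mom (fun ξ => ξ 2) t (pnt y b))).sub hmom
  rw [sub_zero] at hdiff
  refine tendsto_nhds_unique hdiff (hsum.congr' ?_)
  filter_upwards [hpos] with a ha
  exact (h.mass_between hε hρ ha.1 ha.2 ht y).symm

end Admissible

end Config

/-! ### Tangential derivatives of the normal mass flux -/

section

variable {T z ε : ℝ} {u v : ℝ → V3 → ℝ}

lemma SSm.px_add_mul (hu : SSm T u) (hv : SSm T v) (c d : ℝ) {t : ℝ} (ht : t ∈ Ioo 0 T) {x : V3}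
    (hx : 0 < x 2) (i : Fin 3) :
    px i (fun t x => c * u t x + d * v t x) t x = c * px i u t x + d * px i v t x := by
  have h1 := ((hu.hasDerivAt_line ht hx i).const_mul c).add ((hv.hasDerivAt_line ht hx i).const_mul d)
  rw [← hu.px_eq ht hx, ← hv.px_eq ht hx] at h1
  exact h1.deriv

end

namespace Config

variable {S : Config} {K τU ρ : ℝ}

variable (S) in
/-- The fluid term `∂_t P + ∇_∥·(P U_∥)`. -/
def transP (t : ℝ) (x : V3) : ℝ := pt S.P t x
  + ∑ i ∈ ({0, 1} : Finset (Fin 3)), px i (fun r z => S.P r z * S.Uc i r z) t x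

variable (S) in
/-- The divergence whose integral along the normal is the normal mass flux of the remainder. -/
def fluxDiv (t : ℝ) (x : V3) : ℝ := (∑ i, dT S.ε i (S.avg (wT i)) t x)
  + (S.δ⁻¹ * S.divU t x + (S.ε ^ 2 / S.δ * S.transP t x + S.ε ^ 2 / S.δ * px 2 S.PU3 t x))

namespace Admissible

variable (h : S.Admissible K τU ρ)
include h

lemma sm_PUc (k : Fin 3) : SSm S.T (fun t x => S.P t x * S.Uc k t x) := h.smP.mul (h.smUc k)

lemma sm_PU3 : SSm S.T S.PU3 := h.sm_PUc 2

lemma sm_U3sq : SSm S.T S.U3sq := by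
  have h2 := (h.smUc 2).mul (h.smUc 2)
  have e : S.U3sq = fun t x => S.Uc 2 t x * S.Uc 2 t x := by ext t x; simp [U3sq, sq]
  rw [e]; exact h2

lemma tbdd_transP : TBdd S.ε S.T S.transP := by
  have hε := h.eps_pos.ne'
  have h0 := (((TBdd.of_ssm (ε := S.ε) h.smP).deriv 0).const_mul S.ε⁻¹)
  have h1 := (TBdd.of_ssm (ε := S.ε) (h.sm_PUc 0)).deriv 1
  have h2 := (TBdd.of_ssm (ε := S.ε) (h.sm_PUc 1)).deriv 2
  refine (h0.add (h1.add h2)).congr fun s _ t _ x _ => ?_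
  simp [transP, dT, hε]

lemma tbdd_divU : TBdd S.ε S.T S.divU := by
  have h0 := (TBdd.of_ssm (ε := S.ε) (h.smUc 0)).deriv 1
  have h1 := (TBdd.of_ssm (ε := S.ε) (h.smUc 1)).deriv 2
  have h2 := TBdd.px_two (ε := S.ε) (h.smUc 2)
  refine ((h0.add h1).add h2).congr fun s hs t ht x hx => ?_
  simp only [divU, Fin.sum_univ_three, ← h.px_Uc ht (hx ▸ hs)]
  rfl

/-- The space-time divergence of the mass and momentum densities of the fluid part. -/
lemma sum_dT_fluid {t : ℝ} (ht : t ∈ Ioo 0 S.T) {x : V3} (hx : 0 < x 2) :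
    ∑ i, dT S.ε i (S.flT i) t x + px 2 S.flN t x = S.ε * S.δ *
      (S.δ⁻¹ * S.divU t x + (S.ε ^ 2 / S.δ * S.transP t x + S.ε ^ 2 / S.δ * px 2 S.PU3 t x)) := by
  have hδ := h.delta_pos.ne'
  have e0 : dT S.ε 0 (S.flT 0) t x = S.ε ^ 3 * pt S.P t x := by
    simp [dT, flT, pt]; ring
  have key : ∀ i k : Fin 3, px i (fun t x => (1 + S.ε ^ 2 * S.P t x) * (S.ε * S.Uc k t x)) t x
      = S.ε * px i S.U t x k + S.ε ^ 3 * px i (fun t x => S.P t x * S.Uc k t x) t x := by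
    intro i k
    have e : (fun t x => (1 + S.ε ^ 2 * S.P t x) * (S.ε * S.Uc k t x))
        = fun t x => S.ε * S.Uc k t x + S.ε ^ 3 * (S.P t x * S.Uc k t x) := by
      ext t x; ring
    rw [e, (h.smUc k).px_add_mul (h.sm_PUc k) _ _ ht hx, h.px_Uc ht hx]
  have e1 : dT S.ε 1 (S.flT 1) t x = _ := key 0 0
  have e2 : dT S.ε 2 (S.flT 2) t x = _ := key 1 1
  have e3 : px 2 S.flN t x = _ := key 2 2
  rw [Fin.sum_univ_three, e0, e1, e2, e3]
  have e4 : px 2 S.PU3 t x = px 2 (fun t x => S.P t x * S.Uc 2 t x) t x := rfl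
  have e5 : S.transP t x = pt S.P t x + (px 0 (fun t x => S.P t x * S.Uc 0 t x) t x
      + px 1 (fun t x => S.P t x * S.Uc 1 t x) t x) := by simp [transP]
  rw [divU, Fin.sum_univ_three, e4, e5]
  field_simp
  ring

variable (hε : S.ε ≤ 1) (hρ : 0 < ρ)
include hε hρ

lemma tbdd_avg_wT (i : Fin 3) : TBdd S.ε S.T (S.avg (wT i)) :=
  h.tbdd_avg (continuous_wT i) (abs_wT_le i) hε hρ

lemma tbdd_fluxDiv : TBdd S.ε S.T S.fluxDiv :=
  (TBdd.sum fun i _ => (h.tbdd_avg_wT hε hρ i).deriv i).add ((h.tbdd_divU.const_mul _).add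
    ((h.tbdd_transP.const_mul _).add ((TBdd.px_two h.sm_PU3).const_mul _)))

lemma dT_mom {t : ℝ} (ht : t ∈ Ioo 0 S.T) {x : V3} (hx : 0 < x 2) (i : Fin 3) :
    dT S.ε i (S.mom (wT i)) t x
      = dT S.ε i (S.flT i) t x + S.ε * S.δ * dT S.ε i (S.avg (wT i)) t x := by
  have h1 : TEq S.T (x 2) (S.mom (wT i)) fun t x => S.flT i t x + S.ε * S.δ * S.avg (wT i) t x :=
    fun s hs y hy => h.mom_wT_eq hε hρ i hs (hy ▸ hx)
  have hs1 := (h.sm_flT i).tsm hx.le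
  have hs2 := (h.tbdd_avg_wT hε hρ i).smooth _ hx
  have h2 := hs1.pMI_add (ε := S.ε) (((h.tbdd_avg_wT hε hρ i).const_mul (S.ε * S.δ)).smooth _ hx)
    (Pi.single i 1) t ht x rfl
  have h3 := hs2.pMI_const_mul (ε := S.ε) (S.ε * S.δ) (Pi.single i 1) t ht x rfl
  simp only [pMI_single] at h2 h3
  rw [h1.deriv i t ht x rfl, h2, h3]

/-- The normal mass flux of the remainder is the integral of a divergence along the normal. -/
lemma avg_normal_eq {b : ℝ} (hb : 0 < b) {t : ℝ} (ht : t ∈ Ioo 0 S.T) (y : ℝ × ℝ) :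
    S.avg (fun ξ => ξ 2) t (pnt y b) = -∫ s in Ioc 0 b, S.fluxDiv t (pnt y s) := by
  have h1 := h.mass_from_boundary hε hρ hb ht y
  rw [h.mom_normal_eq hε hρ ht (by simpa using hb)] at h1
  have h2 := h.sm_flN.integral_normal ht y hb.le
  rw [intervalIntegral.integral_of_le hb.le] at h2
  have h3 : S.flN t (pnt y 0) = 0 := by simp [flN, h.Uc_boundary ht]
  rw [h3, sub_zero] at h2
  have i1 := fun i => ((h.tbdd_mom_wT hε hρ i).deriv i).integrable_normal ht y b
  have i2 := (TBdd.px_two (ε := S.ε) h.sm_flN).integrable_normal ht y b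
  have h4 : ∫ s in Ioc 0 b, S.ε * S.δ * S.fluxDiv t (pnt y s)
      = (∑ i, ∫ s in Ioc 0 b, dT S.ε i (S.mom (wT i)) t (pnt y s))
        + ∫ s in Ioc 0 b, px 2 S.flN t (pnt y s) := by
    rw [← integral_finsetSum _ fun i _ => i1 i,
      ← integral_add (integrable_finsetSum _ fun i _ => i1 i) i2]
    refine setIntegral_congr_fun measurableSet_Ioc fun s hs => ?_
    have hp : 0 < pnt y s 2 := by simpa using hs.1
    simp only [h.dT_mom hε hρ ht hp, Finset.sum_add_distrib, fluxDiv, ← Finset.mul_sum]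
    have := h.sum_dT_fluid ht hp
    linear_combination -this
  rw [integral_const_mul, h2] at h4
  have hεδ : S.ε * S.δ ≠ 0 := mul_ne_zero h.eps_pos.ne' h.delta_pos.ne'
  apply mul_left_cancel₀ hεδ
  linear_combination h1 + h4

/-- The normal mass flux of `∂^α (f √μ)` at height `b`, as an integral over the heights below. -/
lemma D_avg_normal_eq (α : MI) {b : ℝ} (hb : 0 < b) {t : ℝ} (ht : t ∈ Ioo 0 S.T) (y : ℝ × ℝ) :
    S.D α (S.avg fun ξ => ξ 2) t (pnt y b) = -∫ s in Ioc 0 b, S.D α S.fluxDiv t (pnt y s) := by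
  have hG := h.tbdd_fluxDiv hε hρ
  have h1 : TEq S.T b (S.avg fun ξ => ξ 2)
      fun t x => (-1) * ∫ s in Ioc 0 b, S.fluxDiv t (pnt (x 0, x 1) s) := by
    intro t ht x hx
    have := h.avg_normal_eq hε hρ hb ht (x 0, x 1)
    rw [← hx, pnt_eta] at this
    rw [this, hx]; ring
  have h2 := (h1.derivMI (ε := S.ε) α).trans
    ((hG.tsm_integral h.eps_pos.ne' b b le_rfl).pMI_const_mul (-1) α)
  have h3 := hG.pMI_integral h.eps_pos.ne' b b le_rfl α t ht (pnt y b) (by simp)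
  have h4 := h2 t ht (pnt y b) (by simp)
  simp only [] at h3 h4
  rw [h3] at h4
  simpa using h4

/-- The integrand of the mass flux: tangential derivatives of moments of `f √μ`, and fluid terms. -/
lemma D_fluxDiv_eq (α : MI) {t : ℝ} (ht : t ∈ Ioo 0 S.T) {x : V3} (hx : 0 < x 2) :
    S.D α S.fluxDiv t x = (∑ i, ∫ ξ, wT i ξ * S.D (α + Pi.single i 1) (S.fs ξ) t x)
      + (S.δ⁻¹ * S.D α S.divU t x + (S.ε ^ 2 / S.δ * S.D α S.transP t x
        + S.ε ^ 2 / S.δ * px 2 (S.D α S.PU3) t x)) := by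
  have s1 := fun i => ((h.tbdd_avg_wT hε hρ i).deriv i).smooth _ hx
  have s2 := h.tbdd_divU.smooth _ hx
  have s3 := h.tbdd_transP.smooth _ hx
  have s4 := (TBdd.px_two (ε := S.ε) h.sm_PU3).smooth _ hx
  have c2 := (h.tbdd_divU.const_mul S.δ⁻¹).smooth _ hx
  have c3 := (h.tbdd_transP.const_mul (S.ε ^ 2 / S.δ)).smooth _ hx
  have c4 := ((TBdd.px_two (ε := S.ε) h.sm_PU3).const_mul (S.ε ^ 2 / S.δ)).smooth _ hx
  have e1 := (TSm.sum (s := Finset.univ) fun i _ => s1 i).pMI_add (ε := S.ε) (c2.add (c3.add c4))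
    α t ht x rfl
  have e2 := TSm.pMI_sum (ε := S.ε) Finset.univ (fun i _ => s1 i) α t ht x rfl
  have e3 := c2.pMI_add (ε := S.ε) (c3.add c4) α t ht x rfl
  have e4 := c3.pMI_add (ε := S.ε) c4 α t ht x rfl
  have e5 := s2.pMI_const_mul (ε := S.ε) S.δ⁻¹ α t ht x rfl
  have e6 := s3.pMI_const_mul (ε := S.ε) (S.ε ^ 2 / S.δ) α t ht x rfl
  have e7 := s4.pMI_const_mul (ε := S.ε) (S.ε ^ 2 / S.δ) α t ht x rfl
  have e8 : px 2 (S.D α S.PU3) t x = pMI S.ε α (px 2 S.PU3) t x :=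
    h.sm_PU3.px_two_pMI hx α t ht x rfl
  have e9 : ∀ i, pMI S.ε α (dT S.ε i (S.avg (wT i))) t x
      = ∫ ξ, wT i ξ * S.D (α + Pi.single i 1) (S.fs ξ) t x := fun i => by
    rw [← ((h.tbdd_avg_wT hε hρ i).smooth _ hx).pMI_add_single α i t ht x rfl]
    exact h.D_avg (continuous_wT i) (abs_wT_le i) hε hρ _ ht hx
  have e0 : S.D α S.fluxDiv t x = _ := e1
  rw [e0]
  simp only [] at e2 e3 e4 e5 e6 e7 ⊢
  rw [e2, e3, e4, e5, e6, e7, e8]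
  simp only [e9]

omit hε hρ in
/-- Leibniz' rule for `∂^α ∂_i (f √μ)`, with the derivative `∂_i` on either factor. -/
lemma D_fs_add_single (α : MI) (i : Fin 3) {t : ℝ} (ht : t ∈ Ioo 0 S.T) {x ξ : V3} (hx : 0 < x 2)
    (hξ : ξ 2 ≠ 0) : S.D (α + Pi.single i 1) (S.fs ξ) t x = ∑ γ ∈ Finset.Iic α, (α.binom γ : ℝ) *
      (S.fd (α - γ + Pi.single i 1) t x ξ * S.dSqrtMu γ ξ t x
        + S.fd (α - γ) t x ξ * dT S.ε i (S.dSqrtMu γ ξ) t x) := by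
  have hf := h.tsm_f hx hξ
  have hs := h.tsm_sqrtMu ξ hx.le
  have e1 := (h.tsm_fs hx hξ).pMI_add_single (ε := S.ε) α i t ht x rfl
  have e2 := (hf.dT_mul (ε := S.ε) hs i).derivMI (ε := S.ε) α t ht x rfl
  have e3 := ((hf.deriv (ε := S.ε) i).mul hs).pMI_add (ε := S.ε)
    (hf.mul (hs.deriv (ε := S.ε) i)) α t ht x rfl
  have e4 := (hf.deriv (ε := S.ε) i).pMI_mul (ε := S.ε) hs α ht rfl
  have e5 := hf.pMI_mul (ε := S.ε) (hs.deriv (ε := S.ε) i) α ht rfl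
  have e0 : S.D (α + Pi.single i 1) (S.fs ξ) t x = _ := e1.trans (e2.trans e3)
  rw [e0]
  simp only []
  rw [e4, e5, ← Finset.sum_add_distrib]
  refine Finset.sum_congr rfl fun γ _ => ?_
  rw [← hf.pMI_add_single (α - γ) i t ht x rfl, hs.pMI_dT γ i t ht x rfl, ← mul_add]
  rfl

end Admissible

end Config

/-! ### Velocity averages in `L²` and commutators with `√μ` -/

/-- Cauchy–Schwarz in the velocity variable. -/
lemma eLpNorm_integral_le {G F : V3 × V3 → ℝ} {k : V3 × V3 → ℝ≥0∞} {N : ℝ≥0∞}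
    (hF : AEStronglyMeasurable F mXV) (hk : AEMeasurable k mXV)
    (hG : ∀ᵐ p ∂mXV, ‖G p‖ₑ ≤ ‖F p‖ₑ * k p)
    (hN : ∀ᵐ x ∂mX, ∫⁻ ξ, k (x, ξ) ^ 2 ≤ N ^ 2) :
    eLpNorm (fun x => ∫ ξ, G (x, ξ)) 2 mX ≤ N * eLpNorm F 2 mXV := by
  have h1 : ∀ᵐ x ∂mX, ‖∫ ξ, G (x, ξ)‖ₑ ^ 2 ≤ N ^ 2 * ∫⁻ ξ, ‖F (x, ξ)‖ₑ ^ 2 := by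
    have hF' : ∀ᵐ x ∂mX, AEMeasurable (fun ξ => ‖F (x, ξ)‖ₑ) volume :=
      hF.prodMk_left.mono fun x hx => hx.enorm
    have hk' : ∀ᵐ x ∂mX, AEMeasurable (fun ξ => k (x, ξ)) volume := by
      obtain ⟨k', m', e'⟩ := hk
      filter_upwards [Measure.ae_ae_of_ae_prod e'] with x hx
      exact ⟨fun ξ => k' (x, ξ), m'.comp measurable_prodMk_left, hx⟩
    filter_upwards [hF', hk', Measure.ae_ae_of_ae_prod hG, hN] with x f1 f2 f3 f4
    calc ‖∫ ξ, G (x, ξ)‖ₑ ^ 2 ≤ (∫⁻ ξ, ‖F (x, ξ)‖ₑ * k (x, ξ)) ^ 2 := by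
          gcongr
          exact (enorm_integral_le_lintegral_enorm _).trans (lintegral_mono_ae f3)
      _ ≤ (∫⁻ ξ, ‖F (x, ξ)‖ₑ ^ 2) * ∫⁻ ξ, k (x, ξ) ^ 2 := lintegral_mul_sq_le f1 f2
      _ ≤ _ := by rw [mul_comm]; gcongr
  have h2 : eLpNorm (fun x => ∫ ξ, G (x, ξ)) 2 mX ^ 2 ≤ (N * eLpNorm F 2 mXV) ^ 2 := by
    rw [eLpNorm_two_sq, mul_pow, eLpNorm_two_sq]
    unfold mXV at hF ⊢
    rw [lintegral_prod _ (hF.enorm.pow_const 2)]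
    have hm : AEMeasurable (fun x => ∫⁻ ξ, ‖F (x, ξ)‖ₑ ^ 2) mX :=
      (hF.enorm.pow_const 2).lintegral_prod_right'
    calc _ ≤ ∫⁻ x, N ^ 2 * ∫⁻ ξ, ‖F (x, ξ)‖ₑ ^ 2 ∂volume ∂mX := lintegral_mono_ae h1
      _ = _ := lintegral_const_mul'' _ hm
  exact (ENNReal.pow_le_pow_left_iff two_ne_zero).1 h2

/-- The interior of the fundamental cell. -/
def cellInt : Set V3 := {x | x 0 ∈ Ioo (0 : ℝ) 1 ∧ x 1 ∈ Ioo (0 : ℝ) 1 ∧ 0 < x 2}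

lemma isOpen_cellInt : IsOpen cellInt :=
  ((isOpen_Ioo.preimage (continuous_coord 0)).inter
    ((isOpen_Ioo.preimage (continuous_coord 1)).inter (isOpen_Ioi.preimage (continuous_coord 2))))

lemma cellInt_subset : cellInt ⊆ cell := fun _ hx =>
  ⟨Ioo_subset_Ico_self hx.1, Ioo_subset_Ico_self hx.2.1, hx.2.2⟩

lemma ae_coord_ne (i : Fin 3) (a : ℝ) : ∀ᵐ x : V3, x i ≠ a := by
  have hq : Measure.QuasiMeasurePreserving (fun x : V3 => x i) volume volume :=
    (Measure.quasiMeasurePreserving_eval (fun _ : Fin 3 => (volume : Measure ℝ)) i).comp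
      (EuclideanSpace.volume_preserving_symm_measurableEquiv_toLp (Fin 3)).quasiMeasurePreserving
  exact hq.ae (Measure.ae_ne volume a)

lemma ae_mem_cellInt : ∀ᵐ x ∂mX, x ∈ cellInt := by
  unfold mX
  filter_upwards [ae_restrict_mem measurableSet_cell, ae_restrict_of_ae (ae_coord_ne 0 0),
    ae_restrict_of_ae (ae_coord_ne 1 0)] with x hx h0 h1
  exact ⟨⟨lt_of_le_of_ne hx.1.1 h0.symm, hx.1.2⟩, ⟨lt_of_le_of_ne hx.2.1.1 h1.symm, hx.2.1.2⟩,
    hx.2.2⟩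

lemma aesm_mX {T : ℝ} {t : ℝ} (ht : t ∈ Ioo 0 T) {g : ℝ → V3 → ℝ} (hg : MeasX T g) :
    AEStronglyMeasurable (g t) mX := by
  refine hg.aestronglyMeasurable (φ := fun x => (t, x)) (by fun_prop) ?_
  filter_upwards [ae_mem_cellInt] with x hx using ⟨ht, hx.2.2⟩

/-- An almost everywhere bound of a function continuous on the cell holds at every interior
point. -/
lemma le_of_ae_mX {u : V3 → ℝ} {B : ℝ} (hu : ContinuousOn u cellInt) (hB : ∀ᵐ x ∂mX, u x ≤ B) :
    ∀ x ∈ cellInt, u x ≤ B := by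
  intro x hx
  by_contra! hlt
  have ho : IsOpen (cellInt ∩ u ⁻¹' Ioi B) := hu.isOpen_inter_preimage isOpen_cellInt isOpen_Ioi
  have h1 : (volume : Measure V3) (cellInt ∩ u ⁻¹' Ioi B) = 0 := by
    have h2 : ∀ᵐ x : V3, ¬ x ∈ cellInt ∩ u ⁻¹' Ioi B := by
      filter_upwards [(ae_restrict_iff' measurableSet_cell).1 hB] with x hx h3
      exact absurd (hx (cellInt_subset h3.1)) (not_le.2 h3.2)
    rw [ae_iff] at h2
    simpa only [not_not, ofPred_mem_eq] using h2
  exact (ho.measure_pos volume ⟨x, hx, hlt⟩).ne' h1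

lemma ae_wInf_bound {c t : ℝ} {g : V3 → ℝ → V3 → ℝ} {N : ℝ} (hN0 : 0 ≤ N)
    (hN : Config.wInf c g t ≤ ofReal N) :
    ∀ᵐ p ∂mXV, |g p.2 t p.1| ≤ N * exp (-c * ‖p.2‖ ^ 2) := by
  unfold Config.wInf at hN
  rw [eLpNorm_exponent_top] at hN
  filter_upwards [enorm_ae_le_eLpNormEssSup
    (fun p : V3 × V3 => exp (c * ‖p.2‖ ^ 2) * g p.2 t p.1) mXV] with p hp
  have h1 := hp.trans hN
  rw [Real.enorm_eq_ofReal_abs, ENNReal.ofReal_le_ofReal_iff hN0, abs_mul,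
    abs_of_pos (Real.exp_pos _)] at h1
  rw [neg_mul, Real.exp_neg, ← div_eq_mul_inv, le_div_iff₀ (Real.exp_pos _), mul_comm]
  exact h1

lemma pnt_mem_cellInt {x : V3} (hx : x ∈ cellInt) {s : ℝ} (hs : 0 < s) :
    pnt (x 0, x 1) s ∈ cellInt := by
  refine ⟨?_, ?_, ?_⟩
  · simpa [pnt] using hx.1
  · simpa [pnt] using hx.2.1
  · simpa [pnt] using hs

namespace Config

variable {S : Config} {K τU ρ : ℝ}

variable (S) in
lemma dSqrtMu_zero (ξ : V3) : S.dSqrtMu 0 ξ = fun t x => S.sqrtMu t x ξ := rfl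

namespace Admissible

variable (h : S.Admissible K τU ρ)
include h

lemma nMu_ne_top {c : ℝ} (hc : c < 1 / 4) (hε : S.ε ≤ 1) {t : ℝ} (ht : t ∈ Ioo 0 S.T) {γ : MI}
    (hγ : γ ≠ 0) : S.nMu c γ t ≠ ⊤ := by
  obtain ⟨M, hM0, hM⟩ := wgt_le_exp K hc
  exact ne_top_of_le_ne_top ENNReal.ofReal_ne_top (h.nMu_le hM hM0 ht hε hγ)

lemma dSqrtMu_boundary {γ : MI} (hγ : γ ≠ 0) (ξ : V3) {t : ℝ} (ht : t ∈ Ioo 0 S.T) {x : V3}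
    (hx : x 2 = 0) : S.dSqrtMu γ ξ t x = 0 := by
  have h1 : TEq S.T 0 (fun t x => S.sqrtMu t x ξ) fun _ _ => √(mu0 ξ) := by
    intro t ht x hx
    simp [sqrtMu, mu, phi, h.flow.no_slip t ht x hx]
  obtain ⟨i, hi⟩ : ∃ i, γ i ≠ 0 := by
    by_contra! hcon
    exact hγ (funext hcon)
  have h2 : γ = (γ - Pi.single i 1) + Pi.single i 1 := by
    rw [tsub_add_cancel_of_le]
    intro j
    by_cases hj : j = i
    · subst hj; simpa using Nat.one_le_iff_ne_zero.2 hi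
    · simp [hj]
  have h3 : TEq S.T 0 (dT S.ε i fun t x => S.sqrtMu t x ξ) fun _ _ => 0 := by
    refine (h1.deriv (ε := S.ε) i).trans fun t ht x hx => ?_
    fin_cases i <;> simp [dT, pt, px, lineDeriv]
  have h4 := (h.tsm_sqrtMu ξ le_rfl).pMI_add_single (ε := S.ε) (γ - Pi.single i 1) i
  rw [← h2] at h4
  exact (h4.trans (h3.pMI_eq_zero _)) t ht x hx

/-- The commutator kernels `∂^γ √μ`, `γ ≠ 0`, vanish at the boundary, hence are `O(x₃)`. -/
lemma ae_commutator_le {c : ℝ} (hc : c < 1 / 4) (hε : S.ε ≤ 1) {t : ℝ} (ht : t ∈ Ioo 0 S.T)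
    {γ : MI} (hγ : γ ≠ 0) : ∀ᵐ p ∂mXV, |S.dSqrtMu γ p.2 t p.1|
      ≤ p.1 2 * ((S.nMu c γ t).toReal * exp (-c * ‖p.2‖ ^ 2)) := by
  have hfin := h.nMu_ne_top hc hε ht hγ
  have h1 : wInf c (fun ξ => px 2 (S.dSqrtMu γ ξ)) t
      ≤ ofReal (S.nMu c γ t).toReal := by
    rw [ENNReal.ofReal_toReal hfin]
    refine le_add_left ?_
    exact Finset.single_le_sum (f := fun i => wInf c (fun ξ => px i (S.dSqrtMu γ ξ)) t)
      (fun _ _ => zero_le) (Finset.mem_univ 2)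
  have h2 := ae_wInf_bound ENNReal.toReal_nonneg h1
  have h3 : ∀ᵐ ξ : V3, ∀ᵐ x ∂mX, |px 2 (S.dSqrtMu γ ξ) t x|
      ≤ (S.nMu c γ t).toReal * exp (-c * ‖ξ‖ ^ 2) := by
    have h5 : ∀ᵐ p ∂(volume : Measure V3).prod mX, |px 2 (S.dSqrtMu γ p.1) t p.2|
      ≤ (S.nMu c γ t).toReal * exp (-c * ‖p.1‖ ^ 2) :=
      (Measure.measurePreserving_swap (μ := (volume : Measure V3)) (ν := mX)).quasiMeasurePreserving.ae
        h2
    exact Measure.ae_ae_of_ae_prod h5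
  have h4 : ∀ᵐ ξ : V3, ∀ x ∈ cellInt, |S.dSqrtMu γ ξ t x|
      ≤ x 2 * ((S.nMu c γ t).toReal * exp (-c * ‖ξ‖ ^ 2)) := by
    filter_upwards [h3] with ξ hξ x hx
    have hs : SSm S.T (S.dSqrtMu γ ξ) := (h.sm_sqrtMu ξ).derivMI γ
    have hc' : ContinuousOn (fun x => |px 2 (S.dSqrtMu γ ξ) t x|) cellInt :=
      ((continuousOn_px 2 hs).comp (Continuous.prodMk_right t).continuousOn
        fun x hx => ⟨ht, hx.2.2⟩).abs
    have h5 := le_of_ae_mX hc' hξ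
    have h6 := hs.integral_normal ht (x 0, x 1) hx.2.2.le
    have e1 : S.dSqrtMu γ ξ t (pnt (x 0, x 1) 0) = 0 := h.dSqrtMu_boundary hγ ξ ht (by simp)
    rw [e1, sub_zero, pnt_eta] at h6
    rw [← h6, ← Real.norm_eq_abs]
    refine (intervalIntegral.norm_integral_le_of_norm_le_const (C :=
      (S.nMu c γ t).toReal * exp (-c * ‖ξ‖ ^ 2)) fun s hs => ?_).trans_eq ?_
    · rw [uIoc_of_le hx.2.2.le] at hs
      exact h5 _ (pnt_mem_cellInt hx hs.1)
    · rw [sub_zero, abs_of_pos hx.2.2, mul_comm]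
  have q1 : ∀ᵐ p ∂mXV, p.1 ∈ cellInt := Measure.quasiMeasurePreserving_fst.ae ae_mem_cellInt
  have q2 := (Measure.quasiMeasurePreserving_snd (μ := mX) (ν := (volume : Measure V3))).ae h4
  filter_upwards [q1, q2] with p h5 h6 using h6 _ h5

lemma ae_dSqrtMu_le {c : ℝ} (hc : c < 1 / 4) (hε : S.ε ≤ 1) {t : ℝ} (ht : t ∈ Ioo 0 S.T)
    {γ : MI} (hγ : γ ≠ 0) : ∀ᵐ p ∂mXV,
      |S.dSqrtMu γ p.2 t p.1| ≤ (S.nMu c γ t).toReal * exp (-c * ‖p.2‖ ^ 2) := by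
  have hfin := h.nMu_ne_top hc hε ht hγ
  refine ae_wInf_bound ENNReal.toReal_nonneg ?_
  rw [ENNReal.ofReal_toReal hfin]
  exact (le_add_right le_rfl).trans (le_add_right le_rfl)

lemma ae_dT_dSqrtMu_le {c : ℝ} (hc : c < 1 / 4) (hε : S.ε ≤ 1) {t : ℝ} (ht : t ∈ Ioo 0 S.T)
    {γ : MI} (hγ : γ ≠ 0) (i : Fin 3) : ∀ᵐ p ∂mXV,
      |dT S.ε i (S.dSqrtMu γ p.2) t p.1| ≤ (S.nMu c γ t).toReal * exp (-c * ‖p.2‖ ^ 2) := by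
  have hfin := h.nMu_ne_top hc hε ht hγ
  refine ae_wInf_bound (g := fun ξ => dT S.ε i (S.dSqrtMu γ ξ)) ENNReal.toReal_nonneg ?_
  rw [ENNReal.ofReal_toReal hfin]
  have key : ∀ j : Fin 3, wInf c (fun ξ => px j (S.dSqrtMu γ ξ)) t ≤ S.nMu c γ t := fun j =>
    le_add_left (Finset.single_le_sum (f := fun i => wInf c (fun ξ => px i (S.dSqrtMu γ ξ)) t)
      (fun _ _ => zero_le) (Finset.mem_univ j))
  fin_cases i
  · exact (le_add_left le_rfl).trans (le_add_right le_rfl)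
  · exact key 0
  · exact key 1

end Admissible

end Config

/-! ### The Hardy bound of the normal momentum -/

lemma sum_Iic_eq_add_filter {M : Type*} [AddCommMonoid M] (α : MI) (u : MI → M) :
    ∑ γ ∈ Finset.Iic α, u γ = u 0 + ∑ γ ∈ (Finset.Iic α).filter (fun γ => γ ≠ 0), u γ := by
  classical
  have h0 : (0 : MI) ∈ Finset.Iic α := by simp
  rw [Finset.filter_ne', Finset.add_sum_erase _ _ h0]

lemma MI.binom_zero (α : MI) : α.binom 0 = 1 := by simp [MI.binom]

lemma lintegral_ofReal_sq_eq {k : V3 → ℝ} (hk : ∀ ξ, 0 ≤ k ξ) (hi : Integrable fun ξ => k ξ ^ 2) :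
    ∫⁻ ξ, ofReal (k ξ) ^ 2 = ofReal √(∫ ξ, k ξ ^ 2) ^ 2 := by
  rw [← ENNReal.ofReal_pow (Real.sqrt_nonneg _),
    Real.sq_sqrt (integral_nonneg fun ξ => sq_nonneg _),
    ofReal_integral_eq_lintegral_ofReal hi (Filter.Eventually.of_forall fun ξ => sq_nonneg _)]
  simp only [ENNReal.ofReal_pow (hk _)]

/-- `‖(1 + |ξ|) e^{-c|ξ|²}‖_{L²}`. -/
def velC (c : ℝ) : ℝ := √(∫ ξ : V3, ((1 + ‖ξ‖) * exp (-c * ‖ξ‖ ^ 2)) ^ 2)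

/-- `‖(1 + |φ|) √μ₀‖_{L²}`. -/
def momC : ℝ := √(∫ ξ : V3, ((1 + ‖ξ‖) * √(mu0 ξ)) ^ 2)

lemma integrable_velC {c : ℝ} (hc : 0 < c) :
    Integrable fun ξ : V3 => ((1 + ‖ξ‖) * exp (-c * ‖ξ‖ ^ 2)) ^ 2 := by
  refine (integrable_pow_mul_exp (a := 2 * c) (by positivity) 2).congr
    (Filter.Eventually.of_forall fun ξ => ?_)
  simp only []
  rw [mul_pow, ← Real.exp_nat_mul]
  congr 2; push_cast; ring

lemma integrable_momC : Integrable fun ξ : V3 => ((1 + ‖ξ‖) * √(mu0 ξ)) ^ 2 := by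
  refine (integrable_pow_mul_mu0 2).congr (Filter.Eventually.of_forall fun ξ => ?_)
  simp only [mul_pow, Real.sq_sqrt (mu0_pos ξ).le]

lemma aesm_avg {T : ℝ} {t : ℝ} (ht : t ∈ Ioo 0 T) {k : ℝ → V3 → V3 → ℝ} (hk : MeasOn T k) :
    AEStronglyMeasurable (fun x => ∫ ξ, k t x ξ) mX := by
  refine hk.integral.aestronglyMeasurable (φ := fun x => (t, x)) (by fun_prop) ?_
  filter_upwards [ae_mem_cellInt] with x hx using ⟨ht, hx.2.2⟩

namespace Config

variable {S : Config} {K τU ρ : ℝ}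

namespace Admissible

variable (h : S.Admissible K τU ρ)
include h

lemma integrable_fd_mul (hρ : 0 < ρ) (β : MI) {t : ℝ} (ht : t ∈ Ioo 0 S.T) {x : V3} (hx : 0 < x 2)
    {k : ℝ → V3 → V3 → ℝ} (hk : MeasOn S.T k) {B : ℝ} {n : ℕ}
    (hB : ∀ ξ, |k t x ξ| ≤ B * (1 + ‖ξ‖) ^ n) :
    Integrable fun ξ => S.fd β t x ξ * k t x ξ := by
  obtain ⟨M, hM⟩ := h.sol.decay β
  refine ((integrable_pow_mul_exp hρ n).const_mul (|M| * B)).mono'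
    (aesm_vel ht hx ((h.measOn_fd β).mul hk)) ?_
  filter_upwards [ae_normal_ne] with ξ hξ
  have h1 := hM t ht x ξ hx hξ
  rw [norm_mul, Real.norm_eq_abs, Real.norm_eq_abs]
  calc _ ≤ (|M| * exp (-ρ * ‖ξ‖ ^ 2)) * (B * (1 + ‖ξ‖) ^ n) := by
        refine mul_le_mul (h1.trans ?_) (hB ξ) (abs_nonneg _) (by positivity)
        gcongr; exact le_abs_self M
    _ = _ := by ring

lemma ssm_dSqrtMu (γ : MI) (ξ : V3) : SSm S.T (S.dSqrtMu γ ξ) := (h.sm_sqrtMu ξ).derivMI γ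

lemma measOn_dT_dSqrtMu (γ : MI) (i : Fin 3) :
    MeasOn S.T fun t x ξ => dT S.ε i (S.dSqrtMu γ ξ) t x :=
  (h.measOn_dSqrtMu γ).deriv (fun _ hz ξ _ => (h.ssm_dSqrtMu γ ξ).tsm hz.le) i

omit h in
lemma measOn_vel {w : V3 → ℝ} (hw : Continuous w) : MeasOn S.T fun _ _ ξ => w ξ :=
  MeasOn.of_measurable (hw.measurable.comp (measurable_snd.comp measurable_snd))

lemma exists_abs_dSqrtMu_le (hε : S.ε ≤ 1) (γ : MI) : ∃ B : ℝ, 0 ≤ B ∧ ∀ t ∈ Ioo 0 S.T, ∀ x ξ : V3,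
    0 < x 2 → |S.dSqrtMu γ ξ t x| ≤ B ∧ ∀ i, |dT S.ε i (S.dSqrtMu γ ξ) t x| ≤ B := by
  obtain ⟨M, hM0, hM⟩ := wgt_le_exp K (c := 0) (by norm_num)
  have hM' : ∀ ξ, wgt K ξ ≤ M := fun ξ => by simpa using hM ξ
  have hr := h.radius_pos
  have hs := h.sqrtκ_pos
  have he := h.eps_pos
  refine ⟨γ.fact / (3 / 4 * τU) ^ γ.deg * M + γ.fact / (3 / 4 * τU) ^ γ.deg
    * (S.ε / √S.κ * |cA K| * M), by positivity, fun t ht x ξ hx => ⟨?_, fun i => ?_⟩⟩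
  · refine (h.abs_D_sqrtMu_le ht hx hε γ ξ).trans (le_trans ?_ (le_add_of_nonneg_right
      (by positivity)))
    gcongr; exact hM' ξ
  · refine (h.abs_dT_D_sqrtMu_le ht hx hε γ ξ i).trans (le_trans ?_ (le_add_of_nonneg_left
      (by positivity)))
    gcongr
    · exact (wgt_pos K ξ).le
    · exact le_abs_self _
    · exact hM' ξ

variable {w : V3 → ℝ} (hw : Continuous w) (hwb : ∀ ξ, |w ξ| ≤ 1 + ‖ξ‖) (hε : S.ε ≤ 1) (hρ : 0 < ρ)
include hwb

/-- `L²` bound of the velocity average of `f_β` against a kernel with Gaussian decay. -/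
lemma eLpNorm_avg_le {c : ℝ} (hc : 0 < c) {t : ℝ} (ht : t ∈ Ioo 0 S.T) (β : MI)
    {q : V3 × V3 → ℝ} {N : ℝ} (hN : 0 ≤ N)
    (hq : ∀ᵐ p ∂mXV, |q p| ≤ N * exp (-c * ‖p.2‖ ^ 2)) :
    eLpNorm (fun x => ∫ ξ, w ξ * (S.fd β t x ξ * q (x, ξ))) 2 mX
      ≤ ofReal (velC c) * ofReal N * S.nf β t := by
  have hi := integrable_velC hc
  refine eLpNorm_integral_le (G := fun p => w p.2 * (S.fd β t p.1 p.2 * q p))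
    (k := fun p => ofReal (N * ((1 + ‖p.2‖) * exp (-c * ‖p.2‖ ^ 2))))
    (aesm_mXV ht (h.measOn_fd β)) (by fun_prop) ?_ (Filter.Eventually.of_forall fun x => ?_)
  · filter_upwards [hq] with p hp
    rw [Real.enorm_eq_ofReal_abs, Real.enorm_eq_ofReal_abs, ← ENNReal.ofReal_mul (abs_nonneg _)]
    refine ENNReal.ofReal_le_ofReal ?_
    rw [abs_mul, abs_mul]
    calc _ ≤ (1 + ‖p.2‖) * (|S.fd β t p.1 p.2| * (N * exp (-c * ‖p.2‖ ^ 2))) := by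
          gcongr; exact hwb _
      _ = _ := by ring
  · have e1 := lintegral_ofReal_sq_eq (fun ξ : V3 => by positivity) hi
    simp only [ENNReal.ofReal_mul hN, mul_pow]
    rw [lintegral_const_mul _ (by fun_prop), e1, mul_comm]
    rfl

/-- `L²` bound of the velocity average of `f_β` against `√μ`. -/
lemma eLpNorm_avg_sqrtMu_le {t : ℝ} (ht : t ∈ Ioo 0 S.T) (β : MI) :
    eLpNorm (fun x => ∫ ξ, w ξ * (S.fd β t x ξ * S.sqrtMu t x ξ)) 2 mX
      ≤ ofReal ((1 + S.ε * K) * momC) * S.nf β t := by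
  have hi := integrable_momC
  have hK := h.K_nonneg ht
  have he := h.eps_pos
  have hB : 0 ≤ 1 + S.ε * K := by positivity
  have hk : MeasOn S.T fun t x ξ => (1 + S.ε * K) * ((1 + ‖S.phi t x ξ‖) * √(mu0 (S.phi t x ξ))) :=
    h.measOn_comp_phi (g := fun v => (1 + S.ε * K) * ((1 + ‖v‖) * √(mu0 v)))
      (by have := continuous_mu0; fun_prop)
  refine eLpNorm_integral_le (G := fun p => w p.2 * (S.fd β t p.1 p.2 * S.sqrtMu t p.1 p.2))
    (k := fun p => ofReal ((1 + S.ε * K) *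
      ((1 + ‖S.phi t p.1 p.2‖) * √(mu0 (S.phi t p.1 p.2)))))
    (aesm_mXV ht (h.measOn_fd β)) (aesm_mXV ht hk).aemeasurable.ennreal_ofReal ?_
    (Filter.Eventually.of_forall fun x => ?_)
  · filter_upwards [ae_mXV_pos] with p hp
    rw [Real.enorm_eq_ofReal_abs, Real.enorm_eq_ofReal_abs, ← ENNReal.ofReal_mul (abs_nonneg _)]
    refine ENNReal.ofReal_le_ofReal ?_
    have h1 : ‖S.U t p.1‖ ≤ K := by
      have := h.flow.bound t ht p.1 hp 0
      simpa [MI.deg, MI.fact] using this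
    have h2 : 1 + ‖p.2‖ ≤ (1 + S.ε * K) * (1 + ‖S.phi t p.1 p.2‖) := by
      have := one_add_norm_shift_le (S.phi t p.1 p.2) (S.ε • S.U t p.1)
      rw [phi, sub_add_cancel, norm_smul, Real.norm_of_nonneg he.le] at this
      refine this.trans ?_
      rw [← phi]
      gcongr
    rw [abs_mul, abs_mul, abs_of_nonneg (show 0 ≤ S.sqrtMu t p.1 p.2 from Real.sqrt_nonneg _)]
    calc _ ≤ ((1 + S.ε * K) * (1 + ‖S.phi t p.1 p.2‖)) *
          (|S.fd β t p.1 p.2| * S.sqrtMu t p.1 p.2) := by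
          have : 0 ≤ S.sqrtMu t p.1 p.2 := Real.sqrt_nonneg _
          gcongr
          exact (hwb _).trans h2
      _ = _ := by simp only [sqrtMu, mu]; ring
  · have e1 := lintegral_ofReal_sq_eq (fun ξ : V3 => by positivity) hi
    have e2 := lintegral_sub_right_eq_self (μ := (volume : Measure V3))
      (fun ξ : V3 => ofReal ((1 + S.ε * K) * ((1 + ‖ξ‖) * √(mu0 ξ))) ^ 2) (S.ε • S.U t x)
    simp only [phi]
    rw [e2]
    have := continuous_mu0
    simp only [ENNReal.ofReal_mul hB, mul_pow]
    rw [lintegral_const_mul _ (by fun_prop)]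
    rw [e1]; rfl

end Admissible

end Config

namespace Config

variable {S : Config} {K τU ρ : ℝ}

namespace Admissible

variable (h : S.Admissible K τU ρ)
include h

lemma abs_Uc_le {t : ℝ} (ht : t ∈ Ioo 0 S.T) {x : V3} (hx : 0 < x 2) : ‖S.U t x‖ ≤ K := by
  have := h.flow.bound t ht x hx 0
  simpa [MI.deg, MI.fact] using this

section
variable {w : V3 → ℝ} (hw : Continuous w) (hwb : ∀ ξ, |w ξ| ≤ 1 + ‖ξ‖) (hε : S.ε ≤ 1) (hρ : 0 < ρ)
include hw hwb hε hρ

lemma integrable_w_fd_dSqrtMu (β γ : MI) {t : ℝ} (ht : t ∈ Ioo 0 S.T) {x : V3} (hx : 0 < x 2) :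
    Integrable (fun ξ => w ξ * (S.fd β t x ξ * S.dSqrtMu γ ξ t x)) ∧
    ∀ i, Integrable fun ξ => w ξ * (S.fd β t x ξ * dT S.ε i (S.dSqrtMu γ ξ) t x) := by
  obtain ⟨B, hB0, hB⟩ := h.exists_abs_dSqrtMu_le hε γ
  have key : ∀ k : ℝ → V3 → V3 → ℝ, MeasOn S.T k → (∀ ξ, |k t x ξ| ≤ B) →
      Integrable fun ξ => w ξ * (S.fd β t x ξ * k t x ξ) := fun k hk hkB => by
    refine (h.integrable_fd_mul hρ β ht hx (k := fun t x ξ => w ξ * k t x ξ)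
      ((measOn_vel hw).mul hk) (B := B) (n := 1) fun ξ => ?_).congr
      (Filter.Eventually.of_forall fun ξ => by ring)
    rw [abs_mul, pow_one, mul_comm]
    gcongr
    · exact hkB ξ
    · exact hwb ξ
  exact ⟨key _ (h.measOn_dSqrtMu γ) fun ξ => (hB t ht x ξ hx).1,
    fun i => key _ (h.measOn_dT_dSqrtMu γ i) fun ξ => (hB t ht x ξ hx).2 i⟩

lemma integral_w_D_fs (α : MI) {t : ℝ} (ht : t ∈ Ioo 0 S.T) {x : V3} (hx : 0 < x 2) :
    ∫ ξ, w ξ * S.D α (S.fs ξ) t x = ∑ γ ∈ Finset.Iic α, (α.binom γ : ℝ) *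
      ∫ ξ, w ξ * (S.fd (α - γ) t x ξ * S.dSqrtMu γ ξ t x) := by
  simp only [← integral_const_mul]
  rw [← integral_finsetSum _ fun γ _ => ((h.integrable_w_fd_dSqrtMu hw hwb hε hρ (α - γ) γ ht
    hx).1).const_mul _]
  refine integral_congr_ae ?_
  filter_upwards [ae_normal_ne] with ξ hξ
  rw [h.D_fs α ht hx hξ, Finset.mul_sum]
  exact Finset.sum_congr rfl fun γ _ => by ring

lemma integral_w_D_fs_add_single (α : MI) (i : Fin 3) {t : ℝ} (ht : t ∈ Ioo 0 S.T) {x : V3}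
    (hx : 0 < x 2) :
    ∫ ξ, w ξ * S.D (α + Pi.single i 1) (S.fs ξ) t x = ∑ γ ∈ Finset.Iic α, (α.binom γ : ℝ) *
      ((∫ ξ, w ξ * (S.fd (α - γ + Pi.single i 1) t x ξ * S.dSqrtMu γ ξ t x))
        + ∫ ξ, w ξ * (S.fd (α - γ) t x ξ * dT S.ε i (S.dSqrtMu γ ξ) t x)) := by
  have i1 := fun γ => (h.integrable_w_fd_dSqrtMu hw hwb hε hρ (α - γ + Pi.single i 1) γ ht hx).1
  have i2 := fun γ => (h.integrable_w_fd_dSqrtMu hw hwb hε hρ (α - γ) γ ht hx).2 i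
  have i3 : ∀ γ, Integrable fun ξ => (w ξ * (S.fd (α - γ + Pi.single i 1) t x ξ * S.dSqrtMu γ ξ t x)
        + w ξ * (S.fd (α - γ) t x ξ * dT S.ε i (S.dSqrtMu γ ξ) t x)) :=
    fun γ => (i1 γ).add (i2 γ)
  have e : ∀ γ, (∫ ξ, w ξ * (S.fd (α - γ + Pi.single i 1) t x ξ * S.dSqrtMu γ ξ t x))
        + ∫ ξ, w ξ * (S.fd (α - γ) t x ξ * dT S.ε i (S.dSqrtMu γ ξ) t x)
      = ∫ ξ, (w ξ * (S.fd (α - γ + Pi.single i 1) t x ξ * S.dSqrtMu γ ξ t x)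
        + w ξ * (S.fd (α - γ) t x ξ * dT S.ε i (S.dSqrtMu γ ξ) t x)) := fun γ =>
    (integral_add (i1 γ) (i2 γ)).symm
  simp only [e, ← integral_const_mul]
  rw [← integral_finsetSum _ fun γ _ => (i3 γ).const_mul _]
  refine integral_congr_ae ?_
  filter_upwards [ae_normal_ne] with ξ hξ
  rw [h.D_fs_add_single α i ht hx hξ, Finset.mul_sum]
  exact Finset.sum_congr rfl fun γ _ => by ring

end

variable (hε : S.ε ≤ 1) (hρ : 0 < ρ)
include hε hρ

/-- `b_{α,3} + ε U₃ a_α = ∫ ξ₃ f_α √μ` is the differentiated mass flux up to the commutators with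
`∂^γ √μ`, `γ ≠ 0`. -/
lemma b_two_add_eq (α : MI) {t : ℝ} (ht : t ∈ Ioo 0 S.T) {x : V3} (hx : 0 < x 2) :
    S.b α 2 t x + S.ε * S.Uc 2 t x * S.a α t x = S.D α (S.avg fun ξ => ξ 2) t x
      - ∑ γ ∈ (Finset.Iic α).filter (fun γ => γ ≠ 0), (α.binom γ : ℝ) *
        ∫ ξ : V3, ξ 2 * (S.fd (α - γ) t x ξ * S.dSqrtMu γ ξ t x) := by
  have hw : Continuous fun ξ : V3 => ξ 2 := continuous_coord 2
  have hwb : ∀ ξ : V3, |ξ 2| ≤ 1 + ‖ξ‖ := fun ξ => (abs_coord_le ξ 2).trans (by linarith)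
  have i1 := (h.integrable_w_fd_dSqrtMu hw hwb hε hρ α 0 ht hx).1
  have i2 := (h.integrable_w_fd_dSqrtMu (w := fun _ => 1) continuous_const
    (fun ξ => by simp) hε hρ α 0 ht hx).1
  have e1 := h.D_avg hw hwb hε hρ α ht hx
  rw [e1, h.integral_w_D_fs hw hwb hε hρ α ht hx, sum_Iic_eq_add_filter, add_sub_cancel_right,
    MI.binom_zero, tsub_zero, Nat.cast_one, one_mul, b, a, ← integral_const_mul]
  have e2 : ∀ ξ, S.fd α t x ξ * S.phi t x ξ 2 * S.sqrtMu t x ξ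
      = ξ 2 * (S.fd α t x ξ * S.dSqrtMu 0 ξ t x)
        - S.ε * S.Uc 2 t x * (1 * (S.fd α t x ξ * S.dSqrtMu 0 ξ t x)) := fun ξ => by
    simp only [dSqrtMu_zero, phi, Uc, PiLp.sub_apply, PiLp.smul_apply, smul_eq_mul]; ring
  have e3 : ∀ ξ, S.ε * S.Uc 2 t x * (S.fd α t x ξ * S.sqrtMu t x ξ)
      = S.ε * S.Uc 2 t x * (1 * (S.fd α t x ξ * S.dSqrtMu 0 ξ t x)) := fun ξ => by
    simp only [dSqrtMu_zero]; ring
  simp only [e2, e3]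
  rw [integral_sub i1 (i2.const_mul _), sub_add_cancel]

/-- Bound of the commutators between the velocity average and the derivatives, after division by
the distance to the wall. -/
lemma eLpNorm_commutator_div_le {c : ℝ} (hc0 : 0 < c) (hc : c < 1 / 4) (β : MI) {γ : MI}
    (hγ : γ ≠ 0) {t : ℝ} (ht : t ∈ Ioo 0 S.T) :
    eLpNorm (fun x : V3 => (∫ ξ : V3, ξ 2 * (S.fd β t x ξ * S.dSqrtMu γ ξ t x)) / x 2) 2 mX
      ≤ ofReal (velC c) * S.nMu c γ t * S.nf β t := by
  have h1 := h.eLpNorm_avg_le (w := fun ξ => ξ 2)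
    (fun ξ => (abs_coord_le ξ 2).trans (by linarith)) hc0 ht β
    (q := fun p => S.dSqrtMu γ p.2 t p.1 / p.1 2) (N := (S.nMu c γ t).toReal)
    ENNReal.toReal_nonneg ?_
  · rw [ENNReal.ofReal_toReal (h.nMu_ne_top hc hε ht hγ)] at h1
    refine le_trans (le_of_eq ?_) h1
    congr 1
    ext x
    rw [← integral_div]
    congr 1 with ξ
    ring
  · filter_upwards [h.ae_commutator_le hc hε ht hγ, ae_mXV_pos] with p hp hpos
    rw [abs_div, abs_of_pos hpos, div_le_iff₀ hpos, mul_comm]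
    exact hp

variable {c M : ℝ} (hc0 : 0 < c) (hc : c < 1 / 4) (hM0 : 0 < M)
  (hM : ∀ ξ : V3, wgt K ξ ≤ M * exp (-c * ‖ξ‖ ^ 2)) (hεκ : S.ε ≤ √S.κ)
include hc0 hc hM0 hM hεκ

/-- The tangential fluxes in `L²`. The coefficient of `nf (α + e_i)` does not involve the constants of
the commutators; the absolute constant `C₀` stems from it. -/
lemma eLpNorm_flux_le (α : MI) (i : Fin 3) {t : ℝ} (ht : t ∈ Ioo 0 S.T) :
    eLpNorm (fun x => ∫ ξ, wT i ξ * S.D (α + Pi.single i 1) (S.fs ξ) t x) 2 mX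
      ≤ ofReal ((1 + S.ε * K) * momC) * S.nf (α + Pi.single i 1) t
        + ofReal (velC c) * ofReal (cA K * M) * S.nf α t
        + ofReal (velC c) * ∑ γ ∈ (Finset.Iic α).filter (fun γ => γ ≠ 0),
          (α.binom γ : ℝ≥0∞) * ((S.nf (α - γ + Pi.single i 1) t + S.nf (α - γ) t)
            * S.nMu c γ t) := by
  have hw := continuous_wT i
  have hwb := abs_wT_le i
  have hcA := cA_nonneg (h.K_nonneg ht)
  set A : MI → V3 → ℝ := fun γ x =>
    ∫ ξ, wT i ξ * (S.fd (α - γ + Pi.single i 1) t x ξ * S.dSqrtMu γ ξ t x) with hA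
  set B : MI → V3 → ℝ := fun γ x =>
    ∫ ξ, wT i ξ * (S.fd (α - γ) t x ξ * dT S.ε i (S.dSqrtMu γ ξ) t x) with hB
  have mA : ∀ γ, AEStronglyMeasurable (A γ) mX := fun γ =>
    aesm_avg ht ((measOn_vel hw).mul ((h.measOn_fd _).mul (h.measOn_dSqrtMu γ)))
  have mB : ∀ γ, AEStronglyMeasurable (B γ) mX := fun γ =>
    aesm_avg ht ((measOn_vel hw).mul ((h.measOn_fd _).mul (h.measOn_dT_dSqrtMu γ i)))
  have e1 : eLpNorm (fun x => ∫ ξ, wT i ξ * S.D (α + Pi.single i 1) (S.fs ξ) t x) 2 mX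
      = eLpNorm (∑ γ ∈ Finset.Iic α, (α.binom γ : ℝ) • (A γ + B γ)) 2 mX := by
    refine eLpNorm_congr_ae ?_
    filter_upwards [ae_mem_cellInt] with x hx
    rw [h.integral_w_D_fs_add_single hw hwb hε hρ α i ht hx.2.2]
    simp [Finset.sum_apply, hA, hB, mul_add]
  have e2 : ∀ γ, eLpNorm ((α.binom γ : ℝ) • (A γ + B γ)) 2 mX
      ≤ (α.binom γ : ℝ≥0∞) * (eLpNorm (A γ) 2 mX + eLpNorm (B γ) 2 mX) := fun γ => by
    rw [eLpNorm_const_smul, Real.enorm_natCast]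
    gcongr
    exact eLpNorm_add_le (mA γ) (mB γ) one_le_two
  rw [e1]
  refine (eLpNorm_sum_le (fun γ _ => ((mA γ).add (mB γ)).const_smul _) one_le_two).trans
    ((Finset.sum_le_sum fun γ _ => e2 γ).trans ?_)
  rw [sum_Iic_eq_add_filter, MI.binom_zero, Nat.cast_one, one_mul]
  refine add_le_add (add_le_add ?_ ?_) ?_
  · simpa [hA, dSqrtMu_zero] using h.eLpNorm_avg_sqrtMu_le hwb ht (α + Pi.single i 1)
  · have h1 := h.eLpNorm_avg_le hwb hc0 ht α (q := fun p => dT S.ε i (S.dSqrtMu 0 p.2) t p.1)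
      (N := cA K * M) (by positivity) ?_
    · simpa [hB] using h1
    · filter_upwards [ae_mXV_pos] with p hp
      refine (h.abs_dT_D_sqrtMu_le ht hp hε 0 p.2 i).trans ?_
      have h2 : S.ε / √S.κ ≤ 1 := (div_le_one h.sqrtκ_pos).2 hεκ
      have h3 := h.eps_pos
      have h4 := h.sqrtκ_pos
      have h5 := (wgt_pos K p.2).le
      calc _ = S.ε / √S.κ * (cA K * wgt K p.2) := by simp [MI.deg, MI.fact]; ring
        _ ≤ 1 * (cA K * (M * exp (-c * ‖p.2‖ ^ 2))) := by gcongr; exact hM _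
        _ = _ := by ring
  · rw [Finset.mul_sum]
    refine Finset.sum_le_sum fun γ hγ => ?_
    have hγ0 := (Finset.mem_filter.1 hγ).2
    have hfin := h.nMu_ne_top hc hε ht hγ0
    have h1 := h.eLpNorm_avg_le hwb hc0 ht (α - γ + Pi.single i 1)
      (q := fun p => S.dSqrtMu γ p.2 t p.1) ENNReal.toReal_nonneg (h.ae_dSqrtMu_le hc hε ht hγ0)
    have h2 := h.eLpNorm_avg_le hwb hc0 ht (α - γ)
      (q := fun p => dT S.ε i (S.dSqrtMu γ p.2) t p.1) ENNReal.toReal_nonneg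
      (h.ae_dT_dSqrtMu_le hc hε ht hγ0 i)
    rw [ENNReal.ofReal_toReal hfin] at h1 h2
    calc _ ≤ (α.binom γ : ℝ≥0∞) *
          (ofReal (velC c) * S.nMu c γ t * S.nf (α - γ + Pi.single i 1) t
            + ofReal (velC c) * S.nMu c γ t * S.nf (α - γ) t) := by
          gcongr
      _ = _ := by ring

/-- The main part of the normal momentum is an integral along the normal, so that Hardy's
inequality applies. -/
lemma eLpNorm_flux_div_le (α : MI) {t : ℝ} (ht : t ∈ Ioo 0 S.T) :
    eLpNorm (fun x : V3 => (S.D α (S.avg fun ξ => ξ 2) t x + S.ε / (2 * S.δ) * S.D α S.U3sq t x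
      + S.ε / S.δ * S.D α S.PU3 t x) / x 2) 2 mX
      ≤ 2 * ((∑ i, eLpNorm (fun x => ∫ ξ, wT i ξ * S.D (α + Pi.single i 1) (S.fs ξ) t x) 2 mX)
        + 2 * S.forceT α t) := by
  have t1 := (h.tbdd_fluxDiv hε hρ).derivMI α
  have t2 := TBdd.px_two (ε := S.ε) (h.sm_U3sq.derivMI (ε := S.ε) α)
  have t3 := TBdd.px_two (ε := S.ε) (h.sm_PU3.derivMI (ε := S.ε) α)
  have hm : ∀ {u : ℝ → V3 → ℝ}, TBdd S.ε S.T u → AEStronglyMeasurable (u t) mX := fun hu =>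
    aesm_mX ht (hu.meas 0)
  have m1 := hm t1
  have m2 := hm t2
  have m3 := hm t3
  set r : V3 → ℝ := (-S.D α S.fluxDiv t) + ((S.ε / (2 * S.δ)) • px 2 (S.D α S.U3sq) t
    + (S.ε / S.δ) • px 2 (S.D α S.PU3) t) with hr
  have mr : AEStronglyMeasurable r mX :=
    m1.neg.add ((m2.const_smul _).add (m3.const_smul _))
  have hz : ∀ (u : ℝ → V3 → ℝ), TEq S.T 0 u (fun _ _ => 0) → ∀ y, S.D α u t (pnt y 0) = 0 :=
    fun u hu y => (hu.pMI_eq_zero α) t ht _ (by simp)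
  have z2 := hz S.U3sq fun t ht x hx => by simp [U3sq, Uc, h.flow.no_slip t ht x hx]
  have z3 := hz S.PU3 fun t ht x hx => by simp [PU3, Uc, h.flow.no_slip t ht x hx]
  have hH := eLpNorm_div_le (g := fun x : V3 => S.D α (S.avg fun ξ => ξ 2) t x
      + S.ε / (2 * S.δ) * S.D α S.U3sq t x + S.ε / S.δ * S.D α S.PU3 t x)
      (H := fun x => ‖r x‖ₑ) mr.enorm fun y _ b hb => by
    have j1 := t1.integrable_normal ht y b
    have j2 := t2.integrable_normal ht y b
    have j3 := t3.integrable_normal ht y b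
    have f1 := h.D_avg_normal_eq hε hρ α hb ht y
    have f2 := (h.sm_U3sq.derivMI (ε := S.ε) α).integral_normal ht y hb.le
    have f3 := (h.sm_PU3.derivMI (ε := S.ε) α).integral_normal ht y hb.le
    rw [intervalIntegral.integral_of_le hb.le] at f2 f3
    have f2' : S.D α S.U3sq t (pnt y b) = ∫ s in Ioc 0 b, px 2 (S.D α S.U3sq) t (pnt y s) := by
      rw [f2]; have := z2 y; simp only [D] at this ⊢; rw [this, sub_zero]
    have f3' : S.D α S.PU3 t (pnt y b) = ∫ s in Ioc 0 b, px 2 (S.D α S.PU3) t (pnt y s) := by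
      rw [f3]; have := z3 y; simp only [D] at this ⊢; rw [this, sub_zero]
    have f4 : S.D α (S.avg fun ξ => ξ 2) t (pnt y b) + S.ε / (2 * S.δ) * S.D α S.U3sq t (pnt y b)
        + S.ε / S.δ * S.D α S.PU3 t (pnt y b) = ∫ s in Ioc 0 b, r (pnt y s) := by
      have j4 : IntegrableOn (fun s => -S.D α S.fluxDiv t (pnt y s)) (Ioc 0 b) := j1.neg
      have j5 : IntegrableOn (fun s => S.ε / (2 * S.δ) * px 2 (S.D α S.U3sq) t (pnt y s)
        + S.ε / S.δ * px 2 (S.D α S.PU3) t (pnt y s)) (Ioc 0 b) :=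
        (j2.const_mul _).add (j3.const_mul _)
      have e : ∀ s, r (pnt y s) = -S.D α S.fluxDiv t (pnt y s)
        + (S.ε / (2 * S.δ) * px 2 (S.D α S.U3sq) t (pnt y s)
        + S.ε / S.δ * px 2 (S.D α S.PU3) t (pnt y s)) := fun _ => rfl
      simp only [e]
      rw [integral_add j4 j5, integral_add (j2.const_mul _) (j3.const_mul _), integral_neg,
        integral_const_mul, integral_const_mul, f1, f2', f3', add_assoc]
    rw [f4]
    exact enorm_integral_le_lintegral_enorm _
  refine hH.trans ?_
  gcongr
  have hεp := h.eps_pos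
  have hδ := h.delta_pos
  have e0 : eLpNorm (fun x => ‖r x‖ₑ) 2 mX = eLpNorm r 2 mX := eLpNorm_enorm _
  rw [e0]
  set A : Fin 3 → V3 → ℝ := fun i x => ∫ ξ, wT i ξ * S.D (α + Pi.single i 1) (S.fs ξ) t x with hA
  have hAmeas : ∀ i, AEStronglyMeasurable (A i) mX := fun i => by
    have k1 := (h.tbdd_avg (continuous_wT i) (abs_wT_le i) hε hρ)
    refine (aesm_mX ht (k1.meas (α + Pi.single i 1))).congr ?_
    filter_upwards [ae_mem_cellInt] with x hx
    exact h.D_avg (continuous_wT i) (abs_wT_le i) hε hρ _ ht hx.2.2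
  have md := aesm_mX ht (h.tbdd_divU.meas α)
  have mt := aesm_mX ht (h.tbdd_transP.meas α)
  have e1 : eLpNorm r 2 mX = eLpNorm ((-∑ i, A i) + ((-S.δ⁻¹) • S.D α S.divU t
      + ((-(S.ε ^ 2 / S.δ)) • S.D α S.transP t + ((S.ε / (2 * S.δ)) • px 2 (S.D α S.U3sq) t
      + (S.ε / S.δ - S.ε ^ 2 / S.δ) • px 2 (S.D α S.PU3) t)))) 2 mX := by
    refine eLpNorm_congr_ae ?_
    filter_upwards [ae_mem_cellInt] with x hx
    have := h.D_fluxDiv_eq hε hρ α ht hx.2.2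
    simp only [hr, Pi.add_apply, Pi.neg_apply, Pi.smul_apply, smul_eq_mul, this, hA,
      Finset.sum_apply]
    ring
  rw [e1]
  have key : ∀ (a B : ℝ) (u : V3 → ℝ), |a| ≤ B → eLpNorm (a • u) 2 mX
      ≤ ofReal B * eLpNorm u 2 mX := fun a B u hab => by
    rw [eLpNorm_const_smul, Real.enorm_eq_ofReal_abs]
    gcongr
  have q0 : eLpNorm (-∑ i, A i) 2 mX ≤ ∑ i, eLpNorm (A i) 2 mX := by
    rw [eLpNorm_neg]
    exact eLpNorm_sum_le (fun i _ => hAmeas i) one_le_two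
  have q1 := key (-S.δ⁻¹) (S.ε * S.δ)⁻¹ (S.D α S.divU t) (by
    rw [abs_neg, abs_of_pos (by positivity), mul_inv]
    exact le_mul_of_one_le_left (by positivity) ((one_le_inv₀ hεp).2 hε))
  have q2 := key (-(S.ε ^ 2 / S.δ)) (S.ε ^ 2 / S.δ) (S.D α S.transP t) (by
    rw [abs_neg, abs_of_pos (by positivity)])
  have q3 := key (S.ε / (2 * S.δ)) (S.ε / S.δ) (px 2 (S.D α S.U3sq) t) (by
    rw [abs_of_pos (by positivity)]
    gcongr; linarith)
  have q4 := key (S.ε / S.δ - S.ε ^ 2 / S.δ) (S.ε / S.δ) (px 2 (S.D α S.PU3) t) (by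
    have : S.ε ^ 2 / S.δ ≤ S.ε / S.δ := by gcongr; nlinarith
    rw [abs_of_nonneg (by linarith)]
    have : 0 ≤ S.ε ^ 2 / S.δ := by positivity
    linarith)
  have mA : AEStronglyMeasurable (-∑ i, A i) mX :=
    (Finset.aestronglyMeasurable_sum _ fun i _ => hAmeas i).neg
  refine (eLpNorm_add_le mA ((md.const_smul _).add ((mt.const_smul _).add
    ((m2.const_smul _).add (m3.const_smul _)))) one_le_two).trans ?_
  refine add_le_add q0 ?_
  refine (eLpNorm_add_le (md.const_smul _) ((mt.const_smul _).add
    ((m2.const_smul _).add (m3.const_smul _))) one_le_two).trans ?_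
  refine (add_le_add q1 ((eLpNorm_add_le (mt.const_smul _)
    ((m2.const_smul _).add (m3.const_smul _)) one_le_two).trans (add_le_add q2
    ((eLpNorm_add_le (m2.const_smul _) (m3.const_smul _) one_le_two).trans
      (add_le_add q3 q4))))).trans ?_
  refine le_trans ?_ (le_mul_of_one_le_left zero_le one_le_two)
  rw [forceT, ← mul_add, ← add_assoc]
  refine add_le_add ?_ le_rfl
  refine le_add_right (add_le_add (le_add_right le_rfl) le_rfl)

/-- The Hardy bound of `𝒯^b_α`, with explicit constants. -/
lemma nTb_le (α : MI) {t : ℝ} (ht : t ∈ Ioo 0 S.T) :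
    S.nTb α t ≤ ofReal (2 * ((1 + S.ε * K) * momC)) * S.nfOne α t
      + ofReal (6 * (velC c * (cA K * M))) * S.nf α t + 4 * S.forceT α t
      + ofReal (7 * velC c) * ∑ γ ∈ (Finset.Iic α).filter (fun γ => γ ≠ 0),
        (α.binom γ : ℝ≥0∞) * (S.nf (α - γ) t + S.nfOne (α - γ) t) * S.nMu c γ t := by
  have hv : 0 ≤ velC c := Real.sqrt_nonneg _
  have hcA := cA_nonneg (h.K_nonneg ht)
  have hK := h.K_nonneg ht
  have hm : 0 ≤ momC := Real.sqrt_nonneg _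
  have hεp := h.eps_pos
  set F := (Finset.Iic α).filter (fun γ => γ ≠ 0) with hF
  set m : V3 → ℝ := fun x : V3 => (S.D α (S.avg fun ξ => ξ 2) t x
    + S.ε / (2 * S.δ) * S.D α S.U3sq t x + S.ε / S.δ * S.D α S.PU3 t x) / x 2 with hmdef
  set k : MI → V3 → ℝ := fun γ (x : V3) =>
    (∫ ξ : V3, ξ 2 * (S.fd (α - γ) t x ξ * S.dSqrtMu γ ξ t x)) / x 2 with hk
  have hwb : ∀ ξ : V3, |ξ 2| ≤ 1 + ‖ξ‖ := fun ξ => (abs_coord_le ξ 2).trans (by linarith)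
  have mk : ∀ γ, AEStronglyMeasurable (k γ) mX := fun γ =>
    (aesm_avg ht ((measOn_vel (continuous_coord 2)).mul
      ((h.measOn_fd _).mul (h.measOn_dSqrtMu γ)))).div₀ (continuous_coord 2).aestronglyMeasurable
  have mm : AEStronglyMeasurable m mX := by
    refine AEStronglyMeasurable.div₀ (((aesm_mX ht ((h.tbdd_avg (continuous_coord 2) hwb hε hρ).meas α)).add
      ((aesm_mX ht ((TBdd.of_ssm h.sm_U3sq).meas α)).const_mul _)).add
      ((aesm_mX ht ((TBdd.of_ssm h.sm_PU3).meas α)).const_mul _))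
      (continuous_coord 2).aestronglyMeasurable
  have e1 : S.nTb α t = eLpNorm (m - ∑ γ ∈ F, (α.binom γ : ℝ) • k γ) 2 mX := by
    refine eLpNorm_congr_ae ?_
    filter_upwards [ae_mem_cellInt] with x hx
    simp only [Tb, Pi.sub_apply, Finset.sum_apply, Pi.smul_apply, smul_eq_mul, hmdef, hk]
    rw [h.b_two_add_eq hε hρ α ht hx.2.2]
    simp only [← mul_div_assoc, ← Finset.sum_div]
    ring
  have e2 : eLpNorm (∑ γ ∈ F, (α.binom γ : ℝ) • k γ) 2 mX ≤ ofReal (velC c) *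
      ∑ γ ∈ F, (α.binom γ : ℝ≥0∞) * (S.nf (α - γ) t + S.nfOne (α - γ) t) * S.nMu c γ t := by
    refine (eLpNorm_sum_le (fun γ _ => (mk γ).const_smul _) one_le_two).trans ?_
    rw [Finset.mul_sum]
    refine Finset.sum_le_sum fun γ hγ => ?_
    rw [eLpNorm_const_smul, Real.enorm_natCast]
    calc _ ≤ (α.binom γ : ℝ≥0∞) * (ofReal (velC c) * S.nMu c γ t * S.nf (α - γ) t) := by
          gcongr
          exact h.eLpNorm_commutator_div_le hε hρ hc0 hc _ (Finset.mem_filter.1 hγ).2 ht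
      _ ≤ (α.binom γ : ℝ≥0∞) * (ofReal (velC c) * S.nMu c γ t *
          (S.nf (α - γ) t + S.nfOne (α - γ) t)) := by
          gcongr; exact le_self_add
      _ = _ := by ring
  have e3 : ∑ i, eLpNorm (fun x => ∫ ξ, wT i ξ * S.D (α + Pi.single i 1) (S.fs ξ) t x) 2 mX
      ≤ ofReal ((1 + S.ε * K) * momC) * S.nfOne α t
        + 3 * (ofReal (velC c) * ofReal (cA K * M) * S.nf α t)
        + ofReal (velC c) * (3 * ∑ γ ∈ F, (α.binom γ : ℝ≥0∞) *
          (S.nf (α - γ) t + S.nfOne (α - γ) t) * S.nMu c γ t) := by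
    refine (Finset.sum_le_sum fun i _ =>
      h.eLpNorm_flux_le hε hρ hc0 hc hM0 hM hεκ α i ht).trans ?_
    rw [Finset.sum_add_distrib, Finset.sum_add_distrib, ← Finset.mul_sum, ← Finset.mul_sum,
      ← Finset.mul_sum]
    refine add_le_add (add_le_add le_rfl (le_of_eq ?_)) ?_
    · simp only [Finset.sum_const, Finset.card_univ, Fintype.card_fin, nsmul_eq_mul]
      push_cast
      ring
    refine mul_le_mul_right ?_ _
    rw [Finset.sum_comm, Finset.mul_sum]
    refine Finset.sum_le_sum fun γ _ => ?_
    rw [← Finset.mul_sum, ← Finset.sum_mul, Finset.sum_add_distrib]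
    have : ∑ i, S.nf (α - γ + Pi.single i 1) t + ∑ _i : Fin 3, S.nf (α - γ) t
        ≤ 3 * (S.nf (α - γ) t + S.nfOne (α - γ) t) := by
      simp only [Finset.sum_const, Finset.card_univ, Fintype.card_fin, nsmul_eq_mul]
      rw [mul_add, add_comm]
      refine add_le_add (by norm_num) ?_
      exact le_mul_of_one_le_left zero_le (by norm_num)
    calc _ ≤ (α.binom γ : ℝ≥0∞) * (3 * (S.nf (α - γ) t + S.nfOne (α - γ) t) * S.nMu c γ t) := by
          gcongr
      _ = _ := by ring
  rw [e1]
  refine (eLpNorm_sub_le mm (Finset.aestronglyMeasurable_sum _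
    fun γ _ => (mk γ).const_smul _) one_le_two).trans ?_
  have e4 := h.eLpNorm_flux_div_le hε hρ hc0 hc hM0 hM hεκ α ht
  refine (add_le_add (e4.trans (mul_le_mul_right (add_le_add_left e3 _) 2)) e2).trans ?_
  rw [ENNReal.ofReal_mul (p := 2) (by norm_num), ENNReal.ofReal_mul (p := 6) (by norm_num),
    ENNReal.ofReal_mul (p := 7) (by norm_num), ENNReal.ofReal_mul (p := velC c) hv]
  simp only [ENNReal.ofReal_ofNat]
  refine le_of_eq ?_
  ring

end Admissible

end Config

/-! ### Lower bound of the collision frequency -/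

/-- `∫ |v·ω| dω`. -/
def sphAbs (v : V3) : ℝ := ∫ w : S2, |inner ℝ v (w : V3)| ∂(volume : Measure V3).toSphere

lemma abs_inner_S2_le (v : V3) (w : S2) : |inner ℝ v (w : V3)| ≤ ‖v‖ := by
  have hw : ‖(w : V3)‖ = 1 := by simp
  simpa [hw] using abs_real_inner_le_norm v (w : V3)

lemma integrable_sphAbs (v : V3) :
    Integrable (fun w : S2 => |inner ℝ v (w : V3)|) (volume : Measure V3).toSphere :=
  (integrable_const ‖v‖).mono' (by fun_prop : Continuous fun w : S2 => |inner ℝ v (w : V3)|).aestronglyMeasurable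
    (Filter.Eventually.of_forall fun w => by
      rw [Real.norm_eq_abs, abs_abs]; exact abs_inner_S2_le v w)

lemma sphAbs_smul (r : ℝ) (v : V3) : sphAbs (r • v) = |r| * sphAbs v := by
  simp only [sphAbs, inner_smul_left, abs_mul, ← integral_const_mul]
  simp

lemma continuous_sphAbs : Continuous sphAbs := by
  refine continuous_iff_continuousAt.2 fun v => ?_
  refine continuousAt_of_dominated (bound := fun _ => ‖v‖ + 1) ?_ ?_ (integrable_const _) ?_
  · exact Filter.Eventually.of_forall fun v => (integrable_sphAbs v).aestronglyMeasurable
  · filter_upwards [Metric.ball_mem_nhds v one_pos] with u hu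
    refine Filter.Eventually.of_forall fun w => ?_
    rw [Real.norm_eq_abs, abs_abs]
    refine (abs_inner_S2_le u w).trans ?_
    have := norm_sub_norm_le u v
    rw [mem_ball_iff_norm] at hu
    linarith
  · exact Filter.Eventually.of_forall fun w => by fun_prop

lemma sphAbs_pos {v : V3} (hv : v ≠ 0) : 0 < sphAbs v := by
  have hc : Continuous fun w : S2 => |inner ℝ v (w : V3)| := by fun_prop
  refine hc.integral_pos_of_hasCompactSupport_nonneg_nonzero
    (HasCompactSupport.of_compactSpace _) (fun w => abs_nonneg _)
    (x := ⟨‖v‖⁻¹ • v, by simp [norm_smul, hv]⟩) ?_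
  simp [inner_smul_right, hv]

/-- By homogeneity and compactness of the sphere. -/
lemma exists_sphAbs_ge : ∃ a : ℝ, 0 < a ∧ ∀ v, a * ‖v‖ ≤ sphAbs v := by
  obtain ⟨u, hu, hmin⟩ := (isCompact_sphere (0 : V3) 1).exists_isMinOn
    (NormedSpace.sphere_nonempty.2 zero_le_one) continuous_sphAbs.continuousOn
  have hu0 : u ≠ 0 := by
    rintro rfl; simp at hu
  refine ⟨sphAbs u, sphAbs_pos hu0, fun v => ?_⟩
  rcases eq_or_ne v 0 with rfl | hv
  · simp [sphAbs]
  · have h1 := hmin (show ‖v‖⁻¹ • v ∈ Metric.sphere (0 : V3) 1 by simp [norm_smul, hv])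
    have h2 : sphAbs v = ‖v‖ * sphAbs (‖v‖⁻¹ • v) := by
      rw [sphAbs_smul, abs_of_nonneg (by positivity), mul_inv_cancel_left₀ (norm_ne_zero_iff.2 hv)]
    rw [h2, mul_comm]
    exact mul_le_mul_of_nonneg_left h1 (norm_nonneg _)

lemma integrable_nu (v : V3) :
    Integrable (fun p : V3 × S2 => |inner ℝ (v - p.1) (p.2 : V3)| * mu0 p.1) mColl := by
  have := continuous_mu0
  have h1 : Integrable (fun p : V3 × S2 => (‖v‖ + 1) * ((1 + ‖p.1‖) ^ 1 * mu0 p.1)) mColl := by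
    unfold mColl
    exact ((integrable_pow_mul_mu0 1).comp_fst (ν := (volume : Measure V3).toSphere)).const_mul _
  refine h1.mono' (Continuous.aestronglyMeasurable (by fun_prop))
    (Filter.Eventually.of_forall fun p => ?_)
  have h2 := abs_inner_S2_le (v - p.1) p.2
  have h3 := norm_sub_le v p.1
  rw [norm_mul, Real.norm_eq_abs, abs_abs, Real.norm_of_nonneg (mu0_pos _).le, ← mul_assoc, pow_one]
  refine mul_le_mul_of_nonneg_right ?_ (mu0_pos _).le
  nlinarith [norm_nonneg v, norm_nonneg p.1]

/-- The collision frequency grows linearly: `∫ |(v - v_*)·ω| μ₀(v_*) dv_* dω ≥ c (1 + |v|)`. The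
integrand is symmetrized in `v_*`. -/
lemma exists_nu_ge : ∃ c₀ : ℝ, 0 < c₀ ∧ ∀ v : V3, c₀ * (1 + ‖v‖) ≤
    ∫ p : V3 × S2, |inner ℝ (v - p.1) (p.2 : V3)| * mu0 p.1 ∂mColl := by
  obtain ⟨a, ha, hA⟩ := exists_sphAbs_ge
  have hm : 0 < ∫ v : V3, ‖v‖ * mu0 v := by
    have hc : Continuous fun v : V3 => ‖v‖ * mu0 v := by have := continuous_mu0; fun_prop
    have hi : Integrable fun v : V3 => ‖v‖ * mu0 v :=
      integrable_mul_mu0 (n := 1) (C := 1) continuous_norm fun ξ => by simp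
    refine (integral_pos_iff_support_of_nonneg
      (fun v => mul_nonneg (norm_nonneg _) (mu0_pos v).le) hi).2
      (hc.isOpen_support.measure_pos volume ⟨e 0, ?_⟩)
    simp [e, (mu0_pos _).ne']
  set m := ∫ v : V3, ‖v‖ * mu0 v with hmdef
  refine ⟨a / 2 * min 1 m, by positivity, fun v => ?_⟩
  set n := ∫ p : V3 × S2, |inner ℝ (v - p.1) (p.2 : V3)| * mu0 p.1 ∂mColl with hn
  have hmu := continuous_mu0
  have i1 := integrable_nu v
  have mp : MeasurePreserving (fun p : V3 × S2 => (-p.1, p.2)) mColl mColl :=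
    (Measure.measurePreserving_neg (volume : Measure V3)).prod (MeasurePreserving.id _)
  have me : MeasurableEmbedding (fun p : V3 × S2 => (-p.1, p.2)) :=
    ((Homeomorph.neg V3).prodCongr (Homeomorph.refl S2)).measurableEmbedding
  have i2 : Integrable (fun p : V3 × S2 => |inner ℝ (v + p.1) (p.2 : V3)| * mu0 p.1) mColl := by
    have := (mp.integrable_comp_emb me).2 i1
    refine this.congr (Filter.Eventually.of_forall fun p => ?_)
    simp [mu0_neg]
  have e2 : ∫ p : V3 × S2, |inner ℝ (v + p.1) (p.2 : V3)| * mu0 p.1 ∂mColl = n := by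
    rw [hn, ← mp.integral_comp me fun p => |inner ℝ (v - p.1) (p.2 : V3)| * mu0 p.1]
    simp [mu0_neg]
  have i3 : Integrable (fun p : V3 × S2 => mu0 p.1 * |inner ℝ v (p.2 : V3)|) mColl := by
    have h1 : Integrable mu0 := by simpa using integrable_pow_mul_mu0 0
    unfold mColl
    exact h1.mul_prod (integrable_sphAbs v)
  have i4 : Integrable (fun p : V3 × S2 => |inner ℝ p.1 (p.2 : V3)| * mu0 p.1) mColl := by
    have := integrable_nu 0
    simpa using this
  have e3 : ∫ p : V3 × S2, mu0 p.1 * |inner ℝ v (p.2 : V3)| ∂mColl = sphAbs v := by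
    unfold mColl
    refine (integral_prod_mul mu0 fun w : S2 => |inner ℝ v (w : V3)|).trans ?_
    rw [integral_mu0, one_mul]; rfl
  have e4 : ∫ p : V3 × S2, |inner ℝ p.1 (p.2 : V3)| * mu0 p.1 ∂mColl
      = ∫ u : V3, sphAbs u * mu0 u := by
    unfold mColl at i4 ⊢
    rw [integral_prod _ i4]
    simp only [integral_mul_const]; rfl
  have h4 : a * m ≤ ∫ u : V3, sphAbs u * mu0 u := by
    rw [hmdef, ← integral_const_mul]
    refine integral_mono_of_nonneg (Filter.Eventually.of_forall fun u => ?_) ?_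
      (Filter.Eventually.of_forall fun u => ?_)
    · have := (mu0_pos u).le
      positivity
    · unfold mColl at i4
      have := i4.integral_prod_left
      simp only [integral_mul_const] at this
      exact this
    · simp only [← mul_assoc]
      exact mul_le_mul_of_nonneg_right (hA u) (mu0_pos u).le
  have key : sphAbs v + ∫ u : V3, sphAbs u * mu0 u ≤ 2 * n := by
    rw [← e3, ← e4, two_mul]
    nth_rewrite 2 [← e2]
    rw [hn, ← integral_add i3 i4, ← integral_add i1 i2]
    refine integral_mono (i3.add i4) (i1.add i2) fun p => ?_
    simp only [inner_sub_left, inner_add_left]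
    set s := inner ℝ v (p.2 : V3)
    set r := inner ℝ p.1 (p.2 : V3)
    have h5 : |s| + |r| ≤ |s - r| + |s + r| := by
      have a1 := abs_add_le (s - r) (s + r)
      have a2 := abs_sub (s + r) (s - r)
      rw [show s - r + (s + r) = 2 * s by ring, abs_mul, abs_two] at a1
      rw [show s + r - (s - r) = 2 * r by ring, abs_mul, abs_two] at a2
      linarith
    have := mul_le_mul_of_nonneg_right h5 (mu0_pos p.1).le
    linarith
  have h6 := hA v
  have h7 : min 1 m ≤ 1 := min_le_left _ _
  have h8 : min 1 m ≤ m := min_le_right _ _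
  have h9 : a * (min 1 m * (1 + ‖v‖)) ≤ a * (m + ‖v‖) := by
    gcongr
    nlinarith [norm_nonneg v]
  linarith

namespace Config

variable {S : Config}

lemma nu_eq (t : ℝ) (x ξ : V3) : S.nu t x ξ =
    ∫ p : V3 × S2, |inner ℝ (S.phi t x ξ - p.1) (p.2 : V3)| * mu0 p.1 ∂mColl := by
  have mp : MeasurePreserving (fun p : V3 × S2 => (p.1 + S.ε • S.U t x, p.2)) mColl mColl :=
    (measurePreserving_add_right (volume : Measure V3) _).prod (MeasurePreserving.id _)
  have me : MeasurableEmbedding (fun p : V3 × S2 => (p.1 + S.ε • S.U t x, p.2)) :=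
    ((Homeomorph.addRight (S.ε • S.U t x)).prodCongr (Homeomorph.refl S2)).measurableEmbedding
  rw [nu, ← mp.integral_comp me]
  simp only [mu, phi, add_sub_cancel_right, sub_sub, add_comm]

end Config

/-! ### Moments of the macroscopic part -/

/-- The reflection of the coordinate `k`. -/
def refl (k : Fin 3) : V3 ≃ₗᵢ[ℝ] V3 :=
  LinearIsometryEquiv.piLpCongrRight 2 fun i =>
    if i = k then LinearIsometryEquiv.neg ℝ else LinearIsometryEquiv.refl ℝ ℝ

lemma refl_apply (k : Fin 3) (v : V3) (i : Fin 3) : refl k v i = if i = k then -v i else v i := by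
  by_cases h : i = k <;> simp [refl, h]

lemma integral_eq_zero_of_refl (k : Fin 3) {g : V3 → ℝ} (hg : ∀ v, g (refl k v) = -g v) :
    ∫ v, g v = 0 := by
  have h1 := (refl k).measurePreserving.integral_comp (refl k).toHomeomorph.measurableEmbedding g
  simp only [hg, integral_neg] at h1
  linarith

lemma mu0_refl (k : Fin 3) (v : V3) : mu0 (refl k v) = mu0 v := by
  simp [mu0]

/-- `∫ φ_i² φ_j² μ₀ dφ`. -/
def mom22 (i j : Fin 3) : ℝ := ∫ v : V3, (v i ^ 2 * v j ^ 2) * mu0 v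

/-- By parity, `∫ φ_i φ_j (a + b·φ + c (|φ|² - 3)/2)² μ₀ dφ = 2 b_i b_j ∫ φ_i² φ_j² μ₀ dφ` for
`i ≠ j`. -/
lemma integral_offdiag_macro {i j : Fin 3} (hij : i ≠ j) (a c : ℝ) (b : Fin 3 → ℝ) :
    ∫ v : V3, v i * v j * (a + ∑ k, b k * v k + c * ((‖v‖ ^ 2 - 3) / 2)) ^ 2 * mu0 v
      = 2 * mom22 i j * (b i * b j) := by
  set A : V3 → ℝ := fun v => a + ∑ k, b k * v k + c * ((‖v‖ ^ 2 - 3) / 2) - b i * v i - b j * v j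
    with hA
  have hAc : Continuous A := by fun_prop
  set CA := |a| + ∑ k, |b k| + 2 * |c| + |b i| + |b j| with hCA
  have hv1 : ∀ (v : V3) k, |v k| ≤ (1 + ‖v‖) ^ 2 := fun v k => by
    have := abs_coord_le v k
    nlinarith [norm_nonneg v]
  have hAb : ∀ v, |A v| ≤ CA * (1 + ‖v‖) ^ 2 := fun v => by
    have h1 : |∑ k, b k * v k| ≤ (∑ k, |b k|) * (1 + ‖v‖) ^ 2 := by
      refine (Finset.abs_sum_le_sum_abs _ _).trans ?_
      rw [Finset.sum_mul]
      refine Finset.sum_le_sum fun k _ => ?_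
      rw [abs_mul]
      exact mul_le_mul_of_nonneg_left (hv1 v k) (abs_nonneg _)
    have h2 : |(‖v‖ ^ 2 - 3) / 2| ≤ 2 * (1 + ‖v‖) ^ 2 := by
      rw [abs_le]; constructor <;> nlinarith [norm_nonneg v]
    have h3 : |a| ≤ |a| * (1 + ‖v‖) ^ 2 :=
      le_mul_of_one_le_right (abs_nonneg _) (by nlinarith [norm_nonneg v])
    have h4 : ∀ k, |b k * v k| ≤ |b k| * (1 + ‖v‖) ^ 2 := fun k => by
      rw [abs_mul]; exact mul_le_mul_of_nonneg_left (hv1 v k) (abs_nonneg _)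
    have h5 : |c * ((‖v‖ ^ 2 - 3) / 2)| ≤ 2 * |c| * (1 + ‖v‖) ^ 2 := by
      rw [abs_mul, mul_comm 2 |c|, mul_assoc]; gcongr
    calc |A v| ≤ |a| + |∑ k, b k * v k| + |c * ((‖v‖ ^ 2 - 3) / 2)| + |b i * v i| + |b j * v j| := by
          refine (abs_sub _ _).trans (add_le_add_left ((abs_sub _ _).trans
            (add_le_add_left (abs_add_three _ _ _) _)) _)
      _ ≤ _ := by
          rw [hCA]
          linarith [h4 i, h4 j]
  have hCA0 : 0 ≤ CA := by positivity
  have hint : ∀ g : V3 → ℝ, Continuous g → ∀ B n, (∀ v, |g v| ≤ B * (1 + ‖v‖) ^ n) →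
      Integrable fun v => g v * mu0 v := fun g hg B n hb => integrable_mul_mu0 hg hb
  -- a product of four factors of quadratic growth has a finite Gaussian integral
  have h4 : ∀ p q r s : V3 → ℝ, Continuous p → Continuous q → Continuous r → Continuous s →
      ∀ P Q R D : ℝ, (∀ v, |p v| ≤ P * (1 + ‖v‖) ^ 2) → (∀ v, |q v| ≤ Q * (1 + ‖v‖) ^ 2) →
      (∀ v, |r v| ≤ R * (1 + ‖v‖) ^ 2) → (∀ v, |s v| ≤ D * (1 + ‖v‖) ^ 2) →
      Integrable fun v => (p v * q v * (r v * s v)) * mu0 v := by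
    intro p q r s hp hq hr hs P Q R D bp bq br bs
    refine hint _ (by fun_prop) (P * Q * (R * D)) 8 fun v => ?_
    rw [abs_mul, abs_mul, abs_mul]
    calc _ ≤ (P * (1 + ‖v‖) ^ 2) * (Q * (1 + ‖v‖) ^ 2)
          * ((R * (1 + ‖v‖) ^ 2) * (D * (1 + ‖v‖) ^ 2)) := by
          have b1 := (abs_nonneg _).trans (bp v)
          have b2 := (abs_nonneg _).trans (bq v)
          have b3 := (abs_nonneg _).trans (br v)
          gcongr
          · exact bp v
          · exact bq v
          · exact br v
          · exact bs v
      _ = _ := by ring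
  have c1 : ∀ k : Fin 3, Continuous fun v : V3 => v k := continuous_coord
  have b1 : ∀ (k : Fin 3) (v : V3), |v k| ≤ 1 * (1 + ‖v‖) ^ 2 := fun k v => by simpa using hv1 v k
  have cb : ∀ k : Fin 3, Continuous fun v : V3 => b k * v k := fun k => (c1 k).const_mul _
  have bb : ∀ (k : Fin 3) (v : V3), |b k * v k| ≤ |b k| * (1 + ‖v‖) ^ 2 := fun k v => by
    rw [abs_mul]; exact mul_le_mul_of_nonneg_left (hv1 v k) (abs_nonneg _)
  have j1 := h4 _ _ _ _ (c1 i) (c1 j) hAc hAc _ _ _ _ (b1 i) (b1 j) hAb hAb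
  have j2 := h4 _ _ _ _ (c1 i) (c1 j) (cb i) (cb i) _ _ _ _ (b1 i) (b1 j) (bb i) (bb i)
  have j3 := h4 _ _ _ _ (c1 i) (c1 j) (cb j) (cb j) _ _ _ _ (b1 i) (b1 j) (bb j) (bb j)
  have j4 := h4 _ _ _ _ (c1 i) (c1 j) hAc (cb i) _ _ _ _ (b1 i) (b1 j) hAb (bb i)
  have j5 := h4 _ _ _ _ (c1 i) (c1 j) hAc (cb j) _ _ _ _ (b1 i) (b1 j) hAb (bb j)
  have j6 := h4 _ _ _ _ (c1 i) (c1 j) (c1 i) (c1 j) _ _ _ _ (b1 i) (b1 j) (b1 i) (b1 j)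
  have hs : ∀ k, k = i ∨ k = j → ∀ v, A (refl k v) = A v := by
    intro k hk v
    have hji : j ≠ i := hij.symm
    simp only [hA, LinearIsometryEquiv.norm_map]
    have e1 : ∑ l, b l * (refl k v) l = ∑ l, b l * v l - 2 * (b k * v k) := by
      have : ∀ l, b l * (refl k v) l = b l * v l - if l = k then 2 * (b k * v k) else 0 :=
        fun l => by
          rw [refl_apply]; split_ifs with hl
          · subst hl; ring
          · ring
      simp [this, Finset.sum_sub_distrib]
    rw [e1]
    rcases hk with rfl | rfl
    · simp [refl_apply, hji]; ring
    · simp [refl_apply, hij]; ring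
  have hs' := fun v => hs i (Or.inl rfl) v
  have hs'' := fun v => hs j (Or.inr rfl) v
  have z1 : ∫ v : V3, (v i * v j * (A v * A v)) * mu0 v = 0 :=
    integral_eq_zero_of_refl i fun v => by
      simp only [hs', mu0_refl, refl_apply, if_true, hij.symm, if_false]; ring
  have z2 : ∫ v : V3, (v i * v j * (b i * v i * (b i * v i))) * mu0 v = 0 :=
    integral_eq_zero_of_refl i fun v => by
      simp only [mu0_refl, refl_apply, if_true, hij.symm, if_false]; ring
  have z3 : ∫ v : V3, (v i * v j * (b j * v j * (b j * v j))) * mu0 v = 0 :=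
    integral_eq_zero_of_refl i fun v => by
      simp only [mu0_refl, refl_apply, if_true, hij.symm, if_false]; ring
  have z4 : ∫ v : V3, (v i * v j * (A v * (b i * v i))) * mu0 v = 0 :=
    integral_eq_zero_of_refl j fun v => by
      simp only [hs'', mu0_refl, refl_apply, if_true, hij, if_false]; ring
  have z5 : ∫ v : V3, (v i * v j * (A v * (b j * v j))) * mu0 v = 0 :=
    integral_eq_zero_of_refl i fun v => by
      simp only [hs', mu0_refl, refl_apply, if_true, hij.symm, if_false]; ring
  have e1 : ∀ v : V3, v i * v j * (a + ∑ k, b k * v k + c * ((‖v‖ ^ 2 - 3) / 2)) ^ 2 * mu0 v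
      = (v i * v j * (A v * A v)) * mu0 v + ((v i * v j * (b i * v i * (b i * v i))) * mu0 v
      + ((v i * v j * (b j * v j * (b j * v j))) * mu0 v
      + (2 * ((v i * v j * (A v * (b i * v i))) * mu0 v)
      + (2 * ((v i * v j * (A v * (b j * v j))) * mu0 v)
      + 2 * (b i * b j) * ((v i * v j * (v i * v j)) * mu0 v))))) := fun v => by
    have : a + ∑ k, b k * v k + c * ((‖v‖ ^ 2 - 3) / 2) = A v + b i * v i + b j * v j := by
      simp only [hA]; ring
    rw [this]; ring
  simp only [e1]
  have add' : ∀ {f g : V3 → ℝ}, Integrable f → Integrable g → Integrable fun v => f v + g v :=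
    fun hf hg => hf.add hg
  have k6 := j6.const_mul (2 * (b i * b j))
  have k5 := add' (j5.const_mul 2) k6
  have k4 := add' (j4.const_mul 2) k5
  have k3 := add' j3 k4
  have k2 := add' j2 k3
  rw [integral_add j1 k2, integral_add j2 k3, integral_add j3 k4, integral_add (j4.const_mul 2) k5,
    integral_add (j5.const_mul 2) k6]
  rw [integral_const_mul, integral_const_mul, integral_const_mul, z1, z2, z3, z4, z5, mom22]
  have e2 : ∀ v : V3, (v i * v j * (v i * v j)) * mu0 v = (v i ^ 2 * v j ^ 2) * mu0 v :=
    fun v => by ring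
  simp only [e2]
  ring

/-! ### Pointwise decomposition of the bulk integrand -/

set_option maxHeartbeats 1000000 in
/-- The algebra behind the bulk estimate at one point: `f = P + g` with macroscopic part `P`, `S`
the singular part of the bulk factor `B`, `X = |φ|`, `s = √κ`, `n = ν`. The smallness of `e = ε`
relative to `s` makes the coefficient of `n g²` small. -/
lemma bulk_pointwise_le {K CR c₀ η ε₀ e s X B S P g n W : ℝ} (hK : 0 ≤ K) (hCR : 0 ≤ CR)
    (hc₀ : 0 < c₀) (hη : 0 < η) (he : 0 < e) (hs : 0 < s) (hs1 : s ≤ 1) (hes : e ≤ ε₀ * s)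
    (hε1 : ε₀ ≤ 1) (hε3 : ε₀ ^ 2 ≤ c₀ * η / 4)
    (hε4 : ε₀ * (K * (1 + K) + 2 * CR * (2 + K) + 2 * K) ≤ c₀ * η / 2)
    (hX : 0 ≤ X) (hS : |S| ≤ K / s * X ^ 2) (hR : |B - S| ≤ CR * (1 + X) ^ 2)
    (hn : c₀ * (1 + X) ≤ n)
    (hnf : X ≤ (1 + K) / e ∨ (1 ≤ 2 * e * X ∧ |B| ≤ K * X + W)) :
    |B * (P + g) ^ 2 - S * P ^ 2| ≤ η / (s ^ 2 * e ^ 2) * (n * g ^ 2)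
      + (K ^ 2 + 2 * CR + 4 * K) * ((1 + X) ^ 4 * P ^ 2)
      + (if X ≤ (1 + K) / e then 0 else W * (P + g) ^ 2) := by
  have he1 : e ≤ 1 := hes.trans (mul_le_one₀ hε1 hs.le hs1)
  have hε0 : 0 < ε₀ := pos_of_mul_pos_left (he.trans_le hes) hs.le
  set E := 1 / (s ^ 2 * e ^ 2) with hE
  have hE0 : 0 < E := by positivity
  have hEe : E * (s ^ 2 * e ^ 2) = 1 := by rw [hE]; field_simp
  have hee : e ≤ ε₀ := hes.trans (mul_le_of_le_one_right hε0.le hs1)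
  have hse : s * e ≤ ε₀ := (mul_le_of_le_one_left he.le hs1).trans hee
  have hsse : s ^ 2 * e ≤ ε₀ := (mul_le_of_le_one_left he.le (pow_le_one₀ hs.le hs1)).trans hee
  have hssee : s ^ 2 * e ^ 2 ≤ ε₀ := by
    have : s ^ 2 * e ^ 2 = (s ^ 2 * e) * e := by ring
    rw [this]
    exact (mul_le_of_le_one_right (by positivity) he1).trans hsse
  have hE1 : η / (s ^ 2 * e ^ 2) = η * E := by rw [hE]; ring
  have hgn : E * (c₀ * (1 + X)) * g ^ 2 ≤ E * (n * g ^ 2) := by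
    have := mul_le_mul_of_nonneg_right hn (sq_nonneg g)
    calc _ = E * (c₀ * (1 + X) * g ^ 2) := by ring
      _ ≤ _ := by gcongr
  rw [hE1]
  have hG0 : 0 ≤ E * ((1 + X) * g ^ 2) := by positivity
  have hP0 : 0 ≤ (1 + X) ^ 4 * P ^ 2 := by positivity
  have hZ : 1 ≤ 1 + X := by linarith
  have p2 : (1 + X) ^ 2 ≤ (1 + X) ^ 4 := pow_le_pow_right₀ hZ (by norm_num)
  have p1 : X ≤ (1 + X) ^ 4 :=
    (by linarith : X ≤ 1 + X).trans (le_self_pow₀ hZ (by norm_num))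
  have p3 : X ^ 3 ≤ (1 + X) ^ 4 :=
    (pow_le_pow_left₀ hX (by linarith) 3).trans (pow_le_pow_right₀ hZ (by norm_num))
  have p4 : X ^ 4 ≤ (1 + X) ^ 4 := by gcongr; linarith
  by_cases hnear : X ≤ (1 + K) / e
  · rw [if_pos hnear, add_zero]
    have hXe : X * e ≤ 1 + K := (le_div_iff₀ he).1 hnear
    set R := B - S with hRdef
    have e1 : B * (P + g) ^ 2 - S * P ^ 2 = S * g ^ 2 + 2 * S * (P * g) + R * (P + g) ^ 2 := by
      rw [hRdef]; ring
    rw [e1]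
    -- the quadratic part in `g` of the singular term
    have t1 : |S * g ^ 2| ≤ ε₀ * (K * (1 + K)) * (E * ((1 + X) * g ^ 2)) := by
      rw [abs_mul, abs_of_nonneg (sq_nonneg g)]
      have : K / s * X ^ 2 ≤ ε₀ * (K * (1 + K)) * E * (1 + X) := by
        have a1 : K / s * X ^ 2 = E * (s * e) * K * (X * e) * X := by
          rw [hE]; field_simp
        rw [a1]
        calc _ ≤ E * ε₀ * K * (1 + K) * (1 + X) := by gcongr; linarith
          _ = _ := by ring
      calc _ ≤ (ε₀ * (K * (1 + K)) * E * (1 + X)) * g ^ 2 := by gcongr; exact hS.trans this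
        _ = _ := by ring
    have t2 : |2 * S * (P * g)| ≤ c₀ * η / 4 * (E * ((1 + X) * g ^ 2)) + K ^ 2 * ((1 + X) ^ 4 * P ^ 2) := by
      have a1 : |2 * S * (P * g)| ≤ 2 * (K / s * X ^ 2) * (|P| * |g|) := by
        rw [abs_mul, abs_mul, abs_two, abs_mul]
        gcongr
      -- weighted Young inequality, with weight `ε₀²`
      have a2 : 2 * (K / s * X ^ 2) * (|P| * |g|) ≤ ε₀ ^ 2 * (E * g ^ 2) + K ^ 2 * (X ^ 4 * P ^ 2) := by
        have b1 : K / s * X ^ 2 * (|P| * |g|) = (K * X ^ 2 * |P|) * (e * (|g| / (s * e))) := by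
          field_simp
        have b2 : E * g ^ 2 = (|g| / (s * e)) ^ 2 := by
          rw [div_pow, sq_abs, hE]; ring
        have b4 : 0 ≤ |g| / (s * e) := by positivity
        have b5 : (K * X ^ 2 * |P|) * (e * (|g| / (s * e))) ≤ (K * X ^ 2 * |P|) * (ε₀ * (|g| / (s * e))) := by
          gcongr
        have b6 : K ^ 2 * (X ^ 4 * P ^ 2) = (K * X ^ 2 * |P|) ^ 2 := by
          rw [mul_pow, sq_abs]; ring
        have b7 := two_mul_le_add_sq (K * X ^ 2 * |P|) (ε₀ * (|g| / (s * e)))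
        rw [mul_pow ε₀] at b7
        rw [b2, b6]
        linarith
      have a3 : ε₀ ^ 2 * (E * g ^ 2) ≤ c₀ * η / 4 * (E * ((1 + X) * g ^ 2)) := by
        have : E * g ^ 2 ≤ E * ((1 + X) * g ^ 2) := by
          gcongr; exact le_mul_of_one_le_left (sq_nonneg g) hZ
        gcongr
      have a4 : K ^ 2 * (X ^ 4 * P ^ 2) ≤ K ^ 2 * ((1 + X) ^ 4 * P ^ 2) := by gcongr
      linarith
    have t3 : |R * (P + g) ^ 2| ≤ ε₀ * (2 * CR * (2 + K)) * (E * ((1 + X) * g ^ 2))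
        + 2 * CR * ((1 + X) ^ 4 * P ^ 2) := by
      have a1 : |R * (P + g) ^ 2| ≤ CR * (1 + X) ^ 2 * (2 * (P ^ 2 + g ^ 2)) := by
        rw [abs_mul, abs_of_nonneg (sq_nonneg (P + g))]
        exact mul_le_mul hR add_sq_le (sq_nonneg _) (by positivity)
      have a2 : (1 + X) ^ 2 * g ^ 2 ≤ ε₀ * (2 + K) * (E * ((1 + X) * g ^ 2)) := by
        have b1 : (1 + X) * e ≤ 2 + K := by rw [add_mul, one_mul]; linarith
        have b2 : (1 + X) ^ 2 * g ^ 2 = E * (s ^ 2 * e) * ((1 + X) * e) * ((1 + X) * g ^ 2) := by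
          calc _ = (E * (s ^ 2 * e ^ 2)) * ((1 + X) ^ 2 * g ^ 2) := by rw [hEe, one_mul]
            _ = _ := by ring
        rw [b2]
        calc _ ≤ E * ε₀ * (2 + K) * ((1 + X) * g ^ 2) := by gcongr
          _ = _ := by ring
      have a3 : (1 + X) ^ 2 * P ^ 2 ≤ (1 + X) ^ 4 * P ^ 2 := by gcongr
      have a4 := mul_le_mul_of_nonneg_left a2 (by positivity : 0 ≤ 2 * CR)
      have a5 := mul_le_mul_of_nonneg_left a3 (by positivity : 0 ≤ 2 * CR)
      linarith
    have t4 := (abs_add_three (S * g ^ 2) (2 * S * (P * g)) (R * (P + g) ^ 2))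
    have t5 := mul_le_mul_of_nonneg_right hε4 hG0
    have t6 : 0 ≤ ε₀ * (2 * K) * (E * ((1 + X) * g ^ 2)) := by positivity
    have t7 : 0 ≤ 4 * K * ((1 + X) ^ 4 * P ^ 2) := by positivity
    have t8 := mul_le_mul_of_nonneg_left hgn hη.le
    have t9 : 0 ≤ c₀ * η * (E * ((1 + X) * g ^ 2)) := by positivity
    linarith
  · rw [if_neg hnear]
    obtain ⟨hfar, hB⟩ := hnf.resolve_left hnear
    have t1 : |B * (P + g) ^ 2| ≤ ε₀ * (2 * K) * (E * ((1 + X) * g ^ 2))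
        + 2 * K * ((1 + X) ^ 4 * P ^ 2) + W * (P + g) ^ 2 := by
      rw [abs_mul, abs_of_nonneg (sq_nonneg (P + g))]
      have a1 := mul_le_mul_of_nonneg_right hB (sq_nonneg (P + g))
      have a2 : K * X * (P + g) ^ 2 ≤ K * X * (2 * (P ^ 2 + g ^ 2)) := by
        exact mul_le_mul_of_nonneg_left add_sq_le (by positivity)
      have a3 : X * g ^ 2 ≤ ε₀ * (E * ((1 + X) * g ^ 2)) := by
        have b2 : X * g ^ 2 = E * (s ^ 2 * e ^ 2) * (X * g ^ 2) := by rw [hEe, one_mul]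
        rw [b2]
        calc _ ≤ E * ε₀ * ((1 + X) * g ^ 2) := by gcongr; linarith
          _ = _ := by ring
      have a4 : X * P ^ 2 ≤ (1 + X) ^ 4 * P ^ 2 := by gcongr
      have a5 := mul_le_mul_of_nonneg_left a3 (by positivity : 0 ≤ 2 * K)
      have a6 := mul_le_mul_of_nonneg_left a4 (by positivity : 0 ≤ 2 * K)
      linarith
    have t2 : |S * P ^ 2| ≤ 2 * K * ((1 + X) ^ 4 * P ^ 2) := by
      rw [abs_mul, abs_of_nonneg (sq_nonneg P)]
      have a1 : K / s * X ^ 2 ≤ 2 * K * X ^ 3 := by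
        have b1 : X ^ 2 ≤ 2 * s * X ^ 3 := by
          have : e ≤ s := hes.trans (mul_le_of_le_one_left hs.le hε1)
          have : X ^ 2 * 1 ≤ X ^ 2 * (2 * s * X) :=
            mul_le_mul_of_nonneg_left (hfar.trans (by gcongr)) (by positivity)
          linarith
        calc _ ≤ K / s * (2 * s * X ^ 3) := by gcongr
          _ = _ := by field_simp
      have a2 : 2 * K * X ^ 3 ≤ 2 * K * (1 + X) ^ 4 := by gcongr
      calc _ ≤ (2 * K * (1 + X) ^ 4) * P ^ 2 := by gcongr; linarith
        _ = _ := by ring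
    have t4 := abs_sub (B * (P + g) ^ 2) (S * P ^ 2)
    have t5 := mul_le_mul_of_nonneg_right hε4 hG0
    have t6 : 0 ≤ ε₀ * (K * (1 + K) + 2 * CR * (2 + K)) * (E * ((1 + X) * g ^ 2)) := by positivity
    have t7 : 0 ≤ (K ^ 2 + 2 * CR) * ((1 + X) ^ 4 * P ^ 2) := by positivity
    have t8 := mul_le_mul_of_nonneg_left hgn hη.le
    have t9 : 0 ≤ c₀ * η * (E * ((1 + X) * g ^ 2)) := by positivity
    linarith

namespace Config

variable {S : Config} {K τU ρ : ℝ}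

variable (S) in
/-- The part of the bulk factor that is singular in the boundary layer. -/
def bulkSing (t : ℝ) (x ξ : V3) : ℝ := 1 / 2 * (S.phi t x ξ 2 *
  ((px 2 S.U t x) 0 * S.phi t x ξ 0 + (px 2 S.U t x) 1 * S.phi t x ξ 1))

namespace Admissible

variable (h : S.Admissible K τU ρ)
include h

/-- As `log √μ = -|ξ - ε U|² / 4` up to a constant, the bulk factor is `½ φ · (ε ∂ₜ + ξ · ∇) U`. -/
lemma bulkFactor_eq {t : ℝ} (ht : t ∈ Ioo 0 S.T) {x : V3} (hx : 0 < x 2) (ξ : V3) :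
    S.bulkFactor t x ξ = 1 / 2 * ((∑ k, S.phi t x ξ k * (S.ε • pt S.U t x) k)
      + ∑ i, ξ i * ∑ k, S.phi t x ξ k * (px i S.U t x) k) := by
  have hε := h.eps_pos.ne'
  have hs := (S.sqrtMu_pos t x ξ).ne'
  have e0 := (h.dT_sqrtMu ξ hx.le 0) t ht x rfl
  have e1 := (h.dT_sqrtMu ξ hx.le 1) t ht x rfl
  have e2 := (h.dT_sqrtMu ξ hx.le 2) t ht x rfl
  have e3 := (h.px_two_sqrtMu ξ hx) t ht x rfl
  have f0 := (h.dT_lg ξ hx.le 0) t ht x rfl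
  have f1 := h.px_lg ξ ht hx
  simp only [] at e0 e1 e2 e3 f0
  have g0 : S.ε * pt (fun s y => S.sqrtMu s y ξ) t x = S.sqrtMu t x ξ * dT S.ε 0 (S.lg ξ) t x := e0
  have g1 : px 0 (fun s y => S.sqrtMu s y ξ) t x = S.sqrtMu t x ξ * px 0 (S.lg ξ) t x := e1
  have g2 : px 1 (fun s y => S.sqrtMu s y ξ) t x = S.sqrtMu t x ξ * px 1 (S.lg ξ) t x := e2
  have g3 : px 2 (fun s y => S.sqrtMu s y ξ) t x = S.sqrtMu t x ξ * px 2 (S.lg ξ) t x := e3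
  have g4 : pt (fun s y => S.sqrtMu s y ξ) t x
      = S.ε⁻¹ * (S.sqrtMu t x ξ * dT S.ε 0 (S.lg ξ) t x) := by
    rw [← g0, inv_mul_cancel_left₀ hε]
  have g5 : ∀ k, dT S.ε 0 S.U t x k = (S.ε • pt S.U t x) k := fun k => rfl
  rw [bulkFactor, g4, Fin.sum_univ_three, g1, g2, g3, f0, f1, f1, f1]
  simp only [g5, Fin.sum_univ_three, phi, PiLp.sub_apply, PiLp.smul_apply, smul_eq_mul, Uc]
  field_simp
  ring

lemma bound_zero {t : ℝ} (ht : t ∈ Ioo 0 S.T) {x : V3} (hx : 0 < x 2) :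
    (∀ k, |(S.ε • pt S.U t x) k| ≤ K) ∧ ‖S.ε • pt S.U t x‖ ≤ K ∧
    (∀ i, i ≠ 2 → ‖px i S.U t x‖ ≤ K) ∧
    ‖px 2 S.U t x‖ ≤ K / √S.κ ∧ |(px 2 S.U t x) 2| ≤ 3 * K := by
  have a1 := h.flow.bound_time t ht x hx 0
  have a2 := fun i hi => h.flow.bound_tangential t ht x hx 0 i hi
  have a3 := h.flow.bound_normal t ht x hx 0
  have a4 := h.flow.bound_div t ht x hx
  have e0 : ∀ u : ℝ → V3 → V3, S.D 0 u t x = u t x := fun u => rfl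
  simp only [e0, MI.deg, MI.fact, Pi.zero_apply, Finset.sum_const_zero, pow_zero,
    Nat.factorial_zero, Finset.prod_const_one, Nat.cast_one, div_one, one_mul] at a1 a2 a3
  refine ⟨fun k => (abs_coord_le _ k).trans a1, a1, a2, a3, ?_⟩
  have b0 := (abs_coord_le _ 0).trans (a2 0 (by decide))
  have b1 := (abs_coord_le _ 1).trans (a2 1 (by decide))
  rw [divU, Fin.sum_univ_three] at a4
  rw [abs_le] at *
  constructor <;> linarith [b0.1, b0.2, b1.1, b1.2, a4.1, a4.2]

lemma abs_bulkSing_le {t : ℝ} (ht : t ∈ Ioo 0 S.T) {x : V3} (hx : 0 < x 2) (ξ : V3) :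
    |S.bulkSing t x ξ| ≤ K / √S.κ * ‖S.phi t x ξ‖ ^ 2 := by
  obtain ⟨-, -, -, b3, -⟩ := h.bound_zero ht hx
  set φ := S.phi t x ξ
  have n0 := (abs_coord_le (px 2 S.U t x) 0).trans b3
  have n1 := (abs_coord_le (px 2 S.U t x) 1).trans b3
  have c0 := abs_coord_le φ 0
  have c1 := abs_coord_le φ 1
  have c2 := abs_coord_le φ 2
  have hB : 0 ≤ K / √S.κ := (norm_nonneg _).trans b3
  rw [bulkSing, abs_mul, abs_mul, abs_of_pos (by norm_num : (0 : ℝ) < 1 / 2)]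
  have h1 : |(px 2 S.U t x) 0 * φ 0 + (px 2 S.U t x) 1 * φ 1| ≤ K / √S.κ * ‖φ‖ + K / √S.κ * ‖φ‖ := by
    refine (abs_add_le _ _).trans ?_
    rw [abs_mul, abs_mul]
    gcongr
  calc _ ≤ 1 / 2 * (‖φ‖ * (K / √S.κ * ‖φ‖ + K / √S.κ * ‖φ‖)) := by gcongr
    _ = _ := by ring

lemma norm_le_phi {t : ℝ} (ht : t ∈ Ioo 0 S.T) {x : V3} (hx : 0 < x 2) (ξ : V3) :
    ‖ξ‖ ≤ ‖S.phi t x ξ‖ + S.ε * K ∧ ‖S.phi t x ξ‖ ≤ ‖ξ‖ + S.ε * K := by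
  have h1 := h.abs_Uc_le ht hx
  have h2 : ‖S.ε • S.U t x‖ ≤ S.ε * K := by
    rw [norm_smul, Real.norm_of_nonneg h.eps_pos.le]
    exact mul_le_mul_of_nonneg_left h1 h.eps_pos.le
  constructor
  · have := norm_add_le (S.phi t x ξ) (S.ε • S.U t x)
    rw [phi, sub_add_cancel] at this
    rw [phi]
    linarith
  · have := norm_sub_le ξ (S.ε • S.U t x)
    rw [phi]
    linarith

omit h in
lemma abs_sum_mul_le (u v : V3) : |∑ k, u k * v k| ≤ ‖u‖ * ‖v‖ := by
  have h1 : ∑ k, u k * v k = inner ℝ v u := by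
    simp [PiLp.inner_apply]
  rw [h1, mul_comm]
  exact abs_real_inner_le_norm _ _

/-- After the removal of `bulkSing` every normal derivative of `U` is multiplied by `ε` (from
`ξ₃ = φ₃ + ε U₃`) or is `∂₃U₃`, which the bound on the divergence controls. -/
lemma abs_bulkFactor_sub_le (hεκ : S.ε ≤ √S.κ) {t : ℝ} (ht : t ∈ Ioo 0 S.T) {x : V3}
    (hx : 0 < x 2) (ξ : V3) :
    |S.bulkFactor t x ξ - S.bulkSing t x ξ| ≤ (6 * K + 7 * K ^ 2) * (1 + ‖S.phi t x ξ‖) ^ 2 := by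
  obtain ⟨-, b1, b2, b3, b4⟩ := h.bound_zero ht hx
  have hK := h.K_nonneg ht
  have hε : S.ε ≤ 1 := hεκ.trans h.sqrtκ_le
  have hs := h.sqrtκ_pos
  have hεp := h.eps_pos
  obtain ⟨hξ, -⟩ := h.norm_le_phi ht hx ξ
  rw [h.bulkFactor_eq ht hx, bulkSing]
  have hφ2 : ξ 2 = S.phi t x ξ 2 + S.ε * S.U t x 2 := by simp [phi]
  set φ := S.phi t x ξ
  have hξ' : ‖ξ‖ ≤ ‖φ‖ + K := hξ.trans (by gcongr; exact mul_le_of_le_one_left hK hε)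
  have e1 : 1 / 2 * ((∑ k, φ k * (S.ε • pt S.U t x) k) + ∑ i, ξ i * ∑ k, φ k * (px i S.U t x) k)
      - 1 / 2 * (φ 2 * ((px 2 S.U t x) 0 * φ 0 + (px 2 S.U t x) 1 * φ 1))
      = 1 / 2 * ((∑ k, φ k * (S.ε • pt S.U t x) k) + ξ 0 * (∑ k, φ k * (px 0 S.U t x) k)
        + ξ 1 * (∑ k, φ k * (px 1 S.U t x) k) + (S.ε * S.U t x 2) * ((px 2 S.U t x) 0 * φ 0)
        + (S.ε * S.U t x 2) * ((px 2 S.U t x) 1 * φ 1) + ξ 2 * (φ 2 * (px 2 S.U t x) 2)) := by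
    rw [Fin.sum_univ_three (f := fun i => ξ i * ∑ k, φ k * (px i S.U t x) k),
      Fin.sum_univ_three (f := fun k => φ k * (px 2 S.U t x) k)]
    linear_combination 1 / 2 * (φ 0 * (px 2 S.U t x) 0 + φ 1 * (px 2 S.U t x) 1) * hφ2
  rw [e1, abs_mul, abs_of_pos (by norm_num : (0 : ℝ) < 1 / 2)]
  have t0 : |∑ k, φ k * (S.ε • pt S.U t x) k| ≤ ‖φ‖ * K :=
    (abs_sum_mul_le _ _).trans (by gcongr)
  have t1 : ∀ i, i ≠ 2 → |ξ i * (∑ k, φ k * (px i S.U t x) k)| ≤ (‖φ‖ + K) * (‖φ‖ * K) := fun i hi => by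
    rw [abs_mul]
    refine mul_le_mul ((abs_coord_le ξ i).trans hξ') ((abs_sum_mul_le _ _).trans ?_)
      (abs_nonneg _) (by positivity)
    have := b2 i hi
    gcongr
  have t2 : ∀ j, |(S.ε * S.U t x 2) * ((px 2 S.U t x) j * φ j)| ≤ K ^ 2 * ‖φ‖ := fun j => by
    rw [abs_mul, abs_mul, abs_mul, abs_of_pos hεp]
    have u2 := (abs_coord_le (S.U t x) 2).trans (h.abs_Uc_le ht hx)
    have uj := (abs_coord_le _ j).trans b3
    calc _ ≤ (S.ε * K) * (K / √S.κ * ‖φ‖) := by gcongr; exact abs_coord_le _ _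
      _ = (S.ε / √S.κ) * (K ^ 2 * ‖φ‖) := by ring
      _ ≤ 1 * (K ^ 2 * ‖φ‖) := by gcongr; exact (div_le_one hs).2 hεκ
      _ = _ := one_mul _
  have t3 : |ξ 2 * (φ 2 * (px 2 S.U t x) 2)| ≤ (‖φ‖ + K) * (‖φ‖ * (3 * K)) := by
    rw [abs_mul, abs_mul]
    gcongr
    · exact (abs_coord_le ξ 2).trans hξ'
    · exact abs_coord_le _ _
  have t4 := abs_le.1 t0
  have t5 := abs_le.1 (t1 0 (by decide))
  have t6 := abs_le.1 (t1 1 (by decide))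
  have t7 := abs_le.1 (t2 0)
  have t8 := abs_le.1 (t2 1)
  have t9 := abs_le.1 t3
  have hX := norm_nonneg φ
  have hfin : ‖φ‖ * K + (‖φ‖ + K) * (‖φ‖ * K) + (‖φ‖ + K) * (‖φ‖ * K) + K ^ 2 * ‖φ‖ + K ^ 2 * ‖φ‖
      + (‖φ‖ + K) * (‖φ‖ * (3 * K)) ≤ 2 * ((6 * K + 7 * K ^ 2) * (1 + ‖φ‖) ^ 2) := by
    rw [← sub_nonneg]
    have : 0 ≤ 12 * K + 23 * K * ‖φ‖ + 7 * K * ‖φ‖ ^ 2 + 14 * K ^ 2 + 21 * K ^ 2 * ‖φ‖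
      + 14 * K ^ 2 * ‖φ‖ ^ 2 := by positivity
    linarith
  rw [← le_div_iff₀' (by norm_num), abs_le]
  constructor <;> linarith

lemma abs_bulkFactor_le {t : ℝ} (ht : t ∈ Ioo 0 S.T) {x : V3}
    (hx : 0 < x 2) (ξ : V3) :
    |S.bulkFactor t x ξ| ≤ K * ‖S.phi t x ξ‖ + ‖ξ‖ * ‖S.phi t x ξ‖ * S.gradU t x := by
  obtain ⟨-, b1, -⟩ := h.bound_zero ht hx
  have hK := h.K_nonneg ht
  rw [h.bulkFactor_eq ht hx]
  set φ := S.phi t x ξ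
  have t0 : |∑ k, φ k * (S.ε • pt S.U t x) k| ≤ K * ‖φ‖ :=
    (abs_sum_mul_le _ _).trans (by rw [mul_comm]; gcongr)
  have t1 : |∑ i, ξ i * ∑ k, φ k * (px i S.U t x) k| ≤ ‖ξ‖ * ‖φ‖ * S.gradU t x := by
    calc _ ≤ ∑ i, |ξ i| * (‖φ‖ * ‖px i S.U t x‖) := by
          refine (Finset.abs_sum_le_sum_abs _ _).trans (Finset.sum_le_sum fun i _ => ?_)
          rw [abs_mul]
          gcongr
          exact abs_sum_mul_le _ _
      _ = ‖φ‖ * ∑ i, |ξ i| * ‖px i S.U t x‖ := by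
          rw [Finset.mul_sum]; exact Finset.sum_congr rfl fun i _ => by ring
      _ ≤ ‖φ‖ * (√(∑ i, |ξ i| ^ 2) * √(∑ i, ‖px i S.U t x‖ ^ 2)) := by
          gcongr
          exact Real.sum_mul_le_sqrt_mul_sqrt _ _ _
      _ = _ := by
          have : √(∑ i, |ξ i| ^ 2) = ‖ξ‖ := by
            rw [EuclideanSpace.norm_eq]; rfl
          rw [this, gradU]; ring
  have hg : 0 ≤ ‖ξ‖ * ‖φ‖ * S.gradU t x := (abs_nonneg _).trans t1
  have hp : 0 ≤ K * ‖φ‖ := by positivity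
  rw [abs_mul, abs_of_pos (by norm_num : (0 : ℝ) < 1 / 2)]
  have := abs_add_le (∑ k, φ k * (S.ε • pt S.U t x) k) (∑ i, ξ i * ∑ k, φ k * (px i S.U t x) k)
  linarith

end Admissible

end Config

/-! ### The macroscopic part in `L²` -/

lemma lintegral_enorm_mul_le {X : Type*} [MeasurableSpace X] {m : Measure X} {f g : X → ℝ}
    (hf : AEStronglyMeasurable f m) (hg : AEStronglyMeasurable g m) :
    ∫⁻ x, ‖f x‖ₑ * ‖g x‖ₑ ∂m ≤ eLpNorm f 2 m * eLpNorm g 2 m := by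
  have h1 := lintegral_mul_sq_le hf.enorm hg.enorm
  rw [← eLpNorm_two_sq, ← eLpNorm_two_sq, ← mul_pow] at h1
  exact (ENNReal.pow_le_pow_left_iff two_ne_zero).1 h1

lemma MeasX.measOn {T : ℝ} {g : ℝ → V3 → ℝ} (H : MeasX T g) : MeasOn T fun t x _ => g t x := by
  have h1 : MeasOn T fun t x _ => (slabO T).indicator (fun q : ℝ × V3 => g q.1 q.2) (t, x) :=
    MeasOn.of_measurable (Measurable.comp H (f := fun q : ℝ × V3 × V3 => (q.1, q.2.1))
      (by fun_prop))
  refine h1.congr fun q hq => ?_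
  rw [indicator_of_mem (show (q.1, q.2.1) ∈ slabO T from ⟨hq.1, hq.2.1⟩)]

/-- `‖(1 + |φ|)² √μ₀‖_{L²}`. -/
def momD : ℝ := √(∫ ξ : V3, ((1 + ‖ξ‖) ^ 2 * √(mu0 ξ)) ^ 2)

/-- `∫ (1 + |φ|)⁸ μ₀ dφ`. -/
def mom8 : ℝ := ∫ ξ : V3, (1 + ‖ξ‖) ^ 8 * mu0 ξ

lemma integrable_momD : Integrable fun ξ : V3 => ((1 + ‖ξ‖) ^ 2 * √(mu0 ξ)) ^ 2 := by
  refine (integrable_pow_mul_mu0 4).congr (Filter.Eventually.of_forall fun ξ => ?_)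
  simp only [mul_pow, Real.sq_sqrt (mu0_pos ξ).le]
  ring

lemma momD_nonneg : 0 ≤ momD := Real.sqrt_nonneg _

lemma mom8_nonneg : 0 ≤ mom8 := integral_nonneg fun ξ => mul_nonneg (by positivity) (mu0_pos ξ).le

lemma mom22_nonneg (i j : Fin 3) : 0 ≤ mom22 i j :=
  integral_nonneg fun ξ => mul_nonneg (by positivity) (mu0_pos ξ).le

lemma abs_coord_le_sq (v : V3) (k : Fin 3) : |v k| ≤ (1 + ‖v‖) ^ 2 := by
  have := abs_coord_le v k
  nlinarith [norm_nonneg v]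

lemma abs_energy_le (v : V3) : |(‖v‖ ^ 2 - 3) / 2| ≤ 2 * (1 + ‖v‖) ^ 2 := by
  rw [abs_le]; constructor <;> nlinarith [norm_nonneg v]

lemma abs_macro_le (a c : ℝ) (b : Fin 3 → ℝ) (v : V3) :
    |a + ∑ k, b k * v k + c * ((‖v‖ ^ 2 - 3) / 2)|
      ≤ 2 * (|a| + ∑ k, |b k| + |c|) * (1 + ‖v‖) ^ 2 := by
  have h0 : 0 ≤ (1 + ‖v‖) ^ 2 := by positivity
  have h1 : |∑ k, b k * v k| ≤ (∑ k, |b k|) * (1 + ‖v‖) ^ 2 := by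
    refine (Finset.abs_sum_le_sum_abs _ _).trans ?_
    rw [Finset.sum_mul]
    refine Finset.sum_le_sum fun k _ => ?_
    rw [abs_mul]
    exact mul_le_mul_of_nonneg_left (abs_coord_le_sq v k) (abs_nonneg _)
  have h3 : |a| ≤ |a| * (1 + ‖v‖) ^ 2 :=
    le_mul_of_one_le_right (abs_nonneg _) (by nlinarith [norm_nonneg v])
  have h5 : |c * ((‖v‖ ^ 2 - 3) / 2)| ≤ |c| * (2 * (1 + ‖v‖) ^ 2) := by
    rw [abs_mul]; exact mul_le_mul_of_nonneg_left (abs_energy_le v) (abs_nonneg _)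
  have h6 := abs_add_three a (∑ k, b k * v k) (c * ((‖v‖ ^ 2 - 3) / 2))
  have h7 : 0 ≤ |a| * (1 + ‖v‖) ^ 2 := by positivity
  have h8 : 0 ≤ (∑ k, |b k|) * (1 + ‖v‖) ^ 2 :=
    mul_nonneg (Finset.sum_nonneg fun _ _ => abs_nonneg _) h0
  linarith

lemma integrable_offdiag_macro (i j : Fin 3) (a c : ℝ) (b : Fin 3 → ℝ) :
    Integrable fun v : V3 =>
      v i * v j * (a + ∑ k, b k * v k + c * ((‖v‖ ^ 2 - 3) / 2)) ^ 2 * mu0 v := by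
  have c1 := continuous_coord
  refine integrable_mul_mu0 (by fun_prop) (n := 8)
    (C := (2 * (|a| + ∑ k, |b k| + |c|)) ^ 2) fun v => ?_
  rw [abs_mul, abs_mul, abs_pow]
  calc _ ≤ (1 + ‖v‖) ^ 2 * (1 + ‖v‖) ^ 2 *
        (2 * (|a| + ∑ k, |b k| + |c|) * (1 + ‖v‖) ^ 2) ^ 2 := by
        gcongr
        · exact abs_coord_le_sq v i
        · exact abs_coord_le_sq v j
        · exact abs_macro_le a c b v
    _ = _ := by ring

namespace Config

variable {S : Config} {K τU ρ : ℝ}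

variable (S) in
/-- `|a_α| + |b_α|₁ + |c_α|`. -/
def macroAbs (α : MI) (t : ℝ) (x : V3) : ℝ := |S.a α t x| + ∑ k, |S.b α k t x| + |S.c α t x|

lemma Pf_sq_le (α : MI) (t : ℝ) (x ξ : V3) :
    (1 + ‖S.phi t x ξ‖) ^ 4 * S.Pf α t x ξ ^ 2
      ≤ 4 * S.macroAbs α t x ^ 2 * ((1 + ‖S.phi t x ξ‖) ^ 8 * S.mu t x ξ) := by
  have h1 := abs_macro_le (S.a α t x) (S.c α t x) (fun k => S.b α k t x) (S.phi t x ξ)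
  have h2 := S.mu_eq_sq t x ξ
  have h3 := sq_le_sq' (abs_le.1 h1).1 (abs_le.1 h1).2
  have hp : 0 ≤ (1 + ‖S.phi t x ξ‖) ^ 4 * S.sqrtMu t x ξ ^ 2 := by positivity
  have h4 := mul_le_mul_of_nonneg_left h3 hp
  rw [Pf, mul_pow, h2, macroAbs]
  linarith

/-- By parity only the product `b₃ b_j` survives in the macroscopic part. -/
lemma integral_bulkSing_mul (α : MI) (t : ℝ) (x : V3) :
    ∫ ξ, S.bulkSing t x ξ * S.Pf α t x ξ ^ 2
      = mom22 2 0 * ((px 2 S.U t x) 0 * (S.b α 2 t x * S.b α 0 t x))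
        + mom22 2 1 * ((px 2 S.U t x) 1 * (S.b α 2 t x * S.b α 1 t x)) := by
  set G : V3 → ℝ := fun v => S.a α t x + ∑ k, S.b α k t x * v k + S.c α t x * ((‖v‖ ^ 2 - 3) / 2)
  have e1 : ∀ ξ, S.bulkSing t x ξ * S.Pf α t x ξ ^ 2
      = (fun v : V3 => 1 / 2 * (px 2 S.U t x) 0 * (v 2 * v 0 * G v ^ 2 * mu0 v)
        + 1 / 2 * (px 2 S.U t x) 1 * (v 2 * v 1 * G v ^ 2 * mu0 v)) (ξ - S.ε • S.U t x) := fun ξ => by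
    have h2 := S.mu_eq_sq t x ξ
    simp only [bulkSing, Pf, mul_pow, ← h2, mu, phi, G]
    ring
  simp only [e1]
  rw [integral_sub_right_eq_self (μ := (volume : Measure V3))
      (fun v : V3 => 1 / 2 * (px 2 S.U t x) 0 * (v 2 * v 0 * G v ^ 2 * mu0 v)
        + 1 / 2 * (px 2 S.U t x) 1 * (v 2 * v 1 * G v ^ 2 * mu0 v)) (S.ε • S.U t x),
    integral_add ((integrable_offdiag_macro 2 0 _ _ _).const_mul _)
      ((integrable_offdiag_macro 2 1 _ _ _).const_mul _), integral_const_mul, integral_const_mul,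
    integral_offdiag_macro (by decide), integral_offdiag_macro (by decide)]
  ring

namespace Admissible

variable (h : S.Admissible K τU ρ)
include h

lemma eLpNorm_moment_le {q : V3 → ℝ} (hqb : ∀ v, |q v| ≤ (1 + ‖v‖) ^ 2)
    {t : ℝ} (ht : t ∈ Ioo 0 S.T) (α : MI) :
    eLpNorm (fun x => ∫ ξ, S.fd α t x ξ * q (S.phi t x ξ) * S.sqrtMu t x ξ) 2 mX
      ≤ ofReal momD * S.nf α t := by
  have hmu := continuous_mu0
  refine eLpNorm_integral_le (G := fun p => S.fd α t p.1 p.2 * q (S.phi t p.1 p.2)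
      * S.sqrtMu t p.1 p.2)
    (k := fun p => ofReal ((1 + ‖S.phi t p.1 p.2‖) ^ 2 * √(mu0 (S.phi t p.1 p.2))))
    (aesm_mXV ht (h.measOn_fd α)) (aesm_mXV ht (h.measOn_comp_phi
      (g := fun v => (1 + ‖v‖) ^ 2 * √(mu0 v)) (by fun_prop))).aemeasurable.ennreal_ofReal
    (Filter.Eventually.of_forall fun p => ?_) (Filter.Eventually.of_forall fun x => le_of_eq ?_)
  · rw [Real.enorm_eq_ofReal_abs, Real.enorm_eq_ofReal_abs, ← ENNReal.ofReal_mul (abs_nonneg _)]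
    refine ENNReal.ofReal_le_ofReal ?_
    rw [abs_mul, abs_mul, abs_of_pos (S.sqrtMu_pos t p.1 p.2), mul_assoc]
    refine mul_le_mul_of_nonneg_left ?_ (abs_nonneg _)
    exact mul_le_mul_of_nonneg_right (hqb _) (S.sqrtMu_pos t p.1 p.2).le
  · have e1 := lintegral_ofReal_sq_eq (fun ξ : V3 => by positivity) integrable_momD
    have e2 := lintegral_sub_right_eq_self (μ := (volume : Measure V3))
      (fun ξ : V3 => ofReal ((1 + ‖ξ‖) ^ 2 * √(mu0 ξ)) ^ 2) (S.ε • S.U t x)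
    simp only [phi]
    rw [e2, e1]; rfl

lemma eLpNorm_a_le {t : ℝ} (ht : t ∈ Ioo 0 S.T) (α : MI) :
    eLpNorm (S.a α t) 2 mX ≤ ofReal momD * S.nf α t := by
  have := h.eLpNorm_moment_le (q := fun _ => 1)
    (fun v => by rw [abs_one]; nlinarith [norm_nonneg v]) ht α
  simp only [mul_one] at this
  exact this

lemma eLpNorm_b_le {t : ℝ} (ht : t ∈ Ioo 0 S.T) (α : MI) (k : Fin 3) :
    eLpNorm (S.b α k t) 2 mX ≤ ofReal momD * S.nf α t :=
  h.eLpNorm_moment_le (q := fun v => v k) (fun v => abs_coord_le_sq v k) ht α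

lemma eLpNorm_c_le {t : ℝ} (ht : t ∈ Ioo 0 S.T) (α : MI) :
    eLpNorm (S.c α t) 2 mX ≤ ofReal momD * S.nf α t :=
  h.eLpNorm_moment_le (q := fun v => (‖v‖ ^ 2 - 3) / 3) (fun v => by
    rw [abs_le]; constructor <;> nlinarith [norm_nonneg v]) ht α

lemma measX_moment {q : V3 → ℝ} (hq : Continuous q) (α : MI) :
    MeasX S.T fun t x => ∫ ξ, S.fd α t x ξ * q (S.phi t x ξ) * S.sqrtMu t x ξ :=
  MeasOn.integral (((h.measOn_fd α).mul (h.measOn_comp_phi hq)).mul h.measOn_sqrtMu)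

lemma measX_a (α : MI) : MeasX S.T (S.a α) := by
  have := h.measX_moment (q := fun _ => 1) continuous_const α
  simp only [mul_one] at this
  exact this

lemma measX_b (α : MI) (k : Fin 3) : MeasX S.T (S.b α k) :=
  h.measX_moment (q := fun v => v k) (continuous_coord k) α

lemma measX_c (α : MI) : MeasX S.T (S.c α) :=
  h.measX_moment (q := fun v => (‖v‖ ^ 2 - 3) / 3) (by fun_prop) α

lemma measOn_Pf (α : MI) : MeasOn S.T fun t x ξ => S.Pf α t x ξ :=
  (((h.measX_a α).measOn.add (MeasOn.sum fun k _ => (h.measX_b α k).measOn.mul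
    (h.measOn_comp_phi (continuous_coord k)))).add ((h.measX_c α).measOn.mul
    (h.measOn_comp_phi (g := fun v => (‖v‖ ^ 2 - 3) / 2) (by fun_prop)))).mul h.measOn_sqrtMu

lemma measOn_px_U (i j : Fin 3) : MeasOn S.T fun t x _ => (px i S.U t x) j := by
  refine (measOn_of_continuousOn (continuousOn_px i (h.smUc j))).congr fun q hq => ?_
  exact (h.px_Uc hq.1 hq.2.1 i j).symm

lemma measOn_bulkSing : MeasOn S.T fun t x ξ => S.bulkSing t x ξ :=
  (MeasOn.const _).mul ((h.measOn_comp_phi (continuous_coord 2)).mul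
    (((h.measOn_px_U 2 0).mul (h.measOn_comp_phi (continuous_coord 0))).add
      ((h.measOn_px_U 2 1).mul (h.measOn_comp_phi (continuous_coord 1)))))

lemma measOn_bulkFactor : MeasOn S.T fun t x ξ => S.bulkFactor t x ξ := by
  have hε := h.eps_pos.ne'
  have m0 : ∀ i, MeasOn S.T fun t x ξ => dT S.ε i (fun t x => S.sqrtMu t x ξ) t x := fun i =>
    h.measOn_sqrtMu.deriv (fun z hz ξ _ => h.tsm_sqrtMu ξ hz.le) i
  have mc : ∀ k : Fin 3, MeasOn S.T fun _ _ ξ => ξ k := fun k => measOn_vel (continuous_coord k)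
  have mU : ∀ k, MeasOn S.T fun t x _ => S.Uc k t x := fun k =>
    measOn_of_continuousOn ((h.smUc k).continuousOn.mono (slabO_subset _))
  have m2 : MeasOn S.T fun t x ξ => px 2 (fun s y => S.sqrtMu s y ξ) t x := by
    refine (h.measOn_sqrtMu.mul (MeasOn.sum (s := Finset.univ) fun k _ =>
      (((MeasOn.const (S.ε / 2)).mul (mc k)).mul (h.measOn_px_U 2 k)).add
        ((MeasOn.const (-(1 / 2) * S.ε ^ 2)).mul ((mU k).mul (h.measOn_px_U 2 k))))).congr
      fun q hq => ?_
    have e1 := (h.px_two_sqrtMu q.2.2 hq.2.1) q.1 hq.1 q.2.1 rfl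
    simp only [] at e1 ⊢
    rw [e1, h.px_lg q.2.2 hq.1 hq.2.1]
  have m3 := ((((MeasOn.const (T := S.T) S.ε⁻¹).mul (m0 0)).add ((MeasOn.const S.ε⁻¹).mul
    ((((mc 0).mul (m0 1)).add ((mc 1).mul (m0 2))).add ((mc 2).mul m2)))).div h.measOn_sqrtMu)
  refine m3.congr fun q hq => ?_
  have e0 : dT S.ε 0 (fun t x => S.sqrtMu t x q.2.2) q.1 q.2.1
      = S.ε * pt (fun s y => S.sqrtMu s y q.2.2) q.1 q.2.1 := rfl
  have e1 : dT S.ε 1 (fun t x => S.sqrtMu t x q.2.2) q.1 q.2.1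
      = px 0 (fun s y => S.sqrtMu s y q.2.2) q.1 q.2.1 := rfl
  have e2 : dT S.ε 2 (fun t x => S.sqrtMu t x q.2.2) q.1 q.2.1
      = px 1 (fun s y => S.sqrtMu s y q.2.2) q.1 q.2.1 := rfl
  simp only [bulkFactor, Fin.sum_univ_three, e0, e1, e2, inv_mul_cancel_left₀ hε]

/-- `∫ (1 + |φ|)⁴ |𝐏 f_α|² ≲ ‖f_α‖²`. -/
lemma lintegral_Pf_le {t : ℝ} (ht : t ∈ Ioo 0 S.T) (α : MI) :
    ∫⁻ p, ofReal ((1 + ‖S.phi t p.1 p.2‖) ^ 4 * S.Pf α t p.1 p.2 ^ 2) ∂mXV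
      ≤ ofReal (100 * mom8 * momD ^ 2) * S.nf α t ^ 2 := by
  have ma := aesm_mX ht (h.measX_a α)
  have mb := fun k => aesm_mX ht (h.measX_b α k)
  have mc := aesm_mX ht (h.measX_c α)
  have hmu := continuous_mu0
  have mN : AEStronglyMeasurable (S.macroAbs α t) mX := by
    refine ((ma.norm).add (Finset.aestronglyMeasurable_sum Finset.univ fun k _ => (mb k).norm)).add
      mc.norm |>.congr (Filter.Eventually.of_forall fun x => ?_)
    simp [macroAbs, Finset.sum_apply]
  have h1 : eLpNorm (S.macroAbs α t) 2 mX ≤ 5 * (ofReal momD * S.nf α t) := by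
    have e : S.macroAbs α t = (fun x => ‖S.a α t x‖) + (∑ k, fun x => ‖S.b α k t x‖)
        + fun x => ‖S.c α t x‖ := by
      ext x; simp [macroAbs, Finset.sum_apply]
    rw [e]
    have ms := Finset.aestronglyMeasurable_sum Finset.univ fun k _ => (mb k).norm
    refine (eLpNorm_add_le (ma.norm.add ms) mc.norm one_le_two).trans ?_
    refine (add_le_add_left ((eLpNorm_add_le ma.norm ms one_le_two).trans
      (add_le_add_right (eLpNorm_sum_le (fun k _ => (mb k).norm) one_le_two) _)) _).trans ?_
    simp only [eLpNorm_norm]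
    refine (add_le_add (add_le_add (h.eLpNorm_a_le ht α)
      (Finset.sum_le_sum fun k _ => h.eLpNorm_b_le ht α k)) (h.eLpNorm_c_le ht α)).trans (le_of_eq ?_)
    simp only [Finset.sum_const, Finset.card_univ, Fintype.card_fin, nsmul_eq_mul]
    push_cast
    ring
  have h2 : ∀ x, ∫⁻ ξ, ofReal ((1 + ‖S.phi t x ξ‖) ^ 8 * S.mu t x ξ)
      = ofReal mom8 := fun x => by
    have e2 := lintegral_sub_right_eq_self (μ := (volume : Measure V3))
      (fun ξ : V3 => ofReal ((1 + ‖ξ‖) ^ 8 * mu0 ξ)) (S.ε • S.U t x)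
    simp only [phi, mu]
    rw [e2, mom8, ofReal_integral_eq_lintegral_ofReal (integrable_pow_mul_mu0 8)
      (Filter.Eventually.of_forall fun ξ => mul_nonneg (by positivity) (mu0_pos ξ).le)]
  have mk : AEMeasurable (fun p : V3 × V3 => 4 * ‖S.macroAbs α t p.1‖ₑ ^ 2 *
      ofReal ((1 + ‖S.phi t p.1 p.2‖) ^ 8 * S.mu t p.1 p.2)) mXV := by
    have k1 : AEMeasurable (fun p : V3 × V3 => ‖S.macroAbs α t p.1‖ₑ) mXV :=
      mN.comp_fst.enorm
    have k2 := (aesm_mXV ht (h.measOn_comp_phi (g := fun v => (1 + ‖v‖) ^ 8 * mu0 v)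
      (by fun_prop))).aemeasurable.ennreal_ofReal
    exact ((k1.pow_const 2).const_mul 4).mul k2
  calc _ ≤ ∫⁻ p, 4 * ‖S.macroAbs α t p.1‖ₑ ^ 2 *
        ofReal ((1 + ‖S.phi t p.1 p.2‖) ^ 8 * S.mu t p.1 p.2) ∂mXV := by
        refine lintegral_mono fun p => ?_
        refine (ENNReal.ofReal_le_ofReal (Pf_sq_le α t p.1 p.2)).trans (le_of_eq ?_)
        have hmu0 : 0 ≤ S.mu t p.1 p.2 := (mu0_pos _).le
        rw [ENNReal.ofReal_mul (by positivity), ENNReal.ofReal_mul (by norm_num),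
          Real.enorm_eq_ofReal_abs, ← ENNReal.ofReal_pow (abs_nonneg _), sq_abs]
        norm_num
    _ = ∫⁻ x, ∫⁻ ξ, 4 * ‖S.macroAbs α t x‖ₑ ^ 2 *
        ofReal ((1 + ‖S.phi t x ξ‖) ^ 8 * S.mu t x ξ) ∂volume ∂mX := by
        unfold mXV at mk ⊢
        rw [lintegral_prod _ mk]
    _ = ∫⁻ x, 4 * ofReal mom8 * ‖S.macroAbs α t x‖ₑ ^ 2 ∂mX := by
        refine lintegral_congr fun x => ?_
        rw [lintegral_const_mul' _ _ (ENNReal.mul_ne_top (by norm_num)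
          (ENNReal.pow_ne_top enorm_ne_top)), h2]
        ring
    _ = 4 * ofReal mom8 * eLpNorm (S.macroAbs α t) 2 mX ^ 2 := by
        rw [lintegral_const_mul' _ _ (ENNReal.mul_ne_top (by norm_num) ENNReal.ofReal_ne_top),
          eLpNorm_two_sq]
    _ ≤ 4 * ofReal mom8 * (5 * (ofReal momD * S.nf α t)) ^ 2 := by gcongr
    _ = _ := by
        rw [ENNReal.ofReal_mul (by have := mom8_nonneg; positivity),
          ENNReal.ofReal_mul (p := 100) (by norm_num), ENNReal.ofReal_pow momD_nonneg]
        norm_num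
        ring

end Admissible

end Config

/-! ### The bulk estimate for one multi-index -/

/-- `‖(1 + |ξ|)² e^{-a|ξ|²}‖_{L²}`. -/
def velD (a : ℝ) : ℝ := √(∫ ξ : V3, ((1 + ‖ξ‖) ^ 2 * exp (-a * ‖ξ‖ ^ 2)) ^ 2)

lemma integrable_velD {a : ℝ} (ha : 0 < a) :
    Integrable fun ξ : V3 => ((1 + ‖ξ‖) ^ 2 * exp (-a * ‖ξ‖ ^ 2)) ^ 2 := by
  refine (integrable_pow_mul_exp (a := 2 * a) (by positivity) 4).congr
    (Filter.Eventually.of_forall fun ξ => ?_)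
  simp only []
  rw [mul_pow, ← Real.exp_nat_mul, ← pow_mul]
  congr 2; push_cast; ring

lemma eq_of_ennreal_sq_eq_sq {x y : ℝ≥0∞} (h : x ^ 2 = y ^ 2) : x = y :=
  le_antisymm ((ENNReal.pow_le_pow_left_iff two_ne_zero).1 h.le)
    ((ENNReal.pow_le_pow_left_iff two_ne_zero).1 h.ge)

lemma eLpNorm_prod_mul {u k : V3 → ℝ} (hu : AEStronglyMeasurable u mX)
    (hk : AEStronglyMeasurable k volume) :
    eLpNorm (fun p : V3 × V3 => u p.1 * k p.2) 2 mXV = eLpNorm u 2 mX * eLpNorm k 2 volume := by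
  refine eq_of_ennreal_sq_eq_sq ?_
  rw [mul_pow, eLpNorm_two_sq, eLpNorm_two_sq, eLpNorm_two_sq]
  simp only [enorm_mul, mul_pow]
  unfold mXV
  rw [lintegral_prod_mul (hu.enorm.pow_const 2) (hk.enorm.pow_const 2)]

lemma eLpNorm_velD {a : ℝ} (ha : 0 < a) :
    eLpNorm (fun ξ : V3 => (1 + ‖ξ‖) ^ 2 * exp (-a * ‖ξ‖ ^ 2)) 2 volume
      = ofReal (velD a) := by
  refine eq_of_ennreal_sq_eq_sq ?_
  rw [eLpNorm_two_sq, velD, ← lintegral_ofReal_sq_eq (fun ξ => by positivity) (integrable_velD ha)]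
  refine lintegral_congr fun ξ => ?_
  rw [Real.enorm_of_nonneg (by positivity)]

namespace Config

variable {S : Config} {K τU ρ : ℝ}

namespace Admissible

variable (h : S.Admissible K τU ρ)
include h

lemma nInf_ne_top {t : ℝ} (ht : t ∈ Ioo 0 S.T) (α : MI) : S.nInf ρ α t ≠ ⊤ := by
  obtain ⟨M, hM⟩ := h.sol.decay α
  refine ne_top_of_le_ne_top (ENNReal.ofReal_ne_top (r := M)) ?_
  rw [nInf, eLpNorm_exponent_top]
  refine eLpNormEssSup_le_of_ae_enorm_bound ?_
  filter_upwards [ae_mXV_good ht] with p hp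
  have h1 := hM t ht p.1 p.2 hp.2.1 hp.2.2
  rw [Real.enorm_eq_ofReal_abs, abs_mul, abs_of_pos (Real.exp_pos _)]
  refine ENNReal.ofReal_le_ofReal ?_
  calc _ ≤ exp (ρ * ‖p.2‖ ^ 2) * (M * exp (-ρ * ‖p.2‖ ^ 2)) := by gcongr
    _ = M * (exp (ρ * ‖p.2‖ ^ 2) * exp (-ρ * ‖p.2‖ ^ 2)) := by ring
    _ = M := by rw [← Real.exp_add]; simp

lemma ae_abs_fd_le {t : ℝ} (ht : t ∈ Ioo 0 S.T) (α : MI) :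
    ∀ᵐ p ∂mXV, |S.fd α t p.1 p.2| ≤ (S.nInf ρ α t).toReal * exp (-ρ * ‖p.2‖ ^ 2) := by
  refine ae_wInf_bound (g := fun ξ s y => S.fd α s y ξ) ENNReal.toReal_nonneg ?_
  rw [ENNReal.ofReal_toReal (h.nInf_ne_top ht α)]
  exact le_rfl

lemma measX_gradU : MeasX S.T S.gradU := by
  have h1 : ContinuousOn (fun q : ℝ × V3 => √(∑ i, ∑ j, px i (S.Uc j) q.1 q.2 ^ 2)) (slabO S.T) :=
    (continuousOn_finsetSum _ fun i _ => continuousOn_finsetSum _ fun j _ =>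
      (continuousOn_px i (h.smUc j)).pow 2).sqrt
  refine (MeasX.of_continuousOn (g := fun t x => √(∑ i, ∑ j, px i (S.Uc j) t x ^ 2)) h1).congr
    fun q hq => ?_
  simp only [gradU, EuclideanSpace.norm_sq_eq, Real.norm_eq_abs, sq_abs, h.px_Uc hq.1 hq.2]

/-- The high velocities `|ξ| ≥ 1/ε` contribute an exponentially small term. -/
lemma lintegral_far_le (hρ : 0 < ρ) (hε : S.ε ≤ 1) {t : ℝ} (ht : t ∈ Ioo 0 S.T) (α : MI) :
    ∫⁻ p, ofReal (if ‖S.phi t p.1 p.2‖ ≤ (1 + K) / S.ε then 0 else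
        ‖p.2‖ * ‖S.phi t p.1 p.2‖ * S.gradU t p.1 * S.fd α t p.1 p.2 ^ 2) ∂mXV
      ≤ ofReal ((1 + K) * velD (ρ / 2)) * (ofReal (exp (-ρ / (2 * S.ε ^ 2)))
        * eLpNorm (S.gradU t) 2 mX * S.nInf ρ α t * S.nf α t) := by
  have hK := h.K_nonneg ht
  have hεp := h.eps_pos
  set N := (S.nInf ρ α t).toReal with hN
  have hN0 : 0 ≤ N := ENNReal.toReal_nonneg
  set k : V3 → ℝ := fun ξ => (1 + ‖ξ‖) ^ 2 * exp (-(ρ / 2) * ‖ξ‖ ^ 2) with hk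
  have mk : AEStronglyMeasurable k volume := by
    rw [hk]; exact Continuous.aestronglyMeasurable (by fun_prop)
  have mg := aesm_mX ht h.measX_gradU
  have hpt : ∀ᵐ p ∂mXV, ofReal (if ‖S.phi t p.1 p.2‖ ≤ (1 + K) / S.ε then 0 else
        ‖p.2‖ * ‖S.phi t p.1 p.2‖ * S.gradU t p.1 * S.fd α t p.1 p.2 ^ 2)
      ≤ ofReal (exp (-ρ / (2 * S.ε ^ 2)) * N * (1 + K)) *
        (‖S.gradU t p.1 * k p.2‖ₑ * ‖S.fd α t p.1 p.2‖ₑ) := by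
    filter_upwards [h.ae_abs_fd_le ht α, ae_mXV_pos] with p hp hpos
    split_ifs with hcase
    · simp
    · obtain ⟨b1, b2⟩ := h.norm_le_phi ht hpos p.2
      have hg : 0 ≤ S.gradU t p.1 := Real.sqrt_nonneg _
      have hk0 : 0 ≤ k p.2 := by rw [hk]; positivity
      have hεK : S.ε * K ≤ K := mul_le_of_le_one_left hK hε
      -- the velocity itself is large
      have hξ : 1 / S.ε ≤ ‖p.2‖ := by
        have h1 : (1 + K) / S.ε < ‖S.phi t p.1 p.2‖ := not_le.1 hcase
        have h2 : (1 + K) / S.ε = 1 / S.ε + K / S.ε := add_div _ _ _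
        have h3 : K ≤ K / S.ε := le_div_self hK hεp hε
        linarith
      have hexp : exp (-ρ * ‖p.2‖ ^ 2)
          ≤ exp (-ρ / (2 * S.ε ^ 2)) * exp (-(ρ / 2) * ‖p.2‖ ^ 2) := by
        rw [← Real.exp_add]
        refine Real.exp_le_exp.2 ?_
        have h1 : (1 / S.ε) ^ 2 ≤ ‖p.2‖ ^ 2 := pow_le_pow_left₀ (by positivity) hξ 2
        have h2 : -ρ / (2 * S.ε ^ 2) = -(ρ / 2) * (1 / S.ε) ^ 2 := by field_simp
        rw [h2]
        nlinarith
      rw [Real.enorm_of_nonneg (mul_nonneg hg hk0), Real.enorm_eq_ofReal_abs,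
        ← ENNReal.ofReal_mul (mul_nonneg hg hk0), ← ENNReal.ofReal_mul (by positivity)]
      refine ENNReal.ofReal_le_ofReal ?_
      have h4 : ‖p.2‖ * ‖S.phi t p.1 p.2‖ ≤ (1 + K) * (1 + ‖p.2‖) ^ 2 := by
        calc _ ≤ (1 + ‖p.2‖) * ((1 + K) * (1 + ‖p.2‖)) := by
              gcongr
              · linarith
              · nlinarith [norm_nonneg p.2]
          _ = _ := by ring
      have h5 : S.fd α t p.1 p.2 ^ 2
          ≤ (N * (exp (-ρ / (2 * S.ε ^ 2)) * exp (-(ρ / 2) * ‖p.2‖ ^ 2)))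
            * |S.fd α t p.1 p.2| := by
        rw [← sq_abs, sq]
        refine mul_le_mul_of_nonneg_right (hp.trans ?_) (abs_nonneg _)
        exact mul_le_mul_of_nonneg_left hexp hN0
      calc _ ≤ ((1 + K) * (1 + ‖p.2‖) ^ 2) * S.gradU t p.1 *
            ((N * (exp (-ρ / (2 * S.ε ^ 2)) * exp (-(ρ / 2) * ‖p.2‖ ^ 2)))
            * |S.fd α t p.1 p.2|) := by gcongr
        _ = _ := by rw [hk]; ring
  refine (lintegral_mono_ae hpt).trans ?_
  rw [lintegral_const_mul' _ _ ENNReal.ofReal_ne_top]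
  have m1 : AEStronglyMeasurable (fun p : V3 × V3 => S.gradU t p.1 * k p.2) mXV :=
    (mg.comp_fst).mul mk.comp_snd
  refine (mul_le_mul_right (lintegral_enorm_mul_le m1 (aesm_mXV ht (h.measOn_fd α))) _).trans ?_
  rw [eLpNorm_prod_mul mg mk, hk, eLpNorm_velD (half_pos hρ), ENNReal.ofReal_mul (by positivity),
    ENNReal.ofReal_mul (by positivity), ENNReal.ofReal_mul (q := velD _) (by positivity), hN,
    ENNReal.ofReal_toReal (h.nInf_ne_top ht α)]
  refine le_of_eq ?_
  rw [nf]
  ring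

/-- Up to the singular macroscopic part `bulkSing · (𝐏f_α)²`, the bulk integrand is absorbed by
the dissipation, the macroscopic part, and the contribution of the high velocities. -/
lemma lintegral_bulk_sub_le (hρ : 0 < ρ) {c₀ η ε₀ : ℝ} (hc₀ : 0 < c₀)
    (hν : ∀ v : V3, c₀ * (1 + ‖v‖) ≤
      ∫ p : V3 × S2, |inner ℝ (v - p.1) (p.2 : V3)| * mu0 p.1 ∂mColl)
    (hη : 0 < η) (hes : S.ε ≤ ε₀ * √S.κ) (hε1 : ε₀ ≤ 1) (hε3 : ε₀ ^ 2 ≤ c₀ * η / 4)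
    (hε4 : ε₀ * (K * (1 + K) + 2 * (6 * K + 7 * K ^ 2) * (2 + K) + 2 * K) ≤ c₀ * η / 2)
    {t : ℝ} (ht : t ∈ Ioo 0 S.T) (α : MI) :
    ∫⁻ p, ‖S.bulkIntegrand α t p - S.bulkSing t p.1 p.2 * S.Pf α t p.1 p.2 ^ 2‖ₑ ∂mXV
      ≤ ofReal (η / (S.κ * S.ε ^ 2)) * S.nDiss α t ^ 2
        + (ofReal ((K ^ 2 + 2 * (6 * K + 7 * K ^ 2) + 4 * K) * (100 * mom8 * momD ^ 2))
            * S.nf α t ^ 2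
          + ofReal ((1 + K) * velD (ρ / 2)) *
            (ofReal (exp (-ρ / (2 * S.ε ^ 2)))
              * eLpNorm (S.gradU t) 2 mX * S.nInf ρ α t * S.nf α t)) := by
  have hK := h.K_nonneg ht
  have hεp := h.eps_pos
  have hs := h.sqrtκ_pos
  have hs1 := h.sqrtκ_le
  have hεκ : S.ε ≤ √S.κ := hes.trans (mul_le_of_le_one_left hs.le hε1)
  have hε : S.ε ≤ 1 := hεκ.trans hs1
  set C1 := K ^ 2 + 2 * (6 * K + 7 * K ^ 2) + 4 * K with hC1
  have hC0 : 0 ≤ C1 := by positivity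
  set Q : V3 × V3 → ℝ := fun p => (1 + ‖S.phi t p.1 p.2‖) ^ 4 * S.Pf α t p.1 p.2 ^ 2 with hQ
  set R : V3 × V3 → ℝ := fun p => if ‖S.phi t p.1 p.2‖ ≤ (1 + K) / S.ε then 0 else
        ‖p.2‖ * ‖S.phi t p.1 p.2‖ * S.gradU t p.1 * S.fd α t p.1 p.2 ^ 2 with hR
  have hR0 : ∀ p, 0 ≤ R p := fun p => by
    have : 0 ≤ S.gradU t p.1 := Real.sqrt_nonneg _
    simp only [hR]; split_ifs <;> positivity
  have mQ : AEMeasurable (fun p => ofReal (C1 * Q p)) mXV := by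
    have := aesm_mXV ht (((MeasOn.const C1).mul ((h.measOn_comp_phi
      (g := fun v => (1 + ‖v‖) ^ 4) (by fun_prop)).mul ((h.measOn_Pf α).mul (h.measOn_Pf α)))))
    refine (this.aemeasurable.congr (Filter.Eventually.of_forall fun p => ?_)).ennreal_ofReal
    simp only [hQ]; ring
  have mR : AEMeasurable (fun p => ofReal (R p)) mXV := by
    have m1 : AEMeasurable (fun p : V3 × V3 => ‖S.phi t p.1 p.2‖) mXV :=
      (aesm_mXV ht (h.measOn_comp_phi continuous_norm)).aemeasurable
    have m2 : AEMeasurable (fun p : V3 × V3 => S.gradU t p.1) mXV :=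
      (aesm_mX ht h.measX_gradU).comp_fst.aemeasurable
    have m3 := (aesm_mXV ht (h.measOn_fd α)).aemeasurable
    have m4 : AEMeasurable (fun p : V3 × V3 =>
        ‖p.2‖ * ‖S.phi t p.1 p.2‖ * S.gradU t p.1 * S.fd α t p.1 p.2 ^ 2) mXV :=
      ((((by fun_prop : Measurable fun p : V3 × V3 => ‖p.2‖).aemeasurable).mul m1).mul m2).mul
        (m3.pow_const 2)
    have m5 : AEMeasurable (fun p : V3 × V3 => (Iic ((1 + K) / S.ε)).indicator
      (fun _ => (0 : ℝ)) ‖S.phi t p.1 p.2‖ + (Ioi ((1 + K) / S.ε)).indicator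
      (fun _ => (1 : ℝ)) ‖S.phi t p.1 p.2‖ * (‖p.2‖ * ‖S.phi t p.1 p.2‖ * S.gradU t p.1
        * S.fd α t p.1 p.2 ^ 2)) mXV :=
      ((measurable_const.indicator measurableSet_Iic).comp_aemeasurable m1).add
        (((measurable_const.indicator measurableSet_Ioi).comp_aemeasurable m1).mul m4)
    refine (m5.congr (Filter.Eventually.of_forall fun p => ?_)).ennreal_ofReal
    simp only [hR, indicator, mem_Iic, mem_Ioi]
    split_ifs <;> first | (exfalso; linarith) | simp
  have hpt : ∀ᵐ p ∂mXV, ‖S.bulkIntegrand α t p - S.bulkSing t p.1 p.2 * S.Pf α t p.1 p.2 ^ 2‖ₑ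
      ≤ ofReal (η / (S.κ * S.ε ^ 2)) *
        ‖√(S.nu t p.1 p.2) * (S.fd α t p.1 p.2 - S.Pf α t p.1 p.2)‖ₑ ^ 2
        + (ofReal (C1 * Q p) + ofReal (R p)) := by
    filter_upwards [ae_mXV_pos] with p hp
    have hn := hν (S.phi t p.1 p.2)
    rw [← nu_eq] at hn
    have hn0 : 0 ≤ S.nu t p.1 p.2 := le_trans (by positivity) hn
    have hW : |S.bulkFactor t p.1 p.2| ≤ K * ‖S.phi t p.1 p.2‖
        + ‖p.2‖ * ‖S.phi t p.1 p.2‖ * S.gradU t p.1 := h.abs_bulkFactor_le ht hp p.2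
    have hnf : ‖S.phi t p.1 p.2‖ ≤ (1 + K) / S.ε ∨ (1 ≤ 2 * S.ε * ‖S.phi t p.1 p.2‖ ∧
        |S.bulkFactor t p.1 p.2| ≤ K * ‖S.phi t p.1 p.2‖
        + ‖p.2‖ * ‖S.phi t p.1 p.2‖ * S.gradU t p.1) := by
      rcases le_or_gt ‖S.phi t p.1 p.2‖ ((1 + K) / S.ε) with h1 | h1
      · exact Or.inl h1
      · refine Or.inr ⟨?_, hW⟩
        have := (div_lt_iff₀ hεp).1 h1
        linarith
    have key := bulk_pointwise_le (P := S.Pf α t p.1 p.2)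
      (g := S.fd α t p.1 p.2 - S.Pf α t p.1 p.2) hK (by positivity) hc₀ hη hεp hs hs1 hes hε1
      hε3 hε4 (norm_nonneg (S.phi t p.1 p.2)) (h.abs_bulkSing_le ht hp p.2)
      (h.abs_bulkFactor_sub_le hεκ ht hp p.2) hn hnf
    rw [add_sub_cancel, Real.sq_sqrt h.kappa_pos.le] at key
    rw [bulkIntegrand, sq_abs, Real.enorm_eq_ofReal_abs]
    have hfirst : 0 ≤ η / (S.κ * S.ε ^ 2) := by have := h.kappa_pos; positivity
    have hQ0 : 0 ≤ Q p := by rw [hQ]; positivity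
    have e1 : ‖√(S.nu t p.1 p.2) * (S.fd α t p.1 p.2 - S.Pf α t p.1 p.2)‖ₑ ^ 2
        = ofReal (S.nu t p.1 p.2 * (S.fd α t p.1 p.2 - S.Pf α t p.1 p.2) ^ 2) := by
      rw [Real.enorm_eq_ofReal_abs, ← ENNReal.ofReal_pow (abs_nonneg _), sq_abs, mul_pow,
        Real.sq_sqrt hn0]
    rw [e1, ← ENNReal.ofReal_mul hfirst, ← ENNReal.ofReal_add (by positivity) (hR0 p),
      ← ENNReal.ofReal_add (by positivity) (add_nonneg (by positivity) (hR0 p))]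
    refine ENNReal.ofReal_le_ofReal (key.trans (le_of_eq ?_))
    simp only [hQ, hR]
    ring
  refine (lintegral_mono_ae hpt).trans ?_
  have mQR : AEMeasurable (fun p => ofReal (C1 * Q p) + ofReal (R p)) mXV :=
    mQ.add mR
  rw [lintegral_add_right' _ mQR, lintegral_add_right' _ mR,
    lintegral_const_mul' _ _ ENNReal.ofReal_ne_top, nDiss, eLpNorm_two_sq]
  refine add_le_add le_rfl (add_le_add ?_ (h.lintegral_far_le hρ hε ht α))
  simp only [ENNReal.ofReal_mul hC0]
  rw [lintegral_const_mul' _ _ ENNReal.ofReal_ne_top, mul_assoc]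
  gcongr
  exact h.lintegral_Pf_le ht α

end Admissible

end Config

/-- The constant of the regular terms in the bulk estimate. The summand `1` makes it positive, so
that the bound is infinite where `‖f_α‖` is. -/
def bulkConst (K ρ : ℝ) : ℝ :=
  (K ^ 2 + 2 * (6 * K + 7 * K ^ 2) + 4 * K) * (100 * mom8 * momD ^ 2)
    + (1 + K) * velD (ρ / 2) + (mom22 2 0 + mom22 2 1) * (momD * (K ^ 2 * momD + K)) + 1

lemma velD_nonneg (a : ℝ) : 0 ≤ velD a := Real.sqrt_nonneg _

namespace Config

variable {S : Config} {K τU ρ : ℝ}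

namespace Admissible

variable (h : S.Admissible K τU ρ)
include h

/-- Only the part of `b_{α,3}` that vanishes linearly at the wall meets the boundary layer gradient
at full strength; the explicit parts carry a factor `ε ≤ √κ`. -/
lemma lintegral_macro_le (hεκ : S.ε ≤ √S.κ) {t : ℝ} (ht : t ∈ Ioo 0 S.T) (α : MI) (j : Fin 3)
    (hj : eLpNorm (fun x : V3 => x 2 * (px 2 S.U t x) j) ∞ mX ≤ S.layer t) :
    ∫⁻ x, ‖(px 2 S.U t x) j * (S.b α 2 t x * S.b α j t x)‖ₑ ∂mX
      ≤ ofReal momD * (S.layer t * S.nTb α t * S.nf α t)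
        + ofReal (momD * (K ^ 2 * momD + K)) *
          (S.nf α t ^ 2 + S.forceB α t * S.nf α t) := by
  have hK := h.K_nonneg ht
  have hεp := h.eps_pos
  have hδ := h.delta_pos
  have hs := h.sqrtκ_pos
  have hmD := momD_nonneg
  have ma := aesm_mX ht (h.measX_a α)
  have mb := fun k => aesm_mX ht (h.measX_b α k)
  have m1 := aesm_mX ht ((TBdd.of_ssm (ε := S.ε) h.sm_U3sq).meas α)
  have m2 := aesm_mX ht ((TBdd.of_ssm (ε := S.ε) h.sm_PU3).meas α)
  have mU : AEStronglyMeasurable (S.Uc 2 t) mX :=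
    aesm_mX ht ((TBdd.of_ssm (ε := S.ε) (h.smUc 2)).meas 0)
  have mT : AEStronglyMeasurable (fun x => S.Tb α t x / x 2) mX := by
    have c1 := continuous_coord 2
    exact (((((mb 2).add ((mU.const_mul S.ε).mul ma)).add (m1.const_mul _)).add
      (m2.const_mul _)).aemeasurable.div c1.aestronglyMeasurable.aemeasurable).aestronglyMeasurable
  set B := ofReal (K * (S.ε / (√S.κ * S.δ))) with hB
  have hpt : ∀ᵐ x ∂mX, ‖(px 2 S.U t x) j * (S.b α 2 t x * S.b α j t x)‖ₑ
      ≤ S.layer t * (‖S.Tb α t x / x 2‖ₑ * ‖S.b α j t x‖ₑ)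
        + (ofReal (K ^ 2) * (‖S.a α t x‖ₑ * ‖S.b α j t x‖ₑ)
          + (B * (‖S.D α S.U3sq t x‖ₑ * ‖S.b α j t x‖ₑ)
            + B * (‖S.D α S.PU3 t x‖ₑ * ‖S.b α j t x‖ₑ))) := by
    have hl := ae_le_eLpNormEssSup (f := fun x : V3 => x 2 * (px 2 S.U t x) j) (μ := mX)
    filter_upwards [ae_mem_cellInt, hl] with x hx hlx
    have hx2 : 0 < x 2 := hx.2.2
    rw [eLpNorm_exponent_top] at hj
    have hv : |(px 2 S.U t x) j| ≤ K / √S.κ :=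
      (abs_coord_le _ j).trans (h.bound_zero ht hx2).2.2.2.1
    have hU : |S.Uc 2 t x| ≤ K := (abs_coord_le _ 2).trans (h.abs_Uc_le ht hx2)
    set v := (px 2 S.U t x) j with hvd
    have e1 : v * (S.b α 2 t x * S.b α j t x) = (x 2 * v) * (S.Tb α t x / x 2 * S.b α j t x)
        + (-(v * (S.ε * S.Uc 2 t x)) * (S.a α t x * S.b α j t x)
          + (-(v * (S.ε / (2 * S.δ))) * (S.D α S.U3sq t x * S.b α j t x)
            + -(v * (S.ε / S.δ)) * (S.D α S.PU3 t x * S.b α j t x))) := by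
      simp only [Tb]
      field_simp
      ring
    have en : ∀ {r R : ℝ}, |r| ≤ R → ‖r‖ₑ ≤ ofReal R := fun hr => by
      rw [Real.enorm_eq_ofReal_abs]; exact ENNReal.ofReal_le_ofReal hr
    have f2 : ‖-(v * (S.ε * S.Uc 2 t x))‖ₑ ≤ ofReal (K ^ 2) := en <| by
      rw [abs_neg, abs_mul, abs_mul, abs_of_pos hεp]
      calc _ ≤ K / √S.κ * (√S.κ * K) := by gcongr
        _ = K ^ 2 := by field_simp
    have f4 : |v| * (S.ε / S.δ) ≤ K * (S.ε / (√S.κ * S.δ)) := by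
      calc _ ≤ K / √S.κ * (S.ε / S.δ) := by gcongr
        _ = _ := by field_simp
    have f5 : ‖-(v * (S.ε / S.δ))‖ₑ ≤ B := en <| by
      rw [abs_neg, abs_mul, abs_of_pos (show 0 < S.ε / S.δ by positivity)]
      exact f4
    have f3 : ‖-(v * (S.ε / (2 * S.δ)))‖ₑ ≤ B := en <| by
      rw [abs_neg, abs_mul, abs_of_pos (show 0 < S.ε / (2 * S.δ) by positivity)]
      refine le_trans (mul_le_mul_of_nonneg_left ?_ (abs_nonneg _)) f4
      gcongr; linarith
    rw [e1]
    refine (enorm_add_le _ _).trans (add_le_add ?_ ((enorm_add_le _ _).trans (add_le_add ?_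
      ((enorm_add_le _ _).trans (add_le_add ?_ ?_)))))
    · rw [enorm_mul, enorm_mul (S.Tb α t x / x 2)]
      exact mul_le_mul_left (hlx.trans hj) _
    all_goals
      rw [enorm_mul, enorm_mul _ (S.b α j t x)]
      exact mul_le_mul_left (by assumption) _
  have mm : ∀ {u : V3 → ℝ}, AEStronglyMeasurable u mX →
      AEMeasurable (fun x => ‖u x‖ₑ * ‖S.b α j t x‖ₑ) mX := fun hu => hu.enorm.mul (mb j).enorm
  have m34 : AEMeasurable (fun x => B * (‖S.D α S.U3sq t x‖ₑ * ‖S.b α j t x‖ₑ)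
            + B * (‖S.D α S.PU3 t x‖ₑ * ‖S.b α j t x‖ₑ)) mX :=
    ((mm m1).const_mul B).add ((mm m2).const_mul B)
  have m234 : AEMeasurable (fun x => ofReal (K ^ 2) * (‖S.a α t x‖ₑ * ‖S.b α j t x‖ₑ)
      + (B * (‖S.D α S.U3sq t x‖ₑ * ‖S.b α j t x‖ₑ)
            + B * (‖S.D α S.PU3 t x‖ₑ * ‖S.b α j t x‖ₑ))) mX :=
    ((mm ma).const_mul _).add m34
  refine (lintegral_mono_ae hpt).trans ?_
  rw [lintegral_add_right' _ m234, lintegral_add_right' _ m34,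
    lintegral_add_right' _ ((mm m2).const_mul B), lintegral_const_mul'' _ (mm mT),
    lintegral_const_mul'' _ (mm ma), lintegral_const_mul'' _ (mm m1),
    lintegral_const_mul'' _ (mm m2)]
  have hb := h.eLpNorm_b_le ht α j
  have cs : ∀ {u : V3 → ℝ}, AEStronglyMeasurable u mX → ∫⁻ x, ‖u x‖ₑ * ‖S.b α j t x‖ₑ ∂mX
      ≤ eLpNorm u 2 mX * (ofReal momD * S.nf α t) := fun hu =>
    (lintegral_enorm_mul_le hu (mb j)).trans (mul_le_mul_right hb _)
  refine (add_le_add (mul_le_mul_right (cs mT) _) (add_le_add (mul_le_mul_right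
    ((cs ma).trans (mul_le_mul_left (h.eLpNorm_a_le ht α) _)) _)
    (add_le_add (mul_le_mul_right (cs m1) _) (mul_le_mul_right (cs m2) _)))).trans ?_
  refine add_le_add (le_of_eq (by rw [nTb]; ring)) ?_
  have g1 : ofReal (K ^ 2) * (ofReal momD * S.nf α t *
      (ofReal momD * S.nf α t)) = ofReal (momD * (K ^ 2 * momD)) * S.nf α t ^ 2 := by
    rw [ENNReal.ofReal_mul hmD, ENNReal.ofReal_mul (by positivity)]; ring
  have g2 : B * (eLpNorm (S.D α S.U3sq t) 2 mX * (ofReal momD * S.nf α t))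
      + B * (eLpNorm (S.D α S.PU3 t) 2 mX * (ofReal momD * S.nf α t))
      = ofReal (momD * K) * (S.forceB α t * S.nf α t) := by
    rw [hB, ENNReal.ofReal_mul hK, ENNReal.ofReal_mul hmD, forceB]; ring
  simp only [D] at g2
  rw [g1, g2, mul_add, ENNReal.ofReal_mul hmD, ENNReal.ofReal_mul hmD, ENNReal.ofReal_mul hmD]
  gcongr
  · exact le_add_of_nonneg_right hK
  · exact le_add_of_nonneg_left (by positivity)

lemma integrable_bulkSing_mul {t : ℝ} (ht : t ∈ Ioo 0 S.T) (α : MI) (hf : S.nf α t ≠ ⊤) :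
    Integrable (fun p : V3 × V3 => S.bulkSing t p.1 p.2 * S.Pf α t p.1 p.2 ^ 2) mXV := by
  have hK := h.K_nonneg ht
  have hs := h.sqrtκ_pos
  refine ⟨?_, ?_⟩
  · exact (aesm_mXV ht (h.measOn_bulkSing)).mul ((aesm_mXV ht (h.measOn_Pf α)).pow 2)
  · have hpt : ∀ᵐ p ∂mXV, ‖S.bulkSing t p.1 p.2 * S.Pf α t p.1 p.2 ^ 2‖ₑ
        ≤ ofReal (K / √S.κ) *
          ofReal ((1 + ‖S.phi t p.1 p.2‖) ^ 4 * S.Pf α t p.1 p.2 ^ 2) := by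
      filter_upwards [ae_mXV_pos] with p hp
      rw [← ENNReal.ofReal_mul (by positivity), Real.enorm_eq_ofReal_abs]
      refine ENNReal.ofReal_le_ofReal ?_
      have h1 := h.abs_bulkSing_le ht hp p.2
      have h2 : ‖S.phi t p.1 p.2‖ ^ 2 ≤ (1 + ‖S.phi t p.1 p.2‖) ^ 4 :=
        (pow_le_pow_left₀ (norm_nonneg _) (by linarith) 2).trans
          (pow_le_pow_right₀ (by linarith [norm_nonneg (S.phi t p.1 p.2)]) (by norm_num))
      rw [abs_mul, abs_of_nonneg (sq_nonneg (S.Pf α t p.1 p.2)), ← mul_assoc]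
      refine mul_le_mul_of_nonneg_right (h1.trans ?_) (sq_nonneg _)
      gcongr
    refine (lintegral_mono_ae hpt).trans_lt ?_
    rw [lintegral_const_mul' _ _ ENNReal.ofReal_ne_top]
    refine ENNReal.mul_lt_top ENNReal.ofReal_lt_top ((h.lintegral_Pf_le ht α).trans_lt ?_)
    exact ENNReal.mul_lt_top ENNReal.ofReal_lt_top (ENNReal.pow_lt_top hf.lt_top)

section Bulk

variable (hρ : 0 < ρ) {c₀ η ε₀ : ℝ} (hc₀ : 0 < c₀)
    (hν : ∀ v : V3, c₀ * (1 + ‖v‖) ≤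
      ∫ p : V3 × S2, |inner ℝ (v - p.1) (p.2 : V3)| * mu0 p.1 ∂mColl)
    (hη : 0 < η) (hes : S.ε ≤ ε₀ * √S.κ) (hε1 : ε₀ ≤ 1) (hε3 : ε₀ ^ 2 ≤ c₀ * η / 4)
    (hε4 : ε₀ * (K * (1 + K) + 2 * (6 * K + 7 * K ^ 2) * (2 + K) + 2 * K) ≤ c₀ * η / 2)
include hρ hc₀ hν hη hes hε1 hε3 hε4

lemma integrable_bulk_sub {t : ℝ} (ht : t ∈ Ioo 0 S.T) (α : MI) (hf : S.nf α t ≠ ⊤)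
    (hd : S.nDiss α t ≠ ⊤) : Integrable (fun p : V3 × V3 =>
      S.bulkIntegrand α t p - S.bulkSing t p.1 p.2 * S.Pf α t p.1 p.2 ^ 2) mXV := by
  refine ⟨?_, (h.lintegral_bulk_sub_le hρ hc₀ hν hη hes hε1 hε3 hε4 ht α).trans_lt ?_⟩
  · have m1 := (aesm_mXV ht h.measOn_bulkFactor).mul ((aesm_mXV ht (h.measOn_fd α)).norm.pow 2)
    exact m1.sub (h.integrable_bulkSing_mul ht α hf).1
  · have hg : eLpNorm (S.gradU t) 2 mX < ⊤ :=
      (h.flow.bound_L2 t ht).trans_lt ENNReal.ofReal_lt_top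
    have hi := (h.nInf_ne_top ht α).lt_top
    exact ENNReal.add_lt_top.2 ⟨ENNReal.mul_lt_top ENNReal.ofReal_lt_top
      (ENNReal.pow_lt_top hd.lt_top), ENNReal.add_lt_top.2
      ⟨ENNReal.mul_lt_top ENNReal.ofReal_lt_top (ENNReal.pow_lt_top hf.lt_top),
        ENNReal.mul_lt_top ENNReal.ofReal_lt_top (ENNReal.mul_lt_top (ENNReal.mul_lt_top
          (ENNReal.mul_lt_top ENNReal.ofReal_lt_top hg) hi) hf.lt_top)⟩⟩

lemma integrable_bulkIntegrand {t : ℝ} (ht : t ∈ Ioo 0 S.T) (α : MI) (hf : S.nf α t ≠ ⊤)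
    (hd : S.nDiss α t ≠ ⊤) : Integrable (S.bulkIntegrand α t) mXV := by
  have := (h.integrable_bulk_sub hρ hc₀ hν hη hes hε1 hε3 hε4 ht α hf hd).add
    (h.integrable_bulkSing_mul ht α hf)
  refine this.congr (Filter.Eventually.of_forall fun p => ?_)
  simp

/-- The bulk estimate, with the absolute constant in front of the layer term singled out. -/
lemma abs_bulk_le {t : ℝ} (ht : t ∈ Ioo 0 S.T) (α : MI) :
    ofReal |S.bulk α t| ≤ ofReal (η / (S.κ * S.ε ^ 2)) * S.nDiss α t ^ 2
      + ofReal (bulkConst K ρ) *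
        (ofReal (exp (-ρ / (2 * S.ε ^ 2))) * eLpNorm (S.gradU t) 2 mX
          * S.nInf ρ α t * S.nf α t + S.nf α t ^ 2 + S.forceB α t * S.nf α t)
      + ofReal ((mom22 2 0 + mom22 2 1) * momD) *
        (S.layer t * S.nTb α t * S.nf α t) := by
  have hK := h.K_nonneg ht
  have hκ := h.kappa_pos
  have hεp := h.eps_pos
  have hmD := momD_nonneg
  have h20 := mom22_nonneg 2 0
  have h21 := mom22_nonneg 2 1
  have h8 := mom8_nonneg
  have hv := velD_nonneg (ρ / 2)
  have hb1 : 0 < bulkConst K ρ := by unfold bulkConst; positivity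
  -- `bulk` is a junk value only where one of the two norms is infinite, and so is the bound there
  by_cases hf : S.nf α t = ⊤
  · have e1 : ofReal (bulkConst K ρ) *
        (ofReal (exp (-ρ / (2 * S.ε ^ 2))) * eLpNorm (S.gradU t) 2 mX
          * S.nInf ρ α t * S.nf α t + S.nf α t ^ 2 + S.forceB α t * S.nf α t) = ⊤ := by
      have e2 : S.nf α t ^ 2 = ⊤ := by rw [hf]; exact ENNReal.top_pow two_ne_zero
      rw [e2, add_top, top_add, ENNReal.mul_top (by simpa using hb1)]
    rw [e1, add_top, top_add]
    exact le_top
  by_cases hd : S.nDiss α t = ⊤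
  · have e1 : ofReal (η / (S.κ * S.ε ^ 2)) * S.nDiss α t ^ 2 = ⊤ := by
      rw [hd, ENNReal.top_pow two_ne_zero,
        ENNReal.mul_top (by rw [Ne, ENNReal.ofReal_eq_zero, not_le]; positivity)]
    rw [e1, top_add, top_add]
    exact le_top
  have hεκ : S.ε ≤ √S.κ := hes.trans (mul_le_of_le_one_left h.sqrtκ_pos.le hε1)
  have i1 := h.integrable_bulk_sub hρ hc₀ hν hη hes hε1 hε3 hε4 ht α hf hd
  have i2 := h.integrable_bulkSing_mul ht α hf
  have e1 : S.bulk α t = (∫ p, (S.bulkIntegrand α t p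
        - S.bulkSing t p.1 p.2 * S.Pf α t p.1 p.2 ^ 2) ∂mXV)
      + ∫ x, (mom22 2 0 * ((px 2 S.U t x) 0 * (S.b α 2 t x * S.b α 0 t x))
        + mom22 2 1 * ((px 2 S.U t x) 1 * (S.b α 2 t x * S.b α 1 t x))) ∂mX := by
    have e2 : ∫ p, S.bulkSing t p.1 p.2 * S.Pf α t p.1 p.2 ^ 2 ∂mXV
        = ∫ x, (∫ ξ, S.bulkSing t x ξ * S.Pf α t x ξ ^ 2) ∂mX := integral_prod _ i2
    simp only [S.integral_bulkSing_mul] at e2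
    rw [← e2, ← integral_add i1 i2, bulk]
    simp
  have e3 : ofReal |S.bulk α t| ≤
      (∫⁻ p, ‖S.bulkIntegrand α t p - S.bulkSing t p.1 p.2 * S.Pf α t p.1 p.2 ^ 2‖ₑ ∂mXV)
      + (ofReal (mom22 2 0) *
          ∫⁻ x, ‖(px 2 S.U t x) 0 * (S.b α 2 t x * S.b α 0 t x)‖ₑ ∂mX
        + ofReal (mom22 2 1) *
          ∫⁻ x, ‖(px 2 S.U t x) 1 * (S.b α 2 t x * S.b α 1 t x)‖ₑ ∂mX) := by
    rw [← Real.enorm_eq_ofReal_abs, e1]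
    refine (enorm_add_le _ _).trans (add_le_add (enorm_integral_le_lintegral_enorm _)
      ((enorm_integral_le_lintegral_enorm _).trans ?_))
    have mb := fun k => aesm_mX ht (h.measX_b α k)
    have mp : ∀ j, AEStronglyMeasurable (fun x => (px 2 S.U t x) j) mX := fun j =>
      (aesm_mX ht ((TBdd.px_two (ε := S.ε) (h.smUc j)).meas 0)).congr <| by
        filter_upwards [ae_mem_cellInt] with x hx
        exact h.px_Uc ht hx.2.2 2 j
    have mm : ∀ j, AEMeasurable (fun x => ‖(px 2 S.U t x) j * (S.b α 2 t x * S.b α j t x)‖ₑ) mX :=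
      fun j => ((mp j).mul ((mb 2).mul (mb j))).enorm
    rw [← lintegral_const_mul'' _ (mm 0), ← lintegral_const_mul'' _ (mm 1),
      ← lintegral_add_right' _ ((mm 1).const_mul _)]
    refine lintegral_mono fun x => (enorm_add_le _ _).trans (le_of_eq ?_)
    rw [enorm_mul (mom22 2 0), enorm_mul (mom22 2 1), Real.enorm_of_nonneg h20,
      Real.enorm_of_nonneg h21]
  have q0 := h.lintegral_macro_le hεκ ht α 0 (le_max_left _ _)
  have q1 := h.lintegral_macro_le hεκ ht α 1 (le_max_right _ _)
  refine (e3.trans (add_le_add (h.lintegral_bulk_sub_le hρ hc₀ hν hη hes hε1 hε3 hε4 ht α)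
    (add_le_add (mul_le_mul_right q0 _) (mul_le_mul_right q1 _)))).trans ?_
  rw [bulkConst]
  set C1 := (K ^ 2 + 2 * (6 * K + 7 * K ^ 2) + 4 * K) * (100 * mom8 * momD ^ 2)
  set C2 := (1 + K) * velD (ρ / 2)
  set C3 := momD * (K ^ 2 * momD + K)
  have hC1 : 0 ≤ C1 := by positivity
  have hC2 : 0 ≤ C2 := by positivity
  have hC3 : 0 ≤ C3 := by positivity
  set X := ofReal (exp (-ρ / (2 * S.ε ^ 2))) * eLpNorm (S.gradU t) 2 mX
          * S.nInf ρ α t * S.nf α t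
  set Y := S.nf α t ^ 2
  set Z := S.forceB α t * S.nf α t
  set L := S.layer t * S.nTb α t * S.nf α t
  have hs : 0 ≤ mom22 2 0 + mom22 2 1 := by positivity
  rw [ENNReal.ofReal_add (by positivity) one_pos.le, ENNReal.ofReal_add (by positivity)
    (by positivity), ENNReal.ofReal_add hC1 hC2, ENNReal.ofReal_mul hs, ENNReal.ofReal_mul hs,
    ENNReal.ofReal_add h20 h21, ENNReal.ofReal_one]
  set c1 := ofReal C1
  set c2 := ofReal C2
  set c3 := ofReal C3
  set m0 := ofReal (mom22 2 0)
  set m1 := ofReal (mom22 2 1)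
  set d := ofReal momD
  have key : (ofReal (η / (S.κ * S.ε ^ 2)) * S.nDiss α t ^ 2
      + (c1 + c2 + (m0 + m1) * c3 + 1) * (X + Y + Z)) + (m0 + m1) * d * L
      = (ofReal (η / (S.κ * S.ε ^ 2)) * S.nDiss α t ^ 2 + (c1 * Y + c2 * X)
        + (m0 * (d * L + c3 * (Y + Z)) + m1 * (d * L + c3 * (Y + Z))))
        + (c1 * (X + Z) + c2 * (Y + Z) + (m0 + m1) * c3 * X + (X + Y + Z)) := by ring
  rw [key]
  exact le_self_add

end Bulk

/-- The layer quantity is finite. -/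
lemma layer_le {t : ℝ} (ht : t ∈ Ioo 0 S.T) : S.layer t ≤ ofReal K := by
  have key : ∀ j : Fin 3, j ≠ 2 →
      eLpNorm (fun x : V3 => x 2 * (px 2 S.U t x) j) ∞ mX ≤ ofReal K := fun j hj => by
    rw [eLpNorm_exponent_top]
    refine eLpNormEssSup_le_of_ae_enorm_bound ?_
    filter_upwards [ae_mem_cellInt] with x hx
    rw [Real.enorm_eq_ofReal_abs]
    exact ENNReal.ofReal_le_ofReal (h.flow.bound_layer t ht x hx.2.2 j hj)
  exact max_le (key 0 (by decide)) (key 1 (by decide))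

end Admissible

end Config

/-! ### Sums over multi-indices -/

lemma sq_rpow_half (x : ℝ≥0∞) : (x ^ (1 / 2 : ℝ)) ^ 2 = x := by
  rw [← ENNReal.rpow_natCast, ← ENNReal.rpow_mul]; norm_num

lemma ellTwo_sq (u : MI → ℝ≥0∞) : ellTwo u ^ 2 = ∑' α, u α ^ 2 := sq_rpow_half _

lemma tsum_mul_le_ellTwo (u v : MI → ℝ≥0∞) : ∑' α, u α * v α ≤ ellTwo u * ellTwo v := by
  have h1 := lintegral_mul_sq_le (m := Measure.count) (measurable_of_countable u).aemeasurable
    (measurable_of_countable v).aemeasurable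
  simp only [lintegral_count] at h1
  rw [← ellTwo_sq, ← ellTwo_sq, ← mul_pow] at h1
  exact (ENNReal.pow_le_pow_left_iff two_ne_zero).1 h1

lemma ennreal_mul_le_sq_add_sq (a b : ℝ≥0∞) : a * b ≤ a ^ 2 + b ^ 2 := by
  rcases le_total a b with hab | hab
  · exact (mul_le_mul_left hab b).trans (by rw [sq b]; exact le_add_self)
  · exact (mul_le_mul_right hab a).trans (by rw [sq a]; exact le_self_add)

lemma tsum_weighted_shift_le {k : MI → ℝ≥0∞} (hk : Monotone k) (n : MI → ℝ≥0∞) (σ γ : MI) :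
    ∑' β, k β * (n (β + σ) * n (β + γ)) ≤ 2 * ∑' β, k β * n β ^ 2 := by
  have key : ∀ σ : MI, ∑' β, k β * n (β + σ) ^ 2 ≤ ∑' β, k β * n β ^ 2 := fun σ => by
    refine le_trans (ENNReal.tsum_le_tsum fun β => ?_)
      (ENNReal.tsum_comp_le_tsum_of_injective (add_left_injective σ) fun β => k β * n β ^ 2)
    exact mul_le_mul_left (hk le_self_add) _
  calc _ ≤ ∑' β, (k β * n (β + σ) ^ 2 + k β * n (β + γ) ^ 2) :=
        ENNReal.tsum_le_tsum fun β => by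
          rw [← mul_add]; exact mul_le_mul_right (ennreal_mul_le_sq_add_sq _ _) _
    _ ≤ _ := by
        rw [ENNReal.tsum_add, two_mul]; exact add_le_add (key σ) (key γ)

/-- Summing over `α` and `γ ≤ α` is summing over `γ` and `β = α - γ`. -/
lemma tsum_sum_filter_le (G : MI → MI → ℝ≥0∞) :
    ∑' α, ∑ γ ∈ (Finset.Iic α).filter (fun γ => γ ≠ 0), G γ α ≤ ∑' γ, ∑' β, G γ (β + γ) := by
  classical
  have h1 : ∀ α, ∑ γ ∈ (Finset.Iic α).filter (fun γ => γ ≠ 0), G γ α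
      ≤ ∑' γ, if γ ≤ α then G γ α else 0 := fun α => by
    refine le_trans (Finset.sum_le_sum fun γ hγ => ?_)
      (ENNReal.sum_le_tsum ((Finset.Iic α).filter (fun γ => γ ≠ 0)))
    have : γ ≤ α := Finset.mem_Iic.1 (Finset.mem_filter.1 hγ).1
    rw [if_pos this]
  refine (ENNReal.tsum_le_tsum h1).trans ?_
  rw [ENNReal.tsum_comm]
  refine ENNReal.tsum_le_tsum fun γ => le_of_eq ?_
  rw [← (add_left_injective γ).tsum_eq (f := fun α => if γ ≤ α then G γ α else 0)]
  · exact tsum_congr fun β => if_pos le_add_self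
  · intro α hα
    have : γ ≤ α := by by_contra hc; exact hα (if_neg hc)
    exact ⟨α - γ, tsub_add_cancel_of_le this⟩

/-- The sequence `(2/3)^{|γ|} (1 + |γ|)⁹` that dominates the commutators on the analytic scale. -/
def comSeq (γ : MI) : ℝ := (2 / 3) ^ γ.deg * (1 + (γ.deg : ℝ)) ^ 9

lemma comSeq_nonneg (γ : MI) : 0 ≤ comSeq γ := by unfold comSeq; positivity

lemma tsum_comSeq_ne_top : ∑' γ, ofReal (comSeq γ) ≠ ⊤ := by
  -- the polynomial factor costs an arbitrarily small part of the geometric decay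
  obtain ⟨B, hB⟩ : ∃ B : ℝ, ∀ n : ℕ, (1 + (n : ℝ)) ^ 9 * (4 / 5) ^ n ≤ B := by
    have h1 := (tendsto_pow_const_mul_const_pow_of_abs_lt_one 9
      (r := (4 / 5 : ℝ)) (by rw [abs_of_pos] <;> norm_num)).bddAbove_range
    obtain ⟨B, hB⟩ := h1
    refine ⟨B * (5 / 4), fun n => ?_⟩
    have h2 : ((n + 1 : ℕ) : ℝ) ^ 9 * (4 / 5) ^ (n + 1) ≤ B := hB ⟨n + 1, rfl⟩
    push_cast at h2
    rw [pow_succ (4 / 5 : ℝ), add_comm (n : ℝ)] at h2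
    linarith
  have hB0 : 0 ≤ B := le_trans (by positivity) (hB 0)
  have h3 : ∀ γ, comSeq γ ≤ B * (5 / 6) ^ γ.deg := fun γ => by
    have : (2 / 3 : ℝ) ^ γ.deg = (4 / 5) ^ γ.deg * (5 / 6) ^ γ.deg := by
      rw [← mul_pow]; norm_num
    rw [comSeq, this]
    calc _ = (1 + (γ.deg : ℝ)) ^ 9 * (4 / 5) ^ γ.deg * (5 / 6) ^ γ.deg := by ring
      _ ≤ _ := by gcongr; exact hB _
  refine ne_top_of_le_ne_top (b := ofReal (B * ((1 - 5 / 6 : ℝ)⁻¹) ^ 3))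
    ENNReal.ofReal_ne_top ?_
  rw [ENNReal.tsum_eq_iSup_sum]
  refine iSup_le fun s => ?_
  rw [← ENNReal.ofReal_sum_of_nonneg fun γ _ => comSeq_nonneg γ]
  refine ENNReal.ofReal_le_ofReal ?_
  have hs : s ⊆ Finset.Iic (∑ γ ∈ s, γ) := fun γ hγ =>
    Finset.mem_Iic.2 (Finset.single_le_sum (f := fun γ : MI => γ) (fun _ _ => zero_le) hγ)
  calc ∑ γ ∈ s, comSeq γ ≤ ∑ γ ∈ s, B * (5 / 6) ^ γ.deg := Finset.sum_le_sum fun γ _ => h3 γ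
    _ ≤ ∑ γ ∈ Finset.Iic (∑ γ ∈ s, γ), B * (5 / 6) ^ γ.deg :=
        Finset.sum_le_sum_of_subset_of_nonneg hs fun _ _ _ => by positivity
    _ ≤ _ := by
        rw [← Finset.mul_sum]
        exact mul_le_mul_of_nonneg_left (sum_pow_deg_le (by norm_num) (by norm_num) _) hB0

section Weights

variable {τ0 M0 t : ℝ} (hτ : 0 < tau τ0 M0 t)
include hτ

lemma wA_nonneg (α : MI) : 0 ≤ wA τ0 M0 α t := by unfold wA; positivity

/-- One derivative costs a factor `(|α| + 1)/τ`. -/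
lemma wA_le_add_single (α : MI) (i : Fin 3) :
    wA τ0 M0 α t ≤ ((α.deg : ℝ) + 1) / tau τ0 M0 t * wA τ0 M0 (α + Pi.single i 1) t := by
  have hf : (0 : ℝ) < α.fact := by exact_mod_cast α.fact_pos
  have hi : (α i : ℝ) ≤ α.deg := by exact_mod_cast α.le_deg i
  rw [wA, wA, MI.fact_add_single, MI.deg_add, MI.deg_single, pow_succ (tau τ0 M0 t)]
  push_cast
  set τ := tau τ0 M0 t
  have e1 : ((α.deg : ℝ) + 1) / τ * (τ ^ α.deg * τ / (((α i : ℝ) + 1) * α.fact) *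
      (1 + ((α.deg : ℝ) + 1)) ^ 9) = (((α.deg : ℝ) + 1) / ((α i : ℝ) + 1)) *
        (τ ^ α.deg / α.fact * (1 + ((α.deg : ℝ) + 1)) ^ 9) := by
    field_simp
  rw [e1]
  have h1 : (1 : ℝ) ≤ ((α.deg : ℝ) + 1) / ((α i : ℝ) + 1) := by
    rw [one_le_div (by positivity)]; linarith
  refine le_trans ?_ (le_mul_of_one_le_left (by positivity) h1)
  gcongr
  linarith

/-- The weights are submultiplicative, and `τ ≤ τU/2` leaves room for geometric decay. -/
lemma wA_mul_binom_le {τU : ℝ} (hτU : tau τ0 M0 t ≤ τU / 2) {α γ : MI} (hγ : γ ≤ α) :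
    wA τ0 M0 α t * (α.binom γ * (γ.fact / (3 / 4 * τU) ^ γ.deg))
      ≤ wA τ0 M0 (α - γ) t * comSeq γ := by
  have hU : 0 < τU := by linarith
  have hfa : (0 : ℝ) < α.fact := by exact_mod_cast α.fact_pos
  have hfb : (0 : ℝ) < (α - γ : MI).fact := by exact_mod_cast (α - γ : MI).fact_pos
  have e1 : ((α.binom γ : ℝ) * γ.fact * (α - γ : MI).fact) = α.fact := by
    exact_mod_cast MI.binom_mul_fact hγ
  have hd : α.deg = (α - γ : MI).deg + γ.deg := by rw [← MI.deg_add, tsub_add_cancel_of_le hγ]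
  set b := (α - γ : MI).deg
  set g := γ.deg
  set τ := tau τ0 M0 t
  have e2 : wA τ0 M0 α t * (α.binom γ * (γ.fact / (3 / 4 * τU) ^ g))
      = τ ^ b / (α - γ : MI).fact * ((τ / (3 / 4 * τU)) ^ g * (1 + ((b : ℝ) + g)) ^ 9) := by
    rw [wA, hd, ← e1, pow_add, div_pow]
    have hb0 : (α.binom γ : ℝ) ≠ 0 := fun h0 => by rw [h0] at e1; simp at e1; linarith
    have hg0 : (γ.fact : ℝ) ≠ 0 := by exact_mod_cast γ.fact_pos.ne'
    push_cast
    field_simp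
    rfl
  rw [e2, wA, comSeq]
  have h1 : τ / (3 / 4 * τU) ≤ 2 / 3 := by
    rw [div_le_iff₀ (by positivity)]; linarith
  have h2 : 1 + ((b : ℝ) + g) ≤ (1 + b) * (1 + g) := by
    have : (0 : ℝ) ≤ (b : ℝ) * g := by positivity
    linarith
  calc _ ≤ τ ^ b / (α - γ : MI).fact * ((2 / 3) ^ g * ((1 + (b : ℝ)) * (1 + g)) ^ 9) := by gcongr
    _ = _ := by rw [mul_pow]; ring

end Weights

/-! ### The sum over all multi-indices -/

namespace Config

variable {S : Config} {K τU ρ : ℝ}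

variable (S) in
/-- The weighted norm `𝒜_α ‖f_α‖`. -/
def wnf (τ0 M0 : ℝ) (α : MI) (t : ℝ) : ℝ≥0∞ := ofReal (wA τ0 M0 α t) * S.nf α t

/-- The weight `(|α| + 1)/τ` of `𝒴_f`. -/
def kY (τ : ℝ) (α : MI) : ℝ≥0∞ := ofReal (((α.deg : ℝ) + 1) / τ)

lemma kY_mono {τ : ℝ} (hτ : 0 < τ) : Monotone (kY τ) := fun α β hab => by
  have h1 : (α.deg : ℝ) ≤ β.deg := by
    exact_mod_cast Finset.sum_le_sum fun i _ => hab i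
  exact ENNReal.ofReal_le_ofReal (by gcongr)

lemma En_sq (τ0 M0 t : ℝ) : S.En τ0 M0 t ^ 2 = ∑' α, S.wnf τ0 M0 α t ^ 2 := ellTwo_sq _

lemma Yn_sq (τ0 M0 t : ℝ) :
    S.Yn τ0 M0 t ^ 2 = ∑' α, kY (tau τ0 M0 t) α * S.wnf τ0 M0 α t ^ 2 := sq_rpow_half _

lemma tau_le {τ0 M0 τU t : ℝ} (ht : 0 ≤ t) (hM0 : 0 ≤ M0) (hτU : τ0 ≤ τU / 2) :
    tau τ0 M0 t ≤ τU / 2 := by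
  have := mul_nonneg hM0 ht
  unfold tau; linarith

lemma tsum_wnf_shift_le (τ0 M0 t : ℝ) (γ : MI) :
    ∑' β, S.wnf τ0 M0 β t * S.wnf τ0 M0 (β + γ) t ≤ 2 * S.En τ0 M0 t ^ 2 := by
  have := tsum_weighted_shift_le (k := fun _ => 1) monotone_const (fun α => S.wnf τ0 M0 α t) 0 γ
  simp only [one_mul, add_zero] at this
  rwa [En_sq]

section Weights

variable {τ0 M0 t : ℝ} (hτ : 0 < tau τ0 M0 t)
include hτ

lemma wA_mul_nfOne_le (α : MI) : ofReal (wA τ0 M0 α t) * S.nfOne α t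
    ≤ ∑ i, kY (tau τ0 M0 t) α * S.wnf τ0 M0 (α + Pi.single i 1) t := by
  rw [nfOne, Finset.mul_sum]
  refine Finset.sum_le_sum fun i _ => ?_
  rw [wnf, ← mul_assoc, kY, ← ENNReal.ofReal_mul (by positivity)]
  exact mul_le_mul_left (ENNReal.ofReal_le_ofReal (wA_le_add_single hτ α i)) _

lemma tsum_kY_shift_le (γ : MI) :
    ∑' β, (∑ i, kY (tau τ0 M0 t) β * S.wnf τ0 M0 (β + Pi.single i 1) t) * S.wnf τ0 M0 (β + γ) t
      ≤ 6 * S.Yn τ0 M0 t ^ 2 := by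
  have h1 : ∀ β, (∑ i, kY (tau τ0 M0 t) β * S.wnf τ0 M0 (β + Pi.single i 1) t) *
      S.wnf τ0 M0 (β + γ) t = ∑ i, kY (tau τ0 M0 t) β * (S.wnf τ0 M0 (β + Pi.single i 1) t *
        S.wnf τ0 M0 (β + γ) t) := fun β => by
    rw [Finset.sum_mul]; exact Finset.sum_congr rfl fun i _ => mul_assoc _ _ _
  simp only [h1]
  rw [Summable.tsum_finsetSum fun _ _ => ENNReal.summable]
  refine (Finset.sum_le_sum fun i _ => tsum_weighted_shift_le (kY_mono hτ)
    (fun α => S.wnf τ0 M0 α t) (Pi.single i 1) γ).trans (le_of_eq ?_)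
  simp only [← Yn_sq, Finset.sum_const, Finset.card_univ, Fintype.card_fin, nsmul_eq_mul]
  push_cast
  ring

end Weights

namespace Admissible

variable (h : S.Admissible K τU ρ)
include h

variable {c M : ℝ} (hM0 : 0 < M) (hM : ∀ ξ : V3, wgt K ξ ≤ M * exp (-c * ‖ξ‖ ^ 2))
include hM0 hM

/-- The weighted commutator sum is a convolution with a summable sequence. -/
lemma wA_mul_commutator_le (hε : S.ε ≤ 1) {τ0 M₀ t : ℝ} (ht : t ∈ Ioo 0 S.T)
    (hτ : 0 < tau τ0 M₀ t) (hτU : tau τ0 M₀ t ≤ τU / 2) (α : MI) :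
    ofReal (wA τ0 M₀ α t) * ∑ γ ∈ (Finset.Iic α).filter (fun γ => γ ≠ 0),
        (α.binom γ : ℝ≥0∞) * (S.nf (α - γ) t + S.nfOne (α - γ) t) * S.nMu c γ t
      ≤ ofReal (S.ε / √S.κ * (5 * (cA K * M))) *
        ∑ γ ∈ (Finset.Iic α).filter (fun γ => γ ≠ 0), ofReal (comSeq γ) *
          (S.wnf τ0 M₀ (α - γ) t
            + ∑ i, kY (tau τ0 M₀ t) (α - γ) * S.wnf τ0 M₀ (α - γ + Pi.single i 1) t) := by
  have hK := h.K_nonneg ht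
  have hA := cA_nonneg hK
  have hεp := h.eps_pos.le
  have hs := h.sqrtκ_pos
  rw [Finset.mul_sum, Finset.mul_sum]
  refine Finset.sum_le_sum fun γ hγ => ?_
  obtain ⟨hγα, hγ0⟩ := Finset.mem_filter.1 hγ
  have hγα := Finset.mem_Iic.1 hγα
  have h1 := h.nMu_le hM hM0 ht hε hγ0
  have hU := h.radius_pos
  have h2 : ofReal (wA τ0 M₀ α t) * (α.binom γ : ℝ≥0∞) * S.nMu c γ t
      ≤ ofReal (S.ε / √S.κ * (5 * (cA K * M))) * (ofReal (comSeq γ)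
        * ofReal (wA τ0 M₀ (α - γ) t)) := by
    have hw := wA_nonneg hτ α
    refine (mul_le_mul_right h1 _).trans ?_
    rw [← ENNReal.ofReal_natCast, ← ENNReal.ofReal_mul hw, ← ENNReal.ofReal_mul (by positivity),
      ← ENNReal.ofReal_mul (comSeq_nonneg γ), ← ENNReal.ofReal_mul (by positivity)]
    refine ENNReal.ofReal_le_ofReal ?_
    have h3 := wA_mul_binom_le hτ hτU hγα
    calc _ = S.ε / √S.κ * (5 * (cA K * M)) *
          (wA τ0 M₀ α t * (α.binom γ * (γ.fact / (3 / 4 * τU) ^ γ.deg))) := by ring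
      _ ≤ S.ε / √S.κ * (5 * (cA K * M)) * (wA τ0 M₀ (α - γ) t * comSeq γ) := by gcongr
      _ = _ := by ring
  calc _ = (ofReal (wA τ0 M₀ α t) * (α.binom γ : ℝ≥0∞) * S.nMu c γ t)
        * (S.nf (α - γ) t + S.nfOne (α - γ) t) := by ring
    _ ≤ _ := mul_le_mul_left h2 _
    _ = ofReal (S.ε / √S.κ * (5 * (cA K * M))) * (ofReal (comSeq γ) *
        (S.wnf τ0 M₀ (α - γ) t
          + ofReal (wA τ0 M₀ (α - γ) t) * S.nfOne (α - γ) t)) := by rw [wnf]; ring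
    _ ≤ _ := by
        gcongr
        exact wA_mul_nfOne_le hτ _

/-- The sum of the normal momentum terms with the analytic weights. The tangential derivative in
the Hardy bound is the only source of `𝒴_f`. -/
lemma tsum_nTb_le (hρ : 0 < ρ) (hc0 : 0 < c) (hc : c < 1 / 4) (hεκ : S.ε ≤ √S.κ)
    {τ0 M₀ t : ℝ} (ht : t ∈ Ioo 0 S.T)
    (hτ : 0 < tau τ0 M₀ t) (hτU : tau τ0 M₀ t ≤ τU / 2) :
    ∑' α, ofReal (wA τ0 M₀ α t) ^ 2 * (S.nTb α t * S.nf α t)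
      ≤ ofReal (2 * ((1 + S.ε * K) * momC)) * (6 * S.Yn τ0 M₀ t ^ 2)
        + ofReal (6 * (velC c * (cA K * M))) * S.En τ0 M₀ t ^ 2
        + 4 * (S.Gn τ0 M₀ t * S.En τ0 M₀ t)
        + ofReal (7 * velC c) * (ofReal (S.ε / √S.κ * (5 * (cA K * M))) *
          ((∑' γ, ofReal (comSeq γ))
            * (2 * S.En τ0 M₀ t ^ 2 + 6 * S.Yn τ0 M₀ t ^ 2))) := by
  have hε : S.ε ≤ 1 := hεκ.trans h.sqrtκ_le
  set w : MI → ℝ≥0∞ := fun α => ofReal (wA τ0 M₀ α t) with hw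
  set n : MI → ℝ≥0∞ := fun α => S.wnf τ0 M₀ α t with hn
  set k := kY (tau τ0 M₀ t) with hk
  set A := ofReal (2 * ((1 + S.ε * K) * momC))
  set B := ofReal (6 * (velC c * (cA K * M)))
  set D := ofReal (7 * velC c)
  set E := ofReal (S.ε / √S.κ * (5 * (cA K * M)))
  set q : MI → ℝ≥0∞ := fun γ => ofReal (comSeq γ) with hq
  set G : MI → MI → ℝ≥0∞ := fun γ α =>
    q γ * ((n (α - γ) + ∑ i, k (α - γ) * n (α - γ + Pi.single i 1)) * n α) with hG
  have hpt : ∀ α, w α ^ 2 * (S.nTb α t * S.nf α t)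
      ≤ A * ((∑ i, k α * n (α + Pi.single i 1)) * n (α + 0)) + B * n α ^ 2
        + 4 * ((w α * (S.forceT α t + S.forceB α t)) * n α)
        + D * (E * ∑ γ ∈ (Finset.Iic α).filter (fun γ => γ ≠ 0), G γ α) := fun α => by
    have h1 := h.nTb_le hε hρ hc0 hc hM0 hM hεκ α ht
    have h2 := h.wA_mul_commutator_le hM0 hM hε ht hτ hτU α
    have h3 : w α * S.nfOne α t ≤ ∑ i, k α * n (α + Pi.single i 1) := wA_mul_nfOne_le hτ α
    have hGs : ∑ γ ∈ (Finset.Iic α).filter (fun γ => γ ≠ 0), G γ α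
        = (∑ γ ∈ (Finset.Iic α).filter (fun γ => γ ≠ 0),
          q γ * (n (α - γ) + ∑ i, k (α - γ) * n (α - γ + Pi.single i 1))) * n α := by
      rw [Finset.sum_mul]
      exact Finset.sum_congr rfl fun γ _ => by simp only [hG]; ring
    rw [hGs, add_zero]
    set X₁ := ∑ γ ∈ (Finset.Iic α).filter (fun γ => γ ≠ 0),
        (α.binom γ : ℝ≥0∞) * (S.nf (α - γ) t + S.nfOne (α - γ) t) * S.nMu c γ t
    calc w α ^ 2 * (S.nTb α t * S.nf α t)
        ≤ w α ^ 2 * ((A * S.nfOne α t + B * S.nf α t + 4 * S.forceT α t + D * X₁)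
            * S.nf α t) := by gcongr
      _ = A * ((w α * S.nfOne α t) * n α) + B * n α ^ 2 + 4 * ((w α * S.forceT α t) * n α)
            + D * ((w α * X₁) * n α) := by simp only [hn, wnf, hw]; ring
      _ ≤ _ := by
          refine add_le_add (add_le_add (add_le_add ?_ le_rfl) ?_) ?_
          · gcongr
          · gcongr
            exact le_self_add
          · rw [← mul_assoc E]
            gcongr
  refine (ENNReal.tsum_le_tsum hpt).trans ?_
  rw [ENNReal.tsum_add, ENNReal.tsum_add, ENNReal.tsum_add]
  simp only [ENNReal.tsum_mul_left]
  refine add_le_add (add_le_add (add_le_add ?_ ?_) ?_) ?_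
  · exact mul_le_mul_right (tsum_kY_shift_le hτ 0) _
  · rw [En_sq]
  · exact mul_le_mul_right (tsum_mul_le_ellTwo _ _) _
  · refine mul_le_mul_right (mul_le_mul_right ((tsum_sum_filter_le G).trans ?_) _) _
    rw [← ENNReal.tsum_mul_right]
    refine ENNReal.tsum_le_tsum fun γ => ?_
    simp only [hG, add_tsub_cancel_right]
    rw [ENNReal.tsum_mul_left]
    refine mul_le_mul_right ?_ _
    simp only [add_mul]
    rw [ENNReal.tsum_add]
    exact add_le_add (tsum_wnf_shift_le _ _ _ γ) (tsum_kY_shift_le hτ γ)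

end Admissible

end Config

/-- The absolute constant of the layer term. -/
def layerConst : ℝ := (mom22 2 0 + mom22 2 1) * momD

lemma layerConst_nonneg : 0 ≤ layerConst :=
  mul_nonneg (add_nonneg (mom22_nonneg 2 0) (mom22_nonneg 2 1)) momD_nonneg

lemma bulkConst_pos {K : ℝ} (hK : 0 ≤ K) (ρ : ℝ) : 0 < bulkConst K ρ := by
  have hmD := momD_nonneg
  have h20 := mom22_nonneg 2 0
  have h21 := mom22_nonneg 2 1
  have h8 := mom8_nonneg
  have hv := velD_nonneg (ρ / 2)
  unfold bulkConst; positivity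

lemma momC_nonneg : 0 ≤ momC := Real.sqrt_nonneg _

lemma velC_nonneg (c : ℝ) : 0 ≤ velC c := Real.sqrt_nonneg _

/-- The sum of `comSeq`. -/
def comSum : ℝ := (∑' γ, ofReal (comSeq γ)).toReal

lemma ofReal_comSum : ofReal comSum = ∑' γ, ofReal (comSeq γ) :=
  ENNReal.ofReal_toReal tsum_comSeq_ne_top

lemma comSum_nonneg : 0 ≤ comSum := ENNReal.toReal_nonneg

/-- The constant of the summed estimate; `M` bounds the Gaussian weight of the commutators. -/
def sumConst (K ρ c M : ℝ) : ℝ :=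
  bulkConst K ρ * (4 * K / ρ + 2) + layerConst * K *
    (6 * (velC c * (cA K * M)) + 4 + 7 * velC c * (5 * (cA K * M)) * comSum * 2)

lemma sumConst_nonneg {K ρ M : ℝ} (hK : 0 ≤ K) (hρ : 0 < ρ) (hM : 0 ≤ M) (c : ℝ) :
    0 ≤ sumConst K ρ c M := by
  have h1 := layerConst_nonneg
  have h2 := bulkConst_pos hK ρ
  have h3 := velC_nonneg c
  have h4 := cA_nonneg hK
  have h5 := comSum_nonneg
  unfold sumConst; positivity

namespace Config

variable {S : Config} {K τU ρ : ℝ}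

namespace Admissible

variable (h : S.Admissible K τU ρ)
include h

/-- Half of the exponential pays for the size `κ^{-1/2}` of the velocity gradient. -/
lemma exp_mul_gradU_le (hρ : 0 < ρ) (hεκ : S.ε ≤ √S.κ) {t : ℝ} (ht : t ∈ Ioo 0 S.T) :
    ofReal (exp (-ρ / (2 * S.ε ^ 2))) * eLpNorm (S.gradU t) 2 mX
      ≤ ofReal (4 * K / ρ) * ofReal (exp (-ρ / (4 * S.ε ^ 2))) := by
  have hK := h.K_nonneg ht
  have hεp := h.eps_pos
  have hε1 : S.ε ≤ 1 := hεκ.trans h.sqrtκ_le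
  refine (mul_le_mul_right (h.flow.bound_L2 t ht) _).trans ?_
  rw [← ENNReal.ofReal_mul (Real.exp_pos _).le, ← ENNReal.ofReal_mul (by positivity)]
  refine ENNReal.ofReal_le_ofReal ?_
  set s := ρ / (4 * S.ε ^ 2) with hs
  have hs0 : 0 < s := by positivity
  have e1 : exp (-ρ / (2 * S.ε ^ 2)) = exp (-s) * exp (-s) := by
    rw [← Real.exp_add, hs]; congr 1; field_simp; norm_num
  have e2 : -ρ / (4 * S.ε ^ 2) = -s := by rw [hs]; ring
  have h1 : exp (-s) ≤ 1 / s := by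
    rw [Real.exp_neg, ← one_div]
    exact one_div_le_one_div_of_le hs0 (by linarith [Real.add_one_le_exp s])
  have h2 : K / √S.κ ≤ K / S.ε := by gcongr
  rw [e1, e2]
  calc _ ≤ (1 / s * exp (-s)) * (K / S.ε) := by gcongr
    _ = 4 * K / ρ * exp (-s) * S.ε := by rw [hs]; field_simp
    _ ≤ _ := mul_le_of_le_one_right (by positivity) hε1

lemma Dn_sq {η : ℝ} (hη : 0 < η) (τ0 M₀ t : ℝ) :
    ofReal η * S.Dn τ0 M₀ t ^ 2 = ofReal (η / (S.κ * S.ε ^ 2)) *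
      ∑' α, (ofReal (wA τ0 M₀ α t) * S.nDiss α t) ^ 2 := by
  have hεp := h.eps_pos
  have hs := h.sqrtκ_pos
  rw [Dn, mul_pow, ellTwo_sq, ← mul_assoc, ← ENNReal.ofReal_pow (by positivity),
    ← ENNReal.ofReal_mul hη.le]
  congr 2
  rw [inv_pow, mul_pow, Real.sq_sqrt h.kappa_pos.le]
  have := h.kappa_pos
  field_simp

/-- The summed bulk estimate. -/
lemma tsum_bulk_le (hρ : 0 < ρ) {c₀ η ε₀ c M : ℝ} (hc₀ : 0 < c₀)
    (hν : ∀ v : V3, c₀ * (1 + ‖v‖) ≤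
      ∫ p : V3 × S2, |inner ℝ (v - p.1) (p.2 : V3)| * mu0 p.1 ∂mColl)
    (hη : 0 < η) (hes : S.ε ≤ ε₀ * √S.κ) (hε1 : ε₀ ≤ 1) (hε3 : ε₀ ^ 2 ≤ c₀ * η / 4)
    (hε4 : ε₀ * (K * (1 + K) + 2 * (6 * K + 7 * K ^ 2) * (2 + K) + 2 * K) ≤ c₀ * η / 2)
    (hεK : ε₀ * K ≤ 1) (hc0 : 0 < c) (hc : c < 1 / 4) (hM0 : 0 < M)
    (hM : ∀ ξ : V3, wgt K ξ ≤ M * exp (-c * ‖ξ‖ ^ 2))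
    (hεq : ε₀ * (layerConst * K * (7 * velC c * (5 * (cA K * M)) * comSum * 6)) ≤ η)
    {τ0 M₀ t : ℝ} (ht : t ∈ Ioo 0 S.T) (hM₀ : 0 ≤ M₀) (hτU : τ0 ≤ τU / 2)
    (hτ : 0 < tau τ0 M₀ t) :
    ∑' α, ofReal (wA τ0 M₀ α t ^ 2 * |S.bulk α t|)
      ≤ ofReal η * S.Dn τ0 M₀ t ^ 2
        + ofReal (sumConst K ρ c M) * S.En τ0 M₀ t ^ 2
        + ofReal (sumConst K ρ c M) * ofReal (exp (-ρ / (4 * S.ε ^ 2)))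
            * S.Hn ρ τ0 M₀ t * S.En τ0 M₀ t
        + (ofReal (24 * layerConst * momC) * S.layer t + ofReal η)
            * S.Yn τ0 M₀ t ^ 2
        + ofReal (sumConst K ρ c M) * S.Gn τ0 M₀ t * S.En τ0 M₀ t := by
  have hK := h.K_nonneg ht
  have hεp := h.eps_pos
  have hs := h.sqrtκ_pos
  have hεκ : S.ε ≤ √S.κ := hes.trans (mul_le_of_le_one_left hs.le hε1)
  have hε : S.ε ≤ 1 := hεκ.trans h.sqrtκ_le
  have hεε : S.ε ≤ ε₀ := hes.trans (mul_le_of_le_one_right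
    (nonneg_of_mul_nonneg_left (hεp.le.trans hes) hs) h.sqrtκ_le)
  have hlc := layerConst_nonneg
  have hv := velC_nonneg c
  have hmC := momC_nonneg
  have hA := cA_nonneg hK
  have hq0 := comSum_nonneg
  have hb := bulkConst_pos hK ρ
  set w : MI → ℝ≥0∞ := fun α => ofReal (wA τ0 M₀ α t) with hw
  set bC := ofReal (bulkConst K ρ) with hbC
  set lc := ofReal layerConst with hlcd
  set ex := ofReal (exp (-ρ / (4 * S.ε ^ 2))) with hex
  set cH := ofReal (4 * K / ρ) with hcH
  set L := S.layer t with hL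
  set E := S.En τ0 M₀ t with hE
  set Y := S.Yn τ0 M₀ t with hY
  set G := S.Gn τ0 M₀ t with hG
  set H := S.Hn ρ τ0 M₀ t with hH
  set u : MI → ℝ≥0∞ := fun α => ⨆ s ∈ Ioc 0 t, ofReal (wA τ0 M₀ α s) * S.nInf ρ α s
    with hu
  have hpt : ∀ α, ofReal (wA τ0 M₀ α t ^ 2 * |S.bulk α t|)
      ≤ ofReal (η / (S.κ * S.ε ^ 2)) * (w α * S.nDiss α t) ^ 2
        + bC * (cH * ex * (u α * S.wnf τ0 M₀ α t) + S.wnf τ0 M₀ α t ^ 2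
          + (w α * (S.forceT α t + S.forceB α t)) * S.wnf τ0 M₀ α t)
        + lc * (L * (w α ^ 2 * (S.nTb α t * S.nf α t))) := fun α => by
    have h1 := h.abs_bulk_le hρ hc₀ hν hη hes hε1 hε3 hε4 ht α
    have h2 := h.exp_mul_gradU_le hρ hεκ ht
    have h3 : w α * S.nInf ρ α t ≤ u α := by
      have := le_iSup₂ (f := fun s (_ : s ∈ Ioc 0 t) =>
        ofReal (wA τ0 M₀ α s) * S.nInf ρ α s) t ⟨ht.1, le_rfl⟩
      exact this
    rw [ENNReal.ofReal_mul (sq_nonneg _), ENNReal.ofReal_pow (wA_nonneg hτ α)]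
    refine (mul_le_mul_right h1 _).trans ?_
    set ex2 := ofReal (exp (-ρ / (2 * S.ε ^ 2)))
    calc _ = ofReal (η / (S.κ * S.ε ^ 2)) * (w α * S.nDiss α t) ^ 2
        + bC * ((ex2 * eLpNorm (S.gradU t) 2 mX) * ((w α * S.nInf ρ α t) * S.wnf τ0 M₀ α t)
          + S.wnf τ0 M₀ α t ^ 2 + (w α * S.forceB α t) * S.wnf τ0 M₀ α t)
        + lc * (L * (w α ^ 2 * (S.nTb α t * S.nf α t))) := by
          simp only [wnf, hw, hlcd, layerConst]; ring
      _ ≤ _ := by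
          gcongr
          exact le_add_self
  refine (ENNReal.tsum_le_tsum hpt).trans ?_
  rw [ENNReal.tsum_add, ENNReal.tsum_add]
  simp only [ENNReal.tsum_mul_left]
  rw [ENNReal.tsum_add, ENNReal.tsum_add, h.Dn_sq hη, ENNReal.tsum_mul_left, ← En_sq]
  have s1 : ∑' α, u α * S.wnf τ0 M₀ α t ≤ H * E := tsum_mul_le_ellTwo _ _
  have s2 : ∑' α, (w α * (S.forceT α t + S.forceB α t)) * S.wnf τ0 M₀ α t ≤ G * E :=
    tsum_mul_le_ellTwo _ _
  have s3 := h.tsum_nTb_le hM0 hM hρ hc0 hc hεκ ht hτ (tau_le ht.1.le hM₀ hτU)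
  -- smallness of `ε/√κ` makes the constants absolute, or smaller than `η`
  have k1 : ofReal (2 * ((1 + S.ε * K) * momC)) ≤ ofReal (4 * momC) := by
    refine ENNReal.ofReal_le_ofReal ?_
    have : S.ε * K ≤ 1 := (mul_le_mul_of_nonneg_right hεε hK).trans hεK
    calc _ = 2 * (1 + S.ε * K) * momC := by ring
      _ ≤ _ := by gcongr; linarith
  have hεs : S.ε / √S.κ ≤ ε₀ := (div_le_iff₀ hs).2 hes
  have k2 : ofReal (S.ε / √S.κ * (5 * (cA K * M)))
      ≤ ofReal (ε₀ * (5 * (cA K * M))) := by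
    refine ENNReal.ofReal_le_ofReal ?_
    gcongr
  have k3 : ofReal (ε₀ * (5 * (cA K * M))) ≤ ofReal (5 * (cA K * M)) := by
    refine ENNReal.ofReal_le_ofReal (mul_le_of_le_one_left (by positivity) hε1)
  have hLK : L ≤ ofReal K := h.layer_le ht
  rw [← ofReal_comSum] at s3
  set A := ofReal (4 * momC)
  set B := ofReal (6 * (velC c * (cA K * M)))
  set V := ofReal (7 * velC c)
  set N := ofReal (5 * (cA K * M))
  set N₀ := ofReal (ε₀ * (5 * (cA K * M)))
  set q := ofReal comSum
  have k4 := k2.trans k3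
  set X := ofReal (S.ε / √S.κ * (5 * (cA K * M)))
  set k := ofReal K with hk
  have s4 : lc * (L * ∑' α, w α ^ 2 * (S.nTb α t * S.nf α t))
      ≤ lc * 6 * A * L * Y ^ 2 + lc * k * B * E ^ 2
        + lc * k * 4 * (G * E) + lc * k * (V * N * q * 2) * E ^ 2
        + lc * k * (V * N₀ * q * 6) * Y ^ 2 := by
    calc _ ≤ lc * (L * (A * (6 * Y ^ 2) + B * E ^ 2 + 4 * (G * E)
          + V * (X * (q * (2 * E ^ 2 + 6 * Y ^ 2))))) := by
          refine mul_le_mul_right (mul_le_mul_right (s3.trans ?_) _) _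
          gcongr
      _ = lc * 6 * A * L * Y ^ 2 + lc * L * B * E ^ 2
        + lc * L * 4 * (G * E) + lc * L * (V * X * q * 2) * E ^ 2
        + lc * L * (V * X * q * 6) * Y ^ 2 := by ring
      _ ≤ _ := by gcongr
  have c1 : ofReal (24 * layerConst * momC) = lc * 6 * A := by
    rw [show 24 * layerConst * momC = layerConst * 6 * (4 * momC) by ring,
      ENNReal.ofReal_mul (by positivity), ENNReal.ofReal_mul hlc]
    simp only [ENNReal.ofReal_ofNat]
    rfl
  have c2 : lc * k * (V * N₀ * q * 6) ≤ ofReal η := by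
    refine le_trans (le_of_eq ?_) (ENNReal.ofReal_le_ofReal hεq)
    rw [show ε₀ * (layerConst * K * (7 * velC c * (5 * (cA K * M)) * comSum * 6))
      = layerConst * K * (7 * velC c * (ε₀ * (5 * (cA K * M))) * comSum * 6) by ring]
    have : 0 ≤ ε₀ := hεp.le.trans hεε
    rw [ENNReal.ofReal_mul (by positivity), ENNReal.ofReal_mul hlc,
      ENNReal.ofReal_mul (by positivity), ENNReal.ofReal_mul (by positivity),
      ENNReal.ofReal_mul (by positivity)]
    simp only [ENNReal.ofReal_ofNat]
    rfl
  have c3 : ofReal (sumConst K ρ c M)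
      = bC * (cH + 2) + lc * k * (B + 4 + V * N * q * 2) := by
    rw [sumConst, ENNReal.ofReal_add (by positivity) (by positivity),
      ENNReal.ofReal_mul hb.le, ENNReal.ofReal_mul (by positivity),
      ENNReal.ofReal_mul hlc, ENNReal.ofReal_add (by positivity) (by norm_num),
      ENNReal.ofReal_add (by positivity) (by positivity),
      ENNReal.ofReal_add (by positivity) (by norm_num),
      ENNReal.ofReal_mul (q := 2) (by positivity),
      ENNReal.ofReal_mul (q := comSum) (by positivity),
      ENNReal.ofReal_mul (p := 7 * velC c) (by positivity)]
    simp only [ENNReal.ofReal_ofNat]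
    rfl
  rw [c1, c3]
  set SC := bC * (cH + 2) + lc * k * (B + 4 + V * N * q * 2) with hSC
  have d1 : bC * cH ≤ SC := by
    rw [hSC, mul_add, add_assoc]; exact le_self_add
  have d2 : bC + lc * k * B + lc * k * (V * N * q * 2) ≤ SC := by
    have : SC = (bC + lc * k * B + lc * k * (V * N * q * 2)) + (bC * (cH + 1) + lc * k * 4) := by
      rw [hSC]; ring
    rw [this]; exact le_self_add
  have d3 : bC + lc * k * 4 ≤ SC := by
    have : SC = (bC + lc * k * 4) + (bC * (cH + 1) + lc * k * (B + V * N * q * 2)) := by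
      rw [hSC]; ring
    rw [this]; exact le_self_add
  set Δ := ofReal (η / (S.κ * S.ε ^ 2)) *
      ∑' α, (ofReal (wA τ0 M₀ α t) * S.nDiss α t) ^ 2
  calc _ ≤ Δ + bC * (cH * ex * (H * E) + E ^ 2 + G * E)
        + (lc * 6 * A * L * Y ^ 2 + lc * k * B * E ^ 2
        + lc * k * 4 * (G * E) + lc * k * (V * N * q * 2) * E ^ 2
        + lc * k * (V * N₀ * q * 6) * Y ^ 2) := by
        gcongr
    _ = Δ + (bC + lc * k * B + lc * k * (V * N * q * 2)) * E ^ 2 + bC * cH * ex * H * E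
        + (lc * 6 * A * L + lc * k * (V * N₀ * q * 6)) * Y ^ 2
        + (bC + lc * k * 4) * G * E := by ring
    _ ≤ _ := by gcongr

end Admissible

end Config

/-- The choice of `ε₀`. -/
lemma exists_small {P Q K A η : ℝ} (hP : 0 ≤ P) (hQ : 0 ≤ Q) (hK : 0 ≤ K) (hA : 0 < A)
    (hη : 0 < η) : ∃ ε₀ : ℝ, 0 < ε₀ ∧ ε₀ ≤ 1 ∧ ε₀ ^ 2 ≤ A / 4 ∧ ε₀ * P ≤ A / 2 ∧ ε₀ * K ≤ 1 ∧
      ε₀ * Q ≤ η := by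
  set m := min 1 (min (A / 4) η) with hm
  have hm0 : 0 < m := lt_min one_pos (lt_min (by positivity) hη)
  have m1 : m ≤ 1 := min_le_left _ _
  have m2 : m ≤ A / 4 := (min_le_right _ _).trans (min_le_left _ _)
  have m3 : m ≤ η := (min_le_right _ _).trans (min_le_right _ _)
  set d := 1 + P + K + Q with hd
  have hd0 : 0 < d := by positivity
  have key : ∀ u, 0 ≤ u → u ≤ d → m / d * u ≤ m := fun u _ hu => by
    rw [div_mul_eq_mul_div, div_le_iff₀ hd0]
    exact mul_le_mul_of_nonneg_left hu hm0.le
  have h0 : m / d ≤ m := by simpa using key 1 zero_le_one (by linarith)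
  have hpos : 0 < m / d := by positivity
  refine ⟨m / d, hpos, h0.trans m1, ?_, ?_, ?_, ?_⟩
  · rw [sq]
    exact (mul_le_of_le_one_left hpos.le (h0.trans m1)).trans (h0.trans m2)
  · exact (key P hP (by linarith)).trans (m2.trans (by linarith))
  · exact (key K hK (by linarith)).trans m1
  · exact (key Q hQ (by linarith)).trans m3

namespace Config

variable {S : Config} {K τU ρ : ℝ}

lemma b_two_eq (S : Config) (α : MI) (t : ℝ) (x : V3) :
    S.b α 2 t x = S.Tb α t x - S.ε * S.Uc 2 t x * S.a α t x
      - S.ε / (2 * S.δ) * S.D α S.U3sq t x - S.ε / S.δ * S.D α S.PU3 t x := by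
  unfold Tb; ring

/-- The constant of the Hardy bound; `M` bounds the Gaussian weight of the commutators. -/
def hardyConst (K c M : ℝ) : ℝ :=
  2 * ((1 + K) * momC) + 6 * (velC c * (cA K * M)) + 4 + 7 * velC c

lemma hardyConst_nonneg {K M : ℝ} (hK : 0 ≤ K) (hM : 0 ≤ M) (c : ℝ) : 0 ≤ hardyConst K c M := by
  have hmC := momC_nonneg
  have hv := velC_nonneg c
  have hA := cA_nonneg hK
  unfold hardyConst; positivity

namespace Admissible

variable (h : S.Admissible K τU ρ)
include h

lemma nTb_le_boundT (hρ : 0 < ρ) {c M : ℝ} (hc0 : 0 < c) (hc : c < 1 / 4) (hM0 : 0 < M)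
    (hM : ∀ ξ : V3, wgt K ξ ≤ M * exp (-c * ‖ξ‖ ^ 2)) (hεκ : S.ε ≤ √S.κ)
    {t : ℝ} (ht : t ∈ Ioo 0 S.T) (α : MI) :
    S.nTb α t ≤ ofReal (hardyConst K c M) * S.boundT c α t := by
  have hK := h.K_nonneg ht
  have hε : S.ε ≤ 1 := hεκ.trans h.sqrtκ_le
  have hmC := momC_nonneg
  have hv := velC_nonneg c
  have hA := cA_nonneg hK
  have hεK : S.ε * K ≤ K := mul_le_of_le_one_left hK hε
  refine (h.nTb_le hε hρ hc0 hc hM0 hM hεκ α ht).trans ?_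
  have hc1 : ofReal (2 * ((1 + S.ε * K) * momC)) ≤ ofReal (hardyConst K c M) := by
    refine ENNReal.ofReal_le_ofReal ?_
    have h1 : 2 * ((1 + S.ε * K) * momC) ≤ 2 * ((1 + K) * momC) := by gcongr
    have : 0 ≤ 6 * (velC c * (cA K * M)) := by positivity
    unfold hardyConst; linarith
  have hc2 : ofReal (6 * (velC c * (cA K * M))) ≤ ofReal (hardyConst K c M) := by
    refine ENNReal.ofReal_le_ofReal ?_
    have : 0 ≤ 2 * ((1 + K) * momC) := by positivity
    unfold hardyConst; linarith
  have hc3 : 4 ≤ ofReal (hardyConst K c M) := by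
    rw [← ENNReal.ofReal_ofNat 4]
    refine ENNReal.ofReal_le_ofReal ?_
    have : 0 ≤ 2 * ((1 + K) * momC) := by positivity
    have : 0 ≤ 6 * (velC c * (cA K * M)) := by positivity
    unfold hardyConst; linarith
  have hc4 : ofReal (7 * velC c) ≤ ofReal (hardyConst K c M) := by
    refine ENNReal.ofReal_le_ofReal ?_
    have : 0 ≤ 2 * ((1 + K) * momC) := by positivity
    have : 0 ≤ 6 * (velC c * (cA K * M)) := by positivity
    unfold hardyConst; linarith
  rw [boundT, mul_add, mul_add, mul_add, add_comm (_ * S.nf α t)]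
  gcongr

lemma abs_bulk_le_boundBulk (hρ : 0 < ρ) {c₀ η ε₀ : ℝ} (hc₀ : 0 < c₀)
    (hν : ∀ v : V3, c₀ * (1 + ‖v‖) ≤
      ∫ p : V3 × S2, |inner ℝ (v - p.1) (p.2 : V3)| * mu0 p.1 ∂mColl)
    (hη : 0 < η) (hes : S.ε ≤ ε₀ * √S.κ) (hε1 : ε₀ ≤ 1) (hε3 : ε₀ ^ 2 ≤ c₀ * η / 4)
    (hε4 : ε₀ * (K * (1 + K) + 2 * (6 * K + 7 * K ^ 2) * (2 + K) + 2 * K) ≤ c₀ * η / 2)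
    {t : ℝ} (ht : t ∈ Ioo 0 S.T) (α : MI) :
    ofReal |S.bulk α t|
      ≤ S.boundBulk η (bulkConst K ρ + layerConst * K) ρ α t := by
  have hK := h.K_nonneg ht
  have hlc := layerConst_nonneg
  refine (h.abs_bulk_le hρ hc₀ hν hη hes hε1 hε3 hε4 ht α).trans ?_
  rw [boundBulk, ENNReal.ofReal_add (bulkConst_pos hK ρ).le (by positivity), ENNReal.ofReal_mul hlc]
  set bC := ofReal (bulkConst K ρ)
  set k := ofReal K
  set lc := ofReal layerConst
  set Δ := ofReal (η / (S.κ * S.ε ^ 2)) * S.nDiss α t ^ 2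
  set X := ofReal (exp (-ρ / (2 * S.ε ^ 2))) * eLpNorm (S.gradU t) 2 mX
        * S.nInf ρ α t * S.nf α t
  calc _ ≤ Δ + bC * (X + S.nf α t ^ 2 + S.forceB α t * S.nf α t)
        + lc * (k * S.nTb α t * S.nf α t) := by
        refine add_le_add le_rfl (mul_le_mul_right ?_ _)
        have := h.layer_le ht
        gcongr
    _ ≤ (Δ + bC * (X + S.nf α t ^ 2 + S.forceB α t * S.nf α t)
        + lc * (k * S.nTb α t * S.nf α t)) + (bC * (S.nTb α t * S.nf α t)
          + lc * k * (X + S.nf α t ^ 2 + S.forceB α t * S.nf α t)) := le_self_add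
    _ = _ := by ring

end Admissible

end Config

end PrandtlBoltzmann
end

theorem mainTheorem7 :
    ∃ C₀ : ℝ, 0 < C₀ ∧ ∀ K ρ c : ℝ, 0 < K → 0 < ρ → ρ < 1 / 4 → 0 < c → c < 1 / 4 →
      ∃ C : ℝ, 0 < C ∧
        -- decomposition of the normal momentum, and Hardy bound of its remainder part
        (∀ (S : Config) (τU : ℝ), S.Admissible K τU ρ → S.ε ≤ √S.κ →
          ∀ t ∈ Set.Ioo 0 S.T, ∀ α : MI,
            (∀ x : V3, 0 < x 2 →
              S.b α 2 t x = S.Tb α t x - S.ε * S.Uc 2 t x * S.a α t x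
                - S.ε / (2 * S.δ) * S.D α S.U3sq t x - S.ε / S.δ * S.D α S.PU3 t x) ∧
            S.nTb α t ≤ ENNReal.ofReal C * S.boundT c α t) ∧
        (∀ η : ℝ, 0 < η → ∃ ε₀ : ℝ, 0 < ε₀ ∧
          ∀ (S : Config) (τU : ℝ), S.Admissible K τU ρ → S.ε ≤ ε₀ * √S.κ →
          ∀ t ∈ Set.Ioo 0 S.T,
            -- the bulk term, for each multi-index
            (∀ α : MI,
              (S.nf α t ≠ ⊤ → S.nDiss α t ≠ ⊤ →
                MeasureTheory.Integrable (S.bulkIntegrand α t) mXV) ∧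
              ENNReal.ofReal |S.bulk α t| ≤ S.boundBulk η C ρ α t) ∧
            -- the sum over all multi-indices with the analytic weights
            (∀ τ0 M0 : ℝ, 0 ≤ M0 → τ0 ≤ τU / 2 → 0 < tau τ0 M0 t →
              ∑' α : MI, ENNReal.ofReal (wA τ0 M0 α t ^ 2 * |S.bulk α t|) ≤
                ENNReal.ofReal η * S.Dn τ0 M0 t ^ 2
                + ENNReal.ofReal C * S.En τ0 M0 t ^ 2
                + ENNReal.ofReal C * ENNReal.ofReal (Real.exp (-ρ / (4 * S.ε ^ 2)))
                    * S.Hn ρ τ0 M0 t * S.En τ0 M0 t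
                + (ENNReal.ofReal C₀ * S.layer t + ENNReal.ofReal η) * S.Yn τ0 M0 t ^ 2
                + ENNReal.ofReal C * S.Gn τ0 M0 t * S.En τ0 M0 t)) := by
  refine ⟨24 * layerConst * momC + 1, by
    have := layerConst_nonneg; have := momC_nonneg; positivity, fun K ρ c hK hρ _ hc0 hc => ?_⟩
  obtain ⟨M, hM0, hM⟩ := wgt_le_exp K hc
  obtain ⟨c₀, hc₀, hν⟩ := exists_nu_ge
  have hlc := layerConst_nonneg
  have hH := Config.hardyConst_nonneg hK.le hM0.le c
  have hB : 0 < bulkConst K ρ + layerConst * K :=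
    add_pos_of_pos_of_nonneg (bulkConst_pos hK.le ρ) (mul_nonneg hlc hK.le)
  have hS := sumConst_nonneg hK.le hρ hM0.le c
  set C := Config.hardyConst K c M + (bulkConst K ρ + layerConst * K) + sumConst K ρ c M with hC
  refine ⟨C, by positivity, ?_, ?_⟩
  · intro S τU h hεκ t ht α
    refine ⟨fun x _ => S.b_two_eq α t x, (h.nTb_le_boundT hρ hc0 hc hM0 hM hεκ ht α).trans ?_⟩
    gcongr
    linarith
  · intro η hη
    have hv := velC_nonneg c
    have hA := cA_nonneg hK.le
    have hq := comSum_nonneg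
    obtain ⟨ε₀, hε0, hε1, hε3, hε4, hεK, hεq⟩ := exists_small
      (P := K * (1 + K) + 2 * (6 * K + 7 * K ^ 2) * (2 + K) + 2 * K)
      (Q := layerConst * K * (7 * velC c * (5 * (cA K * M)) * comSum * 6))
      (by positivity) (by positivity) hK.le (mul_pos hc₀ hη) hη
    refine ⟨ε₀, hε0, fun S τU h hes t ht => ⟨fun α => ⟨fun hf hd => ?_, ?_⟩, ?_⟩⟩
    · exact h.integrable_bulkIntegrand hρ hc₀ hν hη hes hε1 hε3 hε4 ht α hf hd
    · refine (h.abs_bulk_le_boundBulk hρ hc₀ hν hη hes hε1 hε3 hε4 ht α).trans ?_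
      unfold Config.boundBulk
      gcongr
      linarith
    · intro τ0 M₀ hM₀ hτU hτ
      refine (h.tsum_bulk_le hρ hc₀ hν hη hes hε1 hε3 hε4 hεK hc0 hc hM0 hM hεq ht hM₀ hτU
        hτ).trans ?_
      have hSC : ENNReal.ofReal (sumConst K ρ c M) ≤ ENNReal.ofReal C :=
        ENNReal.ofReal_le_ofReal (by linarith)
      have hC₀ : ENNReal.ofReal (24 * layerConst * momC)
          ≤ ENNReal.ofReal (24 * layerConst * momC + 1) :=
        ENNReal.ofReal_le_ofReal (by linarith)
      gcongr
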